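/- Conventions. $M$ is a smooth manifold. For a two-form $K$ write also $K : T\to T^*$, $X\mapsto K(X,\cdot)$, and $e^K=\begin{pmatrix}1&0\\K&1\end{pmatrix}\in \mathrm{End}(T\oplus T^*)$. For $\mathbf J\in\mathrm{End}(T\oplus T^*)$ put $\Phi_K(\mathbf J)=[\mathbf J,e^K\mathbf J]$. For a closed three-form $H$, a generalized complex structure is an almost complex structure on $T\oplus T^*$, orthogonal for $\langle X+\xi,Y+\eta\rangle=\tfrac12(\xi(Y)+\eta(X))$, whose $\sqrt{-1}$-eigenbundle is closed under the $H$-twisted Courant bracket $[X+\xi,Y+\eta]=[X,Y]+L_X\eta-L_Y\xi+\tfrac12d(\xi(Y)-\eta(X))+i_Yi_XH$. A generalized Kähler structure is a commuting pair $(\mathbf J_1,\mathbf J_2)$ of generalized complex structures with $\langle-\mathbf J_1\mathbf J_2\cdot,\cdot\rangle>0$. Its bihermitian data are $(g,b,I,J)$, with $g$ a Riemannian metric, $b$ a two-form and $I,J$ $g$-orthogonal almost complex structures, such that, with $\omega_I=gI$, $\omega_J=gJ$, $$\mathbf J_{1/2}=\tfrac12 e^b\begin{pmatrix} I\pm J&-(\omega_I^{-1}\mp\omega_J^{-1})\\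 \omega_I\mp\omega_J&-(I^*\pm J^*)\end{pmatrix}e^{-b}.$$ A smooth family $(\mathbf J_1^t,\mathbf J_2^t)$ of generalized Kähler structures (with $H$ fixed) is a canonical deformation defined by two-forms $K_t$ if $\tfrac{\partial}{\partial t}\mathbf J_i^t=\Phi_{K_t}(\mathbf J_i^t)$, $i=1,2$. For a complex structure $J$ and a function $u$, $dJdu$ is the exterior derivative of the one-form $Jdu=-du\circ J$, so that $dJdu=2\sqrt{-1}\,\partial\bar\partial u$. A two-form $\omega$ is positive with respect to $I$ if $\omega(X,IX)>0$ for all $X\neq0$. Proposition. (1) Let $(M,g,J)$ be a Kähler manifold with Kähler form $\omega$, and let $u\in C^\infty(M)$ be such that $\omega+2\sqrt{-1}\,\partial\bar\partial u>0$. Then there is a canonical deformation $(\mathbf J_1^t,\mathbf J_2^t)$, $0\le t\le1$, for $H=0$, defined by $K_t=dJdu$, with bihermitian data $(g_t,0,J,J)$, where $g_0=g$ and $(\omega_I)_t=\omega+t\,dJdu$. (2) Let $(\mathbf J_1,\mathbf J_2)$ be a generalized Kähler structure for $H$ with bihermitian data $(g,b,I,J)$ such that $[I,J]=0$, let $T=T_+\oplus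 T_-$ be the decomposition into the $\pm1$-eigenbundles of $Q=-IJ$, and let $d=\partial_++\partial_-+\bar\partial_++\bar\partial_-$ be the corresponding splitting of $d$ (types with respect to $I$). Let $u\in C^\infty(M)$ be such that $\omega_I+2\sqrt{-1}(\partial_+\bar\partial_+-\partial_-\bar\partial_-)u>0$ with respect to $I$. Then there is a canonical deformation $(\mathbf J_1^t,\mathbf J_2^t)$, $0\le t\le1$, for $H$, starting at $(\mathbf J_1,\mathbf J_2)$ and defined by $K_t=dJdu$, with bihermitian data $(g_t,b_t,I,J)$, $(g_0,b_0)=(g,b)$, and $(\omega_I)_t=\omega_I+2t\sqrt{-1}(\partial_+\bar\partial_+-\partial_-\bar\partial_-)u$. (3) Let $(\mathbf J_1,\mathbf J_2)$ be a generalized Kähler structure for $H$ with bihermitian data $(g,b,I,J)$ such that $\sigma=\tfrac12[I,J]g^{-1}:T^*\to T$ is invertible, and let $\Omega=\sigma^{-1}$. Let $u_t$ be a smooth family of smooth functions, $t$ in an open interval $\mathcal T\ni0$, and let $\phi_t$, $t\in\mathcal T$, be a smooth family of diffeomorphisms of $M$ that is generated by $u_t$ in the sense that $\phi_0=\mathrm{id}$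 and $\tfrac{\partial}{\partial t}\phi_t=d\phi_t(X_{u_t})$, where $\Omega(X_{u_t},\cdot)=-du_t$. Put $J_t=\phi_t^*J=(d\phi_t)^{-1}\circ J\circ d\phi_t$, let $\Omega_{J_t}=\Omega-\sqrt{-1}\,\Omega(J_t\cdot,\cdot)$ be the form of type $(2,0)$ for $J_t$ with real part $\Omega$, and let $\pi_{\Lambda^{1,1}_I}$ be the projection to the forms of type $(1,1)$ for $I$. Let $\mathcal T_+$ be the set of all $t\in\mathcal T$ with $-\mathrm{Im}\,\pi_{\Lambda^{1,1}_I}\Omega_{J_t}>0$ with respect to $I$. Then $0\in\mathcal T_+$, and there is a canonical deformation $(\mathbf J_1^t,\mathbf J_2^t)$, $t\in\mathcal T_+$, for $H$, equal to $(\mathbf J_1,\mathbf J_2)$ at $t=0$ and defined by $K_t=dJ_tdu_t$, with bihermitian data $(g_t,b_t,I,J_t)$, $(g_0,b_0)=(g,b)$, such that $\sigma_t=\tfrac12[I,J_t]g_t^{-1}$ is invertible and $\Omega_t=\sigma_t^{-1}=\Omega$. -/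

import Mathlib

open Set Bundle ContinuousLinearMap
open scoped Manifold ContDiff Topology

noncomputable section

namespace GenKahler

variable {E : Type*} [NormedAddCommGroup E] [NormedSpace ℝ E]
  {F : Type*} [NormedAddCommGroup F] [NormedSpace ℝ F]
  {M : Type*} [TopologicalSpace M] [ChartedSpace E M]

/-! ### Tensor fields -/

/-- The tangent space `T_x M` of a manifold modelled on the vector space `E`. -/
abbrev Tan (E : Type*) [NormedAddCommGroup E] [NormedSpace ℝ E]
    {M : Type*} [TopologicalSpace M] [ChartedSpace E M] (x : M) : Type _ :=
  TangentSpace 𝓘(ℝ, E) x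

/-- The cotangent space `T_x^* M`. -/
abbrev Cot (E : Type*) [NormedAddCommGroup E] [NormedSpace ℝ E]
    {M : Type*} [TopologicalSpace M] [ChartedSpace E M] (x : M) : Type _ :=
  Tan E x →L[ℝ] ℝ

/-- The fibre of the generalized tangent bundle `T ⊕ T^*`. -/
abbrev GTan (E : Type*) [NormedAddCommGroup E] [NormedSpace ℝ E]
    {M : Type*} [TopologicalSpace M] [ChartedSpace E M] (x : M) : Type _ :=
  Tan E x × Cot E x

/-- Vector fields. -/
abbrev VField (E : Type*) [NormedAddCommGroup E] [NormedSpace ℝ E]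
    (M : Type*) [TopologicalSpace M] [ChartedSpace E M] : Type _ := ∀ x : M, Tan E x

/-- One-forms with values in a normed space `F` (`F = ℝ` or `ℂ` below). -/
abbrev OneForm (E : Type*) [NormedAddCommGroup E] [NormedSpace ℝ E]
    (M : Type*) [TopologicalSpace M] [ChartedSpace E M]
    (F : Type*) [NormedAddCommGroup F] [NormedSpace ℝ F] : Type _ := ∀ x : M, Tan E x →L[ℝ] F

/-- Sections of `T^* ⊗ T^* ⊗ F`. A two-tensor `β` is also read as the map `X ↦ β (X, ·)`
from vectors to covectors. -/
abbrev TwoTensor (E : Type*) [NormedAddCommGroup E] [NormedSpace ℝ E]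
    (M : Type*) [TopologicalSpace M] [ChartedSpace E M]
    (F : Type*) [NormedAddCommGroup F] [NormedSpace ℝ F] : Type _ :=
  ∀ x : M, Tan E x →L[ℝ] Tan E x →L[ℝ] F

/-- Real three-forms. -/
abbrev ThreeForm (E : Type*) [NormedAddCommGroup E] [NormedSpace ℝ E]
    (M : Type*) [TopologicalSpace M] [ChartedSpace E M] : Type _ :=
  ∀ x : M, Tan E x [⋀^Fin 3]→L[ℝ] ℝ

/-- Sections of `End T`. -/
abbrev EndField (E : Type*) [NormedAddCommGroup E] [NormedSpace ℝ E]
    (M : Type*) [TopologicalSpace M] [ChartedSpace E M] : Type _ :=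
  ∀ x : M, Tan E x →L[ℝ] Tan E x

/-- Sections of `T ⊕ T^*`. -/
abbrev GSection (E : Type*) [NormedAddCommGroup E] [NormedSpace ℝ E]
    (M : Type*) [TopologicalSpace M] [ChartedSpace E M] : Type _ := ∀ x : M, GTan E x

/-- Sections of `End (T ⊕ T^*)`. -/
abbrev GEndField (E : Type*) [NormedAddCommGroup E] [NormedSpace ℝ E]
    (M : Type*) [TopologicalSpace M] [ChartedSpace E M] : Type _ :=
  ∀ x : M, GTan E x →L[ℝ] GTan E x

variable [IsManifold 𝓘(ℝ, E) ∞ M]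

/-- Smooth vector fields. -/
def SmoothVField (X : VField E M) : Prop :=
  ContMDiff 𝓘(ℝ, E) (𝓘(ℝ, E).prod 𝓘(ℝ, E)) ∞ (fun x => TotalSpace.mk' E x (X x))

/-- Smooth real one-forms. -/
def SmoothOneForm (ξ : OneForm E M ℝ) : Prop :=
  ContMDiff 𝓘(ℝ, E) (𝓘(ℝ, E).prod 𝓘(ℝ, E →L[ℝ] ℝ)) ∞
    (fun x => TotalSpace.mk' (E →L[ℝ] ℝ) x (ξ x))

/-- Smooth real two-tensors. -/
def SmoothTwoTensor (β : TwoTensor E M ℝ) : Prop :=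
  ContMDiff 𝓘(ℝ, E) (𝓘(ℝ, E).prod 𝓘(ℝ, E →L[ℝ] E →L[ℝ] ℝ)) ∞
    (fun x => TotalSpace.mk' (E →L[ℝ] E →L[ℝ] ℝ) x (β x))

/-- Smooth endomorphism fields of the tangent bundle. -/
def SmoothEnd (J : EndField E M) : Prop :=
  ContMDiff 𝓘(ℝ, E) (𝓘(ℝ, E).prod 𝓘(ℝ, E →L[ℝ] E)) ∞
    (fun x => TotalSpace.mk' (E →L[ℝ] E) x (J x))

/-- Smooth sections of `T ⊕ T^*`. -/
def SmoothGSection (s : GSection E M) : Prop :=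
  SmoothVField (fun x => (s x).1) ∧ SmoothOneForm (fun x => (s x).2)

/-- Smooth endomorphism fields of `T ⊕ T^*`: they preserve smoothness of sections. -/
def SmoothGEnd (𝕁 : GEndField E M) : Prop :=
  ∀ s : GSection E M, SmoothGSection s → SmoothGSection (fun x => 𝕁 x (s x))

/-- Families of endomorphism fields of `T ⊕ T^*` that depend smoothly on `(t, x)`, `t ∈ 𝒯`. -/
def SmoothGEndFamily (𝒯 : Set ℝ) (𝕁 : ℝ → GEndField E M) : Prop :=
  ∀ s : GSection E M, SmoothGSection s →
    ContMDiffOn (𝓘(ℝ, ℝ).prod 𝓘(ℝ, E)) (𝓘(ℝ, E).prod 𝓘(ℝ, E)) ∞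
      (fun p : ℝ × M => TotalSpace.mk' E (E := fun x : M => Tan E x) p.2 (𝕁 p.1 p.2 (s p.2)).1)
      (𝒯 ×ˢ univ) ∧
    ContMDiffOn (𝓘(ℝ, ℝ).prod 𝓘(ℝ, E)) (𝓘(ℝ, E).prod 𝓘(ℝ, E →L[ℝ] ℝ)) ∞
      (fun p : ℝ × M =>
        TotalSpace.mk' (E →L[ℝ] ℝ) (E := fun x : M => Cot E x) p.2 (𝕁 p.1 p.2 (s p.2)).2)
      (𝒯 ×ˢ univ)

/-- Smooth real two-forms. -/
structure IsTwoForm (β : TwoTensor E M ℝ) : Prop where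
  smooth : SmoothTwoTensor β
  skew : ∀ x X Y, β x X Y = -β x Y X

/-! ### Exterior derivative, computed in the preferred chart at each point -/

/-- The differential of the inverse of the preferred chart at `x₀`. -/
def chartInvDiff (x₀ : M) (y : E) : E →L[ℝ] Tan E ((extChartAt 𝓘(ℝ, E) x₀).symm y) :=
  mfderiv 𝓘(ℝ, E) 𝓘(ℝ, E) (extChartAt 𝓘(ℝ, E) x₀).symm y

/-- The differential at `x₀` of the preferred chart at `x₀`. -/
def chartDiff (x₀ : M) : Tan E x₀ →L[ℝ] E :=
  mfderiv 𝓘(ℝ, E) 𝓘(ℝ, E) (extChartAt 𝓘(ℝ, E) x₀) x₀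

/-- A one-form in the coordinates of the chart at `x₀`. -/
def coordOne (x₀ : M) (ξ : OneForm E M F) (y : E) : E →L[ℝ] F :=
  ξ ((extChartAt 𝓘(ℝ, E) x₀).symm y) ∘L chartInvDiff x₀ y

/-- A real two-tensor in the coordinates of the chart at `x₀`. -/
def coordTwo (x₀ : M) (β : TwoTensor E M ℝ) (y : E) : E →L[ℝ] E →L[ℝ] ℝ :=
  precomp ℝ (chartInvDiff x₀ y) ∘L β ((extChartAt 𝓘(ℝ, E) x₀).symm y) ∘L chartInvDiff x₀ y

/-- A three-form in the coordinates of the chart at `x₀`. -/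
def coordThree (x₀ : M) (H : ThreeForm E M) (y : E) : E [⋀^Fin 3]→L[ℝ] ℝ :=
  (H ((extChartAt 𝓘(ℝ, E) x₀).symm y)).compContinuousLinearMap (chartInvDiff x₀ y)

/-- Smooth three-forms. -/
def SmoothThreeForm (H : ThreeForm E M) : Prop :=
  ∀ x₀ : M, ContDiffOn ℝ ∞ (coordThree x₀ H) (extChartAt 𝓘(ℝ, E) x₀).target

/-- The exterior derivative of a one-form, `dξ(X, Y) = X(ξ(Y)) - Y(ξ(X))` for coordinate
vector fields `X`, `Y`. -/
def extD (ξ : OneForm E M F) : TwoTensor E M F := fun x =>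
  let D := fderiv ℝ (coordOne x ξ) (extChartAt 𝓘(ℝ, E) x x)
  precomp F (chartDiff x) ∘L (D - D.flip) ∘L chartDiff x

/-- `dβ = 0` for a two-form `β`. -/
def Closed₂ (β : TwoTensor E M ℝ) : Prop :=
  ∀ (x : M) (a b c : E),
    let D := fderiv ℝ (coordTwo x β) (extChartAt 𝓘(ℝ, E) x x)
    D a b c + D b c a + D c a b = 0

/-- `dH = 0` for a three-form `H`. -/
def Closed₃ (H : ThreeForm E M) : Prop :=
  ∀ x : M, extDeriv (coordThree x H) (extChartAt 𝓘(ℝ, E) x x) = 0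

/-- The covector `i_Y i_X H = H(X, Y, ·)`. -/
def contract₂ {x : M} (H : Tan E x [⋀^Fin 3]→L[ℝ] ℝ) (X Y : Tan E x) : Cot E x :=
  H.toContinuousMultilinearMap.toContinuousLinearMap ![X, Y, 0] 2

/-- The differential of a real function. -/
def dfun (u : M → ℝ) : OneForm E M ℝ := fun x => mvfderiv 𝓘(ℝ, E) u x

/-- The action `(Jα)(X) = -α(JX)` of an endomorphism field on one-forms. -/
def actOne (J : EndField E M) (α : OneForm E M ℝ) : OneForm E M ℝ := fun x => -(α x ∘L J x)

/-- The two-form `d J d u`. -/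
def dJd (J : EndField E M) (u : M → ℝ) : TwoTensor E M ℝ := extD (actOne J (dfun u))

/-! ### Generalized complex and generalized Kähler structures -/

/-- The neutral inner product `⟨X + ξ, Y + η⟩ = (ξ(Y) + η(X)) / 2`. -/
def pairing {x : M} (a b : GTan E x) : ℝ := (a.2 b.1 + b.2 a.1) / 2

/-- The Lie derivative of a one-form, by Cartan's formula `L_X η = i_X dη + d(η(X))`. -/
def lieOne (X : VField E M) (η : OneForm E M ℝ) : OneForm E M ℝ := fun x =>
  extD η x (X x) + dfun (fun y => η y (X y)) x

/-- The Courant bracket twisted by the three-form `H`: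
`[X + ξ, Y + η] = [X, Y] + L_X η - L_Y ξ + d(ξ(Y) - η(X)) / 2 + i_Y i_X H`. -/
def courant (H : ThreeForm E M) (s t : GSection E M) : GSection E M := fun x =>
  (VectorField.mlieBracket 𝓘(ℝ, E) (fun y => (s y).1) (fun y => (t y).1) x,
    lieOne (fun y => (s y).1) (fun y => (t y).2) x - lieOne (fun y => (t y).1) (fun y => (s y).2) x
      + (1 / 2 : ℝ) • dfun (fun y => (s y).2 (t y).1 - (t y).2 (s y).1) x
      + contract₂ (H x) (s x).1 (t x).1)

/-- Smooth sections `s = s₁ + √-1 s₂` (written as pairs) of the `√-1`-eigenbundle of `𝕁` in the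
complexification of `T ⊕ T^*`. -/
structure IsEigenSection (𝕁 : GEndField E M) (s : GSection E M × GSection E M) : Prop where
  smooth_re : SmoothGSection s.1
  smooth_im : SmoothGSection s.2
  eigen_re : ∀ x, 𝕁 x (s.1 x) = -s.2 x
  eigen_im : ∀ x, 𝕁 x (s.2 x) = s.1 x

/-- The complex bilinear extension of the twisted Courant bracket. -/
def courantℂ (H : ThreeForm E M) (s t : GSection E M × GSection E M) :
    GSection E M × GSection E M :=
  (fun x => courant H s.1 t.1 x - courant H s.2 t.2 x,
    fun x => courant H s.1 t.2 x + courant H s.2 t.1 x)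

/-- Generalized complex structures, with respect to the bracket twisted by `H`: orthogonal almost
complex structures on `T ⊕ T^*` whose `√-1`-eigenbundle is closed under the bracket. -/
structure IsGenComplex (H : ThreeForm E M) (𝕁 : GEndField E M) : Prop where
  smooth : SmoothGEnd 𝕁
  sq : ∀ x v, 𝕁 x (𝕁 x v) = -v
  orth : ∀ x v w, pairing (𝕁 x v) (𝕁 x w) = pairing v w
  integrable : ∀ s t, IsEigenSection 𝕁 s → IsEigenSection 𝕁 t → IsEigenSection 𝕁 (courantℂ H s t)

/-- Generalized Kähler structures: commuting pairs of generalized complex structures such that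
`⟨-𝕁₁ 𝕁₂ ·, ·⟩` is positive definite. -/
structure IsGenKahler (H : ThreeForm E M) (𝕁₁ 𝕁₂ : GEndField E M) : Prop where
  fst : IsGenComplex H 𝕁₁
  snd : IsGenComplex H 𝕁₂
  comm : ∀ x v, 𝕁₁ x (𝕁₂ x v) = 𝕁₂ x (𝕁₁ x v)
  pos : ∀ x v, v ≠ 0 → 0 < pairing (-𝕁₁ x (𝕁₂ x v)) v

/-- The endomorphism of `T ⊕ T^*` with block matrix `(A B; C D)`. -/
def block {x : M} (A : Tan E x →L[ℝ] Tan E x) (B : Cot E x →L[ℝ] Tan E x)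
    (C : Tan E x →L[ℝ] Cot E x) (D : Cot E x →L[ℝ] Cot E x) : GTan E x →L[ℝ] GTan E x :=
  (A.coprod B).prod (C.coprod D)

/-- `e^K = (1 0; K 1)`. -/
def expB {x : M} (K : Tan E x →L[ℝ] Cot E x) : GTan E x →L[ℝ] GTan E x :=
  block (ContinuousLinearMap.id ℝ _) 0 K (ContinuousLinearMap.id ℝ _)

/-- `Φ_K(𝕁) = [𝕁, e^K 𝕁]`. -/
def Phi {x : M} (K : Tan E x →L[ℝ] Cot E x) (𝕁 : GTan E x →L[ℝ] GTan E x) :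
    GTan E x →L[ℝ] GTan E x :=
  𝕁 ∘L (expB K ∘L 𝕁) - (expB K ∘L 𝕁) ∘L 𝕁

/-- `(𝕁₁ᵗ, 𝕁₂ᵗ)`, `t ∈ 𝒯`, is a smooth family of generalized Kähler structures which is a canonical
deformation defined by the two-forms `K_t`, that is, `∂𝕁ᵢ/∂t = Φ_{K_t}(𝕁ᵢ)` for `i = 1, 2`. -/
structure IsCanonicalDeformation (H : ThreeForm E M) (𝒯 : Set ℝ) (𝕁₁ 𝕁₂ : ℝ → GEndField E M)
    (K : ℝ → TwoTensor E M ℝ) : Prop where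
  genKahler : ∀ t ∈ 𝒯, IsGenKahler H (𝕁₁ t) (𝕁₂ t)
  smooth₁ : SmoothGEndFamily 𝒯 𝕁₁
  smooth₂ : SmoothGEndFamily 𝒯 𝕁₂
  twoForm : ∀ t ∈ 𝒯, IsTwoForm (K t)
  deriv₁ : ∀ t ∈ 𝒯, ∀ x : M, HasDerivWithinAt (fun s => 𝕁₁ s x) (Phi (K t x) (𝕁₁ t x)) 𝒯 t
  deriv₂ : ∀ t ∈ 𝒯, ∀ x : M, HasDerivWithinAt (fun s => 𝕁₂ s x) (Phi (K t x) (𝕁₂ t x)) 𝒯 t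

/-! ### Bihermitian data -/

/-- Smooth Riemannian metrics. -/
structure IsMetric (g : TwoTensor E M ℝ) : Prop where
  smooth : SmoothTwoTensor g
  symm : ∀ x X Y, g x X Y = g x Y X
  pos : ∀ x X, X ≠ 0 → 0 < g x X X

/-- Smooth almost complex structures compatible with `g`. -/
structure IsHermitian (g : TwoTensor E M ℝ) (J : EndField E M) : Prop where
  smooth : SmoothEnd J
  sq : ∀ x X, J x (J x X) = -X
  orth : ∀ x X Y, g x (J x X) (J x Y) = g x X Y

/-- Vanishing of the Nijenhuis tensor of an endomorphism field. -/
def Integrable (J : EndField E M) : Prop :=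
  ∀ X Y : VField E M, SmoothVField X → SmoothVField Y → ∀ x,
    VectorField.mlieBracket 𝓘(ℝ, E) (fun y => J y (X y)) (fun y => J y (Y y)) x
      - J x (VectorField.mlieBracket 𝓘(ℝ, E) (fun y => J y (X y)) Y x)
      - J x (VectorField.mlieBracket 𝓘(ℝ, E) X (fun y => J y (Y y)) x)
      - VectorField.mlieBracket 𝓘(ℝ, E) X Y x = 0

/-- The fundamental form `ω_J(X, Y) = g(JX, Y)`, that is `ω_J = gJ`. -/
def fundForm (g : TwoTensor E M ℝ) (J : EndField E M) : TwoTensor E M ℝ := fun x => g x ∘L J x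

/-- Kähler structures. -/
structure IsKahler (g : TwoTensor E M ℝ) (J : EndField E M) : Prop where
  metric : IsMetric g
  hermitian : IsHermitian g J
  integrable : Integrable J
  closed : Closed₂ (fundForm g J)

/-- The dual `J^*` acting on covectors, `J^* ξ = ξ ∘ J`. -/
def dualMap {x : M} (J : Tan E x →L[ℝ] Tan E x) : Cot E x →L[ℝ] Cot E x := precomp ℝ J

/-- The Gualtieri map:
`𝕁₁ = ½ e^b (I + J, -(ω_I⁻¹ - ω_J⁻¹); ω_I - ω_J, -(I^* + J^*)) e^{-b}`. -/
def gualtieri₁ (g b : TwoTensor E M ℝ) (I J : EndField E M) : GEndField E M := fun x =>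
  (1 / 2 : ℝ) • (expB (b x) ∘L
    block (I x + J x) (-((fundForm g I x).inverse - (fundForm g J x).inverse))
      (fundForm g I x - fundForm g J x) (-(dualMap (I x) + dualMap (J x))) ∘L
    expB (-b x))

/-- The Gualtieri map:
`𝕁₂ = ½ e^b (I - J, -(ω_I⁻¹ + ω_J⁻¹); ω_I + ω_J, -(I^* - J^*)) e^{-b}`. -/
def gualtieri₂ (g b : TwoTensor E M ℝ) (I J : EndField E M) : GEndField E M := fun x =>
  (1 / 2 : ℝ) • (expB (b x) ∘L
    block (I x - J x) (-((fundForm g I x).inverse + (fundForm g J x).inverse))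
      (fundForm g I x + fundForm g J x) (-(dualMap (I x) - dualMap (J x))) ∘L
    expB (-b x))

/-- `(g, b, I, J)` is the bihermitian data of the pair `(𝕁₁, 𝕁₂)`. -/
structure IsBihermitianData (𝕁₁ 𝕁₂ : GEndField E M) (g b : TwoTensor E M ℝ)
    (I J : EndField E M) : Prop where
  metric : IsMetric g
  twoForm : IsTwoForm b
  hermitian₁ : IsHermitian g I
  hermitian₂ : IsHermitian g J
  eq₁ : 𝕁₁ = gualtieri₁ g b I J
  eq₂ : 𝕁₂ = gualtieri₂ g b I J

/-! ### The operators `∂±`, `∂̄±` -/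

/-- For a field `P` of projections onto an `I`-invariant subbundle `T_P` of `T`, the one-form
`∂̄_P u`, which is the component of `du` in `Λ^{0,1} T_P^*`:
`(∂̄_P u)(X) = (du(PX) + √-1 du(IPX)) / 2`. -/
def dbarFun (I P : EndField E M) (u : M → ℝ) : OneForm E M ℂ := fun x =>
  (1 / 2 : ℂ) • (Complex.ofRealCLM ∘L dfun u x ∘L P x
    + Complex.I • (Complex.ofRealCLM ∘L dfun u x ∘L I x ∘L P x))

/-- The `(1,1)`-part of a complex valued two-form, with respect to `I`. -/
def pr11 {V : Type*} (I : V → V) (β : V → V → ℂ) (X Y : V) : ℂ := (β X Y + β (I X) (I Y)) / 2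

/-- `∂_P ∂̄_P u`, the component of `d (∂̄_P u)` in `Λ^{1,0} T_P^* ⊗ Λ^{0,1} T_P^*`. -/
def ddbarFun (I P : EndField E M) (u : M → ℝ) (x : M) (X Y : Tan E x) : ℂ :=
  pr11 (I x) (fun X Y => extD (dbarFun I P u) x (P x X) (P x Y)) X Y

/-- The identity, projection onto `T` itself. -/
def projAll : EndField E M := fun _ => ContinuousLinearMap.id ℝ _

/-- The projection of `T = T₊ ⊕ T₋` onto `T₊`, the `+1`-eigenbundle of `Q = -IJ`. -/
def projPlus (I J : EndField E M) : EndField E M := fun x =>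
  (1 / 2 : ℝ) • (ContinuousLinearMap.id ℝ _ - I x ∘L J x)

/-- The projection of `T = T₊ ⊕ T₋` onto `T₋`, the `-1`-eigenbundle of `Q = -IJ`. -/
def projMinus (I J : EndField E M) : EndField E M := fun x =>
  (1 / 2 : ℝ) • (ContinuousLinearMap.id ℝ _ + I x ∘L J x)

/-! ### The nondegenerate case -/

/-- The Poisson tensor `σ = ½ [I, J] g⁻¹ : T^* → T`. -/
def poisson (g : TwoTensor E M ℝ) (I J : EndField E M) (x : M) : Cot E x →L[ℝ] Tan E x :=
  (1 / 2 : ℝ) • ((I x ∘L J x - J x ∘L I x) ∘L (g x).inverse)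

/-- The symplectic form `Ω = σ⁻¹`. -/
def sympForm (g : TwoTensor E M ℝ) (I J : EndField E M) : TwoTensor E M ℝ := fun x =>
  (poisson g I J x).inverse

/-- The two-form `Ω_J` of type `(2,0)` with respect to `J` and with real part `Ω`:
`Ω_J(X, Y) = Ω(X, Y) - √-1 Ω(JX, Y)`. -/
def holSymp (Ω : TwoTensor E M ℝ) (J : EndField E M) (x : M) (X Y : Tan E x) : ℂ :=
  (Ω x X Y : ℂ) - Complex.I * (Ω x (J x X) Y : ℂ)

/-- The vector field `X_u` with `Ω(X_u, ·) = -du`, where `σ = Ω⁻¹ : T^* → T`. -/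
def hamField (σ : ∀ x : M, Cot E x →L[ℝ] Tan E x) (u : M → ℝ) : VField E M := fun x =>
  -σ x (dfun u x)

/-- The family `φ_t`, `t ∈ 𝒯`, of Hamiltonian diffeomorphisms generated by the functions `u_t`:
`φ_0 = id` and `∂φ_t/∂t = dφ_t(X_{u_t})`. -/
structure IsHamiltonianFamily (σ : ∀ x : M, Cot E x →L[ℝ] Tan E x) (𝒯 : Set ℝ) (u : ℝ → M → ℝ)
    (φ : ℝ → M ≃ₘ^∞⟮𝓘(ℝ, E), 𝓘(ℝ, E)⟯ M) : Prop where
  smooth : ContMDiffOn (𝓘(ℝ, ℝ).prod 𝓘(ℝ, E)) 𝓘(ℝ, E) ∞ (fun p : ℝ × M => φ p.1 p.2) (𝒯 ×ˢ univ)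
  init : ∀ x, φ 0 x = x
  deriv : ∀ t ∈ 𝒯, ∀ x : M,
    HasMFDerivAt 𝓘(ℝ, ℝ) 𝓘(ℝ, E) (fun s => φ s x) t
      ((ContinuousLinearMap.id ℝ ℝ).smulRight
        (mfderiv 𝓘(ℝ, E) 𝓘(ℝ, E) (φ t) x (hamField σ (u t) x)))

/-- The pullback `φ^* J = (dφ)⁻¹ ∘ J ∘ dφ`. -/
def pullEnd (φ : M → M) (J : EndField E M) : EndField E M := fun x =>
  (mfderiv 𝓘(ℝ, E) 𝓘(ℝ, E) φ x).inverse ∘L J (φ x) ∘L mfderiv 𝓘(ℝ, E) 𝓘(ℝ, E) φ x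

end GenKahler

end

open GenKahler

noncomputable section

namespace GenKahler

section

variable {E : Type*} [NormedAddCommGroup E] [NormedSpace ℝ E]
  {F : Type*} [NormedAddCommGroup F] [NormedSpace ℝ F]
  {M : Type*} [TopologicalSpace M] [ChartedSpace E M]

local notation "𝔠" => extChartAt 𝓘(ℝ, E)

/-! ### Local coordinates -/

section Charts

/-! The splitting of `T ⊕ T^*` into the graphs of `a = b + g` and `c = b - g` governs everything.
Both generalized complex structures act as `I` on the first graph, and they act as `J` and `-J` on
the second (`gual_plus`, `gual_minus`, `gualtieri₂_eq`). An orthogonal almost complex structure on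
`T ⊕ T^*` is integrable exactly when its Nijenhuis torsion for the Courant bracket vanishes. This
torsion is tensorial, so in the chart centred at a point it is a trilinear expression in values and
first derivatives (`IsOrthJet.courantJet_sub`, `isGenComplex_of_torsion`). Testing it on the two
graphs shows that a pair is generalized Kähler iff `I` is integrable on the graph of `a` and `J` on
the graph of `c`, each a condition on one tensor and one complex structure (`Inv`,
`IsBihermitian.isGenKahler`, `IsBihermitian.inv_of_isGenKahler`).

Two facts then drive all three cases. First, `Inv H a I` survives adding to `a` a tensor `P +
S(I·,·)` with `P` and `S` closed two-forms (`Inv.add`). Second, for fixed `I` and `K` of type (1,1)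
with respect to `J`, the deformation equation can be checked on the two graphs, where it follows
from `∂(b + g) = -K(I·,·)`, `∂(b - g) = -K(·,I·)` and `2g((∂J)X, Y) = K(X, JIY) - K(X, IJY)`
(`hasDerivAt_gual`).

If `I` and `J` commute, the last equation allows `J` to stay constant, and `b + g` and `b - g` move
along straight lines (`IsBihermitian.isBihermitianFamily_line`). The first graph stays integrable
because `K = dJdu` is closed. For the second, `K(·,I·)` is written as `d(du ∘ Q) + d(du ∘ I)(J·,·)`
(`IsBihermitian.dJd_comm`), which rests on a compatibility between the derivatives of `I` and `J`
(`InvJet.mixed`). Positivity on `[0,1]` is convexity. The Kähler case is `I = J`.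

If `[I, J]` is invertible, the structure is encoded by two-forms: `Ω`, `ΩI`, `ΩJ` are closed, `dB +
H = 0`, `g = ½Ω[I,J]` and `b = B - ½Ω(IJ + JI)` (`IsBihermitian.isSympPair`). Conversely such data
with positive `g` are generalized Kähler, because `b + g = B - ΩJI` and `b - g = B - ΩIJ`. A
Hamiltonian isotopy preserves `Ω`, so `Ω`, `B` and `I` are kept and `J` is replaced by `J_t`.
Cartan's formula gives `∂(ΩJ_t) = d(i_X ΩJ_t) = dJ_tdu_t = K_t`, and the three deformation equations
follow algebraically (`IsSympFib.exists_deriv`). -/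

lemma contMDiffAt_iff_coord {g : M → F} {x₀ : M} :
    ContMDiffAt 𝓘(ℝ, E) 𝓘(ℝ, F) ∞ g x₀ ↔
      ContDiffAt ℝ ∞ (fun y => g ((𝔠 x₀).symm y)) (𝔠 x₀ x₀) := by
  rw [← contMDiffWithinAt_univ, contMDiffWithinAt_iff_source, contMDiffWithinAt_iff_contDiffWithinAt,
    ModelWithCorners.range_eq_univ, preimage_univ, inter_univ, contDiffWithinAt_univ]
  rfl

lemma contMDiffWithinAt_iff_coord {g : ℝ × M → F} {𝒯 : Set ℝ} {t₀ : ℝ} {x₀ : M} :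
    ContMDiffWithinAt (𝓘(ℝ, ℝ).prod 𝓘(ℝ, E)) 𝓘(ℝ, F) ∞ g (𝒯 ×ˢ univ) (t₀, x₀) ↔
      ContDiffWithinAt ℝ ∞ (fun q : ℝ × E => g (q.1, (𝔠 x₀).symm q.2)) (𝒯 ×ˢ univ)
        (t₀, 𝔠 x₀ x₀) := by
  rw [contMDiffWithinAt_iff_source, extChartAt_prod, extChartAt_model_space_eq_id,
    ModelWithCorners.range_eq_univ, inter_univ]
  have hset : ((PartialEquiv.refl ℝ).prod (𝔠 x₀)).symm ⁻¹' (𝒯 ×ˢ (univ : Set M))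
      = 𝒯 ×ˢ (univ : Set E) := by
    ext q; simp [PartialEquiv.prod_coe_symm]
  rw [hset]
  exact contMDiffWithinAt_iff_contDiffWithinAt

end Charts

variable [IsManifold 𝓘(ℝ, E) ∞ M]

/-! ### Tangent bundle trivializations as derivatives of charts -/

section Frames

lemma one_manifold : IsManifold 𝓘(ℝ, E) 1 M := IsManifold.of_le (n := ∞) (by simp)

lemma chartDiff_self (x : M) : chartDiff (E := E) x = ContinuousLinearMap.id ℝ E := by
  have : IsManifold 𝓘(ℝ, E) 1 M := one_manifold
  exact mfderiv_extChartAt_self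

lemma chartInvDiff_self (x : M) :
    chartInvDiff (E := E) x (𝔠 x x) = ContinuousLinearMap.id ℝ E := by
  have : IsManifold 𝓘(ℝ, E) 1 M := one_manifold
  have := mfderivWithin_range_extChartAt_symm (I := 𝓘(ℝ, E)) (x := x)
  rw [ModelWithCorners.range_eq_univ, mfderivWithin_univ] at this
  exact this

lemma chartInvDiff_isInvertible {x₀ : M} {y : E} (hy : y ∈ (𝔠 x₀).target) :
    (chartInvDiff x₀ y).IsInvertible := by
  have : IsManifold 𝓘(ℝ, E) 1 M := one_manifold
  have := isInvertible_mfderivWithin_extChartAt_symm hy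
  rw [ModelWithCorners.range_eq_univ, mfderivWithin_univ] at this
  exact this

lemma symmL_eq_chartInvDiff {x₀ : M} {y : E} (hy : y ∈ (𝔠 x₀).target) :
    (trivializationAt E (TangentSpace 𝓘(ℝ, E)) x₀).symmL ℝ ((𝔠 x₀).symm y) =
      chartInvDiff x₀ y := by
  have : IsManifold 𝓘(ℝ, E) 1 M := one_manifold
  have hs : (𝔠 x₀).symm y ∈ (chartAt E x₀).source := by
    rw [← extChartAt_source 𝓘(ℝ, E)]; exact (𝔠 x₀).map_target hy
  rw [TangentBundle.symmL_trivializationAt hs]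
  simp only [chartInvDiff, ModelWithCorners.range_eq_univ, mfderivWithin_univ]
  rw [(𝔠 x₀).right_inv hy]

lemma continuousLinearMapAt_eq_inverse {x₀ : M} {y : E} (hy : y ∈ (𝔠 x₀).target) :
    (trivializationAt E (TangentSpace 𝓘(ℝ, E)) x₀).continuousLinearMapAt ℝ ((𝔠 x₀).symm y) =
      (chartInvDiff x₀ y).inverse := by
  have hs : (𝔠 x₀).symm y ∈ (trivializationAt E (TangentSpace 𝓘(ℝ, E)) x₀).baseSet := by
    rw [TangentBundle.trivializationAt_baseSet, ← extChartAt_source 𝓘(ℝ, E)]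
    exact (𝔠 x₀).map_target hy
  rw [← symmL_eq_chartInvDiff hy]
  symm
  apply ContinuousLinearMap.inverse_eq
  · ext v
    exact Trivialization.symmL_continuousLinearMapAt _ hs v
  · ext v
    exact Trivialization.continuousLinearMapAt_symmL _ hs v

/-- A vector field in the coordinates of the chart at `x₀`. -/
def coordV (x₀ : M) (X : VField E M) (y : E) : E :=
  (chartInvDiff x₀ y).inverse (X ((𝔠 x₀).symm y))

/-- An endomorphism field in the coordinates of the chart at `x₀`. -/
def coordEnd (x₀ : M) (A : EndField E M) (y : E) : E →L[ℝ] E :=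
  (chartInvDiff x₀ y).inverse ∘L A ((𝔠 x₀).symm y) ∘L chartInvDiff x₀ y

lemma triv_vector {x₀ : M} {y : E} (hy : y ∈ (𝔠 x₀).target) (v : Tan E ((𝔠 x₀).symm y)) :
    (trivializationAt E (TangentSpace 𝓘(ℝ, E)) x₀ ⟨(𝔠 x₀).symm y, v⟩).2 =
      (chartInvDiff x₀ y).inverse v := by
  have hs : (𝔠 x₀).symm y ∈ (trivializationAt E (TangentSpace 𝓘(ℝ, E)) x₀).baseSet := by
    rw [TangentBundle.trivializationAt_baseSet, ← extChartAt_source 𝓘(ℝ, E)]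
    exact (𝔠 x₀).map_target hy
  rw [← continuousLinearMapAt_eq_inverse hy, Trivialization.continuousLinearMapAt_apply,
    Trivialization.linearMapAt_apply, if_pos hs]

/-- The target bundle stays general so as to serve three times: trivial for one-forms, tangent for
endomorphisms, and itself a bundle of homomorphisms for two-tensors. -/
lemma triv_hom {G : Type*} [NormedAddCommGroup G] [NormedSpace ℝ G] {V : M → Type*}
    [TopologicalSpace (TotalSpace G V)] [∀ x, TopologicalSpace (V x)] [∀ x, AddCommGroup (V x)]
    [∀ x, Module ℝ (V x)] [FiberBundle G V] [VectorBundle ℝ G V] 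
    [∀ x, IsTopologicalAddGroup (V x)] [∀ x, ContinuousSMul ℝ (V x)]
    {x₀ : M} {y : E} (hy : y ∈ (𝔠 x₀).target) (α : Tan E ((𝔠 x₀).symm y) →L[ℝ] V ((𝔠 x₀).symm y)) :
    (trivializationAt (E →L[ℝ] G) (fun x : M => Tan E x →L[ℝ] V x) x₀ ⟨(𝔠 x₀).symm y, α⟩).2 =
      (trivializationAt G V x₀).continuousLinearMapAt ℝ ((𝔠 x₀).symm y) ∘L α ∘L
        chartInvDiff x₀ y := by
  rw [hom_trivializationAt_apply]
  simp only [inCoordinates]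
  rw [← symmL_eq_chartInvDiff hy]

end Frames

end

section

variable {E : Type*} [NormedAddCommGroup E] [NormedSpace ℝ E]
  {F : Type*} [NormedAddCommGroup F] [NormedSpace ℝ F]
  {M : Type*} [TopologicalSpace M] [ChartedSpace E M]

local notation "𝔠" => extChartAt 𝓘(ℝ, E)

/-! ### Smoothness of tensor fields in centred charts -/

section SmoothCoord

lemma _root_.Filter.EventuallyEq.contDiffAt_iff {f g : E → F} {x : E} (h : f =ᶠ[𝓝 x] g) :
    ContDiffAt ℝ ∞ f x ↔ ContDiffAt ℝ ∞ g x :=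
  ⟨fun H => H.congr_of_eventuallyEq h.symm, fun H => H.congr_of_eventuallyEq h⟩

lemma target_mem_nhds (x₀ : M) : (𝔠 x₀).target ∈ 𝓝 (𝔠 x₀ x₀) := extChartAt_target_mem_nhds x₀

lemma snd_mem_target (t₀ : ℝ) (x₀ : M) :
    ∀ᶠ q : ℝ × E in 𝓝 (t₀, 𝔠 x₀ x₀), q.2 ∈ (𝔠 x₀).target :=
  (continuousAt_snd (p := (t₀, 𝔠 x₀ x₀))).eventually (target_mem_nhds x₀)

lemma trivial_continuousLinearMapAt (x₀ x : M) :
    (trivializationAt ℝ (Bundle.Trivial M ℝ) x₀).continuousLinearMapAt ℝ x =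
      ContinuousLinearMap.id ℝ ℝ :=
  Bundle.Trivial.continuousLinearMapAt_trivialization ..

variable [IsManifold 𝓘(ℝ, E) ∞ M]

/-- Smoothness is a pointwise notion, so at each point it is enough to look at the chart centred
there. All later arguments are therefore local computations at the single point `𝔠 x₀ x₀`. -/
lemma contMDiffAt_vField_iff {X : VField E M} {x₀ : M} :
    ContMDiffAt 𝓘(ℝ, E) (𝓘(ℝ, E).prod 𝓘(ℝ, E)) ∞ (fun x => TotalSpace.mk' E x (X x)) x₀ ↔
      ContDiffAt ℝ ∞ (coordV x₀ X) (𝔠 x₀ x₀) := by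
  rw [contMDiffAt_section, contMDiffAt_iff_coord]
  refine Filter.EventuallyEq.contDiffAt_iff ?_
  filter_upwards [target_mem_nhds x₀] with y hy
  exact triv_vector hy _

lemma smoothVField_iff {X : VField E M} :
    SmoothVField X ↔ ∀ x₀, ContDiffAt ℝ ∞ (coordV x₀ X) (𝔠 x₀ x₀) :=
  forall_congr' fun _ => contMDiffAt_vField_iff

lemma smoothOneForm_iff {ξ : OneForm E M ℝ} :
    SmoothOneForm ξ ↔ ∀ x₀, ContDiffAt ℝ ∞ (coordOne x₀ ξ) (𝔠 x₀ x₀) := by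
  refine forall_congr' fun x₀ => ?_
  rw [contMDiffAt_section, contMDiffAt_iff_coord]
  refine Filter.EventuallyEq.contDiffAt_iff ?_
  filter_upwards [target_mem_nhds x₀] with y hy
  rw [triv_hom (V := Bundle.Trivial M ℝ) hy]
  rw [trivial_continuousLinearMapAt]
  rfl

lemma smoothEnd_iff {A : EndField E M} :
    SmoothEnd A ↔ ∀ x₀, ContDiffAt ℝ ∞ (coordEnd x₀ A) (𝔠 x₀ x₀) := by
  refine forall_congr' fun x₀ => ?_
  rw [contMDiffAt_section, contMDiffAt_iff_coord]
  refine Filter.EventuallyEq.contDiffAt_iff ?_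
  filter_upwards [target_mem_nhds x₀] with y hy
  rw [triv_hom hy, continuousLinearMapAt_eq_inverse hy]
  rfl

lemma smoothTwoTensor_iff {β : TwoTensor E M ℝ} :
    SmoothTwoTensor β ↔ ∀ x₀, ContDiffAt ℝ ∞ (coordTwo x₀ β) (𝔠 x₀ x₀) := by
  refine forall_congr' fun x₀ => ?_
  rw [contMDiffAt_section, contMDiffAt_iff_coord]
  refine Filter.EventuallyEq.contDiffAt_iff ?_
  filter_upwards [target_mem_nhds x₀] with y hy
  rw [triv_hom (V := fun x : M => Tan E x →L[ℝ] Bundle.Trivial M ℝ x) hy]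
  ext v w
  have hs : (𝔠 x₀).symm y ∈ (trivializationAt (E →L[ℝ] ℝ)
      (fun x : M => Tan E x →L[ℝ] Bundle.Trivial M ℝ x) x₀).baseSet := by
    rw [hom_trivializationAt_baseSet, TangentBundle.trivializationAt_baseSet,
      ← extChartAt_source 𝓘(ℝ, E)]
    exact ⟨(𝔠 x₀).map_target hy, mem_univ _⟩
  rw [ContinuousLinearMap.comp_apply, Trivialization.continuousLinearMapAt_apply,
    Trivialization.linearMapAt_apply, if_pos hs]
  rw [triv_hom (V := Bundle.Trivial M ℝ) hy]
  rw [trivial_continuousLinearMapAt]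
  rfl

lemma contMDiffWithinAt_vField_iff {X : ℝ → VField E M} {𝒯 : Set ℝ} {t₀ : ℝ} {x₀ : M} :
    ContMDiffWithinAt (𝓘(ℝ, ℝ).prod 𝓘(ℝ, E)) (𝓘(ℝ, E).prod 𝓘(ℝ, E)) ∞
      (fun p : ℝ × M => TotalSpace.mk' E (E := fun x : M => Tan E x) p.2 (X p.1 p.2))
      (𝒯 ×ˢ univ) (t₀, x₀) ↔
    ContDiffWithinAt ℝ ∞ (fun q : ℝ × E => coordV x₀ (X q.1) q.2) (𝒯 ×ˢ univ) (t₀, 𝔠 x₀ x₀) := by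
  rw [contMDiffWithinAt_totalSpace, and_iff_right contMDiffWithinAt_snd,
    contMDiffWithinAt_iff_coord]
  refine (fun h => Filter.EventuallyEq.congr_contDiffWithinAt
    (Filter.EventuallyEq.filter_mono h nhdsWithin_le_nhds) h.self_of_nhds) ?_
  filter_upwards [snd_mem_target t₀ x₀] with q hq
  exact triv_vector hq _

lemma contMDiffWithinAt_oneForm_iff {ξ : ℝ → OneForm E M ℝ} {𝒯 : Set ℝ} {t₀ : ℝ} {x₀ : M} :
    ContMDiffWithinAt (𝓘(ℝ, ℝ).prod 𝓘(ℝ, E)) (𝓘(ℝ, E).prod 𝓘(ℝ, E →L[ℝ] ℝ)) ∞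
      (fun p : ℝ × M => TotalSpace.mk' (E →L[ℝ] ℝ) (E := fun x : M => Cot E x) p.2 (ξ p.1 p.2))
      (𝒯 ×ˢ univ) (t₀, x₀) ↔
    ContDiffWithinAt ℝ ∞ (fun q : ℝ × E => coordOne x₀ (ξ q.1) q.2) (𝒯 ×ˢ univ)
      (t₀, 𝔠 x₀ x₀) := by
  rw [contMDiffWithinAt_totalSpace, and_iff_right contMDiffWithinAt_snd,
    contMDiffWithinAt_iff_coord]
  refine (fun h => Filter.EventuallyEq.congr_contDiffWithinAt
    (Filter.EventuallyEq.filter_mono h nhdsWithin_le_nhds) h.self_of_nhds) ?_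
  filter_upwards [snd_mem_target t₀ x₀] with q hq
  rw [triv_hom (V := Bundle.Trivial M ℝ) hq]
  rw [trivial_continuousLinearMapAt]
  rfl

end SmoothCoord

end

section

variable {E : Type*} [NormedAddCommGroup E] [NormedSpace ℝ E]
  {F : Type*} [NormedAddCommGroup F] [NormedSpace ℝ F]
  {M : Type*} [TopologicalSpace M] [ChartedSpace E M]

local notation "𝔠" => extChartAt 𝓘(ℝ, E)

/-- A map `M → M` in the coordinates of the charts at `x` and at `y`. -/
def coordMap (x y : M) (f : M → M) (z : E) : E :=
  extChartAt 𝓘(ℝ, E) y (f ((extChartAt 𝓘(ℝ, E) x).symm z))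

/-! ### Exterior derivatives under maps of a vector space -/

section PullbackCalculus

lemma two_le_infty : (2 : WithTop ℕ∞) ≤ ∞ := WithTop.coe_le_coe.2 le_top

/-- The exterior derivative commutes with pullback. -/
lemma alt_fderiv_pullback {f : E → E} {α : E → E →L[ℝ] F} {z : E}
    (hf : ContDiffAt ℝ ∞ f z) (hα : DifferentiableAt ℝ α (f z)) (a b : E) :
    fderiv ℝ (fun w => α (f w) ∘L fderiv ℝ f w) z a b
      - fderiv ℝ (fun w => α (f w) ∘L fderiv ℝ f w) z b a
      = fderiv ℝ α (f z) (fderiv ℝ f z a) (fderiv ℝ f z b)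
        - fderiv ℝ α (f z) (fderiv ℝ f z b) (fderiv ℝ f z a) := by
  have hf1 : DifferentiableAt ℝ f z := hf.differentiableAt (by simp)
  have hf2 : DifferentiableAt ℝ (fderiv ℝ f) z :=
    (hf.fderiv_right (m := 1) (WithTop.coe_le_coe.2 le_top)).differentiableAt (by simp)
  have hsym : IsSymmSndFDerivAt ℝ f z := hf.isSymmSndFDerivAt (by simpa using two_le_infty)
  have h1 := (hα.hasFDerivAt.comp z hf1.hasFDerivAt).clm_comp hf2.hasFDerivAt
  have h2 : fderiv ℝ (fun w => α (f w) ∘L fderiv ℝ f w) z = _ := h1.fderiv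
  rw [h2]
  -- After skew-symmetrization, the terms in which `f` is differentiated twice cancel by symmetry of
  -- the second derivative.
  have := hsym a b
  simp [this]

end PullbackCalculus

variable [IsManifold 𝓘(ℝ, E) ∞ M]

/-! ### Maps between charts -/

section Chain

lemma contDiffAt_coordMap {x y₀ : M} {f : M → M} {z : E} (hz : z ∈ (𝔠 x).target)
    (hf : ContMDiffAt 𝓘(ℝ, E) 𝓘(ℝ, E) ∞ f ((𝔠 x).symm z)) (hy : f ((𝔠 x).symm z) ∈ (𝔠 y₀).source) :
    ContDiffAt ℝ ∞ (coordMap x y₀ f) z := by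
  rw [← contMDiffAt_iff_contDiffAt]
  have h1 : ContMDiffAt 𝓘(ℝ, E) 𝓘(ℝ, E) ∞ (𝔠 x).symm z := by
    have := contMDiffWithinAt_extChartAt_symm_range (n := ∞) (I := 𝓘(ℝ, E)) x hz
    rwa [ModelWithCorners.range_eq_univ, contMDiffWithinAt_univ] at this
  have h2 : ContMDiffAt 𝓘(ℝ, E) 𝓘(ℝ, E) ∞ (𝔠 y₀) (f ((𝔠 x).symm z)) := by
    apply contMDiffAt_extChartAt'
    rwa [← extChartAt_source 𝓘(ℝ, E)]
  exact h2.comp z (hf.comp z h1)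

lemma mdifferentiableAt_symm {x : M} {z : E} (hz : z ∈ (𝔠 x).target) :
    MDifferentiableAt 𝓘(ℝ, E) 𝓘(ℝ, E) (𝔠 x).symm z := by
  have := contMDiffWithinAt_extChartAt_symm_range (n := ∞) (I := 𝓘(ℝ, E)) x hz
  rw [ModelWithCorners.range_eq_univ, contMDiffWithinAt_univ] at this
  exact this.mdifferentiableAt (by simp)

/-- Both sides are the derivative at `z` of `f` composed with the inverse chart at `x`, which near
`z` factors through the chart at `y₀`. -/
lemma mfderiv_comp_chartInvDiff {x y₀ : M} {f : M → M} {z : E} (hz : z ∈ (𝔠 x).target)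
    (hf : ContMDiffAt 𝓘(ℝ, E) 𝓘(ℝ, E) ∞ f ((𝔠 x).symm z))
    (hy : f ((𝔠 x).symm z) ∈ (𝔠 y₀).source) (v : E) :
    mfderiv 𝓘(ℝ, E) 𝓘(ℝ, E) f ((𝔠 x).symm z) (chartInvDiff x z v) =
      chartInvDiff y₀ (coordMap x y₀ f z) (fderiv ℝ (coordMap x y₀ f) z v) := by
  have hF : MDifferentiableAt 𝓘(ℝ, E) 𝓘(ℝ, E) (coordMap x y₀ f) z :=
    ((contDiffAt_coordMap hz hf hy).differentiableAt (by simp)).mdifferentiableAt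
  have hsy : coordMap x y₀ f z ∈ (𝔠 y₀).target := (𝔠 y₀).map_source hy
  have heq : (f ∘ (𝔠 x).symm) =ᶠ[𝓝 z] ((𝔠 y₀).symm ∘ coordMap x y₀ f) := by
    have hc : ContinuousAt (f ∘ (𝔠 x).symm) z :=
      ContinuousAt.comp hf.continuousAt (mdifferentiableAt_symm hz).continuousAt
    have : ∀ᶠ w in 𝓝 z, (f ∘ (𝔠 x).symm) w ∈ (𝔠 y₀).source :=
      hc.eventually_mem ((isOpen_extChartAt_source y₀).mem_nhds hy)
    filter_upwards [this] with w hw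
    exact ((𝔠 y₀).left_inv hw).symm
  have h1 := mfderiv_comp z (hf.mdifferentiableAt (by simp)) (mdifferentiableAt_symm hz)
  have h2 := mfderiv_comp z (mdifferentiableAt_symm hsy) hF
  rw [mfderiv_eq_fderiv] at h2
  have h3 := heq.mfderiv_eq (I := 𝓘(ℝ, E)) (I' := 𝓘(ℝ, E))
  have h4 : mfderiv 𝓘(ℝ, E) 𝓘(ℝ, E) (f ∘ (𝔠 x).symm) z v
     = mfderiv 𝓘(ℝ, E) 𝓘(ℝ, E) ((𝔠 y₀).symm ∘ coordMap x y₀ f) z v := by rw [h3]; rfl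
  rw [h1, h2] at h4
  exact h4

end Chain

/-! ### Contractions and compositions in coordinates -/

section CoordAlgebra

variable {x₀ : M} {y : E}

lemma chartInvDiff_inverse_apply (hy : y ∈ (𝔠 x₀).target) (v : Tan E ((𝔠 x₀).symm y)) :
    chartInvDiff x₀ y ((chartInvDiff x₀ y).inverse v) = v :=
  (chartInvDiff_isInvertible hy).self_apply_inverse v

lemma inverse_chartInvDiff_apply (hy : y ∈ (𝔠 x₀).target) (v : E) :
    (chartInvDiff (M := M) x₀ y).inverse (chartInvDiff x₀ y v) = v :=
  (chartInvDiff_isInvertible hy).inverse_apply_self v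

lemma chartInvDiff_coordV (hy : y ∈ (𝔠 x₀).target) (X : VField E M) :
    chartInvDiff x₀ y (coordV x₀ X y) = X ((𝔠 x₀).symm y) :=
  chartInvDiff_inverse_apply hy _

lemma coordOne_coordV (hy : y ∈ (𝔠 x₀).target) (α : OneForm E M F) (X : VField E M) :
    coordOne x₀ α y (coordV x₀ X y) = α ((𝔠 x₀).symm y) (X ((𝔠 x₀).symm y)) := by
  simp only [coordOne, ContinuousLinearMap.comp_apply, chartInvDiff_coordV hy]

lemma coordV_end (hy : y ∈ (𝔠 x₀).target) (A : EndField E M) (X : VField E M) :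
    coordV x₀ (fun x => A x (X x)) y = coordEnd x₀ A y (coordV x₀ X y) := by
  simp only [coordEnd, ContinuousLinearMap.comp_apply, chartInvDiff_coordV hy]
  rfl

lemma coordOne_two (hy : y ∈ (𝔠 x₀).target) (β : TwoTensor E M ℝ) (X : VField E M) :
    coordOne x₀ (fun x => β x (X x)) y = coordTwo x₀ β y (coordV x₀ X y) := by
  ext v
  simp only [coordOne, coordTwo, ContinuousLinearMap.comp_apply, chartInvDiff_coordV hy]
  rfl

omit [IsManifold 𝓘(ℝ, E) ∞ M] in
lemma coordTwo_apply (β : TwoTensor E M ℝ) (v w : E) :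
    coordTwo x₀ β y v w = β ((𝔠 x₀).symm y) (chartInvDiff x₀ y v) (chartInvDiff x₀ y w) := rfl

lemma chartInvDiff_coordEnd (hy : y ∈ (𝔠 x₀).target) (A : EndField E M) (v : E) :
    chartInvDiff x₀ y (coordEnd x₀ A y v) = A ((𝔠 x₀).symm y) (chartInvDiff x₀ y v) :=
  chartInvDiff_inverse_apply hy _

lemma coordOne_comp_end (hy : y ∈ (𝔠 x₀).target) (α : OneForm E M F) (A : EndField E M) :
    coordOne x₀ (fun x => α x ∘L A x) y = coordOne x₀ α y ∘L coordEnd x₀ A y := by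
  ext v
  simp only [coordOne, ContinuousLinearMap.comp_apply, chartInvDiff_coordEnd hy]

lemma coordEnd_comp (hy : y ∈ (𝔠 x₀).target) (A B : EndField E M) :
    coordEnd x₀ (fun x => A x ∘L B x) y = coordEnd x₀ A y ∘L coordEnd x₀ B y := by
  ext v
  rw [ContinuousLinearMap.comp_apply, coordEnd, coordEnd]
  simp only [ContinuousLinearMap.comp_apply, chartInvDiff_coordEnd hy]

lemma coordTwo_comp_left (hy : y ∈ (𝔠 x₀).target) (β : TwoTensor E M ℝ) (A : EndField E M) :
    coordTwo x₀ (fun x => β x ∘L A x) y = coordTwo x₀ β y ∘L coordEnd x₀ A y := by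
  ext v w
  simp only [coordTwo_apply, ContinuousLinearMap.comp_apply, chartInvDiff_coordEnd hy]

lemma coordTwo_comp_right (hy : y ∈ (𝔠 x₀).target) (β : TwoTensor E M ℝ) (A : EndField E M) :
    coordTwo x₀ (fun x => dualMap (A x) ∘L β x) y
      = precomp ℝ (coordEnd x₀ A y) ∘L coordTwo x₀ β y := by
  ext v w
  change β ((𝔠 x₀).symm y) (chartInvDiff x₀ y v) (A _ (chartInvDiff x₀ y w)) =
    β ((𝔠 x₀).symm y) (chartInvDiff x₀ y v) (chartInvDiff x₀ y (coordEnd x₀ A y w))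
  rw [chartInvDiff_coordEnd hy]

end CoordAlgebra

end

section

variable {E : Type*} [NormedAddCommGroup E] [NormedSpace ℝ E]
  {F : Type*} [NormedAddCommGroup F] [NormedSpace ℝ F]
  {M : Type*} [TopologicalSpace M] [ChartedSpace E M]

local notation "𝔠" => extChartAt 𝓘(ℝ, E)

instance : NormedAddCommGroup (E →L[ℝ] ℝ) := inferInstance
instance : NormedSpace ℝ (E →L[ℝ] ℝ) := inferInstance
instance : NormedAddCommGroup (E →L[ℝ] E →L[ℝ] ℝ) := inferInstance
instance : NormedSpace ℝ (E →L[ℝ] E →L[ℝ] ℝ) := inferInstance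
instance : NormedAddCommGroup (E →L[ℝ] E) := inferInstance
instance : NormedSpace ℝ (E →L[ℝ] E) := inferInstance

variable [IsManifold 𝓘(ℝ, E) ∞ M]

/-! ### Chart independence of the exterior derivative, and `d² = 0` -/

section ExteriorDerivative

lemma extD_apply (ξ : OneForm E M F) (x : M) (X Y : Tan E x) :
    extD ξ x X Y = fderiv ℝ (coordOne x ξ) (𝔠 x x) X Y - fderiv ℝ (coordOne x ξ) (𝔠 x x) Y X := by
  have h : chartDiff (E := E) x = ContinuousLinearMap.id ℝ E := chartDiff_self x
  have : extD ξ x X Y = fderiv ℝ (coordOne x ξ) (𝔠 x x) (chartDiff x X) (chartDiff x Y)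
    - fderiv ℝ (coordOne x ξ) (𝔠 x x) (chartDiff x Y) (chartDiff x X) := rfl
  rw [this, h]
  rfl

/-- The transition map from the chart at `x` to the chart at `x₀`. -/
lemma chartInvDiff_transition {x x₀ : M} {z : E} (hz : z ∈ (𝔠 x).target)
    (h : (𝔠 x).symm z ∈ (𝔠 x₀).source) (v : E) :
    chartInvDiff x z v = chartInvDiff x₀ (coordMap x x₀ id z) (fderiv ℝ (coordMap x x₀ id) z v) := by
  have := mfderiv_comp_chartInvDiff (f := id) hz contMDiffAt_id h v
  rw [mfderiv_id] at this
  exact this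

omit [IsManifold 𝓘(ℝ, E) ∞ M] in
lemma coordMap_id_symm {x x₀ : M} {z : E} (h : (𝔠 x).symm z ∈ (𝔠 x₀).source) :
    (𝔠 x₀).symm (coordMap x x₀ id z) = (𝔠 x).symm z := (𝔠 x₀).left_inv h

lemma coordOne_transition {x x₀ : M} {z : E} (hz : z ∈ (𝔠 x).target)
    (h : (𝔠 x).symm z ∈ (𝔠 x₀).source) (ξ : OneForm E M F) :
    coordOne x ξ z = coordOne x₀ ξ (coordMap x x₀ id z) ∘L fderiv ℝ (coordMap x x₀ id) z := by
  ext v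
  simp only [coordOne, ContinuousLinearMap.comp_apply]
  have h1 := chartInvDiff_transition hz h v
  have h2 := coordMap_id_symm h
  -- The two base points are only propositionally equal; the point is made a variable so that the
  -- two fibres can be identified by substitution.
  have key : ∀ (p : M), p = (𝔠 x).symm z → ∀ (w w' : E), w = w' →
      ξ ((𝔠 x).symm z) w' = ξ p w := by
    rintro p rfl w w' rfl; rfl
  exact key _ h2 _ _ h1.symm

omit [IsManifold 𝓘(ℝ, E) ∞ M] in
lemma source_preimage_mem_nhds {x x₀ : M} (h : x ∈ (𝔠 x₀).source) :
    ∀ᶠ z in 𝓝 (𝔠 x x), z ∈ (𝔠 x).target ∧ (𝔠 x).symm z ∈ (𝔠 x₀).source := by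
  refine Filter.Eventually.and (target_mem_nhds x) ?_
  have hc : ContinuousAt (𝔠 x).symm (𝔠 x x) := continuousAt_extChartAt_symm x
  apply hc.eventually_mem
  rw [(𝔠 x).left_inv (mem_extChartAt_source x)]
  exact (isOpen_extChartAt_source x₀).mem_nhds h

/-- The exterior derivative can be computed in any chart. -/
lemma coordTwo_extD {x₀ : M} {y : E} (hy : y ∈ (𝔠 x₀).target) (ξ : OneForm E M ℝ)
    (hξ : DifferentiableAt ℝ (coordOne x₀ ξ) y) (a b : E) :
    coordTwo x₀ (extD ξ) y a b =
      fderiv ℝ (coordOne x₀ ξ) y a b - fderiv ℝ (coordOne x₀ ξ) y b a := by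
  set x := (𝔠 x₀).symm y with hx
  have hxs : x ∈ (𝔠 x₀).source := (𝔠 x₀).map_target hy
  set τ : E → E := coordMap x x₀ id with hτ
  have hτx : τ (𝔠 x x) = y := by
    simp only [hτ, coordMap, id, (𝔠 x).left_inv (mem_extChartAt_source x)]
    rw [hx, (𝔠 x₀).right_inv hy]
  have hxt : 𝔠 x x ∈ (𝔠 x).target := mem_extChartAt_target x
  have hxs' : (𝔠 x).symm (𝔠 x x) ∈ (𝔠 x₀).source := by
    rwa [(𝔠 x).left_inv (mem_extChartAt_source x)]
  have hτs : ContDiffAt ℝ ∞ τ (𝔠 x x) := contDiffAt_coordMap hxt contMDiffAt_id hxs'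
  have hev : coordOne x ξ =ᶠ[𝓝 (𝔠 x x)] fun z => coordOne x₀ ξ (τ z) ∘L fderiv ℝ τ z := by
    filter_upwards [source_preimage_mem_nhds (E := E) hxs] with z hz
    exact coordOne_transition hz.1 hz.2 ξ
  -- The chart at `x` has identity differential at `x`, so the derivative of the transition map `τ`
  -- and `chartInvDiff x₀ y` are inverse to each other.
  have hD : ∀ v : E, v = chartInvDiff x₀ y (fderiv ℝ τ (𝔠 x x) v) := by
    intro v
    have h1 := chartInvDiff_transition hxt hxs' v
    rw [chartInvDiff_self] at h1
    have key : ∀ z z' : E, z = z' → ∀ w : E,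
        (chartInvDiff (M := M) x₀ z w : E) = chartInvDiff (M := M) x₀ z' w := by
      rintro z z' rfl w; rfl
    exact h1.trans (key _ _ hτx _)
  have hinv : ∀ v : E, fderiv ℝ τ (𝔠 x x) ((chartInvDiff x₀ y) v) = v := by
    intro v
    have h1 := hD (chartInvDiff x₀ y v)
    have h2 := congrArg (chartInvDiff (M := M) x₀ y).inverse h1
    have h3 := inverse_chartInvDiff_apply hy v
    have h4 := inverse_chartInvDiff_apply hy (fderiv ℝ τ (𝔠 x x) (chartInvDiff x₀ y v))
    exact h4.symm.trans (h2.symm.trans h3)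
  obtain ⟨a', ha'⟩ : ∃ a' : E, a' = chartInvDiff x₀ y a := ⟨_, rfl⟩
  obtain ⟨b', hb'⟩ : ∃ b' : E, b' = chartInvDiff x₀ y b := ⟨_, rfl⟩
  have ha : fderiv ℝ τ (𝔠 x x) a' = a := by rw [ha']; exact hinv a
  have hb : fderiv ℝ τ (𝔠 x x) b' = b := by rw [hb']; exact hinv b
  have h0 : coordTwo x₀ (extD ξ) y a b = extD ξ x a' b' := by rw [ha', hb']; rfl
  refine h0.trans ((extD_apply ξ x a' b').trans ?_)
  change fderiv ℝ (coordOne x ξ) (𝔠 x x) a' b' - fderiv ℝ (coordOne x ξ) (𝔠 x x) b' a' = _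
  rw [hev.fderiv_eq, alt_fderiv_pullback hτs (by rwa [hτx]), hτx, ha, hb]

/-- Transposition of bilinear forms. -/
def flipCLM : (E →L[ℝ] E →L[ℝ] ℝ) →L[ℝ] (E →L[ℝ] E →L[ℝ] ℝ) :=
  (ContinuousLinearMap.flipₗᵢ ℝ E E ℝ).toContinuousLinearEquiv

/-- The definition of `extD` uses a different chart at every point. A formula in one fixed chart
near `x₀` is what allows `extD ξ` itself to be differentiated. -/
lemma coordTwo_extD_eventually {x₀ : M} {ξ : OneForm E M ℝ}
    (hξ : ContDiffAt ℝ ∞ (coordOne x₀ ξ) (𝔠 x₀ x₀)) :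
    coordTwo x₀ (extD ξ) =ᶠ[𝓝 (𝔠 x₀ x₀)]
      fun y => fderiv ℝ (coordOne x₀ ξ) y - (fderiv ℝ (coordOne x₀ ξ) y).flip := by
  have h1 : ∀ᶠ y in 𝓝 (𝔠 x₀ x₀), ContDiffAt ℝ 1 (coordOne x₀ ξ) y :=
    (hξ.of_le (WithTop.coe_le_coe.2 le_top)).eventually (by simp)
  filter_upwards [target_mem_nhds x₀, h1] with y hy hd
  ext a b
  exact coordTwo_extD hy ξ (hd.differentiableAt (by simp)) a b

lemma SmoothOneForm.extD {ξ : OneForm E M ℝ} (hξ : SmoothOneForm ξ) :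
    SmoothTwoTensor (extD ξ) := by
  rw [smoothTwoTensor_iff]
  intro x₀
  have h := smoothOneForm_iff.1 hξ x₀
  refine ContDiffAt.congr_of_eventuallyEq ?_ (coordTwo_extD_eventually h)
  have h' : ContDiffAt ℝ ∞ (fderiv ℝ (coordOne x₀ ξ)) (𝔠 x₀ x₀) :=
    h.fderiv_right (WithTop.coe_le_coe.2 le_top)
  have h'' := flipCLM.contDiff.contDiffAt.comp (𝔠 x₀ x₀) h'
  exact h'.sub h''

lemma extD_skew (ξ : OneForm E M F) (x : M) (X Y : Tan E x) : extD ξ x X Y = -extD ξ x Y X := by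
  rw [extD_apply, extD_apply]; abel

lemma SmoothOneForm.isTwoForm_extD {ξ : OneForm E M ℝ} (hξ : SmoothOneForm ξ) :
    IsTwoForm (GenKahler.extD ξ) := ⟨hξ.extD, extD_skew ξ⟩

/-- `d² = 0` on one-forms. -/
lemma SmoothOneForm.closed_extD {ξ : OneForm E M ℝ} (hξ : SmoothOneForm ξ) :
    Closed₂ (GenKahler.extD ξ) := by
  intro x a b c
  have h := smoothOneForm_iff.1 hξ x
  have h' : ContDiffAt ℝ ∞ (fderiv ℝ (coordOne x ξ)) (𝔠 x x) :=
    h.fderiv_right (WithTop.coe_le_coe.2 le_top)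
  have hd := (h'.differentiableAt (by simp)).hasFDerivAt
  have hd' := (flipCLM (E := E)).hasFDerivAt.comp (𝔠 x x) hd
  have hsym : IsSymmSndFDerivAt ℝ (coordOne x ξ) (𝔠 x x) :=
    h.isSymmSndFDerivAt (by simpa using two_le_infty)
  have heq : fderiv ℝ (coordTwo x (GenKahler.extD ξ)) (𝔠 x x) = _ :=
    (coordTwo_extD_eventually h).fderiv_eq.trans (hd.sub hd').fderiv
  simp only [heq]
  -- The cyclic sum contains six second derivatives of the coefficients, which these symmetries
  -- cancel in pairs.
  have e1 := hsym a b
  have e2 := hsym b c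
  have e3 := hsym c a
  have f1 : ∀ u v w : E, ((fderiv ℝ (fderiv ℝ (coordOne x ξ)) (𝔠 x x) -
    flipCLM ∘L
      fderiv ℝ (fderiv ℝ (coordOne x ξ)) (𝔠 x x)) u) v w =
      fderiv ℝ (fderiv ℝ (coordOne x ξ)) (𝔠 x x) u v w
        - fderiv ℝ (fderiv ℝ (coordOne x ξ)) (𝔠 x x) u w v := fun u v w => rfl
  rw [f1, f1, f1, e1, e2, e3]
  ring

end ExteriorDerivative

/-! ### Differentials of functions -/

section Differential

lemma coordOne_dfun {u : M → ℝ} (hu : ContMDiff 𝓘(ℝ, E) 𝓘(ℝ, ℝ) ∞ u) {x₀ : M} {y : E}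
    (hy : y ∈ (𝔠 x₀).target) :
    coordOne x₀ (dfun u) y = fderiv ℝ (fun z => u ((𝔠 x₀).symm z)) y := by
  have h1 := mfderiv_comp y ((hu _).mdifferentiableAt (by simp)) (mdifferentiableAt_symm hy)
  rw [mfderiv_eq_fderiv] at h1
  ext v
  exact (congrArg (fun L : E →L[ℝ] ℝ => L v) h1).symm

omit [IsManifold 𝓘(ℝ, E) ∞ M] in
lemma contDiffAt_coord_fun {u : M → ℝ} (hu : ContMDiff 𝓘(ℝ, E) 𝓘(ℝ, ℝ) ∞ u) (x₀ : M) :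
    ContDiffAt ℝ ∞ (fun z => u ((𝔠 x₀).symm z)) (𝔠 x₀ x₀) := contMDiffAt_iff_coord.1 (hu x₀)

lemma smoothOneForm_dfun {u : M → ℝ} (hu : ContMDiff 𝓘(ℝ, E) 𝓘(ℝ, ℝ) ∞ u) :
    SmoothOneForm (E := E) (dfun u) := by
  rw [smoothOneForm_iff]
  intro x₀
  refine ContDiffAt.congr_of_eventuallyEq
    ((contDiffAt_coord_fun (E := E) hu x₀).fderiv_right (m := ∞) (WithTop.coe_le_coe.2 le_top)) ?_
  filter_upwards [target_mem_nhds (E := E) x₀] with y hy using coordOne_dfun hu hy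

lemma dfun_apply {u : M → ℝ} {x : M} (hu : ContMDiffAt 𝓘(ℝ, E) 𝓘(ℝ, ℝ) ∞ u x) (X : Tan E x) :
    dfun u x X = fderiv ℝ (fun z => u ((𝔠 x).symm z)) (𝔠 x x) X := by
  have hx : (𝔠 x).symm (𝔠 x x) = x := (𝔠 x).left_inv (mem_extChartAt_source x)
  have h1 := mfderiv_comp (I := 𝓘(ℝ, E)) (I' := 𝓘(ℝ, E)) (I'' := 𝓘(ℝ, ℝ)) (g := u) (𝔠 x x)
    (by rw [hx]; exact hu.mdifferentiableAt (by simp))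
    (mdifferentiableAt_symm (mem_extChartAt_target x))
  rw [mfderiv_eq_fderiv] at h1
  have h2 := congrArg (fun L : E →L[ℝ] ℝ => L X) h1
  have h3 : mfderiv 𝓘(ℝ, E) 𝓘(ℝ, E) (𝔠 x).symm (𝔠 x x) = ContinuousLinearMap.id ℝ E :=
    chartInvDiff_self x
  rw [h3] at h2
  refine Eq.trans ?_ h2.symm
  have key : ∀ p : M, p = x → (dfun u x X : ℝ) = (mfderiv 𝓘(ℝ, E) 𝓘(ℝ, ℝ) u p : E →L[ℝ] ℝ) X := by
    rintro p rfl; rfl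
  exact key _ hx

end Differential

/-! ### The Lie bracket in the centred chart -/

section Bracket

lemma coordV_self (Z : VField E M) (x : M) : coordV x Z (𝔠 x x) = Z x := by
  have hx : (𝔠 x).symm (𝔠 x x) = x := (𝔠 x).left_inv (mem_extChartAt_source x)
  have h3 : chartInvDiff (E := E) x (𝔠 x x) = ContinuousLinearMap.id ℝ E := chartInvDiff_self x
  have h1 : ∀ L : E →L[ℝ] E, L = ContinuousLinearMap.id ℝ E → ∀ v, L.inverse v = v := by
    rintro L rfl v; rw [ContinuousLinearMap.inverse_id]; rfl
  have key : ∀ p : M, p = x → (Z p : E) = Z x := by rintro p rfl; rfl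
  exact (h1 _ h3 _).trans (key _ hx)

lemma mlieBracket_apply (X Y : VField E M) (x : M) :
    VectorField.mlieBracket 𝓘(ℝ, E) X Y x =
      fderiv ℝ (coordV x Y) (𝔠 x x) (X x) - fderiv ℝ (coordV x X) (𝔠 x x) (Y x) := by
  have : IsManifold 𝓘(ℝ, E) 1 M := one_manifold
  have h1 : ∀ L : E →L[ℝ] E, L = ContinuousLinearMap.id ℝ E → ∀ v, L.inverse v = v := by
    rintro L rfl v; rw [ContinuousLinearMap.inverse_id]; rfl
  have h2 : VectorField.mlieBracket 𝓘(ℝ, E) X Y x =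
      VectorField.lieBracketWithin ℝ
      (VectorField.mpullbackWithin 𝓘(ℝ, E) 𝓘(ℝ, E) (𝔠 x).symm X (range 𝓘(ℝ, E)))
      (VectorField.mpullbackWithin 𝓘(ℝ, E) 𝓘(ℝ, E) (𝔠 x).symm Y (range 𝓘(ℝ, E)))
      ((𝔠 x).symm ⁻¹' univ ∩ range 𝓘(ℝ, E)) (𝔠 x x) :=
    h1 (mfderiv 𝓘(ℝ, E) 𝓘(ℝ, E) (𝔠 x) x) mfderiv_extChartAt_self _
  have hV : ∀ Z : VField E M,
      VectorField.mpullbackWithin 𝓘(ℝ, E) 𝓘(ℝ, E) (𝔠 x).symm Z (range 𝓘(ℝ, E)) = coordV x Z := by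
    intro Z
    ext y
    rw [ModelWithCorners.range_eq_univ, VectorField.mpullbackWithin_apply, mfderivWithin_univ]
    rfl
  have hs : (𝔠 x).symm ⁻¹' univ ∩ range 𝓘(ℝ, E) = univ := by
    rw [ModelWithCorners.range_eq_univ, preimage_univ, inter_univ]
  have key : ∀ (V W V' W' : E → E) (s : Set E), V = V' → W = W' → s = univ →
      VectorField.lieBracketWithin ℝ V W s (𝔠 x x) =
        fderiv ℝ W' (𝔠 x x) (V' (𝔠 x x)) - fderiv ℝ V' (𝔠 x x) (W' (𝔠 x x)) := by
    rintro V W _ _ _ rfl rfl rfl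
    rw [VectorField.lieBracketWithin_univ]; rfl
  refine h2.trans ((key _ _ _ _ _ (hV X) (hV Y) hs).trans ?_)
  rw [coordV_self, coordV_self]

end Bracket

end

section

variable {E : Type*} [NormedAddCommGroup E] [NormedSpace ℝ E]
  {F : Type*} [NormedAddCommGroup F] [NormedSpace ℝ F]
  {M : Type*} [TopologicalSpace M] [ChartedSpace E M]

local notation "𝔠" => extChartAt 𝓘(ℝ, E)

/-! ### Closure properties of smooth tensor fields -/

section CoordLinear

lemma coordV_add (x₀ : M) (X Y : VField E M) :
    coordV x₀ (fun x => X x + Y x) = fun y => coordV x₀ X y + coordV x₀ Y y :=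
  funext fun y => map_add (chartInvDiff x₀ y).inverse _ _

lemma coordV_sub (x₀ : M) (X Y : VField E M) :
    coordV x₀ (fun x => X x - Y x) = fun y => coordV x₀ X y - coordV x₀ Y y :=
  funext fun y => map_sub (chartInvDiff x₀ y).inverse _ _

lemma coordV_neg (x₀ : M) (X : VField E M) :
    coordV x₀ (fun x => -X x) = fun y => -coordV x₀ X y :=
  funext fun _ => map_neg _ _

lemma coordOne_add (x₀ : M) (α β : OneForm E M F) :
    coordOne x₀ (fun x => α x + β x) = fun y => coordOne x₀ α y + coordOne x₀ β y := rfl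

lemma coordOne_sub (x₀ : M) (α β : OneForm E M F) :
    coordOne x₀ (fun x => α x - β x) = fun y => coordOne x₀ α y - coordOne x₀ β y := rfl

lemma coordOne_neg (x₀ : M) (α : OneForm E M F) :
    coordOne x₀ (fun x => -α x) = fun y => -coordOne x₀ α y := rfl

lemma coordOne_smul (x₀ : M) (c : ℝ) (α : OneForm E M F) :
    coordOne x₀ (fun x => c • α x) = fun y => c • coordOne x₀ α y := rfl

lemma coordTwo_add (x₀ : M) (α β : TwoTensor E M ℝ) :
    coordTwo x₀ (fun x => α x + β x) = fun y => coordTwo x₀ α y + coordTwo x₀ β y := rfl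

lemma coordTwo_sub (x₀ : M) (α β : TwoTensor E M ℝ) :
    coordTwo x₀ (fun x => α x - β x) = fun y => coordTwo x₀ α y - coordTwo x₀ β y := rfl

lemma coordTwo_smul (x₀ : M) (c : ℝ) (α : TwoTensor E M ℝ) :
    coordTwo x₀ (fun x => c • α x) = fun y => c • coordTwo x₀ α y := rfl

lemma coordEnd_add (x₀ : M) (A B : EndField E M) :
    coordEnd x₀ (fun x => A x + B x) = fun y => coordEnd x₀ A y + coordEnd x₀ B y := by
  ext y v; exact map_add (chartInvDiff x₀ y).inverse _ _

lemma coordEnd_sub (x₀ : M) (A B : EndField E M) :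
    coordEnd x₀ (fun x => A x - B x) = fun y => coordEnd x₀ A y - coordEnd x₀ B y := by
  ext y v; exact map_sub (chartInvDiff x₀ y).inverse _ _

lemma coordEnd_neg (x₀ : M) (A : EndField E M) :
    coordEnd x₀ (fun x => -A x) = fun y => -coordEnd x₀ A y := by
  ext y v; exact map_neg (chartInvDiff x₀ y).inverse _

end CoordLinear

variable [IsManifold 𝓘(ℝ, E) ∞ M]

section Closure

variable {X Y : VField E M} {α β : OneForm E M ℝ} {B C : TwoTensor E M ℝ} {A A' : EndField E M}

lemma SmoothVField.add (hX : SmoothVField X) (hY : SmoothVField Y) :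
    SmoothVField (fun x => X x + Y x) := by
  rw [smoothVField_iff] at *
  intro x₀; rw [coordV_add]; exact (hX x₀).add (hY x₀)

lemma SmoothVField.sub (hX : SmoothVField X) (hY : SmoothVField Y) :
    SmoothVField (fun x => X x - Y x) := by
  rw [smoothVField_iff] at *
  intro x₀; rw [coordV_sub]; exact (hX x₀).sub (hY x₀)

lemma SmoothVField.neg (hX : SmoothVField X) : SmoothVField (fun x => -X x) := by
  rw [smoothVField_iff] at *
  intro x₀; rw [coordV_neg]; exact (hX x₀).neg

lemma SmoothOneForm.add (hα : SmoothOneForm α) (hβ : SmoothOneForm β) :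
    SmoothOneForm (fun x => α x + β x) := by
  rw [smoothOneForm_iff] at *
  intro x₀; rw [coordOne_add]; exact (hα x₀).add (hβ x₀)

lemma SmoothOneForm.sub (hα : SmoothOneForm α) (hβ : SmoothOneForm β) :
    SmoothOneForm (fun x => α x - β x) := by
  rw [smoothOneForm_iff] at *
  intro x₀; rw [coordOne_sub]; exact (hα x₀).sub (hβ x₀)

lemma SmoothOneForm.neg (hα : SmoothOneForm α) : SmoothOneForm (fun x => -α x) := by
  rw [smoothOneForm_iff] at *
  intro x₀; rw [coordOne_neg]; exact (hα x₀).neg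

lemma SmoothOneForm.smul (c : ℝ) (hα : SmoothOneForm α) : SmoothOneForm (fun x => c • α x) := by
  rw [smoothOneForm_iff] at *
  intro x₀; rw [coordOne_smul]; exact (contDiffAt_const (c := c)).smul (hα x₀)

lemma SmoothTwoTensor.add (hB : SmoothTwoTensor B) (hC : SmoothTwoTensor C) :
    SmoothTwoTensor (fun x => B x + C x) := by
  rw [smoothTwoTensor_iff] at *
  intro x₀; rw [coordTwo_add]; exact (hB x₀).add (hC x₀)

lemma SmoothTwoTensor.sub (hB : SmoothTwoTensor B) (hC : SmoothTwoTensor C) :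
    SmoothTwoTensor (fun x => B x - C x) := by
  rw [smoothTwoTensor_iff] at *
  intro x₀; rw [coordTwo_sub]; exact (hB x₀).sub (hC x₀)

lemma SmoothTwoTensor.smul (c : ℝ) (hB : SmoothTwoTensor B) :
    SmoothTwoTensor (fun x => c • B x) := by
  rw [smoothTwoTensor_iff] at *
  intro x₀; rw [coordTwo_smul]; exact (contDiffAt_const (c := c)).smul (hB x₀)

lemma SmoothEnd.add (hA : SmoothEnd A) (hA' : SmoothEnd A') :
    SmoothEnd (fun x => A x + A' x) := by
  rw [smoothEnd_iff] at *
  intro x₀; rw [coordEnd_add]; exact (hA x₀).add (hA' x₀)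

lemma SmoothEnd.sub (hA : SmoothEnd A) (hA' : SmoothEnd A') :
    SmoothEnd (fun x => A x - A' x) := by
  rw [smoothEnd_iff] at *
  intro x₀; rw [coordEnd_sub]; exact (hA x₀).sub (hA' x₀)

lemma SmoothEnd.neg (hA : SmoothEnd A) : SmoothEnd (fun x => -A x) := by
  rw [smoothEnd_iff] at *
  intro x₀; rw [coordEnd_neg]; exact (hA x₀).neg

omit [IsManifold 𝓘(ℝ, E) ∞ M] in
lemma eventually_target {p : E → Prop} {x₀ : M} (h : ∀ y ∈ (𝔠 x₀).target, p y) :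
    ∀ᶠ y in 𝓝 (𝔠 x₀ x₀), p y := by
  filter_upwards [target_mem_nhds (E := E) x₀] with y hy using h y hy

lemma SmoothEnd.comp (hA : SmoothEnd A) (hA' : SmoothEnd A') :
    SmoothEnd (fun x => A x ∘L A' x) := by
  rw [smoothEnd_iff] at *
  intro x₀
  exact ((hA x₀).clm_comp (hA' x₀)).congr_of_eventuallyEq
    (eventually_target fun y hy => coordEnd_comp hy A A')

lemma SmoothTwoTensor.apply (hB : SmoothTwoTensor B) (hX : SmoothVField X) :
    SmoothOneForm (fun x => B x (X x)) := by
  rw [smoothVField_iff, smoothTwoTensor_iff, smoothOneForm_iff] at *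
  intro x₀
  exact ((hB x₀).clm_apply (hX x₀)).congr_of_eventuallyEq
    (eventually_target fun y hy => coordOne_two hy B X)

lemma SmoothOneForm.comp (hα : SmoothOneForm α) (hA : SmoothEnd A) :
    SmoothOneForm (fun x => α x ∘L A x) := by
  rw [smoothOneForm_iff, smoothEnd_iff] at *
  intro x₀
  exact ((hα x₀).clm_comp (hA x₀)).congr_of_eventuallyEq
    (eventually_target fun y hy => coordOne_comp_end hy α A)

lemma SmoothTwoTensor.comp_left (hB : SmoothTwoTensor B) (hA : SmoothEnd A) :
    SmoothTwoTensor (fun x => B x ∘L A x) := by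
  rw [smoothTwoTensor_iff, smoothEnd_iff] at *
  intro x₀
  exact ((hB x₀).clm_comp (hA x₀)).congr_of_eventuallyEq
    (eventually_target fun y hy => coordTwo_comp_left hy B A)

lemma SmoothTwoTensor.comp_right (hB : SmoothTwoTensor B) (hA : SmoothEnd A) :
    SmoothTwoTensor (fun x => dualMap (A x) ∘L B x) := by
  rw [smoothTwoTensor_iff, smoothEnd_iff] at *
  intro x₀
  -- Composition in the second slot is composition in the first, conjugated by transposition.
  have h := (flipCLM (E := E)).contDiff.contDiffAt.comp (𝔠 x₀ x₀)
    (((flipCLM (E := E)).contDiff.contDiffAt.comp (𝔠 x₀ x₀) (hB x₀)).clm_comp (hA x₀))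
  exact h.congr_of_eventuallyEq
    (eventually_target fun y hy => coordTwo_comp_right hy B A)

lemma SmoothOneForm.apply (hα : SmoothOneForm α) (hX : SmoothVField X) :
    ContMDiff 𝓘(ℝ, E) 𝓘(ℝ, ℝ) ∞ (fun x => α x (X x)) := by
  rw [smoothOneForm_iff, smoothVField_iff] at *
  intro x₀
  rw [contMDiffAt_iff_coord]
  exact ((hα x₀).clm_apply (hX x₀)).congr_of_eventuallyEq
    (eventually_target fun y hy => (coordOne_coordV hy α X).symm)

lemma smoothEnd_id : SmoothEnd (fun x : M => ContinuousLinearMap.id ℝ (Tan E x)) := by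
  rw [smoothEnd_iff]
  intro x₀
  refine (contDiffAt_const (c := ContinuousLinearMap.id ℝ E)).congr_of_eventuallyEq
    (eventually_target fun y hy => ?_)
  ext v
  exact inverse_chartInvDiff_apply hy v

end Closure

/-! ### Extension of tangent vectors to vector fields -/

section Extension

variable [FiniteDimensional ℝ E] [T2Space M]

/-- Every tangent vector extends to a smooth vector field. -/
lemma exists_vField (x : M) (v : Tan E x) : ∃ X : VField E M, SmoothVField X ∧ X x = v := by
  obtain ⟨s, hs, hσ⟩ := FiberBundle.exists_contMDiffOn_extend (k := ∞) 𝓘(ℝ, E) E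
    (V := fun x : M => Tan E x) v
  obtain ⟨s', hs's, hs'o, hxs'⟩ := mem_nhds_iff.1 hs
  obtain ⟨f, -, hf⟩ := (SmoothBumpFunction.nhds_basis_tsupport (I := 𝓘(ℝ, E)) x).mem_iff.1
    (hs'o.mem_nhds hxs')
  refine ⟨fun p => f p • FiberBundle.extend E v p, ?_, ?_⟩
  · have := ContMDiffOn.smul_section_of_tsupport (n := ∞) (I := 𝓘(ℝ, E)) (F := E)
      (V := fun x : M => Tan E x) (u := s') (ψ := f) f.contMDiff.contMDiffOn hs'o hf (hσ.mono hs's)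
    exact this
  · simp

end Extension

end

section

variable {E : Type*} [NormedAddCommGroup E] [NormedSpace ℝ E]
  {F : Type*} [NormedAddCommGroup F] [NormedSpace ℝ F]
  {M : Type*} [TopologicalSpace M] [ChartedSpace E M]

local notation "𝔠" => extChartAt 𝓘(ℝ, E)

/-! ### Linear algebra of the Courant bracket at a point -/

section Model

variable (E) in
/-- The model fibre of `T ⊕ T^*`. -/
abbrev GFib : Type _ := E × (E →L[ℝ] ℝ)

/-- Twice the neutral pairing. -/
def pair2 (a b : GFib E) : ℝ := a.2 b.1 + b.2 a.1

lemma pair2_comm (a b : GFib E) : pair2 a b = pair2 b a := add_comm _ _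

lemma pair2_add_left (a b c : GFib E) : pair2 (a + b) c = pair2 a c + pair2 b c := by
  simp [pair2]; ring

lemma pair2_add_right (a b c : GFib E) : pair2 a (b + c) = pair2 a b + pair2 a c := by
  simp [pair2]; ring

lemma pair2_neg_left (a b : GFib E) : pair2 (-a) b = -pair2 a b := by
  simp [pair2]; ring

lemma pair2_neg_right (a b : GFib E) : pair2 a (-b) = -pair2 a b := by
  simp [pair2]; ring

lemma pair2_nondegenerate {a : GFib E} (h : ∀ r, pair2 a r = 0) : a = 0 := by
  have h1 : ∀ ζ : E →L[ℝ] ℝ, ζ a.1 = 0 := fun ζ => by simpa [pair2] using h (0, ζ)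
  have h2 : ∀ v : E, a.2 v = 0 := fun v => by simpa [pair2] using h (v, 0)
  refine Prod.ext ?_ (by ext v; exact h2 v)
  by_contra hne
  obtain ⟨ζ, hζ⟩ := SeparatingDual.exists_ne_zero (R := ℝ) hne
  exact hζ (h1 ζ)

/-- A three-form as a function of three vectors. -/
def tri (h : E [⋀^Fin 3]→L[ℝ] ℝ) (X Y Z : E) : ℝ := h ![X, Y, Z]

section tri
variable (h : E [⋀^Fin 3]→L[ℝ] ℝ)

lemma tri_add_left (X X' Y Z : E) : tri h (X + X') Y Z = tri h X Y Z + tri h X' Y Z := by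
  have := h.map_update_add ![X, Y, Z] 0 X X'
  have e : ∀ W : E, Function.update ![X, Y, Z] 0 W = ![W, Y, Z] := fun W => by
    ext i; fin_cases i <;> rfl
  rwa [e, e, e] at this

lemma tri_swap (X Y Z : E) : tri h Y X Z = -tri h X Y Z := by
  have := h.map_swap ![X, Y, Z] (i := 0) (j := 1) (by decide)
  have e : ![X, Y, Z] ∘ Equiv.swap (0 : Fin 3) 1 = ![Y, X, Z] := by
    ext i; fin_cases i <;> rfl
  rwa [e] at this

lemma tri_swap' (X Y Z : E) : tri h X Z Y = -tri h X Y Z := by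
  have := h.map_swap ![X, Y, Z] (i := 1) (j := 2) (by decide)
  have e : ![X, Y, Z] ∘ Equiv.swap (1 : Fin 3) 2 = ![X, Z, Y] := by
    ext i; fin_cases i <;> rfl
  rwa [e] at this

lemma tri_rotate (X Y Z : E) : tri h Y Z X = tri h X Y Z := by
  rw [tri_swap', tri_swap, neg_neg]

lemma tri_neg_left (X Y Z : E) : tri h (-X) Y Z = -tri h X Y Z := by
  have h0 := tri_add_left h 0 0 Y Z
  have := tri_add_left h X (-X) Y Z
  rw [add_zero] at h0
  rw [add_neg_cancel] at this
  linarith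

lemma tri_neg_mid (X Y Z : E) : tri h X (-Y) Z = -tri h X Y Z := by
  rw [tri_swap, tri_neg_left, tri_swap h X Y Z, neg_neg]

lemma tri_neg_right (X Y Z : E) : tri h X Y (-Z) = -tri h X Y Z := by
  rw [← tri_rotate h X, tri_neg_mid, tri_rotate]

end tri

/-- The trilinear form `2⟨[s, t], r⟩` in terms of the one-jets of `s` and `t`. -/
def courantJet (h : E [⋀^Fin 3]→L[ℝ] ℝ) (s t r : GFib E) (s' t' : E →L[ℝ] GFib E) : ℝ :=
  pair2 (t' s.1) r - pair2 (s' t.1) r + (1 / 2) * (pair2 (s' r.1) t - pair2 s (t' r.1))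
    + tri h s.1 t.1 r.1

/-- The one-jet of a field of orthogonal almost complex structures on `T ⊕ T^*`. -/
structure IsOrthJet (𝕁 : GFib E →L[ℝ] GFib E) (𝕁' : E →L[ℝ] GFib E →L[ℝ] GFib E) : Prop where
  sq : ∀ v, 𝕁 (𝕁 v) = -v
  orth : ∀ v w, pair2 (𝕁 v) (𝕁 w) = pair2 v w
  sq' : ∀ u v, 𝕁' u (𝕁 v) = -𝕁 (𝕁' u v)
  orth' : ∀ u v w, pair2 (𝕁' u v) (𝕁 w) = -pair2 (𝕁 v) (𝕁' u w)

/-- Auxiliary summand of the torsion of an almost complex structure on `T ⊕ T^*`. -/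
def torsionAux (𝕁 : GFib E →L[ℝ] GFib E) (𝕁' : E →L[ℝ] GFib E →L[ℝ] GFib E)
    (s t r : GFib E) : ℝ := pair2 (𝕁' (𝕁 s).1 t) r + pair2 (𝕁' s.1 t) (𝕁 r)

/-- The torsion, with respect to the Courant bracket, of an orthogonal almost complex structure,
as a trilinear form in terms of one-jets. -/
def torsion (h : E [⋀^Fin 3]→L[ℝ] ℝ) (𝕁 : GFib E →L[ℝ] GFib E)
    (𝕁' : E →L[ℝ] GFib E →L[ℝ] GFib E) (s t r : GFib E) : ℝ :=
  -(torsionAux 𝕁 𝕁' s t r + torsionAux 𝕁 𝕁' t r s + torsionAux 𝕁 𝕁' r s t)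
    + (tri h s.1 t.1 r.1 - tri h (𝕁 s).1 (𝕁 t).1 r.1 - tri h (𝕁 s).1 t.1 (𝕁 r).1
      - tri h s.1 (𝕁 t).1 (𝕁 r).1)

section IsOrthJet

variable {𝕁 : GFib E →L[ℝ] GFib E} {𝕁' : E →L[ℝ] GFib E →L[ℝ] GFib E}

lemma IsOrthJet.skew (h : IsOrthJet 𝕁 𝕁') (v w : GFib E) : pair2 (𝕁 v) w = -pair2 v (𝕁 w) := by
  rw [← h.orth v (𝕁 w), h.sq, pair2_neg_right, neg_neg]

lemma IsOrthJet.skew' (h : IsOrthJet 𝕁 𝕁') (u : E) (v w : GFib E) :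
    pair2 (𝕁' u v) w = -pair2 v (𝕁' u w) := by
  have h1 := h.orth' u v (𝕁 w)
  rw [h.sq, pair2_neg_right, h.sq', pair2_neg_right, h.orth] at h1
  linarith

/-- This is the differentiated skewness of `𝕁`. When two arguments of the torsion lie in one graph,
it moves the derivative of `𝕁` off the third argument, so that only the jet of that one graph
enters. -/
lemma IsOrthJet.torsionAux_swap (h : IsOrthJet 𝕁 𝕁') (s t r : GFib E) :
    torsionAux 𝕁 𝕁' s r t = -torsionAux 𝕁 𝕁' s t r := by
  have h1 := h.skew' (𝕁 s).1 r t
  have h2 := h.skew' s.1 r (𝕁 t)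
  rw [h.sq', pair2_neg_right, ← neg_neg (pair2 r _), ← h.skew] at h2
  rw [torsionAux, torsionAux, h1, h2, pair2_comm r, pair2_comm (𝕁 r)]; ring

/-- The left side is the pairing of `r` with `[s,t] - [𝕁s,𝕁t] + 𝕁([𝕁s,t] + [s,𝕁t])`, where `𝕁'.flip
s + 𝕁 ∘L s'` is the jet of `𝕁s`. Orthogonality and skewness of `𝕁` cancel every term in `s'` and
`t'`; this is why the torsion is a tensor. -/
lemma IsOrthJet.courantJet_sub (h : IsOrthJet 𝕁 𝕁') (H : E [⋀^Fin 3]→L[ℝ] ℝ) (s t r : GFib E)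
    (s' t' : E →L[ℝ] GFib E) :
    courantJet H s t r s' t'
      - courantJet H (𝕁 s) (𝕁 t) r (𝕁'.flip s + 𝕁 ∘L s') (𝕁'.flip t + 𝕁 ∘L t')
      - courantJet H (𝕁 s) t (𝕁 r) (𝕁'.flip s + 𝕁 ∘L s') t'
      - courantJet H s (𝕁 t) (𝕁 r) s' (𝕁'.flip t + 𝕁 ∘L t')
      = torsion H 𝕁 𝕁' s t r := by
  simp only [courantJet, torsion, torsionAux, add_apply, flip_apply,
    ContinuousLinearMap.comp_apply, pair2_add_left, pair2_add_right]
  linarith [h.skew (t' (𝕁 s).1) r, h.skew (s' (𝕁 t).1) r, h.orth (s' r.1) t, h.orth s (t' r.1),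
    h.orth (s' t.1) r, h.orth (t' s.1) r, h.skew (s' (𝕁 r).1) t, h.skew s (t' (𝕁 r).1),
    h.orth' r.1 s t, h.skew' (𝕁 r).1 s t, h.skew' (𝕁 t).1 s r, pair2_comm s (𝕁' (𝕁 t).1 r),
    h.orth' t.1 s r, pair2_comm (𝕁 s) (𝕁' t.1 r)]

/-- With this symmetry, additivity is needed in one slot only, and a mixed triple of graph vectors
can be rotated until its odd member comes last. -/
lemma torsion_rotate (H : E [⋀^Fin 3]→L[ℝ] ℝ) (s t r : GFib E) :
    torsion H 𝕁 𝕁' t r s = torsion H 𝕁 𝕁' s t r := by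
  simp only [torsion]
  linarith [tri_rotate H s.1 t.1 r.1, tri_rotate H (𝕁 s).1 (𝕁 t).1 r.1,
    tri_rotate H (𝕁 s).1 t.1 (𝕁 r).1, tri_rotate H s.1 (𝕁 t).1 (𝕁 r).1]

lemma torsion_add_left (H : E [⋀^Fin 3]→L[ℝ] ℝ) (s s₁ t r : GFib E) :
    torsion H 𝕁 𝕁' (s + s₁) t r = torsion H 𝕁 𝕁' s t r + torsion H 𝕁 𝕁' s₁ t r := by
  simp only [torsion, torsionAux, map_add, Prod.fst_add, add_apply, pair2_add_left,
    pair2_add_right, tri_add_left]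
  ring

end IsOrthJet

/-! ### Complex structures of symplectic type -/

section Symplectic

variable {𝕁 : GFib E →L[ℝ] GFib E} {𝕁' : E →L[ℝ] GFib E →L[ℝ] GFib E}

/-- If `𝕁 (X + BX) = WX`, then the torsion is given by `dB + H` and `dW`. -/
lemma IsOrthJet.symplectic (h : IsOrthJet 𝕁 𝕁') (H : E [⋀^Fin 3]→L[ℝ] ℝ)
    {B W : E →L[ℝ] E →L[ℝ] ℝ} {B' W' : E →L[ℝ] E →L[ℝ] E →L[ℝ] ℝ}
    (h0 : ∀ X, 𝕁 (X, B X) = (0, W X))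
    (h1 : ∀ u X, 𝕁' u (X, B X) + 𝕁 (0, B' u X) = (0, W' u X)) (X Y Z : E) :
    torsion H 𝕁 𝕁' (X, B X) (Y, B Y) (Z, B Z)
      = B' X Y Z + B' Y Z X + B' Z X Y + tri H X Y Z ∧
    torsion H 𝕁 𝕁' (𝕁 (X, B X)) (Y, B Y) (Z, B Z) = W' X Y Z + W' Y Z X + W' Z X Y := by
  have e1 : ∀ u X, 𝕁' u (X, B X) = (0, W' u X) - 𝕁 (0, B' u X) := fun u X =>
    eq_sub_of_add_eq (h1 u X)
  have p1 : ∀ u X Y, pair2 (𝕁' u (X, B X)) (Y, B Y) = W' u X Y := fun u X Y => by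
    rw [e1, sub_eq_add_neg, pair2_add_left, pair2_neg_left, h.skew, h0]; simp [pair2]
  have p2 : ∀ u X Y, pair2 (𝕁' u (X, B X)) (𝕁 (Y, B Y)) = -B' u X Y := fun u X Y => by
    rw [e1, sub_eq_add_neg, pair2_add_left, pair2_neg_left, h.orth, h0]; simp [pair2]
  -- The image under `𝕁` has no vector part, so derivatives and values of `H` along it vanish.
  have a0 : ∀ X, (𝕁 (X, B X)).1 = 0 := fun X => by rw [h0]
  have t0 : ∀ Y Z, tri H 0 Y Z = 0 := fun Y Z => by
    have := tri_add_left H 0 0 Y Z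
    rw [add_zero] at this; linarith
  have t1 : ∀ Y Z, tri H Y 0 Z = 0 := fun Y Z => by rw [tri_swap, t0, neg_zero]
  constructor
  · simp only [torsion, torsionAux, a0, t0, t1, p2, map_zero, zero_apply]
    simp only [pair2]; simp; ring
  · simp only [torsion, torsionAux, h.sq, a0, t0, t1, h.sq', pair2_neg_left, pair2_neg_right,
      Prod.fst_neg, map_neg, neg_apply, p1, h.orth, map_zero, zero_apply, tri_neg_left]
    have t2 : ∀ X Y, tri H X Y 0 = 0 := fun X Y => by rw [← tri_rotate, t1]
    simp only [pair2, t2]; simp; ring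

end Symplectic

/-! ### Bihermitian geometry in terms of one-jets -/

section Bihermitian

/-- The one-jet of a field `I` of almost complex structures orthogonal with respect to the
symmetric part of the two-tensor `a`. -/
structure IsComplexJet (a : E →L[ℝ] E →L[ℝ] ℝ) (I : E →L[ℝ] E) (I' : E →L[ℝ] E →L[ℝ] E) :
    Prop where
  sq : ∀ X, I (I X) = -X
  sq' : ∀ u X, I' u (I X) = -I (I' u X)
  orth : ∀ X Y, a (I X) (I Y) + a (I Y) (I X) = a X Y + a Y X

/-- The expression `a'(X; Y, Z) - a'(Y; X, Z) + a'(Z; X, Y) + H(X, Y, Z)` in a one-jet of a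
two-tensor. -/
def kap (h : E [⋀^Fin 3]→L[ℝ] ℝ) (a' : E →L[ℝ] E →L[ℝ] E →L[ℝ] ℝ) (X Y Z : E) : ℝ :=
  a' X Y Z - a' Y X Z + a' Z X Y + tri h X Y Z

/-- The integrability of the complex structure `I` on the graph of the two-tensor `a` in
`T ⊕ T^*`, as a condition on one-jets. -/
structure InvJet (h : E [⋀^Fin 3]→L[ℝ] ℝ) (a : E →L[ℝ] E →L[ℝ] ℝ)
    (a' : E →L[ℝ] E →L[ℝ] E →L[ℝ] ℝ) (I : E →L[ℝ] E) (I' : E →L[ℝ] E →L[ℝ] E) : Prop where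
  parallel : ∀ X Y Z, kap h a' X Y Z - kap h a' (I X) (I Y) Z
    = a (I' Z X) (I Y) + a (I Y) (I' Z X)
  nijenhuis : ∀ X Y, I' (I X) Y - I' (I Y) X + I (I' Y X) - I (I' X Y) = 0

/-- `𝕁` preserves the graph of `a` and acts there as `I`, to first order. -/
structure ActsAs (𝕁 : GFib E →L[ℝ] GFib E) (𝕁' : E →L[ℝ] GFib E →L[ℝ] GFib E)
    (a : E →L[ℝ] E →L[ℝ] ℝ) (a' : E →L[ℝ] E →L[ℝ] E →L[ℝ] ℝ) (I : E →L[ℝ] E)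
    (I' : E →L[ℝ] E →L[ℝ] E) : Prop where
  map : ∀ X, 𝕁 (X, a X) = (I X, a (I X))
  map' : ∀ u X, 𝕁' u (X, a X) + 𝕁 (0, a' u X) = (I' u X, a' u (I X) + a (I' u X))

variable {h : E [⋀^Fin 3]→L[ℝ] ℝ} {𝕁 𝕁₂ : GFib E →L[ℝ] GFib E}
  {𝕁' 𝕁₂' : E →L[ℝ] GFib E →L[ℝ] GFib E}
  {a c : E →L[ℝ] E →L[ℝ] ℝ} {a' c' : E →L[ℝ] E →L[ℝ] E →L[ℝ] ℝ}
  {I J : E →L[ℝ] E} {I' J' : E →L[ℝ] E →L[ℝ] E}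

lemma IsComplexJet.orth₂ (hI : IsComplexJet a I I') (X Y : E) :
    a (I X) Y + a Y (I X) = -(a X (I Y) + a (I Y) X) := by
  have := hI.orth X (I Y)
  simp only [hI.sq, map_neg, neg_apply] at this
  linarith

lemma ActsAs.pair_left (hA : ActsAs 𝕁 𝕁' a a' I I') (hJ : IsOrthJet 𝕁 𝕁') (u X : E) (r : GFib E) :
    pair2 (𝕁' u (X, a X)) r
      = r.2 (I' u X) + a (I' u X) r.1 + a' u (I X) r.1 + a' u X (𝕁 r).1 := by
  rw [eq_sub_of_add_eq (hA.map' u X), sub_eq_add_neg, pair2_add_left, pair2_neg_left, hJ.skew]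
  simp only [pair2, add_apply, map_zero]; ring

/-- The torsion of `𝕁` on two vectors in the graph of `a` and one vector in the graph of `c`. -/
lemma ActsAs.torsion_mixed (hJ : IsOrthJet 𝕁 𝕁') (hA : ActsAs 𝕁 𝕁' a a' I I')
    (hc : ∀ X, 𝕁 (X, c X) = (J X, c (J X))) (hac : ∀ X Y, a X Y + c Y X = 0)
    (hI : IsComplexJet a I I') (X Y Z : E) :
    torsion h 𝕁 𝕁' (X, a X) (Y, a Y) (Z, c Z)
      = (kap h a' X Y Z - kap h a' (I X) (I Y) Z - (a (I' Z X) (I Y) + a (I Y) (I' Z X)))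
      - (kap h a' (I X) Y (J Z) + kap h a' X (I Y) (J Z)
        + (a (I' (J Z) X) Y + a Y (I' (J Z) X))) := by
  have e : ∀ u V, 𝕁 (𝕁 (u, V)) = -(u, V) := fun u V => hJ.sq _
  have hac' : ∀ X Y, c Y X = -a X Y := fun X Y => by linarith [hac X Y]
  have c1 : J (J Z) = -Z := by
    have := e Z (c Z); rw [hc, hc] at this; exact congrArg Prod.fst this
  -- After this exchange no derivative of `𝕁` is applied to `(Z, c Z)`, and the jet of `c` is not
  -- needed.
  rw [torsion, hJ.torsionAux_swap (Y, a Y)]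
  simp only [torsionAux, hc, hA.pair_left hJ, hA.map, c1, hI.sq, kap, hac', map_neg]
  ring

/-- The torsion of `𝕁` on the graph of `a`. -/
lemma ActsAs.torsion_pure (hJ : IsOrthJet 𝕁 𝕁') (hA : ActsAs 𝕁 𝕁' a a' I I')
    (hI : IsComplexJet a I I') (X Y Z : E) :
    torsion h 𝕁 𝕁' (X, a X) (Y, a Y) (Z, a Z)
      = (kap h a' X Y Z - kap h a' (I X) (I Y) Z - (a (I' Z X) (I Y) + a (I Y) (I' Z X)))
      - (kap h a' (I X) Y (I Z) + kap h a' X (I Y) (I Z)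
        + (a (I' (I Z) X) Y + a Y (I' (I Z) X)))
      - (a (I' (I X) Y - I' (I Y) X + I (I' Y X) - I (I' X Y)) Z
        + a Z (I' (I X) Y - I' (I Y) X + I (I' Y X) - I (I' X Y))) := by
  rw [torsion, hJ.torsionAux_swap (Y, a Y)]
  simp only [torsionAux, hA.pair_left hJ, hA.map, hI.sq, kap, map_neg, map_add, map_sub,
    add_apply, sub_apply]
  linarith [hI.orth₂ (I' X Y) Z, hI.orth₂ (I' Y X) Z]

/-- The two summands in `ActsAs.torsion_mixed` are related by the action of `I`. -/
lemma IsComplexJet.parallel_apply (hI : IsComplexJet a I I')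
    (hp : ∀ X Y Z, kap h a' X Y Z - kap h a' (I X) (I Y) Z
      = a (I' Z X) (I Y) + a (I Y) (I' Z X)) (X Y Z : E) :
    kap h a' (I X) Y Z + kap h a' X (I Y) Z + (a (I' Z X) Y + a Y (I' Z X)) = 0 := by
  have := hp (I X) Y Z
  have e : kap h a' (-X) (I Y) Z = -kap h a' X (I Y) Z := by
    simp only [kap, map_neg, neg_apply, tri_neg_left]; ring
  rw [hI.sq, e, hI.sq'] at this
  have o := hI.orth (I' Z X) Y
  simp only [map_neg, neg_apply] at this
  linarith

/-- The two structures agree on the graph of `a` and are opposite on that of `c`. In the mixed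
torsion the terms containing `JZ` therefore change sign from one structure to the other, and adding
the two equations isolates the condition `parallel`. Given this, the torsion on the graph of `a`
reduces to the symmetrized pairing of the Nijenhuis vector `N` with the third argument; taking `N`
itself there, definiteness of `a` gives `N = 0`. -/
lemma InvJet.of_torsion (hJ : IsOrthJet 𝕁 𝕁') (hJ₂ : IsOrthJet 𝕁₂ 𝕁₂')
    (hA : ActsAs 𝕁 𝕁' a a' I I') (hA₂ : ActsAs 𝕁₂ 𝕁₂' a a' I I')
    (hc : ∀ X, 𝕁 (X, c X) = (J X, c (J X))) (hc₂ : ∀ X, 𝕁₂ (X, c X) = (-J X, c (-J X)))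
    (hac : ∀ X Y, a X Y + c Y X = 0) (hI : IsComplexJet a I I')
    (hpos : ∀ X, a X X = 0 → X = 0)
    (ht : ∀ s t r, torsion h 𝕁 𝕁' s t r = 0) (ht₂ : ∀ s t r, torsion h 𝕁₂ 𝕁₂' s t r = 0) :
    InvJet h a a' I I' := by
  have p : ∀ X Y Z, kap h a' X Y Z - kap h a' (I X) (I Y) Z
      = a (I' Z X) (I Y) + a (I Y) (I' Z X) := fun X Y Z => by
    have e1 := hA.torsion_mixed (h := h) hJ hc hac hI X Y Z
    have e2 := hA₂.torsion_mixed (h := h) (J := -J) hJ₂ hc₂ hac hI X Y Z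
    rw [ht] at e1; rw [ht₂] at e2
    have n : ∀ X Y Z, kap h a' X Y (-Z) = -kap h a' X Y Z := fun X Y Z => by
      simp only [kap, map_neg, neg_apply, tri_neg_right]; ring
    simp only [neg_apply, n, map_neg] at e2
    linarith
  refine ⟨p, fun X Y => hpos _ ?_⟩
  set N := I' (I X) Y - I' (I Y) X + I (I' Y X) - I (I' X Y)
  have e1 := hA.torsion_pure (h := h) hJ hI X Y N
  rw [ht, hI.parallel_apply p, p] at e1
  linarith

lemma InvJet.torsion_pure (hi : InvJet h a a' I I') (hJ : IsOrthJet 𝕁 𝕁')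
    (hA : ActsAs 𝕁 𝕁' a a' I I') (hI : IsComplexJet a I I') (X Y Z : E) :
    torsion h 𝕁 𝕁' (X, a X) (Y, a Y) (Z, a Z) = 0 := by
  rw [hA.torsion_pure hJ hI, hI.parallel_apply hi.parallel, hi.parallel, hi.nijenhuis]; simp

lemma InvJet.torsion_mixed (hi : InvJet h a a' I I') (hJ : IsOrthJet 𝕁 𝕁')
    (hA : ActsAs 𝕁 𝕁' a a' I I') (hc : ∀ X, 𝕁 (X, c X) = (J X, c (J X)))
    (hac : ∀ X Y, a X Y + c Y X = 0) (hI : IsComplexJet a I I') (X Y Z : E) :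
    torsion h 𝕁 𝕁' (X, a X) (Y, a Y) (Z, c Z) = 0 := by
  rw [hA.torsion_mixed hJ hc hac hI, hI.parallel_apply hi.parallel, hi.parallel]; simp

/-- The torsion vanishes if both halves of the bihermitian structure are integrable. -/
lemma torsion_eq_zero (hi : InvJet h a a' I I') (hi' : InvJet h c c' J J') (hJ : IsOrthJet 𝕁 𝕁')
    (hA : ActsAs 𝕁 𝕁' a a' I I') (hC : ActsAs 𝕁 𝕁' c c' J J')
    (hac : ∀ X Y, a X Y + c Y X = 0) (hI : IsComplexJet a I I') (hJc : IsComplexJet c J J')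
    (hspan : ∀ s : GFib E, ∃ X Y, s = (X, a X) + (Y, c Y)) (s t r : GFib E) :
    torsion h 𝕁 𝕁' s t r = 0 := by
  have hca : ∀ X Y, c X Y + a Y X = 0 := fun X Y => by linarith [hac Y X]
  have m := fun X Y Z => hi.torsion_mixed (c := c) hJ hA hC.map hac hI X Y Z
  have m' := fun X Y Z => hi'.torsion_mixed (c := a) hJ hC hA.map hca hJc X Y Z
  have p := hi.torsion_pure hJ hA hI
  have p' := hi'.torsion_pure hJ hC hJc
  have rot := torsion_rotate (𝕁 := 𝕁) (𝕁' := 𝕁') h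
  have al := torsion_add_left (𝕁 := 𝕁) (𝕁' := 𝕁') h
  generalize torsion h 𝕁 𝕁' = f at *
  -- Additivity in the other two slots is rotated from the first.
  have am : ∀ s t t₁ r, f s (t + t₁) r = f s t r + f s t₁ r := fun s t t₁ r => by
    rw [← rot s, al, rot s t r, rot s t₁ r]
  have ar : ∀ s t r r₁, f s t (r + r₁) = f s t r + f s t r₁ := fun s t r r₁ => by
    rw [rot (r + r₁) s t, al, ← rot r s t, ← rot r₁ s t]
  obtain ⟨X, X', rfl⟩ := hspan s
  obtain ⟨Y, Y', rfl⟩ := hspan t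
  obtain ⟨Z, Z', rfl⟩ := hspan r
  -- Of the eight types of triples two are pure, and the six mixed ones are rotations of `m` or
  -- `m'`.
  have r1 := fun X Y Z => (rot (Z, c Z) (X, a X) (Y, a Y)).symm.trans (m X Y Z)
  have r2 := fun X Y Z => (rot (X, a X) (Y, a Y) (Z, c Z)).trans (m X Y Z)
  have r3 := fun X Y Z => (rot (Z, a Z) (X, c X) (Y, c Y)).symm.trans (m' X Y Z)
  have r4 := fun X Y Z => (rot (X, c X) (Y, c Y) (Z, a Z)).trans (m' X Y Z)
  rw [al, am, am, ar, ar, ar, ar, p, m, m', p', r1, r2, r3, r4]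
  simp only [add_zero]

end Bihermitian
end Model

end

section

variable {E : Type*} [NormedAddCommGroup E] [NormedSpace ℝ E]
  {F : Type*} [NormedAddCommGroup F] [NormedSpace ℝ F]
  {M : Type*} [TopologicalSpace M] [ChartedSpace E M]

local notation "𝔠" => extChartAt 𝓘(ℝ, E)

/-! ### Closed two-forms and integrability, on one-jets -/

section ModelIdentities

/-- The one-jet of a closed two-form. -/
structure ClosedJet (S : E →L[ℝ] E →L[ℝ] ℝ) (S' : E →L[ℝ] E →L[ℝ] E →L[ℝ] ℝ) : Prop where
  skew : ∀ X Y, S X Y = -S Y X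
  skew' : ∀ u X Y, S' u X Y = -S' u Y X
  closed : ∀ X Y Z, S' X Y Z + S' Y Z X + S' Z X Y = 0

variable {h : E [⋀^Fin 3]→L[ℝ] ℝ} {a c a₁ S P W : E →L[ℝ] E →L[ℝ] ℝ}
  {a' c' a₁' S' P' W' : E →L[ℝ] E →L[ℝ] E →L[ℝ] ℝ}
  {I J : E →L[ℝ] E} {I' J' : E →L[ℝ] E →L[ℝ] E}

/-- Integrability on the graph of `a` is not affected by adding `P + SI` to `a`, where `P` and `S`
are closed two-forms. -/
lemma InvJet.add (hi : InvJet h a a' I I') (hsq : ∀ X, I (I X) = -X)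
    (hsq' : ∀ u X, I' u (I X) = -I (I' u X)) (hP : ClosedJet P P') (hS : ClosedJet S S')
    (h1 : ∀ X Y, a₁ X Y = a X Y + P X Y + S (I X) Y)
    (h1' : ∀ u X Y, a₁' u X Y = a' u X Y + P' u X Y + (S' u (I X) Y + S (I' u X) Y)) :
    InvJet h a₁ a₁' I I' := by
  refine ⟨fun X Y Z => ?_, hi.nijenhuis⟩
  have hp := hi.parallel X Y Z
  -- The Nijenhuis identity multiplied by `I` and contracted with `S`; it absorbs the derivatives of
  -- `I` that the new term `S(I·,·)` brings in.
  have hn : S (I' (I X) (I Y) - I' (I Y) (I X) - I' X Y + I' Y X) Z = 0 := by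
    have := congrArg (fun V => S (I V) Z) (hi.nijenhuis X Y)
    simp only [map_add, map_sub, hsq, ← neg_eq_iff_eq_neg.2 (hsq' _ _), map_zero, add_apply,
      sub_apply, neg_apply, zero_apply, map_neg] at this
    simp only [map_add, map_sub, add_apply, sub_apply]
    linarith
  simp only [map_add, map_sub, add_apply, sub_apply, hsq', map_neg, neg_apply] at hn
  simp only [kap, h1, h1', hsq, hsq', map_neg, neg_apply] at hp ⊢
  linarith [hP.closed X Y Z, hP.closed (I X) (I Y) Z, hS.closed X (I Y) Z, hS.closed (I X) Y Z,
    hP.skew' Y X Z, hP.skew' (I Y) (I X) Z, hP.skew (I' Z X) (I Y), hS.skew' Y (I X) Z,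
    hS.skew' (I Y) X Z, hS.skew (I (I' Z X)) (I Y), hS.skew Y (I' Z X), hS.skew' X (I Y) Z,
    hS.skew' (I X) Y Z]

/-- The zero two-tensor. -/
lemma InvJet.zero (hn : ∀ X Y, I' (I X) Y - I' (I Y) X + I (I' Y X) - I (I' X Y) = 0) :
    InvJet 0 0 0 I I' :=
  ⟨fun X Y Z => by simp [kap, tri], hn⟩

/-- A closed two-form `B` with `dB + H = 0`. -/
lemma InvJet.of_closed (hn : ∀ X Y, I' (I X) Y - I' (I Y) X + I (I' Y X) - I (I' X Y) = 0)
    (hs : ∀ X Y, a X Y = -a Y X) (hs' : ∀ u X Y, a' u X Y = -a' u Y X)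
    (hc : ∀ X Y Z, a' X Y Z + a' Y Z X + a' Z X Y + tri h X Y Z = 0) : InvJet h a a' I I' :=
  ⟨fun X Y Z => by
    simp only [kap]
    linarith [hc X Y Z, hc (I X) (I Y) Z, hs (I' Z X) (I Y), hs' Y X Z, hs' (I Y) (I X) Z], hn⟩

/-- The compatibility of the two halves of a bihermitian structure, for commuting `I` and `J`. -/
lemma InvJet.mixed (hi : InvJet h a a' I I') (hi' : InvJet h c c' J J')
    (hac : ∀ X Y, a X Y + c Y X = 0) (hac' : ∀ u X Y, a' u X Y + c' u Y X = 0)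
    (hI : IsComplexJet a I I') (hJ : IsComplexJet c J J') (hcomm : ∀ X, I (J X) = J (I X))
    (hpos : ∀ X, a X X = 0 → X = 0) (X Y : E) :
    I' (J X) Y - J (I' X Y) = J' (I Y) X - I (J' Y X) := by
  rw [← sub_eq_zero]
  refine hpos _ ?_
  -- For the defect `V` of the identity, the symmetrized pairing of `V` with itself is computed.
  -- Each of the four derivative terms of `V` is turned into one instance of `parallel`, two for `I`
  -- and two for `J`. Since `c` is minus the transpose of `a`, these instances cancel.
  obtain ⟨V, hV⟩ : ∃ V, V = I' (J X) Y - J (I' X Y) - (J' (I Y) X - I (J' Y X)) := ⟨_, rfl⟩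
  rw [← hV]
  have e : ∀ X Y, c X Y = -a Y X := fun X Y => by linarith [hac Y X]
  have e' : ∀ u X Y, c' u X Y = -a' u Y X := fun u X Y => by linarith [hac' u Y X]
  have o1 := hI.orth (I' (J X) Y) V
  have p1 := hi.parallel Y (I V) (J X)
  have p2 := hi.parallel Y (I (J V)) X
  have p3 := hi'.parallel X (J V) (I Y)
  have p4 := hi'.parallel X (J (I V)) Y
  have o2 : a (J (I' X Y)) V + a V (J (I' X Y)) = -(a (I' X Y) (J V) + a (J V) (I' X Y)) := by
    have := hJ.orth₂ (I' X Y) V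
    simp only [e] at this; linarith
  have o3 := hI.orth₂ (J' Y X) V
  have k1 := congrArg (fun T => a T V) hV
  have k2 := congrArg (fun T => a V T) hV
  simp only [map_sub, sub_apply] at k1 k2
  simp only [hI.sq, hJ.sq, hcomm, kap, e, e', map_neg, neg_apply, neg_neg, tri_neg_mid]
    at p1 p2 p3 p4
  have t : ∀ X Y Z, tri h Z Y X = -tri h X Y Z := fun X Y Z => by
    rw [tri_swap, tri_swap', neg_neg, tri_swap]
  linarith [t Y (I V) (J X), t (I Y) V (J X), t (I Y) (J V) X, t Y (J (I V)) X]

/-- A complex structure `J` is integrable if `Ω` and `ΩJ` are closed. -/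
lemma nijenhuis_of_closed (hW : ClosedJet W W') (hS : ClosedJet S S')
    (hsq : ∀ X, J (J X) = -X) (hsq' : ∀ u X, J' u (J X) = -J (J' u X))
    (h1 : ∀ X Y, S X Y = W (J X) Y) (h1' : ∀ u X Y, S' u X Y = W' u (J X) Y + W (J' u X) Y)
    (hnd : ∀ X, (∀ Z, W X Z = 0) → X = 0) (X Y : E) :
    J' (J X) Y - J' (J Y) X + J (J' Y X) - J (J' X Y) = 0 := by
  have hj : ∀ X Y, W (J X) Y = W X (J Y) := fun X Y => by
    rw [← h1, hS.skew, h1, hW.skew, neg_neg]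
  have key : ∀ Z, W (J' X Y - J' Y X - J' (J X) (J Y) + J' (J Y) (J X)) Z = 0 := fun Z => by
    have z2 := h1' Z (J X) (J Y)
    have z3 := hj (J' Z X) (J Y)
    simp only [hsq, hsq', map_neg, neg_apply] at z2 z3
    simp only [map_add, map_sub, add_apply, sub_apply]
    have z4 := h1' (J X) (J Y) Z
    have z5 := h1' (J Y) (J X) Z
    simp only [hsq, map_neg, neg_apply] at z4 z5
    linarith [h1' X Y Z, h1' Y X Z, h1' Z X Y, hS.closed X Y Z, hS.closed (J X) (J Y) Z,
      hW.closed X (J Y) Z, hW.closed (J X) Y Z, hS.skew' Y X Z, hS.skew' (J Y) (J X) Z,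
      hW.skew' (J Y) X Z, hW.skew' Y (J X) Z]
  -- Testing against `JZ` and moving `J` across `W` turns the combination in `key` into the
  -- Nijenhuis tensor.
  refine hnd _ fun Z => ?_
  have := key (J Z)
  rw [← hj] at this
  simp only [map_add, map_sub, add_apply, sub_apply, hsq', hsq, map_neg, neg_apply] at this ⊢
  linarith

/-- The two-form `d(α ∘ A)` in terms of one-jets, where `α` is closed. -/
def dComp (α : E →L[ℝ] ℝ) (α' : E →L[ℝ] E →L[ℝ] ℝ) (A : E →L[ℝ] E) (A' : E →L[ℝ] E →L[ℝ] E)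
    (X Y : E) : ℝ :=
  α' X (A Y) + α (A' X Y) - (α' Y (A X) + α (A' Y X))

/-- The terms in `α'` agree by its symmetry; what is left is `α ∘ I` applied to the Nijenhuis
tensor. This is the reason why `dJdu` has type (1,1) when `J` is integrable. -/
lemma dComp_invariant {α : E →L[ℝ] ℝ} {α' : E →L[ℝ] E →L[ℝ] ℝ} (hα : ∀ X Y, α' X Y = α' Y X)
    (hsq : ∀ X, I (I X) = -X) (hsq' : ∀ u X, I' u (I X) = -I (I' u X))
    (hn : ∀ X Y, I' (I X) Y - I' (I Y) X + I (I' Y X) - I (I' X Y) = 0) (X Y : E) :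
    dComp α α' I I' (I X) (I Y) = dComp α α' I I' X Y := by
  have := congrArg (fun V => α (I V)) (hn X Y)
  simp only [map_add, map_sub, hsq, ← neg_eq_iff_eq_neg.2 (hsq' _ _), map_zero, map_neg] at this
  simp only [dComp, hsq, map_neg]
  linarith [hα (I X) Y, hα X (I Y)]

/-- Exhibits `K(·,I·)`, for `K = dJdu`, as a closed two-form plus a closed two-form composed with
`J`, the shape that `InvJet.add` accepts for `J`. The second derivatives match because `I` and `J`
commute; the first derivatives match by `InvJet.mixed` (hypothesis `hm`) and the differentiated
commutation relation. -/
lemma dComp_mixed {α : E →L[ℝ] ℝ} {α' : E →L[ℝ] E →L[ℝ] ℝ} (hα : ∀ X Y, α' X Y = α' Y X)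
    (hcomm : ∀ X, I (J X) = J (I X))
    (hcomm' : ∀ u X, I' u (J X) + I (J' u X) = J' u (I X) + J (I' u X))
    {Q : E →L[ℝ] E} {Q' : E →L[ℝ] E →L[ℝ] E} (hQ : ∀ X, Q X = -I (J X))
    (hQ' : ∀ u X, Q' u X = -(I' u (J X) + I (J' u X)))
    (hm : ∀ X Y, I' (J X) Y - J (I' X Y) = J' (I Y) X - I (J' Y X)) (X Y : E) :
    -dComp α α' J J' X (I Y) = dComp α α' Q Q' X Y + dComp α α' I I' (J X) Y := by
  have e := congrArg α (hm X Y)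
  have e' := congrArg α (hcomm' X Y)
  simp only [map_add, map_sub] at e e'
  simp only [dComp, hQ, hQ', map_add, map_neg, ← hcomm]
  linarith [hα (J X) (I Y)]

end ModelIdentities

end

section

variable {E : Type*} [NormedAddCommGroup E] [NormedSpace ℝ E]
  {F : Type*} [NormedAddCommGroup F] [NormedSpace ℝ F]
  {M : Type*} [TopologicalSpace M] [ChartedSpace E M]

local notation "𝔠" => extChartAt 𝓘(ℝ, E)

/-! ### The Gualtieri map on a fibre -/

section Fibre

/-- A symmetric bilinear form and an orthogonal complex structure on a vector space. -/
structure IsHermFib (g : E →L[ℝ] E →L[ℝ] ℝ) (I : E →L[ℝ] E) : Prop where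
  symm : ∀ X Y, g X Y = g Y X
  sq : ∀ X, I (I X) = -X
  orth : ∀ X Y, g (I X) (I Y) = g X Y

/-- The block matrix `(A B; C D)` acting on the model fibre of `T ⊕ T^*`. -/
def blk (A : E →L[ℝ] E) (B : (E →L[ℝ] ℝ) →L[ℝ] E) (C : E →L[ℝ] E →L[ℝ] ℝ)
    (D : (E →L[ℝ] ℝ) →L[ℝ] (E →L[ℝ] ℝ)) : GFib E →L[ℝ] GFib E :=
  (A.coprod B).prod (C.coprod D)

/-- The first component of the Gualtieri map on a fibre. -/
def gual (g b : E →L[ℝ] E →L[ℝ] ℝ) (I J : E →L[ℝ] E) : GFib E →L[ℝ] GFib E :=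
  (1 / 2 : ℝ) • (blk (.id ℝ E) 0 b (.id ℝ _) ∘L
    blk (I + J) (-((g ∘L I).inverse - (g ∘L J).inverse)) (g ∘L I - g ∘L J)
      (-(precomp ℝ I + precomp ℝ J)) ∘L blk (.id ℝ E) 0 (-b) (.id ℝ _))

variable {g b K : E →L[ℝ] E →L[ℝ] ℝ} {I J : E →L[ℝ] E}

lemma IsHermFib.neg (h : IsHermFib g I) : IsHermFib g (-I) where
  symm := h.symm
  sq X := by simp [h.sq]
  orth X Y := by simp [h.orth]

lemma IsHermFib.skew (h : IsHermFib g I) (X Y : E) : g (I X) Y = -g X (I Y) := by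
  rw [← h.orth X (I Y), h.sq, map_neg, neg_neg]

/-- A complex structure on a vector space as an equivalence. -/
def IsHermFib.equiv (h : IsHermFib g I) : E ≃L[ℝ] E :=
  .equivOfInverse I (-I) (fun X => by simp [h.sq]) (fun X => by simp [h.sq])

lemma IsHermFib.isInvertible (h : IsHermFib g I) (hg : g.IsInvertible) :
    (g ∘L I).IsInvertible := by
  obtain ⟨e, rfl⟩ := hg
  exact ⟨h.equiv.trans e, rfl⟩

lemma IsHermFib.inverse_apply (h : IsHermFib g I) (hg : g.IsInvertible) (X : E) :
    (g ∘L I).inverse (g X) = -I X := by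
  have := (h.isInvertible hg).inverse_apply_self (-I X)
  rwa [comp_apply, map_neg, h.sq, neg_neg] at this

/-- Invertibility is not needed, because `inverse` is zero on non-invertible maps. The lemma serves
the substitution of `-J` for `J`, which turns the formula for `𝕁₁` into that for `𝕁₂`. -/
lemma inverse_neg {V W : Type*} [NormedAddCommGroup V] [NormedSpace ℝ V] [NormedAddCommGroup W]
    [NormedSpace ℝ W] (f : V →L[ℝ] W) : (-f).inverse = -f.inverse := by
  have key : ∀ f : V →L[ℝ] W, f.IsInvertible → (-f).inverse = -f.inverse := by
    rintro _ ⟨e, rfl⟩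
    have h : -(e : V →L[ℝ] W) = (e.trans (ContinuousLinearEquiv.neg ℝ) : V ≃L[ℝ] W) := rfl
    rw [h, inverse_equiv, inverse_equiv]
    ext w; simp
  by_cases h : f.IsInvertible
  · exact key f h
  · have h' : ¬(-f).IsInvertible := fun h' => h <| by
      obtain ⟨e, he⟩ := h'
      exact ⟨e.trans (ContinuousLinearEquiv.neg ℝ), by
        rw [← neg_neg f, ← he]; rfl⟩
    rw [inverse_of_not_isInvertible h, inverse_of_not_isInvertible h', neg_zero]

/-- The lift of vectors to the graph of `b + g`, on which `𝕁₁` acts as `I`. -/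
lemma gual_plus (hI : IsHermFib g I) (hJ : IsHermFib g J) (hg : g.IsInvertible) (X : E) :
    gual g b I J (X, (b + g) X) = (I X, (b + g) (I X)) := by
  have e1 := hI.inverse_apply hg X
  have e2 := hJ.inverse_apply hg X
  refine Prod.ext ?_ ?_
  · simp [gual, blk, e1, e2]
    module
  · ext Y
    simp [gual, blk, e1, e2, hI.skew, hJ.skew]
    ring

lemma gual_minus (hI : IsHermFib g I) (hJ : IsHermFib g J) (hg : g.IsInvertible) (X : E) :
    gual g b I J (X, (b - g) X) = (J X, (b - g) (J X)) := by
  have e1 := hI.inverse_apply hg X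
  have e2 := hJ.inverse_apply hg X
  refine Prod.ext ?_ ?_
  · simp [gual, blk, e1, e2]
    module
  · ext Y
    simp [gual, blk, e1, e2, hI.skew, hJ.skew]
    ring

lemma lift_span (hg : g.IsInvertible) (s : GFib E) :
    ∃ X Y, s = (X, (b + g) X) + (Y, (b - g) Y) := by
  obtain ⟨v, ξ⟩ := s
  obtain ⟨ζ, hζ⟩ : ∃ ζ, g ζ = ξ - b v := ⟨_, hg.self_apply_inverse _⟩
  obtain rfl : ξ = g ζ + b v := by rw [hζ, sub_add_cancel]
  -- The components must satisfy `X + Y = v` and `g(X - Y) = ξ - bv`.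
  refine ⟨(1 / 2 : ℝ) • (v + ζ), (1 / 2 : ℝ) • (v - ζ), Prod.ext ?_ ?_⟩
  · simp; module
  · simp; module

/-- The action of an endomorphism of `T ⊕ T^*` on the graphs of `b ± g`. -/
structure IsFrame (𝕁 : GFib E →L[ℝ] GFib E) (g b : E →L[ℝ] E →L[ℝ] ℝ) (I J : E →L[ℝ] E) :
    Prop where
  plus : ∀ X, 𝕁 (X, (b + g) X) = (I X, (b + g) (I X))
  minus : ∀ X, 𝕁 (X, (b - g) X) = (J X, (b - g) (J X))

lemma isFrame_gual (hI : IsHermFib g I) (hJ : IsHermFib g J) (hg : g.IsInvertible) :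
    IsFrame (gual g b I J) g b I J :=
  ⟨gual_plus hI hJ hg, gual_minus hI hJ hg⟩

/-- The graphs of `b + g` and `b - g` are orthogonal, and the pairing restricts to them as `2g` and
`-2g`. Orthogonality and positivity of the Gualtieri map are read off from this. -/
lemma pair2_lift (hb : ∀ X Y, b X Y = -b Y X) (hs : ∀ X Y, g X Y = g Y X) (X Y X' Y' : E) :
    pair2 ((X, (b + g) X) + (Y, (b - g) Y)) ((X', (b + g) X') + (Y', (b - g) Y'))
      = 2 * (g X X' - g Y Y') := by
  simp [pair2]
  linarith [hb X X', hb X Y', hb Y X', hb Y Y', hs X X', hs Y Y', hs X Y', hs Y X']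

lemma IsFrame.sq {𝕁 : GFib E →L[ℝ] GFib E} (h : IsFrame 𝕁 g b I J) (hI : IsHermFib g I)
    (hJ : IsHermFib g J) (hg : g.IsInvertible) (s : GFib E) : 𝕁 (𝕁 s) = -s := by
  obtain ⟨X, Y, rfl⟩ := lift_span (b := b) hg s
  rw [map_add, map_add, h.plus, h.minus, h.plus, h.minus, hI.sq, hJ.sq]
  simp only [map_neg, neg_add]; rfl

lemma IsFrame.orth {𝕁 : GFib E →L[ℝ] GFib E} (h : IsFrame 𝕁 g b I J) (hI : IsHermFib g I)
    (hJ : IsHermFib g J) (hg : g.IsInvertible) (hb : ∀ X Y, b X Y = -b Y X) (s t : GFib E) :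
    pair2 (𝕁 s) (𝕁 t) = pair2 s t := by
  obtain ⟨X, Y, rfl⟩ := lift_span (b := b) hg s
  obtain ⟨X', Y', rfl⟩ := lift_span (b := b) hg t
  rw [map_add, map_add, h.plus, h.minus, h.plus, h.minus, pair2_lift hb hI.symm,
    pair2_lift hb hI.symm, hI.orth, hJ.orth]

lemma IsFrame.comm {𝕁 𝕁₂ : GFib E →L[ℝ] GFib E} (h : IsFrame 𝕁 g b I J)
    (h₂ : IsFrame 𝕁₂ g b I (-J)) (hg : g.IsInvertible) (s : GFib E) : 𝕁 (𝕁₂ s) = 𝕁₂ (𝕁 s) := by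
  obtain ⟨X, Y, rfl⟩ := lift_span (b := b) hg s
  rw [map_add, map_add, h₂.plus, h₂.minus, map_add, map_add, h.plus, h.minus, h.plus, h.minus,
    h₂.plus, h₂.minus]
  simp

lemma IsFrame.pos {𝕁 𝕁₂ : GFib E →L[ℝ] GFib E} (h : IsFrame 𝕁 g b I J)
    (h₂ : IsFrame 𝕁₂ g b I (-J)) (hg : g.IsInvertible) (hI : IsHermFib g I) (hJ : IsHermFib g J)
    (hb : ∀ X Y, b X Y = -b Y X) (hpos : ∀ X, X ≠ 0 → 0 < g X X) (s : GFib E) (hs : s ≠ 0) :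
    0 < pair2 (-𝕁 (𝕁₂ s)) s := by
  obtain ⟨X, Y, rfl⟩ := lift_span (b := b) hg s
  -- On the graph of `b + g` the operator `-𝕁𝕁₂` is the identity, on that of `b - g` minus the
  -- identity; the pairing becomes `2(g(X,X) + g(Y,Y))`.
  have e : -𝕁 (𝕁₂ ((X, (b + g) X) + (Y, (b - g) Y)))
      = (X, (b + g) X) + (-Y, (b - g) (-Y)) := by
    rw [map_add, h₂.plus, h₂.minus, map_add, h.plus, h.minus, hI.sq, neg_apply, map_neg J, hJ.sq]
    simp only [map_neg, neg_add, neg_neg]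
    rw [← Prod.neg_mk, ← Prod.neg_mk, neg_neg]
  rw [e, pair2_lift hb hI.symm]
  have nn : ∀ X, 0 ≤ g X X := fun X => by
    rcases eq_or_ne X 0 with rfl | hX
    · simp
    · exact (hpos X hX).le
  simp only [map_neg, neg_apply, sub_neg_eq_add]
  have : X ≠ 0 ∨ Y ≠ 0 := by
    by_contra hc
    push Not at hc
    exact hs (by rw [hc.1, hc.2]; simp)
  rcases this with hX | hY
  · linarith [hpos X hX, nn Y]
  · linarith [hpos Y hY, nn X]

lemma isInvertible_of_pos [FiniteDimensional ℝ E] (hpos : ∀ X, X ≠ 0 → g X X ≠ 0) :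
    g.IsInvertible := by
  have hinj : Function.Injective (g : E →ₗ[ℝ] (E →L[ℝ] ℝ)) := by
    rw [← LinearMap.ker_eq_bot, LinearMap.ker_eq_bot']
    intro X hX
    by_contra hne
    exact hpos X hne (by rw [show g X = 0 from hX]; rfl)
  have hd : Module.finrank ℝ E = Module.finrank ℝ (E →L[ℝ] ℝ) := by
    rw [← (LinearMap.toContinuousLinearMap : (E →ₗ[ℝ] ℝ) ≃ₗ[ℝ] _).finrank_eq]
    exact Subspace.dual_finrank_eq.symm
  exact ⟨(LinearEquiv.ofInjectiveOfFinrankEq _ hinj hd).toContinuousLinearEquiv, by ext; rfl⟩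

end Fibre

end

section

variable {E : Type*} [NormedAddCommGroup E] [NormedSpace ℝ E]
  {F : Type*} [NormedAddCommGroup F] [NormedSpace ℝ F]
  {M : Type*} [TopologicalSpace M] [ChartedSpace E M]

local notation "𝔠" => extChartAt 𝓘(ℝ, E)

/-! ### Families on a fibre -/

section FibreFamily

variable {P : Type*} [NormedAddCommGroup P] [NormedSpace ℝ P] {p₀ : P}

instance : NormedAddCommGroup (GFib E →L[ℝ] GFib E) := inferInstance
instance : NormedSpace ℝ (GFib E →L[ℝ] GFib E) := inferInstance

lemma contDiffAt_inverse [FiniteDimensional ℝ E] {n : WithTop ℕ∞} {f : P → E →L[ℝ] E →L[ℝ] ℝ}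
    (hf : ContDiffAt ℝ n f p₀) (hi : (f p₀).IsInvertible) :
    ContDiffAt ℝ n (fun p => (f p).inverse) p₀ := by
  have : CompleteSpace E := FiniteDimensional.complete ℝ E
  obtain ⟨e, he⟩ := hi
  have := contDiffAt_map_inverse (𝕜 := ℝ) (n := n) e
  rw [he] at this
  exact this.comp p₀ hf

lemma contDiffAt_blk {n : WithTop ℕ∞} {A : P → E →L[ℝ] E} {B : P → (E →L[ℝ] ℝ) →L[ℝ] E}
    {C : P → E →L[ℝ] E →L[ℝ] ℝ} {D : P → (E →L[ℝ] ℝ) →L[ℝ] (E →L[ℝ] ℝ)}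
    (hA : ContDiffAt ℝ n A p₀) (hB : ContDiffAt ℝ n B p₀) (hC : ContDiffAt ℝ n C p₀)
    (hD : ContDiffAt ℝ n D p₀) :
    ContDiffAt ℝ n (fun p => blk (A p) (B p) (C p) (D p)) p₀ := by
  have h : (fun p => blk (A p) (B p) (C p) (D p)) = fun p =>
      inl ℝ E (E →L[ℝ] ℝ) ∘L (A p ∘L fst ℝ E (E →L[ℝ] ℝ) + B p ∘L snd ℝ E (E →L[ℝ] ℝ))
      + inr ℝ E (E →L[ℝ] ℝ) ∘L (C p ∘L fst ℝ E (E →L[ℝ] ℝ) + D p ∘L snd ℝ E (E →L[ℝ] ℝ)) := by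
    ext p v <;> simp [blk]
  rw [h]
  exact (contDiffAt_const.clm_comp ((hA.clm_comp contDiffAt_const).add
    (hB.clm_comp contDiffAt_const))).add (contDiffAt_const.clm_comp
    ((hC.clm_comp contDiffAt_const).add (hD.clm_comp contDiffAt_const)))

lemma contDiffAt_precomp {n : WithTop ℕ∞} {A : P → E →L[ℝ] E} (hA : ContDiffAt ℝ n A p₀) :
    ContDiffAt ℝ n (fun p => (precomp ℝ (A p) : (E →L[ℝ] ℝ) →L[ℝ] (E →L[ℝ] ℝ))) p₀ :=
  ((compL ℝ E E ℝ).flip.contDiff (n := n)).contDiffAt.comp p₀ hA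

lemma contDiffAt_gual [FiniteDimensional ℝ E] {n : WithTop ℕ∞} {g b : P → E →L[ℝ] E →L[ℝ] ℝ}
    {I J : P → E →L[ℝ] E} (hg : ContDiffAt ℝ n g p₀) (hb : ContDiffAt ℝ n b p₀)
    (hI : ContDiffAt ℝ n I p₀) (hJ : ContDiffAt ℝ n J p₀) (hhI : IsHermFib (g p₀) (I p₀))
    (hhJ : IsHermFib (g p₀) (J p₀)) (hgi : (g p₀).IsInvertible) :
    ContDiffAt ℝ n (fun p => gual (g p) (b p) (I p) (J p)) p₀ := by
  have hgI := hg.clm_comp hI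
  have hgJ := hg.clm_comp hJ
  have h1 := contDiffAt_inverse hgI (hhI.isInvertible hgi)
  have h2 := contDiffAt_inverse hgJ (hhJ.isInvertible hgi)
  exact ((contDiffAt_blk contDiffAt_const contDiffAt_const hb contDiffAt_const).clm_comp
    ((contDiffAt_blk (hI.add hJ) (h1.sub h2).neg (hgI.sub hgJ)
      ((contDiffAt_precomp hI).add (contDiffAt_precomp hJ)).neg).clm_comp
    (contDiffAt_blk contDiffAt_const contDiffAt_const hb.neg contDiffAt_const))).const_smul _

/-- The parameter space is arbitrary: with the space variable this yields the jet relation in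
`ActsAs`, with the time variable the derivative of a deformation. -/
lemma hasFDerivAt_map_graph {𝕁 : P → GFib E →L[ℝ] GFib E} {𝕁' : P →L[ℝ] GFib E →L[ℝ] GFib E}
    {a : P → E →L[ℝ] E →L[ℝ] ℝ} {a' : P →L[ℝ] E →L[ℝ] E →L[ℝ] ℝ} {I : P → E →L[ℝ] E}
    {I' : P →L[ℝ] E →L[ℝ] E} (h𝕁 : HasFDerivAt 𝕁 𝕁' p₀) (ha : HasFDerivAt a a' p₀)
    (hI : HasFDerivAt I I' p₀)
    (h : ∀ᶠ p in 𝓝 p₀, ∀ X, 𝕁 p (X, a p X) = (I p X, a p (I p X))) (u : P) (X : E) :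
    𝕁' u (X, a p₀ X) + 𝕁 p₀ (0, a' u X) = (I' u X, a' u (I p₀ X) + a p₀ (I' u X)) := by
  have hX := hasFDerivAt_const (𝕜 := ℝ) X p₀
  have h1 := h𝕁.clm_apply (hX.prodMk (ha.clm_apply hX))
  have hIX := hI.clm_apply hX
  have h2 := hIX.prodMk (ha.clm_apply hIX)
  have h3 := h2.congr_of_eventuallyEq (h.mono fun p hp => hp X)
  have := DFunLike.congr_fun (h1.unique h3) u
  simp at this
  rw [add_comm, this]
  simp [add_comm]

lemma isOrthJet_of_hasFDerivAt {𝕁 : E → GFib E →L[ℝ] GFib E}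
    {𝕁' : E →L[ℝ] GFib E →L[ℝ] GFib E} {y₀ : E} (h𝕁 : HasFDerivAt 𝕁 𝕁' y₀)
    (hsq : ∀ᶠ y in 𝓝 y₀, ∀ v, 𝕁 y (𝕁 y v) = -v)
    (horth : ∀ᶠ y in 𝓝 y₀, ∀ v w, pair2 (𝕁 y v) (𝕁 y w) = pair2 v w) : IsOrthJet (𝕁 y₀) 𝕁' where
  sq := hsq.self_of_nhds
  orth := horth.self_of_nhds
  sq' u v := by
    have hv := h𝕁.clm_apply (hasFDerivAt_const (𝕜 := ℝ) v y₀)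
    have h1 := h𝕁.clm_apply hv
    have h2 := (hasFDerivAt_const (𝕜 := ℝ) (-v) y₀).congr_of_eventuallyEq
      (hsq.mono fun p hp => hp v)
    have := DFunLike.congr_fun (h1.unique h2) u
    simp at this
    rw [eq_neg_iff_add_eq_zero, add_comm, this]
  orth' u v w := by
    have hv := h𝕁.clm_apply (hasFDerivAt_const (𝕜 := ℝ) v y₀)
    have hw := h𝕁.clm_apply (hasFDerivAt_const (𝕜 := ℝ) w y₀)
    have h1 := (hv.snd.clm_apply hw.fst).add (hw.snd.clm_apply hv.fst)
    have h2 := (hasFDerivAt_const (𝕜 := ℝ) (pair2 v w) y₀).congr_of_eventuallyEq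
      (horth.mono fun p hp => hp v w)
    have := DFunLike.congr_fun (h1.unique h2) u
    simp at this
    simp only [pair2]
    linarith

lemma complexJet_of_hasFDerivAt {I : E → E →L[ℝ] E} {I' : E →L[ℝ] E →L[ℝ] E} {y₀ : E}
    (hI : HasFDerivAt I I' y₀) (hsq : ∀ᶠ y in 𝓝 y₀, ∀ v, I y (I y v) = -v) (u X : E) :
    I' u (I y₀ X) = -I y₀ (I' u X) := by
  have hv := hI.clm_apply (hasFDerivAt_const (𝕜 := ℝ) X y₀)
  have h1 := hI.clm_apply hv
  have h2 := (hasFDerivAt_const (𝕜 := ℝ) (-X) y₀).congr_of_eventuallyEq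
    (hsq.mono fun p hp => hp X)
  have := DFunLike.congr_fun (h1.unique h2) u
  simp at this
  rw [eq_neg_iff_add_eq_zero, add_comm, this]

/-- The value of `Φ_K` on an orthogonal complex structure. -/
def phi (K : E →L[ℝ] E →L[ℝ] ℝ) (𝕁 : GFib E →L[ℝ] GFib E) : GFib E →L[ℝ] GFib E :=
  𝕁 ∘L (blk (.id ℝ E) 0 K (.id ℝ _) ∘L 𝕁) - (blk (.id ℝ E) 0 K (.id ℝ _) ∘L 𝕁) ∘L 𝕁

/-- Only the nilpotent part of `e^K` contributes: the identity part gives `𝕁² + 1 = 0`. -/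
lemma phi_apply {K : E →L[ℝ] E →L[ℝ] ℝ} {𝕁 : GFib E →L[ℝ] GFib E} (hsq : ∀ s, 𝕁 (𝕁 s) = -s)
    (s : GFib E) : phi K 𝕁 s = 𝕁 (0, K (𝕁 s).1) + (0, K s.1) := by
  have e : ∀ s : GFib E, blk (.id ℝ E) 0 K (.id ℝ _) s = s + (0, K s.1) := fun s => by
    refine Prod.ext ?_ ?_ <;> simp [blk, add_comm]
  simp only [phi, sub_apply, comp_apply, e, map_add, hsq, Prod.fst_neg, map_neg]
  have : ((0 : E), -K s.1) = -((0 : E), K s.1) := by simp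
  rw [this]; abel

/-- The derivative of the Gualtieri map along a family of bihermitian data with fixed `I`. -/
lemma hasDerivAt_gual [FiniteDimensional ℝ E] {g b : ℝ → E →L[ℝ] E →L[ℝ] ℝ} {I : E →L[ℝ] E}
    {J : ℝ → E →L[ℝ] E} {t : ℝ} {g' b' K : E →L[ℝ] E →L[ℝ] ℝ} {J' : E →L[ℝ] E}
    (hg : HasDerivAt g g' t) (hb : HasDerivAt b b' t) (hJ : HasDerivAt J J' t)
    (hhI : ∀ᶠ s in 𝓝 t, IsHermFib (g s) I) (hhJ : ∀ᶠ s in 𝓝 t, IsHermFib (g s) (J s))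
    (hgi : ∀ᶠ s in 𝓝 t, (g s).IsInvertible)
    (hKJ : ∀ X Y, K (J t X) (J t Y) = K X Y)
    (hplus : ∀ X Y, b' X Y + g' X Y = -K (I X) Y)
    (hminus : ∀ X Y, b' X Y - g' X Y = -K X (I Y))
    (hJ' : ∀ X Y, 2 * g t (J' X) Y = K X (J t (I Y)) - K X (I (J t Y))) :
    HasDerivAt (fun s => gual (g s) (b s) I (J s)) (phi K (gual (g t) (b t) I (J t))) t := by
  have hI := hhI.self_of_nhds
  have hJt := hhJ.self_of_nhds
  have hi := hgi.self_of_nhds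
  have hd : DifferentiableAt ℝ (fun s => gual (g s) (b s) I (J s)) t := by
    have h1 : ContDiffAt ℝ 1 (fun p : (E →L[ℝ] E →L[ℝ] ℝ) × (E →L[ℝ] E →L[ℝ] ℝ) × (E →L[ℝ] E) =>
        gual p.1 p.2.1 I p.2.2) (g t, b t, J t) :=
      contDiffAt_gual contDiffAt_fst (contDiffAt_fst.comp _ contDiffAt_snd) contDiffAt_const
        (contDiffAt_snd.comp _ contDiffAt_snd) hI hJt hi
    exact DifferentiableAt.comp (f := fun s => (g s, b s, J s)) t
      (h1.differentiableAt one_ne_zero) (hg.prodMk (hb.prodMk hJ)).differentiableAt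
  have h𝕁 := hd.hasDerivAt
  obtain ⟨𝕁', e𝕁⟩ : ∃ A, A = deriv (fun s => gual (g s) (b s) I (J s)) t := ⟨_, rfl⟩
  rw [← e𝕁] at h𝕁
  have fr : ∀ᶠ s in 𝓝 t, IsFrame (gual (g s) (b s) I (J s)) (g s) (b s) I (J s) := by
    filter_upwards [hhI, hhJ, hgi] with s h1 h2 h3 using isFrame_gual h1 h2 h3
  -- Smoothness of the matrix formula provides the derivative `𝕁'`. Its value comes from
  -- differentiating in time the two graph relations, which determine it since the graphs span.
  have hp := fun X => hasFDerivAt_map_graph h𝕁.hasFDerivAt (hb.add hg).hasFDerivAt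
    (hasDerivAt_const t I).hasFDerivAt (fr.mono fun s hs => hs.plus) 1 X
  have hm := fun X => hasFDerivAt_map_graph h𝕁.hasFDerivAt (hb.sub hg).hasFDerivAt
    hJ.hasFDerivAt (fr.mono fun s hs => hs.minus) 1 X
  have F := fr.self_of_nhds
  have hsq := F.sq hI hJt hi
  suffices h : 𝕁' = phi K (gual (g t) (b t) I (J t)) by rwa [← h]
  refine ContinuousLinearMap.ext fun s => ?_
  generalize gual (g t) (b t) I (J t) = 𝕁 at *
  obtain ⟨X, Y, rfl⟩ := lift_span (b := b t) hi s
  rw [map_add, map_add]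
  congr 1
  · have e : 𝕁' (X, (b t + g t) X) + 𝕁 (0, (b' + g') X) = (0, (b' + g') (I X)) := by
      simpa using hp X
    rw [phi_apply hsq, F.plus, eq_sub_of_add_eq e]
    have e1 : (b' + g') X = -K (I X) := by ext Y; simpa using hplus X Y
    have e2 : (b' + g') (I X) = K X := by ext Y; simpa [hI.sq] using hplus (I X) Y
    have e3 : ((0 : E), -K (I X)) = -(0, K (I X)) := by simp
    rw [e1, e2, e3, map_neg, sub_neg_eq_add, add_comm]
  · have e : 𝕁' (Y, (b t - g t) Y) + 𝕁 (0, (b' - g') Y)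
        = (J' Y, (b' - g') (J t Y) + (b t - g t) (J' Y)) := by
      simpa using hm Y
    -- The vector `U` represents half of the covector `K(Y,·)`, so every covector below takes the
    -- form `2g(V,·)`.
    obtain ⟨U, hU⟩ : ∃ U, g t U = (1 / 2 : ℝ) • K Y := ⟨_, hi.self_apply_inverse _⟩
    have hU' : ∀ Z, K Y Z = 2 * g t U Z := fun Z => by rw [hU]; simp
    have hKJ' : ∀ X Y, K (J t X) Y = -K X (J t Y) := fun X Y => by
      rw [← hKJ X, hJt.sq, map_neg, neg_neg]
    have hinj : ∀ V W : E, (∀ Z, g t V Z = g t W Z) → V = W := fun V W h => by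
      obtain ⟨e, he⟩ := hi
      apply e.injective
      ext Z
      have := h Z
      rw [← he] at this
      exact this
    -- The covector `2g(V,·)` is the difference of the lifts of `V` to the two graphs, on which the
    -- action of `𝕁` is known.
    have z : ∀ (ζ : E →L[ℝ] ℝ) V, (∀ Z, ζ Z = 2 * g t V Z) →
        ((0 : E), ζ) = (V, (b t + g t) V) - (V, (b t - g t) V) := fun ζ V h => by
      refine Prod.ext (by simp) ?_
      ext Z
      simp [h]; ring
    have eJ : J' Y = I (J t U) - J t (I U) := hinj _ _ fun Z => by
      have := hJ' Y Z
      rw [hU', hU', ← neg_eq_iff_eq_neg.2 (hJt.skew U (I Z)), ← neg_eq_iff_eq_neg.2 (hI.skew U _),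
        ← neg_eq_iff_eq_neg.2 (hI.skew _ Z), ← neg_eq_iff_eq_neg.2 (hJt.skew _ Z)] at this
      rw [map_sub, sub_apply]; linarith
    have z1 := z (K Y) U hU'
    have z2 := z ((b' - g') Y) (I U) fun Z => by
      rw [sub_apply, sub_apply, hminus, hU', hI.skew]; ring
    have z3 := z (K (J t Y)) (J t U) fun Z => by rw [hKJ', hU', hJt.skew]; ring
    have z4 : (b' - g') (J t Y) = (2 : ℝ) • g t (I (J t U)) := by
      ext Z
      rw [sub_apply, sub_apply, hminus, hKJ', hU', smul_apply, hI.skew, hJt.skew, smul_eq_mul]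
      ring
    rw [phi_apply hsq, F.minus, eq_sub_of_add_eq e, z1, z2, z3, map_sub, map_sub, F.plus, F.minus,
      F.plus, F.minus, hI.sq, hJt.sq, eJ, z4]
    refine Prod.ext ?_ ?_ <;> simp <;> module

end FibreFamily

end

section

variable {E : Type*} [NormedAddCommGroup E] [NormedSpace ℝ E]
  {F : Type*} [NormedAddCommGroup F] [NormedSpace ℝ F]
  {M : Type*} [TopologicalSpace M] [ChartedSpace E M]

local notation "𝔠" => extChartAt 𝓘(ℝ, E)

lemma symm_self (x : M) : (𝔠 x).symm (𝔠 x x) = x := (𝔠 x).left_inv (mem_extChartAt_source x)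

lemma contract₂_apply {x : M} (H : Tan E x [⋀^Fin 3]→L[ℝ] ℝ) (X Y Z : Tan E x) :
    contract₂ H X Y Z = H ![X, Y, Z] := by
  have h : (Function.update ![X, Y, 0] 2 Z : Fin 3 → Tan E x) = ![X, Y, Z] := by
    ext i; fin_cases i <;> rfl
  calc contract₂ H X Y Z = H (Function.update ![X, Y, 0] 2 Z) := rfl
    _ = _ := by rw [h]

variable [IsManifold 𝓘(ℝ, E) ∞ M]

/-! ### The Courant bracket in coordinates -/

section CourantCoord

variable {x : M} {X Y : VField E M} {α β : OneForm E M ℝ} {B C : TwoTensor E M ℝ}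
  {A A' : EndField E M}

lemma SmoothVField.differentiableAt (hX : SmoothVField X) :
    DifferentiableAt ℝ (coordV x X) (𝔠 x x) :=
  (smoothVField_iff.1 hX x).differentiableAt (by simp)

lemma SmoothOneForm.differentiableAt (hα : SmoothOneForm α) :
    DifferentiableAt ℝ (coordOne x α) (𝔠 x x) :=
  (smoothOneForm_iff.1 hα x).differentiableAt (by simp)

lemma SmoothEnd.differentiableAt (hA : SmoothEnd A) :
    DifferentiableAt ℝ (coordEnd x A) (𝔠 x x) :=
  (smoothEnd_iff.1 hA x).differentiableAt (by simp)

lemma SmoothTwoTensor.differentiableAt (hB : SmoothTwoTensor B) :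
    DifferentiableAt ℝ (coordTwo x B) (𝔠 x x) :=
  (smoothTwoTensor_iff.1 hB x).differentiableAt (by simp)

lemma coordOne_self (α : OneForm E M F) (x : M) : coordOne x α (𝔠 x x) = α x := by
  ext v
  have h := chartInvDiff_self (E := E) x
  have key : ∀ p : M, p = x → ∀ L : E →L[ℝ] E, L = ContinuousLinearMap.id ℝ E →
      (α p (L v) : F) = α x v := by rintro p rfl L rfl; rfl
  exact key _ (symm_self x) _ h

lemma coordTwo_self (B : TwoTensor E M ℝ) (x : M) : coordTwo x B (𝔠 x x) = B x := by
  ext v w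
  have h := chartInvDiff_self (E := E) x
  have key : ∀ p : M, p = x → ∀ L : E →L[ℝ] E, L = ContinuousLinearMap.id ℝ E →
      (B p (L v) (L w) : ℝ) = B x v w := by rintro p rfl L rfl; rfl
  exact key _ (symm_self x) _ h

lemma coordEnd_self (A : EndField E M) (x : M) : coordEnd x A (𝔠 x x) = A x := by
  ext v
  have h := chartInvDiff_self (E := E) x
  have key : ∀ p : M, p = x → ∀ L : E →L[ℝ] E, L = ContinuousLinearMap.id ℝ E →
      (L.inverse (A p (L v)) : E) = A x v := by
    rintro p rfl L rfl; rw [ContinuousLinearMap.inverse_id]; rfl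
  exact key _ (symm_self x) _ h

lemma dfun_pair (hα : SmoothOneForm α) (hX : SmoothVField X) (x : M) (v : E) :
    (dfun (fun y => α y (X y)) x : E →L[ℝ] ℝ) v
      = fderiv ℝ (coordOne x α) (𝔠 x x) v (coordV x X (𝔠 x x))
        + coordOne x α (𝔠 x x) (fderiv ℝ (coordV x X) (𝔠 x x) v) := by
  refine (dfun_apply (hα.apply hX x) v).trans ?_
  have h : (fun z => α ((𝔠 x).symm z) (X ((𝔠 x).symm z))) =ᶠ[𝓝 (𝔠 x x)]
      fun y => coordOne x α y (coordV x X y) :=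
    eventually_target fun y hy => (coordOne_coordV hy α X).symm
  rw [h.fderiv_eq, fderiv_clm_apply hα.differentiableAt hX.differentiableAt]
  exact add_comm _ _

lemma dfun_sub {u v : M → ℝ} (hu : ContMDiff 𝓘(ℝ, E) 𝓘(ℝ, ℝ) ∞ u)
    (hv : ContMDiff 𝓘(ℝ, E) 𝓘(ℝ, ℝ) ∞ v) (x : M) (w : E) :
    (dfun (E := E) (fun y => u y - v y) x : E →L[ℝ] ℝ) w
      = (dfun u x : E →L[ℝ] ℝ) w - (dfun v x : E →L[ℝ] ℝ) w := by
  refine (dfun_apply (hu.sub hv x) w).trans ?_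
  refine Eq.trans ?_ (congrArg₂ (· - ·) (dfun_apply (hu x) w) (dfun_apply (hv x) w)).symm
  exact DFunLike.congr_fun
    (fderiv_fun_sub ((contDiffAt_coord_fun hu x).differentiableAt (by simp))
    ((contDiffAt_coord_fun hv x).differentiableAt (by simp))) w

/-- A section of `T ⊕ T^*` in the coordinates of the chart at `x`. -/
def gcoord (x : M) (s : GSection E M) (y : E) : GFib E :=
  (coordV x (fun p => (s p).1) y, coordOne x (fun p => (s p).2) y)

lemma gcoord_self (x : M) (s : GSection E M) : gcoord x s (𝔠 x x) = s x :=
  Prod.ext (coordV_self (fun p => (s p).1) x) (coordOne_self (fun p => (s p).2) x)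

lemma SmoothGSection.hasFDerivAt {s : GSection E M} (hs : SmoothGSection s) (x : M) :
    HasFDerivAt (gcoord x s) (fderiv ℝ (gcoord x s) (𝔠 x x)) (𝔠 x x) :=
  (hs.1.differentiableAt.prodMk hs.2.differentiableAt).hasFDerivAt

lemma SmoothGSection.fderiv_gcoord {s : GSection E M} (hs : SmoothGSection s) (x : M) (u : E) :
    fderiv ℝ (gcoord x s) (𝔠 x x) u = (fderiv ℝ (coordV x fun p => (s p).1) (𝔠 x x) u,
      fderiv ℝ (coordOne x fun p => (s p).2) (𝔠 x x) u) :=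
  DFunLike.congr_fun (hs.1.differentiableAt.hasFDerivAt.prodMk
    hs.2.differentiableAt.hasFDerivAt).fderiv u

/-- In the chart centred at `x` tensors at `x` coincide with their coordinate expressions, so the
pairing of the bracket with `r` is a polynomial in the one-jets of the sections. This is the passage
from sections on `M` to `courantJet`. -/
lemma pair2_courant {H : ThreeForm E M} {s t : GSection E M} (hs : SmoothGSection s)
    (ht : SmoothGSection t) (x : M) (r : GFib E) :
    pair2 (E := E) (courant H s t x) r =
      courantJet (E := E) (H x) (gcoord x s (𝔠 x x)) (gcoord x t (𝔠 x x)) r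
        (fderiv ℝ (gcoord x s) (𝔠 x x)) (fderiv ℝ (gcoord x t) (𝔠 x x)) := by
  have e1 := extD_apply (fun y => (t y).2) x (s x).1 r.1
  have e2 := extD_apply (fun y => (s y).2) x (t x).1 r.1
  have e3 := dfun_pair hs.2 ht.1 x r.1
  have e4 := dfun_pair ht.2 hs.1 x r.1
  have e5 := contract₂_apply (H x) (s x).1 (t x).1 r.1
  have h1 := mlieBracket_apply (fun y => (s y).1) (fun y => (t y).1) x
  have hd := (dfun_sub (hs.2.apply ht.1) (ht.2.apply hs.1) x r.1).trans
    (congrArg₂ (· - ·) e3 e4)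
  have h2 := congrArg₂ (· + ·) (congrArg₂ (· + ·) (congrArg₂ (· - ·) (congrArg₂ (· + ·) e1 e4)
    (congrArg₂ (· + ·) e2 e3)) (congrArg ((1 / 2 : ℝ) * ·) hd)) e5
  have h3 : pair2 (E := E) (courant H s t x) r = _ := congrArg₂ (· + ·) h2 (congrArg r.2 h1)
  refine h3.trans ?_
  simp only [courantJet, hs.fderiv_gcoord, ht.fderiv_gcoord, gcoord]
  have v1 : (s x).1 = coordV x (fun p => (s p).1) (𝔠 x x) := (coordV_self (fun p => (s p).1) x).symm
  have v2 : (t x).1 = coordV x (fun p => (t p).1) (𝔠 x x) := (coordV_self (fun p => (t p).1) x).symm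
  -- What remains is algebra in the model space; all fibre data are replaced by free variables.
  have final : ∀ S1 T1 : E, S1 = coordV x (fun p => (s p).1) (𝔠 x x) →
    T1 = coordV x (fun p => (t p).1) (𝔠 x x) → ∀ (h : E [⋀^Fin 3]→L[ℝ] ℝ)
    (S2 T2 : E →L[ℝ] ℝ) (s1 t1 : E →L[ℝ] E) (s2 t2 : E →L[ℝ] E →L[ℝ] ℝ), 
    t2 S1 r.1 - t2 r.1 S1 + (t2 r.1 (coordV x (fun p => (s p).1) (𝔠 x x)) + T2 (s1 r.1))
    - (s2 T1 r.1 - s2 r.1 T1 + (s2 r.1 (coordV x (fun p => (t p).1) (𝔠 x x)) + S2 (t1 r.1)))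
    + 1 / 2 * (s2 r.1 (coordV x (fun p => (t p).1) (𝔠 x x)) + S2 (t1 r.1) -
      (t2 r.1 (coordV x (fun p => (s p).1) (𝔠 x x)) + T2 (s1 r.1))) + h ![S1, T1, r.1]
    + r.2 (t1 S1 - s1 T1)
    = pair2 (t1 (coordV x (fun p => (s p).1) (𝔠 x x)), t2 (coordV x (fun p => (s p).1) (𝔠 x x))) r -
      pair2 (s1 (coordV x (fun p => (t p).1) (𝔠 x x)), s2 (coordV x (fun p => (t p).1) (𝔠 x x))) r
      + 1 / 2 * (pair2 (s1 r.1, s2 r.1) (coordV x (fun p => (t p).1) (𝔠 x x), T2)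
        - pair2 (coordV x (fun p => (s p).1) (𝔠 x x), S2) (t1 r.1, t2 r.1))
      + tri h (coordV x (fun p => (s p).1) (𝔠 x x)) (coordV x (fun p => (t p).1) (𝔠 x x)) r.1 := by
    rintro S1 T1 rfl rfl h S2 T2 s1 t1 s2 t2
    simp only [pair2, tri, map_sub]
    ring
  exact final _ _ v1 v2 _ _ _ _ _ _ _

end CourantCoord

end

section

variable {E : Type*} [NormedAddCommGroup E] [NormedSpace ℝ E]
  {F : Type*} [NormedAddCommGroup F] [NormedSpace ℝ F]
  {M : Type*} [TopologicalSpace M] [ChartedSpace E M]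

local notation "𝔠" => extChartAt 𝓘(ℝ, E)

/-! ### Smoothness of the Courant bracket -/

/-- The covector `i_Y i_X H` on the model space. -/
def contractModel (h : E [⋀^Fin 3]→L[ℝ] ℝ) (X Y : E) : E →L[ℝ] ℝ :=
  continuousMultilinearCurryFin1 ℝ E ℝ
    ((h.curryLeft X).curryLeft Y).toContinuousMultilinearMap

lemma contractModel_apply (h : E [⋀^Fin 3]→L[ℝ] ℝ) (X Y Z : E) :
    contractModel h X Y Z = h ![X, Y, Z] := by
  rw [contractModel, continuousMultilinearCurryFin1_apply]
  change h _ = h _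
  congr 1
  ext i; fin_cases i <;> rfl

lemma contDiffAt_contractModel {n : WithTop ℕ∞} {h : E → E [⋀^Fin 3]→L[ℝ] ℝ} {X Y : E → E} {y₀ : E}
    (hh : ContDiffAt ℝ n h y₀) (hX : ContDiffAt ℝ n X y₀) (hY : ContDiffAt ℝ n Y y₀) :
    ContDiffAt ℝ n (fun y => contractModel (h y) (X y) (Y y)) y₀ := by
  have l2 : ContDiff ℝ n (ContinuousAlternatingMap.curryLeftLI (𝕜 := ℝ) (E := E) (F := ℝ)
      (n := 2)) := LinearIsometry.contDiff _
  have l1 : ContDiff ℝ n (ContinuousAlternatingMap.curryLeftLI (𝕜 := ℝ) (E := E) (F := ℝ)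
      (n := 1)) := LinearIsometry.contDiff _
  have l0 : ContDiff ℝ n fun h : E [⋀^Fin 1]→L[ℝ] ℝ => h.toContinuousMultilinearMap :=
    (ContinuousAlternatingMap.toContinuousMultilinearMapLI (𝕜 := ℝ) (E := E) (F := ℝ)
      (ι := Fin 1)).contDiff
  have h1 : ContDiffAt ℝ n (fun y => (h y).curryLeft (X y)) y₀ :=
    (l2.contDiffAt.comp y₀ hh).clm_apply hX
  have h2 : ContDiffAt ℝ n (fun y => ((h y).curryLeft (X y)).curryLeft (Y y)) y₀ :=
    (l1.contDiffAt.comp y₀ h1).clm_apply hY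
  exact (continuousMultilinearCurryFin1 ℝ E ℝ).contDiff.contDiffAt.comp y₀
    (l0.contDiffAt.comp y₀ h2)

variable [IsManifold 𝓘(ℝ, E) ∞ M]

section Smooth

variable {H : ThreeForm E M}

lemma SmoothThreeForm.smooth_contract {X Y : VField E M} (hH : SmoothThreeForm H)
    (hX : SmoothVField X) (hY : SmoothVField Y) :
    SmoothOneForm (fun x => contract₂ (H x) (X x) (Y x)) := by
  rw [smoothOneForm_iff]
  rw [smoothVField_iff] at hX hY
  intro x
  refine (contDiffAt_contractModel ((hH x).contDiffAt (target_mem_nhds x)) (hX x)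
    (hY x)).congr_of_eventuallyEq (eventually_target fun y hy => ?_)
  refine ContinuousLinearMap.ext fun v => ?_
  refine Eq.trans ?_ (contractModel_apply _ _ _ _).symm
  refine (contract₂_apply (H ((𝔠 x).symm y)) (X _) (Y _) (chartInvDiff x y v)).trans ?_
  have e : (![X ((𝔠 x).symm y), Y ((𝔠 x).symm y), chartInvDiff x y v] :
      Fin 3 → Tan E ((𝔠 x).symm y))
      = chartInvDiff x y ∘ ![coordV x X y, coordV x Y y, v] := by
    have e1 := (chartInvDiff_coordV hy X).symm
    have e2 := (chartInvDiff_coordV hy Y).symm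
    ext i
    fin_cases i
    · exact e1
    · exact e2
    · rfl
  exact congrArg (H ((𝔠 x).symm y)) e

lemma SmoothVField.mlieBracket [FiniteDimensional ℝ E] {X Y : VField E M} (hX : SmoothVField X)
    (hY : SmoothVField Y) : SmoothVField (VectorField.mlieBracket 𝓘(ℝ, E) X Y) := by
  have : CompleteSpace E := FiniteDimensional.complete ℝ E
  have : IsManifold 𝓘(ℝ, E) (minSmoothness ℝ 2) M := by
    rw [minSmoothness_of_isRCLikeNormedField]
    exact IsManifold.of_le (n := ∞) two_le_infty
  have : IsManifold 𝓘(ℝ, E) (((⊤ : ℕ∞) : WithTop ℕ∞) + 1) M :=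
    inferInstanceAs (IsManifold 𝓘(ℝ, E) ∞ M)
  intro x
  refine ContMDiffAt.mlieBracket_vectorField (m := ⊤) (n := ⊤) (hX x) (hY x) ?_
  rw [minSmoothness_of_isRCLikeNormedField]
  exact le_rfl

lemma SmoothOneForm.lieOne {X : VField E M} {η : OneForm E M ℝ} (hX : SmoothVField X)
    (hη : SmoothOneForm η) : SmoothOneForm (lieOne X η) :=
  (hη.extD.apply hX).add (smoothOneForm_dfun (hη.apply hX))

lemma SmoothGSection.courant [FiniteDimensional ℝ E] {s t : GSection E M} (hH : SmoothThreeForm H)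
    (hs : SmoothGSection s) (ht : SmoothGSection t) : SmoothGSection (courant H s t) :=
  ⟨hs.1.mlieBracket ht.1, (((ht.2.lieOne hs.1).sub (hs.2.lieOne ht.1)).add
    ((smoothOneForm_dfun ((hs.2.apply ht.1).sub (ht.2.apply hs.1))).smul _)).add
    (hH.smooth_contract hs.1 ht.1)⟩

lemma SmoothGSection.add {s t : GSection E M} (hs : SmoothGSection s) (ht : SmoothGSection t) :
    SmoothGSection (fun x => s x + t x) := ⟨hs.1.add ht.1, hs.2.add ht.2⟩

lemma SmoothGSection.sub {s t : GSection E M} (hs : SmoothGSection s) (ht : SmoothGSection t) :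
    SmoothGSection (fun x => s x - t x) := ⟨hs.1.sub ht.1, hs.2.sub ht.2⟩

lemma SmoothGSection.neg {s : GSection E M} (hs : SmoothGSection s) :
    SmoothGSection (fun x => -s x) := ⟨hs.1.neg, hs.2.neg⟩

end Smooth

/-! ### Almost complex structures on `T ⊕ T^*` in coordinates -/

section GEnd

variable {𝕁 : GEndField E M} {H : ThreeForm E M}

/-- A representation of an endomorphism field of `T ⊕ T^*` near `x`, in the coordinates of the
chart at `x`. -/
structure Represents (x : M) (𝕁 : GEndField E M) (A : E → GFib E →L[ℝ] GFib E) : Prop where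
  smooth : ContDiffAt ℝ ∞ A (𝔠 x x)
  eq : ∀ᶠ y in 𝓝 (𝔠 x x), ∀ s : GSection E M,
    gcoord x (fun p => 𝕁 p (s p)) y = A y (gcoord x s y)

lemma gcoord_contDiffAt {s : GSection E M} :
    SmoothGSection s ↔ ∀ x, ContDiffAt ℝ ∞ (gcoord x s) (𝔠 x x) := by
  rw [SmoothGSection, smoothVField_iff, smoothOneForm_iff]
  exact ⟨fun h x => (h.1 x).prodMk (h.2 x), fun h => ⟨fun x => (h x).fst, fun x => (h x).snd⟩⟩

lemma smoothGEnd_of_represents {A : M → E → GFib E →L[ℝ] GFib E}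
    (h : ∀ x, Represents x 𝕁 (A x)) : SmoothGEnd 𝕁 := fun s hs => by
  rw [gcoord_contDiffAt] at *
  exact fun x => ((h x).smooth.clm_apply (hs x)).congr_of_eventuallyEq
    ((h x).eq.mono fun y hy => hy s)

lemma Represents.apply_self {x : M} {A : E → GFib E →L[ℝ] GFib E} (h : Represents x 𝕁 A)
    (s : GSection E M) : gcoord x (fun p => 𝕁 p (s p)) (𝔠 x x) = A (𝔠 x x) (gcoord x s (𝔠 x x)) :=
  h.eq.self_of_nhds s

lemma Represents.fderiv_apply {x : M} {A : E → GFib E →L[ℝ] GFib E} (h : Represents x 𝕁 A)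
    {s : GSection E M} (hs : SmoothGSection s) :
    fderiv ℝ (gcoord x (fun p => 𝕁 p (s p))) (𝔠 x x) =
      (fderiv ℝ A (𝔠 x x)).flip (gcoord x s (𝔠 x x)) + A (𝔠 x x) ∘L fderiv ℝ (gcoord x s) (𝔠 x x) := by
  have e : gcoord x (fun p => 𝕁 p (s p)) =ᶠ[𝓝 (𝔠 x x)] fun y => A y (gcoord x s y) :=
    h.eq.mono fun y hy => hy s
  rw [e.fderiv_eq, fderiv_clm_apply (h.smooth.differentiableAt (by simp))
    (hs.hasFDerivAt x).differentiableAt, add_comm]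

lemma courantJet_neg_left (h : E [⋀^Fin 3]→L[ℝ] ℝ) (s t r : GFib E) (s' t' : E →L[ℝ] GFib E) :
    courantJet h (-s) t r (-s') t' = -courantJet h s t r s' t' := by
  simp only [courantJet, Prod.fst_neg, map_neg, neg_apply, pair2_neg_left, tri_neg_left]; ring

lemma courantJet_neg_mid (h : E [⋀^Fin 3]→L[ℝ] ℝ) (s t r : GFib E) (s' t' : E →L[ℝ] GFib E) :
    courantJet h s (-t) r s' (-t') = -courantJet h s t r s' t' := by
  simp only [courantJet, Prod.fst_neg, map_neg, neg_apply, pair2_neg_left, pair2_neg_right,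
    tri_neg_mid]; ring

lemma gcoord_neg (x : M) (s : GSection E M) :
    gcoord x (fun p => -s p) = fun y => -gcoord x s y := by
  funext y
  exact Prod.ext (congrFun (coordV_neg x fun p => (s p).1) y)
    (congrFun (coordOne_neg x fun p => (s p).2) y)

lemma pair2_sub_left (a b c : GFib E) : pair2 (a - b) c = pair2 a c - pair2 b c := by
  rw [sub_eq_add_neg, pair2_add_left, pair2_neg_left, sub_eq_add_neg]

/-- The bracket of `s + √-1 s'` with `t + √-1 t'`, for `s' = -𝕁s` and `t' = -𝕁t`, in terms of the
torsion of `𝕁`. -/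
lemma Represents.torsion_eq {x : M} {A : E → GFib E →L[ℝ] GFib E} (h : Represents x 𝕁 A)
    (hA : IsOrthJet (A (𝔠 x x)) (fderiv ℝ A (𝔠 x x))) {s t : GSection E M}
    (hs : SmoothGSection s) (ht : SmoothGSection t) (hs' : SmoothGSection fun p => 𝕁 p (s p))
    (ht' : SmoothGSection fun p => 𝕁 p (t p)) (r : GFib E) :
    torsion (E := E) (H x) (A (𝔠 x x)) (fderiv ℝ A (𝔠 x x)) (s x) (t x) r =
      pair2 (E := E) (courant H s t x
        - courant H (fun p => -𝕁 p (s p)) (fun p => -𝕁 p (t p)) x) r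
      + pair2 (E := E) (courant H s (fun p => -𝕁 p (t p)) x
        + courant H (fun p => -𝕁 p (s p)) t x) (A (𝔠 x x) r) := by
  have c1 := pair2_courant (H := H) hs ht x r
  have c2 := pair2_courant (H := H) hs'.neg ht'.neg x r
  have c3 := pair2_courant (H := H) hs ht'.neg x (A (𝔠 x x) r)
  have c4 := pair2_courant (H := H) hs'.neg ht x (A (𝔠 x x) r)
  have gv : ∀ s : GSection E M, gcoord x (fun p => -𝕁 p (s p)) (𝔠 x x)
      = -A (𝔠 x x) (gcoord x s (𝔠 x x)) := fun s => by
    rw [gcoord_neg, ← h.apply_self]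
  have gf : ∀ s : GSection E M, SmoothGSection s → fderiv ℝ (gcoord x fun p => -𝕁 p (s p)) (𝔠 x x)
      = -((fderiv ℝ A (𝔠 x x)).flip (gcoord x s (𝔠 x x))
        + A (𝔠 x x) ∘L fderiv ℝ (gcoord x s) (𝔠 x x)) := fun s hs => by
    rw [gcoord_neg, ← h.fderiv_apply hs]; exact fderiv_neg
  rw [gv, gf t ht] at c3
  replace c3 := c3.trans (courantJet_neg_mid _ _ _ _ _ _)
  rw [gv, gf s hs] at c4
  replace c4 := c4.trans (courantJet_neg_left _ _ _ _ _ _)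
  rw [gv, gv, gf s hs, gf t ht] at c2
  replace c2 := c2.trans ((courantJet_neg_mid _ _ _ _ _ _).trans
    ((congrArg Neg.neg (courantJet_neg_left _ _ _ _ _ _)).trans (neg_neg _)))
  have key := hA.courantJet_sub (H x) (gcoord x s (𝔠 x x)) (gcoord x t (𝔠 x x)) r
    (fderiv ℝ (gcoord x s) (𝔠 x x)) (fderiv ℝ (gcoord x t) (𝔠 x x))
  rw [eq_comm] at c1 c2 c3 c4
  have e := key.symm.trans (congrArg₂ (· - ·) (congrArg₂ (· - ·) (congrArg₂ (· - ·) c1 c2)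
    (neg_eq_iff_eq_neg.1 c4)) (neg_eq_iff_eq_neg.1 c3))
  rw [gcoord_self, gcoord_self] at e
  refine e.trans (Eq.trans ?_ (congrArg₂ (· + ·) (pair2_sub_left _ _ _).symm
    (pair2_add_left _ _ _).symm))
  ring

lemma Represents.self_eq {x : M} {A : E → GFib E →L[ℝ] GFib E} (h : Represents x 𝕁 A)
    {s : GSection E M} : 𝕁 x (s x) = A (𝔠 x x) (s x) := by
  have e := h.apply_self s
  rw [gcoord_self, gcoord_self] at e
  exact e

/-- With real part `a` and imaginary part `b` of the bracket, lying in the `√-1`-eigenbundle means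
`𝕁a = -b`. As the pairing is nondegenerate and `𝕁` is skew, this says that `⟨a, r⟩ + ⟨b, 𝕁r⟩`
vanishes for all `r`, and twice that sum is the torsion by `Represents.torsion_eq`. -/
lemma pair_courantℂ {x : M} {A : E → GFib E →L[ℝ] GFib E} (h : Represents x 𝕁 A)
    (hA : IsOrthJet (A (𝔠 x x)) (fderiv ℝ A (𝔠 x x))) {s t : GSection E M}
    (hs : SmoothGSection s) (ht : SmoothGSection t) (hs' : SmoothGSection fun p => 𝕁 p (s p))
    (ht' : SmoothGSection fun p => 𝕁 p (t p)) :
    𝕁 x ((courantℂ H (s, fun p => -𝕁 p (s p)) (t, fun p => -𝕁 p (t p))).1 x) =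
        -(courantℂ H (s, fun p => -𝕁 p (s p)) (t, fun p => -𝕁 p (t p))).2 x ↔
      ∀ r : GFib E,
        torsion (E := E) (H x) (A (𝔠 x x)) (fderiv ℝ A (𝔠 x x)) (s x) (t x) r = 0 := by
  have e := h.torsion_eq (H := H) hA hs ht hs' ht'
  have e' := h.self_eq (s := (courantℂ H (s, fun p => -𝕁 p (s p)) (t, fun p => -𝕁 p (t p))).1)
  have key : ∀ a b : GFib E, A (𝔠 x x) a = -b ↔
      ∀ r, pair2 a r + pair2 b (A (𝔠 x x) r) = 0 := fun a b => by
    refine ⟨fun hab r => ?_, fun hab => ?_⟩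
    · rw [← neg_eq_iff_eq_neg.2 hab, pair2_neg_left, hA.orth, add_neg_cancel]
    · have : A (𝔠 x x) a + b = 0 := pair2_nondegenerate fun r => by
        have := hab (-A (𝔠 x x) r)
        rw [map_neg, hA.sq, neg_neg, pair2_neg_right, ← hA.skew] at this
        rw [pair2_add_left, this]
      exact eq_neg_of_add_eq_zero_left this
  refine Iff.trans ⟨fun q => e'.symm.trans q, fun q => e'.trans q⟩ ((key _ _).trans
    (forall_congr' fun r => ?_))
  rw [e r]
  exact Iff.rfl

/-- An orthogonal almost complex structure on `T ⊕ T^*` is integrable if and only if its torsion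
vanishes. -/
lemma isGenComplex_of_torsion [FiniteDimensional ℝ E] {A : M → E → GFib E →L[ℝ] GFib E}
    (hH : SmoothThreeForm H) (h : ∀ x, Represents x 𝕁 (A x))
    (hA : ∀ x, IsOrthJet (A x (𝔠 x x)) (fderiv ℝ (A x) (𝔠 x x)))
    (sq : ∀ x v, 𝕁 x (𝕁 x v) = -v) (orth : ∀ x v w, pairing (𝕁 x v) (𝕁 x w) = pairing v w)
    (h0 : ∀ x (s t r : GFib E),
      torsion (E := E) (H x) (A x (𝔠 x x)) (fderiv ℝ (A x) (𝔠 x x)) s t r = 0) :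
    IsGenComplex H 𝕁 where
  smooth := smoothGEnd_of_represents h
  sq := sq
  orth := orth
  integrable := by
    rintro ⟨s, s'⟩ ⟨t, t'⟩ ⟨hs, hs', es, -⟩ ⟨ht, ht', et, -⟩
    simp only at hs hs' es ht ht' et
    have hJs := smoothGEnd_of_represents h s hs
    have hJt := smoothGEnd_of_represents h t ht
    -- An eigensection is determined by its real part.
    obtain rfl : s' = fun p => -𝕁 p (s p) := funext fun p => by rw [es, neg_neg]
    obtain rfl : t' = fun p => -𝕁 p (t p) := funext fun p => by rw [et, neg_neg]
    have key : ∀ x, 𝕁 x ((courantℂ H (s, fun p => -𝕁 p (s p)) (t, fun p => -𝕁 p (t p))).1 x) =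
        -(courantℂ H (s, fun p => -𝕁 p (s p)) (t, fun p => -𝕁 p (t p))).2 x := fun x => by
      refine (pair_courantℂ (h x) (hA x) hs ht hJs hJt).2 fun r => ?_
      exact h0 x _ _ r
    refine ⟨(hs.courant hH ht).sub (hs'.courant hH ht'), (hs.courant hH ht').add (hs'.courant hH ht),
      key, fun x => ?_⟩
    have e := congrArg (𝕁 x) (neg_eq_iff_eq_neg.2 (key x)).symm
    exact e.trans (((𝕁 x).map_neg _).trans ((congrArg Neg.neg (sq x _)).trans (neg_neg _)))

/-- The torsion is pointwise while integrability speaks of sections; `hext` bridges the two, since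
arbitrary vectors at `x` are values of smooth sections. -/
lemma IsGenComplex.torsion_eq_zero {A : M → E → GFib E →L[ℝ] GFib E} (hJ : IsGenComplex H 𝕁)
    (h : ∀ x, Represents x 𝕁 (A x))
    (hA : ∀ x, IsOrthJet (A x (𝔠 x x)) (fderiv ℝ (A x) (𝔠 x x)))
    (hext : ∀ x (v : GTan E x), ∃ s : GSection E M, SmoothGSection s ∧ s x = v)
    (x : M) (s t r : GFib E) :
    torsion (E := E) (H x) (A x (𝔠 x x)) (fderiv ℝ (A x) (𝔠 x x)) s t r = 0 := by
  obtain ⟨s, hs, rfl⟩ := hext x s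
  obtain ⟨t, ht, rfl⟩ := hext x t
  have hJs := smoothGEnd_of_represents h s hs
  have hJt := smoothGEnd_of_represents h t ht
  exact (pair_courantℂ (h x) (hA x) hs ht hJs hJt).1
    ((hJ.integrable (s, fun p => -𝕁 p (s p)) (t, fun p => -𝕁 p (t p))
    ⟨hs, hJs.neg, fun p => (neg_neg _).symm, fun p =>
      ((𝕁 p).map_neg _).trans ((congrArg Neg.neg (hJ.sq p _)).trans (neg_neg _))⟩
    ⟨ht, hJt.neg, fun p => (neg_neg _).symm, fun p =>
      ((𝕁 p).map_neg _).trans ((congrArg Neg.neg (hJ.sq p _)).trans (neg_neg _))⟩).eigen_re x) r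

end GEnd

end

section

variable {E : Type*} [NormedAddCommGroup E] [NormedSpace ℝ E]
  {F : Type*} [NormedAddCommGroup F] [NormedSpace ℝ F]
  {M : Type*} [TopologicalSpace M] [ChartedSpace E M]

local notation "𝔠" => extChartAt 𝓘(ℝ, E)

/-! ### The Gualtieri map in coordinates -/

section Conj

variable {g b : E →L[ℝ] E →L[ℝ] ℝ} {I J : E →L[ℝ] E} {L : E →L[ℝ] E}

/-- Nondegeneracy of a bilinear form. -/
abbrev IsNondeg (B : E →L[ℝ] E →L[ℝ] ℝ) : Prop := B.IsInvertible

lemma gual_neg (g b : E →L[ℝ] E →L[ℝ] ℝ) (I J : E →L[ℝ] E) :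
    gual g b I (-J) = (1 / 2 : ℝ) • (blk (.id ℝ E) 0 b (.id ℝ _) ∘L
    blk (I - J) (-((g ∘L I).inverse + (g ∘L J).inverse)) (g ∘L I + g ∘L J)
      (-(precomp ℝ I - precomp ℝ J)) ∘L blk (.id ℝ E) 0 (-b) (.id ℝ _)) := by
  have e : (precomp ℝ (-J) : (E →L[ℝ] ℝ) →L[ℝ] (E →L[ℝ] ℝ)) = -precomp ℝ J := by
    ext ξ v; exact map_neg ξ _
  rw [gual, comp_neg, inverse_neg, e]
  simp only [sub_eq_add_neg, neg_neg]

/-- The pullback of a bilinear form by a linear map. -/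
def pullTwo (L : E →L[ℝ] E) (B : E →L[ℝ] E →L[ℝ] ℝ) : E →L[ℝ] E →L[ℝ] ℝ := precomp ℝ L ∘L B ∘L L

lemma pullTwo_apply (B : E →L[ℝ] E →L[ℝ] ℝ) (v w : E) : pullTwo L B v w = B (L v) (L w) := rfl

lemma IsHermFib.conj (h : IsHermFib g I) (hL : L.IsInvertible) :
    IsHermFib (pullTwo L g) (L.inverse ∘L I ∘L L) where
  symm X Y := h.symm _ _
  sq X := by simp [hL.self_apply_inverse, h.sq, hL.inverse_apply_self]
  orth X Y := by simp [pullTwo_apply, hL.self_apply_inverse, h.orth]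

lemma pullTwo_isInvertible (hg : g.IsInvertible) (hL : L.IsInvertible) :
    (pullTwo L g).IsInvertible := by
  obtain ⟨e, rfl⟩ := hg
  obtain ⟨l, rfl⟩ := hL
  exact ⟨(l.trans e).trans (l.symm.arrowCongr (.refl ℝ ℝ)), by ext; simp [pullTwo_apply]⟩

/-- Naturality of the Gualtieri map under linear isomorphisms. Both sides are determined by their
action on the two graphs, and pullback carries the graphs of `b ± g` to those of the pulled-back
tensors. -/
lemma gual_conj (hI : IsHermFib g I) (hJ : IsHermFib g J) (hg : g.IsInvertible)
    (hL : L.IsInvertible) (s : GFib E) :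
    gual (pullTwo L g) (pullTwo L b) (L.inverse ∘L I ∘L L) (L.inverse ∘L J ∘L L)
        (L.inverse s.1, s.2 ∘L L)
      = (L.inverse (gual g b I J s).1, (gual g b I J s).2 ∘L L) := by
  have F := isFrame_gual (b := b) hI hJ hg
  have F' := isFrame_gual (b := pullTwo L b) (hI.conj hL) (hJ.conj hL) (pullTwo_isInvertible hg hL)
  obtain ⟨X, Y, rfl⟩ := lift_span (b := b) hg s
  obtain ⟨X, rfl⟩ : ∃ X', X = L X' := ⟨_, (hL.self_apply_inverse X).symm⟩
  obtain ⟨Y, rfl⟩ : ∃ Y', Y = L Y' := ⟨_, (hL.self_apply_inverse Y).symm⟩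
  rw [map_add, F.plus, F.minus]
  have e : (L.inverse ((L X, (b + g) (L X)) + (L Y, (b - g) (L Y))).1,
      ((L X, (b + g) (L X)) + (L Y, (b - g) (L Y))).2 ∘L L)
      = (X, (pullTwo L b + pullTwo L g) X) + (Y, (pullTwo L b - pullTwo L g) Y) := by
    refine Prod.ext ?_ ?_
    · simp [hL.inverse_apply_self]
    · ext v; rfl
  rw [e, map_add, F'.plus, F'.minus]
  refine Prod.ext ?_ ?_
  · simp
  · ext v
    simp [pullTwo_apply, hL.self_apply_inverse]

/-- The conditions are even in the complex structure, so passing from `𝕁₁` to `𝕁₂`, that is from `J`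
to `-J`, costs nothing. -/
lemma InvJet.neg {h : E [⋀^Fin 3]→L[ℝ] ℝ} {a : E →L[ℝ] E →L[ℝ] ℝ}
    {a' : E →L[ℝ] E →L[ℝ] E →L[ℝ] ℝ} {I' : E →L[ℝ] E →L[ℝ] E} (hi : InvJet h a a' I I') :
    InvJet h a a' (-I) (-I') := by
  refine ⟨fun X Y Z => ?_, fun X Y => ?_⟩
  · have := hi.parallel X Y Z
    simp only [kap, neg_apply, map_neg, neg_neg, tri_neg_left, tri_neg_mid] at this ⊢
    exact this
  · have := hi.nijenhuis X Y
    simp only [neg_apply, map_neg, neg_neg] at this ⊢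
    exact this

section Neg

variable {h : E [⋀^Fin 3]→L[ℝ] ℝ} {𝕁 : GFib E →L[ℝ] GFib E} {𝕁' : E →L[ℝ] GFib E →L[ℝ] GFib E}

lemma IsOrthJet.neg (hJ : IsOrthJet 𝕁 𝕁') : IsOrthJet (-𝕁) (-𝕁') where
  sq v := by simp only [neg_apply, map_neg, hJ.sq, neg_neg]
  orth v w := by simp only [neg_apply, pair2_neg_left, pair2_neg_right, hJ.orth, neg_neg]
  sq' u v := by simp only [neg_apply, map_neg, hJ.sq']
  orth' u v w := by simp only [neg_apply, pair2_neg_left, pair2_neg_right, hJ.orth', neg_neg]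

lemma ActsAs.neg {a : E →L[ℝ] E →L[ℝ] ℝ} {a' : E →L[ℝ] E →L[ℝ] E →L[ℝ] ℝ}
    {I' : E →L[ℝ] E →L[ℝ] E} (hA : ActsAs 𝕁 𝕁' a a' I I') :
    ActsAs (-𝕁) (-𝕁') a a' (-I) (-I') where
  map X := by simp only [neg_apply, hA.map, map_neg, Prod.neg_mk]
  map' u X := by
    have := congrArg (fun v => -v) (hA.map' u X)
    simp only [neg_apply, map_neg, Prod.neg_mk, neg_add] at this ⊢
    exact this

lemma torsion_neg (s t r : GFib E) : torsion h (-𝕁) (-𝕁') s t r = torsion h 𝕁 𝕁' s t r := by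
  simp only [torsion, torsionAux, neg_apply, Prod.fst_neg, map_neg, pair2_neg_left,
    pair2_neg_right, tri_neg_left, tri_neg_mid, tri_neg_right, neg_neg]

end Neg

end Conj

variable [IsManifold 𝓘(ℝ, E) ∞ M]

section Coord

variable {g b : TwoTensor E M ℝ} {I J : EndField E M}

/-- The Gualtieri map in the coordinates of the chart at `x`. -/
def coordGual (x : M) (g b : TwoTensor E M ℝ) (I J : EndField E M) (y : E) : GFib E →L[ℝ] GFib E :=
  gual (coordTwo x g y) (coordTwo x b y) (coordEnd x I y) (coordEnd x J y)

lemma coord_isHermFib {x : M} {y : E} (hy : y ∈ (𝔠 x).target)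
    (hI : IsHermFib (E := E) (g ((𝔠 x).symm y)) (I ((𝔠 x).symm y))) :
    IsHermFib (coordTwo x g y) (coordEnd x I y) :=
  hI.conj (L := chartInvDiff x y) (chartInvDiff_isInvertible hy)

lemma coord_isInvertible {x : M} {y : E} (hy : y ∈ (𝔠 x).target)
    (hg : IsNondeg (E := E) (g ((𝔠 x).symm y))) :
    (coordTwo x g y).IsInvertible :=
  pullTwo_isInvertible (L := chartInvDiff x y) hg (chartInvDiff_isInvertible hy)

lemma gcoord_gualtieri {x : M} {y : E} (hy : y ∈ (𝔠 x).target)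
    (hI : IsHermFib (E := E) (g ((𝔠 x).symm y)) (I ((𝔠 x).symm y)))
    (hJ : IsHermFib (E := E) (g ((𝔠 x).symm y)) (J ((𝔠 x).symm y)))
    (hg : IsNondeg (E := E) (g ((𝔠 x).symm y))) (s : GSection E M) :
    gcoord x (fun p => gualtieri₁ g b I J p (s p)) y = coordGual x g b I J y (gcoord x s y) :=
  (gual_conj (E := E) (g := g ((𝔠 x).symm y)) (b := b ((𝔠 x).symm y)) (I := I ((𝔠 x).symm y))
    (J := J ((𝔠 x).symm y)) hI hJ hg (L := chartInvDiff x y)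
    (chartInvDiff_isInvertible hy) (s ((𝔠 x).symm y))).symm

lemma gualtieri₂_eq (g b : TwoTensor E M ℝ) (I J : EndField E M) :
    gualtieri₂ g b I J = gualtieri₁ g b I (fun x => -J x) := by
  funext x
  exact (gual_neg (E := E) (g x) (b x) (I x) (J x)).symm

end Coord

/-! ### Generalized Kähler structures as integrable pairs of graphs -/

section Bihermitian

variable [FiniteDimensional ℝ E] {g b : TwoTensor E M ℝ} {I J : EndField E M} {H : ThreeForm E M}

/-- Bihermitian data `(g, b, I, J)`. -/
structure IsBihermitian (g b : TwoTensor E M ℝ) (I J : EndField E M) : Prop where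
  metric : IsMetric g
  twoForm : IsTwoForm b
  hermitian₁ : IsHermitian g I
  hermitian₂ : IsHermitian g J

lemma IsBihermitian.neg (h : IsBihermitian g b I J) : IsBihermitian g b I (fun x => -J x) where
  metric := h.metric
  twoForm := h.twoForm
  hermitian₁ := h.hermitian₁
  hermitian₂ := by
    refine ⟨h.hermitian₂.smooth.neg, fun x X => ?_, fun x X Y => ?_⟩
    · have := h.hermitian₂.sq x X
      simp [this]
    · have := h.hermitian₂.orth x X Y
      simp [this]

lemma IsMetric.isHermFib (hg : IsMetric g) (hI : IsHermitian g I) (x : M) :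
    IsHermFib (E := E) (g x) (I x) := ⟨hg.symm x, hI.sq x, hI.orth x⟩

lemma IsMetric.isInvertible (hg : IsMetric g) (x : M) :
    IsNondeg (E := E) (g x) :=
  isInvertible_of_pos (E := E) fun X hX => (hg.pos x X hX).ne'

/-- Integrability on the graph of a two-tensor field `a`. -/
def Inv (H : ThreeForm E M) (a : TwoTensor E M ℝ) (I : EndField E M) : Prop :=
  ∀ x, InvJet (E := E) (H x) (coordTwo x a (𝔠 x x)) (fderiv ℝ (coordTwo x a) (𝔠 x x))
    (coordEnd x I (𝔠 x x)) (fderiv ℝ (coordEnd x I) (𝔠 x x))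

lemma IsBihermitian.represents (h : IsBihermitian g b I J) (x : M) :
    Represents x (gualtieri₁ g b I J) (coordGual x g b I J) where
  smooth := contDiffAt_gual (smoothTwoTensor_iff.1 h.metric.smooth x)
    (smoothTwoTensor_iff.1 h.twoForm.smooth x) (smoothEnd_iff.1 h.hermitian₁.smooth x)
    (smoothEnd_iff.1 h.hermitian₂.smooth x)
    (coord_isHermFib (mem_extChartAt_target x) (h.metric.isHermFib h.hermitian₁ _))
    (coord_isHermFib (mem_extChartAt_target x) (h.metric.isHermFib h.hermitian₂ _))
    (coord_isInvertible (mem_extChartAt_target x) (h.metric.isInvertible _))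
  eq := eventually_target fun _ hy s => gcoord_gualtieri hy (h.metric.isHermFib h.hermitian₁ _)
    (h.metric.isHermFib h.hermitian₂ _) (h.metric.isInvertible _) s

lemma IsBihermitian.isFrame (h : IsBihermitian g b I J) {x : M} {y : E} (hy : y ∈ (𝔠 x).target) :
    IsFrame (coordGual x g b I J y) (coordTwo x g y) (coordTwo x b y) (coordEnd x I y)
      (coordEnd x J y) :=
  isFrame_gual (coord_isHermFib hy (h.metric.isHermFib h.hermitian₁ _))
    (coord_isHermFib hy (h.metric.isHermFib h.hermitian₂ _))
    (coord_isInvertible hy (h.metric.isInvertible _))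

lemma IsBihermitian.isOrthJet (h : IsBihermitian g b I J) (x : M) :
    IsOrthJet (coordGual x g b I J (𝔠 x x)) (fderiv ℝ (coordGual x g b I J) (𝔠 x x)) := by
  refine isOrthJet_of_hasFDerivAt ((h.represents x).smooth.differentiableAt (by simp)).hasFDerivAt
    (eventually_target fun y hy => ?_) (eventually_target fun y hy => ?_)
  · exact (h.isFrame hy).sq (coord_isHermFib hy (h.metric.isHermFib h.hermitian₁ _))
      (coord_isHermFib hy (h.metric.isHermFib h.hermitian₂ _))
      (coord_isInvertible hy (h.metric.isInvertible _))
  · exact (h.isFrame hy).orth (coord_isHermFib hy (h.metric.isHermFib h.hermitian₁ _))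
      (coord_isHermFib hy (h.metric.isHermFib h.hermitian₂ _))
      (coord_isInvertible hy (h.metric.isInvertible _)) fun X Y => h.twoForm.skew _ _ _

lemma IsBihermitian.actsAs_plus (h : IsBihermitian g b I J) (x : M) :
    ActsAs (coordGual x g b I J (𝔠 x x)) (fderiv ℝ (coordGual x g b I J) (𝔠 x x))
      (coordTwo x (b + g) (𝔠 x x)) (fderiv ℝ (coordTwo x (b + g)) (𝔠 x x))
      (coordEnd x I (𝔠 x x)) (fderiv ℝ (coordEnd x I) (𝔠 x x)) where
  map := (h.isFrame (mem_extChartAt_target x)).plus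
  map' := hasFDerivAt_map_graph
    ((h.represents x).smooth.differentiableAt (by simp)).hasFDerivAt
    ((h.twoForm.smooth.add h.metric.smooth).differentiableAt).hasFDerivAt
    (h.hermitian₁.smooth.differentiableAt).hasFDerivAt
    (eventually_target fun _ hy => (h.isFrame hy).plus)

lemma IsBihermitian.actsAs_minus (h : IsBihermitian g b I J) (x : M) :
    ActsAs (coordGual x g b I J (𝔠 x x)) (fderiv ℝ (coordGual x g b I J) (𝔠 x x))
      (coordTwo x (b - g) (𝔠 x x)) (fderiv ℝ (coordTwo x (b - g)) (𝔠 x x))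
      (coordEnd x J (𝔠 x x)) (fderiv ℝ (coordEnd x J) (𝔠 x x)) where
  map := (h.isFrame (mem_extChartAt_target x)).minus
  map' := hasFDerivAt_map_graph
    ((h.represents x).smooth.differentiableAt (by simp)).hasFDerivAt
    ((h.twoForm.smooth.sub h.metric.smooth).differentiableAt).hasFDerivAt
    (h.hermitian₂.smooth.differentiableAt).hasFDerivAt
    (eventually_target fun _ hy => (h.isFrame hy).minus)

lemma IsBihermitian.complexJet_plus (h : IsBihermitian g b I J) (x : M) :
    IsComplexJet (coordTwo x (b + g) (𝔠 x x)) (coordEnd x I (𝔠 x x))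
      (fderiv ℝ (coordEnd x I) (𝔠 x x)) := by
  have hh : ∀ y ∈ (𝔠 x).target, IsHermFib (coordTwo x g y) (coordEnd x I y) := fun y hy =>
    coord_isHermFib hy (h.metric.isHermFib h.hermitian₁ _)
  have h0 := hh _ (mem_extChartAt_target x)
  refine ⟨h0.sq, complexJet_of_hasFDerivAt h.hermitian₁.smooth.differentiableAt.hasFDerivAt
    (eventually_target fun y hy => (hh y hy).sq), fun X Y => ?_⟩
  have hb : ∀ X Y, coordTwo x b (𝔠 x x) X Y = -coordTwo x b (𝔠 x x) Y X := fun X Y =>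
    h.twoForm.skew _ _ _
  have e : coordTwo x (b + g) (𝔠 x x) = coordTwo x b (𝔠 x x) + coordTwo x g (𝔠 x x) := rfl
  simp only [e, add_apply]
  linarith [hb X Y, hb (coordEnd x I (𝔠 x x) X) (coordEnd x I (𝔠 x x) Y), h0.orth X Y, h0.orth Y X]

lemma IsBihermitian.complexJet_minus (h : IsBihermitian g b I J) (x : M) :
    IsComplexJet (coordTwo x (b - g) (𝔠 x x)) (coordEnd x J (𝔠 x x))
      (fderiv ℝ (coordEnd x J) (𝔠 x x)) := by
  have hh : ∀ y ∈ (𝔠 x).target, IsHermFib (coordTwo x g y) (coordEnd x J y) := fun y hy =>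
    coord_isHermFib hy (h.metric.isHermFib h.hermitian₂ _)
  have h0 := hh _ (mem_extChartAt_target x)
  refine ⟨h0.sq, complexJet_of_hasFDerivAt h.hermitian₂.smooth.differentiableAt.hasFDerivAt
    (eventually_target fun y hy => (hh y hy).sq), fun X Y => ?_⟩
  have hb : ∀ X Y, coordTwo x b (𝔠 x x) X Y = -coordTwo x b (𝔠 x x) Y X := fun X Y =>
    h.twoForm.skew _ _ _
  have e : coordTwo x (b - g) (𝔠 x x) = coordTwo x b (𝔠 x x) - coordTwo x g (𝔠 x x) := rfl
  simp only [e, sub_apply]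
  linarith [hb X Y, hb (coordEnd x J (𝔠 x x) X) (coordEnd x J (𝔠 x x) Y), h0.orth X Y, h0.orth Y X]

lemma IsBihermitian.cross (h : IsBihermitian g b I J) (x : M) (y : E) (X Y : E) :
    coordTwo x (b + g) y X Y + coordTwo x (b - g) y Y X = 0 := by
  have e1 : coordTwo x (b + g) y = coordTwo x b y + coordTwo x g y := rfl
  have e2 : coordTwo x (b - g) y = coordTwo x b y - coordTwo x g y := rfl
  have hb : coordTwo x b y X Y = -coordTwo x b y Y X := h.twoForm.skew _ _ _
  have hg : coordTwo x g y X Y = coordTwo x g y Y X := h.metric.symm _ _ _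
  rw [e1, e2, add_apply, add_apply, sub_apply, sub_apply, hb, hg]; ring

/-- The generalized complex structure of a bihermitian structure, both halves of which are
integrable. -/
lemma IsBihermitian.isGenComplex (h : IsBihermitian g b I J) (hH : SmoothThreeForm H)
    (hI : Inv H (b + g) I) (hJ : Inv H (b - g) J) : IsGenComplex H (gualtieri₁ g b I J) := by
  have F : ∀ x, IsFrame (E := E) (gualtieri₁ g b I J x) (g x) (b x) (I x) (J x) := fun x =>
    isFrame_gual (h.metric.isHermFib h.hermitian₁ x) (h.metric.isHermFib h.hermitian₂ x)
      (h.metric.isInvertible x)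
  refine isGenComplex_of_torsion hH h.represents h.isOrthJet ?_ ?_ ?_
  · exact fun x => (F x).sq (h.metric.isHermFib h.hermitian₁ x) (h.metric.isHermFib h.hermitian₂ x)
      (h.metric.isInvertible x)
  · exact fun x v w => congrArg (· / 2) ((F x).orth (h.metric.isHermFib h.hermitian₁ x)
      (h.metric.isHermFib h.hermitian₂ x) (h.metric.isInvertible x) (h.twoForm.skew x) v w)
  · intro x
    have hs : ∀ s : GFib E, ∃ X Y, s = (X, coordTwo x (b + g) (𝔠 x x) X)
        + (Y, coordTwo x (b - g) (𝔠 x x) Y) :=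
      lift_span (g := coordTwo x g (𝔠 x x)) (b := coordTwo x b (𝔠 x x))
        (coord_isInvertible (mem_extChartAt_target x) (h.metric.isInvertible _))
    exact torsion_eq_zero (hI x) (hJ x) (h.isOrthJet x) (h.actsAs_plus x)
      (h.actsAs_minus x) (h.cross x _) (h.complexJet_plus x) (h.complexJet_minus x) hs

lemma Inv.neg (hJ : Inv H b J) : Inv H b (fun x => -J x) := fun x => by
  have e : coordEnd x (fun x => -J x) = fun y => -coordEnd x J y := coordEnd_neg x J
  have e' : fderiv ℝ (coordEnd x (fun x => -J x)) (𝔠 x x) = -fderiv ℝ (coordEnd x J) (𝔠 x x) := by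
    rw [e]; exact fderiv_neg
  rw [e', e]
  exact (hJ x).neg

/-- A bihermitian structure both halves of which are integrable is generalized Kähler. -/
theorem IsBihermitian.isGenKahler (h : IsBihermitian g b I J) (hH : SmoothThreeForm H)
    (hI : Inv H (b + g) I) (hJ : Inv H (b - g) J) :
    IsGenKahler H (gualtieri₁ g b I J) (gualtieri₂ g b I J) := by
  have F : ∀ x, IsFrame (E := E) (gualtieri₁ g b I J x) (g x) (b x) (I x) (J x) := fun x =>
    isFrame_gual (h.metric.isHermFib h.hermitian₁ x) (h.metric.isHermFib h.hermitian₂ x)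
      (h.metric.isInvertible x)
  have F₂ : ∀ x, IsFrame (E := E) (gualtieri₂ g b I J x) (g x) (b x) (I x) (-J x) := fun x => by
    rw [gualtieri₂_eq]
    exact isFrame_gual (h.metric.isHermFib h.hermitian₁ x) (h.metric.isHermFib h.hermitian₂ x).neg
      (h.metric.isInvertible x)
  refine ⟨h.isGenComplex hH hI hJ, ?_, fun x => (F x).comm (F₂ x) (h.metric.isInvertible x),
    fun x v hv => ?_⟩
  · rw [gualtieri₂_eq]
    exact h.neg.isGenComplex hH hI hJ.neg
  · exact half_pos ((F x).pos (F₂ x) (h.metric.isInvertible x)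
      (h.metric.isHermFib h.hermitian₁ x) (h.metric.isHermFib h.hermitian₂ x) (h.twoForm.skew x)
      (h.metric.pos x) v hv)

variable [T2Space M]

lemma IsMetric.exists_gSection (hg : IsMetric g) (x : M) (v : GTan E x) :
    ∃ s : GSection E M, SmoothGSection s ∧ s x = v := by
  obtain ⟨X, hX, eX⟩ := exists_vField x v.1
  -- A covector is extended by extending the vector which `g` identifies with it.
  obtain ⟨V, hV⟩ : ∃ V, g x V = v.2 := 
    ⟨_, (hg.isInvertible x).self_apply_inverse v.2⟩
  obtain ⟨Y, hY, eY⟩ := exists_vField x V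
  refine ⟨fun p => (X p, g p (Y p)), ⟨hX, hg.smooth.apply hY⟩, Prod.ext eX ?_⟩
  change g x (Y x) = v.2
  rw [eY, hV]

/-- The halves of the bihermitian structure of a generalized Kähler structure are integrable. -/
theorem IsBihermitian.inv_of_isGenKahler (h : IsBihermitian g b I J)
    (hK : IsGenKahler H (gualtieri₁ g b I J) (gualtieri₂ g b I J)) :
    Inv H (b + g) I ∧ Inv H (b - g) J := by
  rw [gualtieri₂_eq] at hK
  have t1 := hK.fst.torsion_eq_zero h.represents h.isOrthJet h.metric.exists_gSection
  have t2 := hK.snd.torsion_eq_zero h.neg.represents h.neg.isOrthJet h.metric.exists_gSection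
  have pos : ∀ (x : M) (X : E), coordTwo x g (𝔠 x x) X X = 0 → X = 0 := fun x X e => by
    rw [coordTwo_self] at e
    by_contra hX
    exact (h.metric.pos x X hX).ne' e
  have skew : ∀ (x : M) (X : E), coordTwo x b (𝔠 x x) X X = 0 := fun x X => by
    have : coordTwo x b (𝔠 x x) X X = -coordTwo x b (𝔠 x x) X X := h.twoForm.skew _ _ _
    linarith
  have n := fun x => coordEnd_neg x J
  constructor
  · intro x
    refine InvJet.of_torsion (c := coordTwo x (b - g) (𝔠 x x)) (J := coordEnd x J (𝔠 x x))
      (h.isOrthJet x) (h.neg.isOrthJet x) (h.actsAs_plus x) (h.neg.actsAs_plus x)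
      (h.actsAs_minus x).map ?_ (h.cross x _) (h.complexJet_plus x) (fun X hX => pos x X ?_)
      (t1 x) (t2 x)
    · have := (h.neg.actsAs_minus x).map
      rw [n] at this
      exact this
    · have e : coordTwo x b (𝔠 x x) X X + coordTwo x g (𝔠 x x) X X = 0 := hX
      rwa [skew, zero_add] at e
  · intro x
    have e : coordEnd x (fun x => -J x) = fun y => -coordEnd x J y := coordEnd_neg x J
    have e' : fderiv ℝ (coordEnd x (fun x => -J x)) (𝔠 x x) = -fderiv ℝ (coordEnd x J) (𝔠 x x) := by
      rw [e]; exact fderiv_neg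
    -- The negative of `𝕁₂` acts as `J` on the graph of `b - g` and as `-I` on that of `b + g`; thus
    -- `InvJet.of_torsion` applies to `𝕁₁` and `-𝕁₂` with the roles of the two graphs exchanged.
    have hm := (h.neg.actsAs_minus x).neg
    rw [e', e, neg_neg, neg_neg] at hm
    refine InvJet.of_torsion (c := coordTwo x (b + g) (𝔠 x x)) (J := coordEnd x I (𝔠 x x))
      (h.isOrthJet x) (h.neg.isOrthJet x).neg (h.actsAs_minus x) hm (h.actsAs_plus x).map
      (h.neg.actsAs_plus x).neg.map (fun X Y => (add_comm _ _).trans (h.cross x _ Y X))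
      (h.complexJet_minus x) (fun X hX => pos x X ?_) (t1 x)
      fun s t r => (torsion_neg s t r).trans (t2 x s t r)
    have e : coordTwo x b (𝔠 x x) X X - coordTwo x g (𝔠 x x) X X = 0 := hX
    rw [skew] at e
    linarith

end Bihermitian

end

section

variable {E : Type*} [NormedAddCommGroup E] [NormedSpace ℝ E]
  {F : Type*} [NormedAddCommGroup F] [NormedSpace ℝ F]
  {M : Type*} [TopologicalSpace M] [ChartedSpace E M]

local notation "𝔠" => extChartAt 𝓘(ℝ, E)

variable [IsManifold 𝓘(ℝ, E) ∞ M]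

/-! ### Families of bihermitian data -/

section Family

variable [FiniteDimensional ℝ E] {H : ThreeForm E M} {𝒰 𝒯 : Set ℝ} {g b K : ℝ → TwoTensor E M ℝ}
  {I : EndField E M} {J : ℝ → EndField E M}

/-- A field of two-tensors that depends smoothly on `(t, x)`, `t ∈ 𝒯`. -/
def SmoothTwoFamily (𝒯 : Set ℝ) (g : ℝ → TwoTensor E M ℝ) : Prop :=
  ∀ t ∈ 𝒯, ∀ x, ContDiffAt ℝ ∞ (fun q : ℝ × E => coordTwo x (g q.1) q.2) (t, 𝔠 x x)

/-- A field of endomorphisms that depends smoothly on `(t, x)`, `t ∈ 𝒯`. -/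
def SmoothEndFamily (𝒯 : Set ℝ) (J : ℝ → EndField E M) : Prop :=
  ∀ t ∈ 𝒯, ∀ x, ContDiffAt ℝ ∞ (fun q : ℝ × E => coordEnd x (J q.1) q.2) (t, 𝔠 x x)

/-- A family of bihermitian structures with fixed `I` that satisfies the equations of the canonical
deformation defined by the two-forms `K`. -/
structure IsBihermitianFamily (H : ThreeForm E M) (𝒰 𝒯 : Set ℝ) (g b K : ℝ → TwoTensor E M ℝ)
    (I : EndField E M) (J : ℝ → EndField E M) : Prop where
  isOpen : IsOpen 𝒰
  subset : 𝒯 ⊆ 𝒰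
  smooth_g : SmoothTwoFamily 𝒰 g
  smooth_b : SmoothTwoFamily 𝒰 b
  smooth_J : SmoothEndFamily 𝒰 J
  herm₁ : ∀ t ∈ 𝒰, ∀ x, IsHermFib (E := E) (g t x) (I x)
  herm₂ : ∀ t ∈ 𝒰, ∀ x, IsHermFib (E := E) (g t x) (J t x)
  bihermitian : ∀ t ∈ 𝒯, IsBihermitian (g t) (b t) I (J t)
  inv₁ : ∀ t ∈ 𝒯, Inv H (b t + g t) I
  inv₂ : ∀ t ∈ 𝒯, Inv H (b t - g t) (J t)
  twoForm : ∀ t ∈ 𝒯, IsTwoForm (K t)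
  invariant : ∀ t ∈ 𝒯, ∀ x X Y, K t x (J t x X) (J t x Y) = K t x X Y
  deriv : ∀ t ∈ 𝒯, ∀ x, ∃ (g' b' : E →L[ℝ] E →L[ℝ] ℝ) (J' : E →L[ℝ] E),
    HasDerivAt (F := E →L[ℝ] E →L[ℝ] ℝ) (fun s => g s x) g' t ∧
    HasDerivAt (F := E →L[ℝ] E →L[ℝ] ℝ) (fun s => b s x) b' t ∧
    HasDerivAt (F := E →L[ℝ] E) (fun s => J s x) J' t ∧
    (∀ X Y : E, b' X Y + g' X Y = -K t x (I x X) Y) ∧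
    (∀ X Y : E, b' X Y - g' X Y = -K t x X (I x Y)) ∧
    ∀ X Y : E, 2 * g t x (J' X) Y = K t x X (J t x (I x Y)) - K t x X (I x (J t x Y))

/-- Exchanges `𝕁₁` and `𝕁₂`, so the deformation need be studied only for `𝕁₁`. The equation for the
derivative of `J` is odd in `J` and the other two do not involve it. -/
lemma IsBihermitianFamily.neg (h : IsBihermitianFamily H 𝒰 𝒯 g b K I J) :
    IsBihermitianFamily H 𝒰 𝒯 g b K I (fun t x => -J t x) where
  isOpen := h.isOpen
  subset := h.subset
  smooth_g := h.smooth_g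
  smooth_b := h.smooth_b
  smooth_J t ht x := by
    have : (fun q : ℝ × E => coordEnd x (fun x => -J q.1 x) q.2)
        = fun q => -coordEnd x (J q.1) q.2 := by
      funext q; rw [coordEnd_neg]
    rw [this]; exact (h.smooth_J t ht x).neg
  herm₁ := h.herm₁
  herm₂ t ht x := (h.herm₂ t ht x).neg
  bihermitian t ht := (h.bihermitian t ht).neg
  inv₁ := h.inv₁
  inv₂ t ht := (h.inv₂ t ht).neg
  twoForm := h.twoForm
  invariant t ht x X Y := by
    have := h.invariant t ht x X Y
    simpa using this
  deriv t ht x := by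
    obtain ⟨g', b', J', h1, h2, h3, h4, h5, h6⟩ := h.deriv t ht x
    refine ⟨g', b', -J', h1, h2, h3.neg, h4, h5, fun X Y => ?_⟩
    have := h6 X Y
    have e1 : g t x ((-J') X) Y = -g t x (J' X) Y := by
      have := congrArg (fun f : E →L[ℝ] ℝ => f Y) ((g t x : E →L[ℝ] E →L[ℝ] ℝ).map_neg (J' X))
      exact this
    have e2 : K t x X ((-J t x) (I x Y)) = -K t x X (J t x (I x Y)) := 
      (K t x X : E →L[ℝ] ℝ).map_neg _
    have e3 : K t x X (I x ((-J t x) Y)) = -K t x X (I x (J t x Y)) := by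
      refine Eq.trans ?_ ((K t x X : E →L[ℝ] ℝ).map_neg _)
      exact congrArg (K t x X) ((I x : E →L[ℝ] E).map_neg _)
    rw [e1, e2, e3]; linarith

/-- The set `𝒯` of times with positive metric need not be open. Joint smoothness is available near
each of its points from the open set `𝒰` and is then restricted to `𝒯`. -/
lemma IsBihermitianFamily.smooth (h : IsBihermitianFamily H 𝒰 𝒯 g b K I J) :
    SmoothGEndFamily 𝒯 (fun t => gualtieri₁ (g t) (b t) I (J t)) := by
  intro s hs
  have key : ∀ t₀ ∈ 𝒯, ∀ x : M, ContDiffWithinAt ℝ ∞ (fun q : ℝ × E =>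
      gcoord x (fun p => gualtieri₁ (g q.1) (b q.1) I (J q.1) p (s p)) q.2) (𝒯 ×ˢ univ)
      (t₀, 𝔠 x x) := fun t₀ h₀ x => by
    have hI : ContDiffAt ℝ ∞ (fun q : ℝ × E => coordEnd x I q.2) (t₀, 𝔠 x x) :=
      ContDiffAt.comp (t₀, 𝔠 x x) (g := coordEnd x I)
        (smoothEnd_iff.1 (h.bihermitian t₀ h₀).hermitian₁.smooth x) contDiffAt_snd
    have hs' : ContDiffAt ℝ ∞ (fun q : ℝ × E => gcoord x s q.2) (t₀, 𝔠 x x) :=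
      ContDiffAt.comp (t₀, 𝔠 x x) (g := gcoord x s) (gcoord_contDiffAt.1 hs x) contDiffAt_snd
    have hc := ((contDiffAt_gual (h.smooth_g t₀ (h.subset h₀) x) (h.smooth_b t₀ (h.subset h₀) x) hI
      (h.smooth_J t₀ (h.subset h₀) x)
      (coord_isHermFib (mem_extChartAt_target x) (h.herm₁ t₀ (h.subset h₀) _))
      (coord_isHermFib (mem_extChartAt_target x) (h.herm₂ t₀ (h.subset h₀) _))
      (coord_isInvertible (mem_extChartAt_target x)
        ((h.bihermitian t₀ h₀).metric.isInvertible _))).clm_apply hs').contDiffWithinAt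
        (s := 𝒯 ×ˢ univ)
    refine hc.congr_of_eventuallyEq_of_mem ?_ ⟨h₀, mem_univ _⟩
    filter_upwards [(snd_mem_target t₀ x).filter_mono nhdsWithin_le_nhds, self_mem_nhdsWithin]
      with q hq hq'
    have hm := (h.bihermitian q.1 hq'.1).metric
    exact gcoord_gualtieri hq (h.herm₁ _ (h.subset hq'.1) _) (h.herm₂ _ (h.subset hq'.1) _)
      (hm.isInvertible _) s
  refine ⟨fun p hp => ?_, fun p hp => ?_⟩
  · exact (contMDiffWithinAt_vField_iff (t₀ := p.1) (x₀ := p.2)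
      (X := fun t x => (gualtieri₁ (g t) (b t) I (J t) x (s x)).1)).2 (key p.1 hp.1 p.2).fst
  · exact (contMDiffWithinAt_oneForm_iff (t₀ := p.1) (x₀ := p.2)
      (ξ := fun t x => (gualtieri₁ (g t) (b t) I (J t) x (s x)).2)).2 (key p.1 hp.1 p.2).snd

lemma isInvertible_eventually {P : Type*} [TopologicalSpace P] {f : P → E →L[ℝ] E →L[ℝ] ℝ} {p : P}
    (hf : ContinuousAt f p) (hp : (f p).IsInvertible) : ∀ᶠ q in 𝓝 p, (f q).IsInvertible := by
  have : CompleteSpace E := FiniteDimensional.complete ℝ E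
  obtain ⟨e, he⟩ := hp
  have := ContinuousLinearEquiv.nhds e
  rw [he] at this
  exact hf this

lemma hasDerivWithinAt_phi {x : M} {t : ℝ} {g' b' : E →L[ℝ] E →L[ℝ] ℝ} {J' : E →L[ℝ] E}
    (hg : HasDerivAt (F := E →L[ℝ] E →L[ℝ] ℝ) (fun s => g s x) g' t)
    (hb : HasDerivAt (F := E →L[ℝ] E →L[ℝ] ℝ) (fun s => b s x) b' t)
    (hJ : HasDerivAt (F := E →L[ℝ] E) (fun s => J s x) J' t)
    (e1 : ∀ᶠ s in 𝓝 t, IsHermFib (E := E) (g s x) (I x))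
    (e2 : ∀ᶠ s in 𝓝 t, IsHermFib (E := E) (g s x) (J s x))
    (e3 : ∀ᶠ s in 𝓝 t, IsNondeg (E := E) (g s x))
    (e4 : ∀ X Y, K t x (J t x X) (J t x Y) = K t x X Y)
    (h4 : ∀ X Y : E, b' X Y + g' X Y = -K t x (I x X) Y)
    (h5 : ∀ X Y : E, b' X Y - g' X Y = -K t x X (I x Y))
    (h6 : ∀ X Y : E, 2 * g t x (J' X) Y = K t x X (J t x (I x Y)) - K t x X (I x (J t x Y))) :
    HasDerivWithinAt (fun s => gualtieri₁ (g s) (b s) I (J s) x)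
      (Phi (K t x) (gualtieri₁ (g t) (b t) I (J t) x)) 𝒯 t := by
  have key : HasDerivAt (F := GFib E →L[ℝ] GFib E)
      (fun s => gual (E := E) (g s x) (b s x) (I x) (J s x))
      (phi (E := E) (K t x) (gual (E := E) (g t x) (b t x) (I x) (J t x))) t := by
    exact hasDerivAt_gual (E := E) (g := fun s => g s x) (b := fun s => b s x) (J := fun s => J s x)
      (I := I x) (K := K t x) hg hb hJ e1 e2 e3 e4 h4 h5 h6
  have e : ∀ A : GTan E x →L[ℝ] GTan E x, Phi (K t x) A = phi (E := E) (K t x) A := fun _ => rfl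
  have key₂ : ∀ f : ℝ → GTan E x →L[ℝ] GTan E x,
      f = (fun s => gual (E := E) (g s x) (b s x) (I x) (J s x)) →
      HasDerivWithinAt f (Phi (K t x) (f t)) 𝒯 t := by
    rintro f rfl
    exact key.hasDerivWithinAt.congr_deriv
      (e (gual (E := E) (g t x) (b t x) (I x) (J t x))).symm
  exact key₂ (fun s => gualtieri₁ (g s) (b s) I (J s) x) rfl

lemma IsBihermitianFamily.hasDerivWithinAt (h : IsBihermitianFamily H 𝒰 𝒯 g b K I J) {t : ℝ}
    (ht : t ∈ 𝒯) (x : M) :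
    HasDerivWithinAt (fun s => gualtieri₁ (g s) (b s) I (J s) x)
      (Phi (K t x) (gualtieri₁ (g t) (b t) I (J t) x)) 𝒯 t := by
  obtain ⟨g', b', J', h1, h2, h3, h4, h5, h6⟩ := h.deriv t ht x
  have hu := h.isOpen.mem_nhds (h.subset ht)
  have e1 : ∀ᶠ s in 𝓝 t, IsHermFib (E := E) (g s x) (I x) :=
    Filter.mem_of_superset hu fun s hs => h.herm₁ s hs x
  have e2 : ∀ᶠ s in 𝓝 t, IsHermFib (E := E) (g s x) (J s x) :=
    Filter.mem_of_superset hu fun s hs => h.herm₂ s hs x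
  have e3 : ∀ᶠ s in 𝓝 t, IsNondeg (E := E) (g s x) :=
    isInvertible_eventually h1.continuousAt ((h.bihermitian t ht).metric.isInvertible x)
  have e4 := h.invariant t ht x
  exact hasDerivWithinAt_phi h1 h2 h3 e1 e2 e3 e4 h4 h5 h6

/-- A family of bihermitian structures that satisfies the equations of the canonical deformation
gives a canonical deformation. -/
theorem IsBihermitianFamily.isCanonicalDeformation (h : IsBihermitianFamily H 𝒰 𝒯 g b K I J)
    (hH : SmoothThreeForm H) :
    IsCanonicalDeformation H 𝒯 (fun t => gualtieri₁ (g t) (b t) I (J t))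
      (fun t => gualtieri₂ (g t) (b t) I (J t)) K where
  genKahler t ht := (h.bihermitian t ht).isGenKahler hH (h.inv₁ t ht) (h.inv₂ t ht)
  smooth₁ := h.smooth
  smooth₂ := by
    simp only [gualtieri₂_eq]
    exact h.neg.smooth
  twoForm := h.twoForm
  deriv₁ t ht x := h.hasDerivWithinAt ht x
  deriv₂ t ht x := by
    simp only [gualtieri₂_eq]
    exact h.neg.hasDerivWithinAt ht x

lemma IsBihermitian.isBihermitianData {g b : TwoTensor E M ℝ} {J : EndField E M}
    (h : IsBihermitian g b I J) :
    IsBihermitianData (gualtieri₁ g b I J) (gualtieri₂ g b I J) g b I J :=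
  ⟨h.metric, h.twoForm, h.hermitian₁, h.hermitian₂, rfl, rfl⟩

end Family

end

section

variable {E : Type*} [NormedAddCommGroup E] [NormedSpace ℝ E]
  {F : Type*} [NormedAddCommGroup F] [NormedSpace ℝ F]
  {M : Type*} [TopologicalSpace M] [ChartedSpace E M]

local notation "𝔠" => extChartAt 𝓘(ℝ, E)

/-! ### One-jets of tensor fields -/

section Jets

/-- The value at `x` of a one-form, in the chart at `x`. -/
abbrev ptOne (x : M) (α : OneForm E M ℝ) : E →L[ℝ] ℝ := coordOne x α (𝔠 x x)

/-- The derivative at `x` of a one-form, in the chart at `x`. -/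
abbrev jetOne (x : M) (α : OneForm E M ℝ) : E →L[ℝ] E →L[ℝ] ℝ :=
  fderiv ℝ (coordOne x α) (𝔠 x x)

/-- The value at `x` of a two-tensor, in the chart at `x`. -/
abbrev ptTwo (x : M) (B : TwoTensor E M ℝ) : E →L[ℝ] E →L[ℝ] ℝ := coordTwo x B (𝔠 x x)

/-- The derivative at `x` of a two-tensor, in the chart at `x`. -/
abbrev jetTwo (x : M) (B : TwoTensor E M ℝ) : E →L[ℝ] E →L[ℝ] E →L[ℝ] ℝ :=
  fderiv ℝ (coordTwo x B) (𝔠 x x)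

/-- The value at `x` of an endomorphism field, in the chart at `x`. -/
abbrev ptEnd (x : M) (A : EndField E M) : E →L[ℝ] E := coordEnd x A (𝔠 x x)

/-- The derivative at `x` of an endomorphism field, in the chart at `x`. -/
abbrev jetEnd (x : M) (A : EndField E M) : E →L[ℝ] E →L[ℝ] E := fderiv ℝ (coordEnd x A) (𝔠 x x)

variable [IsManifold 𝓘(ℝ, E) ∞ M]
variable {x : M} {X Y : VField E M} {α β : OneForm E M ℝ} {B C : TwoTensor E M ℝ}
  {A A' : EndField E M}

lemma jetOne_comp (hα : SmoothOneForm α) (hA : SmoothEnd A) (x : M) (u v : E) :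
    jetOne x (fun x => α x ∘L A x) u v
      = jetOne x α u (ptEnd x A v) + ptOne x α (jetEnd x A u v) := by
  have e : coordOne x (fun x => α x ∘L A x) =ᶠ[𝓝 (𝔠 x x)]
      fun y => coordOne x α y ∘L coordEnd x A y :=
    eventually_target fun y hy => coordOne_comp_end hy α A
  have h := (hα.differentiableAt (x := x)).hasFDerivAt.clm_comp hA.differentiableAt.hasFDerivAt
  rw [jetOne, e.fderiv_eq, h.fderiv]
  exact add_comm _ _

lemma ptTwo_comp_left (B : TwoTensor E M ℝ) (A : EndField E M) (x : M) (v : E) :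
    ptTwo x (fun x => B x ∘L A x) v = ptTwo x B (ptEnd x A v) :=
  DFunLike.congr_fun (coordTwo_comp_left (mem_extChartAt_target x) B A) v

lemma jetTwo_comp_left (hB : SmoothTwoTensor B) (hA : SmoothEnd A) (x : M) (u v : E) :
    jetTwo x (fun x => B x ∘L A x) u v
      = jetTwo x B u (ptEnd x A v) + ptTwo x B (jetEnd x A u v) := by
  have e : coordTwo x (fun x => B x ∘L A x) =ᶠ[𝓝 (𝔠 x x)]
      fun y => coordTwo x B y ∘L coordEnd x A y :=
    eventually_target fun y hy => coordTwo_comp_left hy B A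
  have h := (hB.differentiableAt (x := x)).hasFDerivAt.clm_comp hA.differentiableAt.hasFDerivAt
  rw [jetTwo, e.fderiv_eq, h.fderiv]
  exact add_comm _ _

lemma ptEnd_comp (A A' : EndField E M) (x : M) (v : E) :
    ptEnd x (fun x => A x ∘L A' x) v = ptEnd x A (ptEnd x A' v) :=
  DFunLike.congr_fun (coordEnd_comp (mem_extChartAt_target x) A A') v

lemma jetEnd_comp (hA : SmoothEnd A) (hA' : SmoothEnd A') (x : M) (u v : E) :
    jetEnd x (fun x => A x ∘L A' x) u v
      = jetEnd x A u (ptEnd x A' v) + ptEnd x A (jetEnd x A' u v) := by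
  have e : coordEnd x (fun x => A x ∘L A' x) =ᶠ[𝓝 (𝔠 x x)]
      fun y => coordEnd x A y ∘L coordEnd x A' y :=
    eventually_target fun y hy => coordEnd_comp hy A A'
  have h := (hA.differentiableAt (x := x)).hasFDerivAt.clm_comp hA'.differentiableAt.hasFDerivAt
  rw [jetEnd, e.fderiv_eq, h.fderiv]
  exact add_comm _ _

lemma jetEnd_neg (A : EndField E M) (x : M) : jetEnd x (fun x => -A x) = -jetEnd x A := by
  rw [jetEnd, coordEnd_neg]; exact fderiv_neg

lemma ptEnd_neg (A : EndField E M) (x : M) : ptEnd x (fun x => -A x) = -ptEnd x A := by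
  rw [ptEnd, coordEnd_neg]

lemma jetTwo_add (hB : SmoothTwoTensor B) (hC : SmoothTwoTensor C) (x : M) :
    jetTwo x (fun x => B x + C x) = jetTwo x B + jetTwo x C := by
  rw [jetTwo, coordTwo_add]
  exact fderiv_fun_add hB.differentiableAt hC.differentiableAt

lemma jetTwo_sub (hB : SmoothTwoTensor B) (hC : SmoothTwoTensor C) (x : M) :
    jetTwo x (fun x => B x - C x) = jetTwo x B - jetTwo x C := by
  rw [jetTwo, coordTwo_sub]
  exact fderiv_fun_sub hB.differentiableAt hC.differentiableAt

lemma jetTwo_smul (c : ℝ) (hB : SmoothTwoTensor B) (x : M) :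
    jetTwo x (fun x => c • B x) = c • jetTwo x B := by
  rw [jetTwo, coordTwo_smul]
  exact fderiv_fun_const_smul hB.differentiableAt c

/-- Derivatives of a two-tensor along which a symmetry holds. -/
lemma jetTwo_swap (hB : SmoothTwoTensor B) (c : ℝ) (h : ∀ x X Y, B x X Y = c * B x Y X) (x : M)
    (u v w : E) : jetTwo x B u v w = c * jetTwo x B u w v := by
  have hd := (hB.differentiableAt (x := x)).hasFDerivAt
  have h1 := (hd.clm_apply (hasFDerivAt_const (𝕜 := ℝ) v _)).clm_apply
    (hasFDerivAt_const (𝕜 := ℝ) w _)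
  have h2 := ((hd.clm_apply (hasFDerivAt_const (𝕜 := ℝ) w _)).clm_apply
    (hasFDerivAt_const (𝕜 := ℝ) v _)).const_smul c
  have h3 := h2.congr_of_eventuallyEq (f₁ := fun y => coordTwo x B y v w)
    (Filter.Eventually.of_forall fun y => h _ _ _)
  have := DFunLike.congr_fun (h1.unique h3) u
  simpa [jetTwo] using this

lemma IsTwoForm.closedJet (hB : IsTwoForm B) (hc : Closed₂ B) (x : M) :
    ClosedJet (ptTwo x B) (jetTwo x B) where
  skew X Y := hB.skew _ _ _
  skew' u X Y := by
    have := jetTwo_swap hB.smooth (-1) (fun x X Y => by rw [hB.skew]; ring) x u X Y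
    linarith
  closed := hc x

lemma jetEnd_sq (hA : SmoothEnd A) (hsq : ∀ x X, A x (A x X) = -X) (x : M) (u v : E) :
    jetEnd x A u (ptEnd x A v) = -ptEnd x A (jetEnd x A u v) := by
  refine complexJet_of_hasFDerivAt (hA.differentiableAt (x := x)).hasFDerivAt
    (eventually_target fun y hy v => ?_) u v
  have hL : (chartInvDiff (M := M) x y).IsInvertible := chartInvDiff_isInvertible hy
  have key : ∀ (L a : E →L[ℝ] E), L.IsInvertible → (∀ X, a (a X) = -X) →
      ∀ v, (L.inverse ∘L a ∘L L) ((L.inverse ∘L a ∘L L) v) = -v := fun L a hL ha v => by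
    simp [hL.self_apply_inverse, ha, hL.inverse_apply_self]
  exact key _ _ hL (hsq _) v

lemma ptEnd_sq (hsq : ∀ x X, A x (A x X) = -X) (x : M) (v : E) :
    ptEnd x A (ptEnd x A v) = -v := by
  rw [ptEnd, coordEnd_self]
  exact hsq x v

/-- Vanishing of the Nijenhuis tensor in terms of one-jets. -/
def NijZero (J : EndField E M) : Prop := ∀ x (X Y : E),
  jetEnd x J (ptEnd x J X) Y - jetEnd x J (ptEnd x J Y) X + ptEnd x J (jetEnd x J Y X)
    - ptEnd x J (jetEnd x J X Y) = 0

lemma coordV_end_jet (hA : SmoothEnd A) (hX : SmoothVField X) (x : M) (u : E) :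
    fderiv ℝ (coordV x (fun y => A y (X y))) (𝔠 x x) u
      = jetEnd x A u (coordV x X (𝔠 x x)) + ptEnd x A (fderiv ℝ (coordV x X) (𝔠 x x) u) := by
  have e : coordV x (fun y => A y (X y)) =ᶠ[𝓝 (𝔠 x x)]
      fun y => coordEnd x A y (coordV x X y) :=
    eventually_target fun y hy => coordV_end hy A X
  rw [e.fderiv_eq, fderiv_clm_apply hA.differentiableAt hX.differentiableAt]
  exact add_comm _ _

lemma mlieBracket_jet (X Y : VField E M) (x : M) :
    VectorField.mlieBracket 𝓘(ℝ, E) X Y x =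
      fderiv ℝ (coordV x Y) (𝔠 x x) (coordV x X (𝔠 x x))
        - fderiv ℝ (coordV x X) (𝔠 x x) (coordV x Y (𝔠 x x)) := by
  rw [coordV_self, coordV_self]
  exact mlieBracket_apply X Y x

/-- Vectors at `x` are extended to vector fields; their derivatives cancel in the Nijenhuis tensor
and only the jet of `J` remains. -/
lemma Integrable.nijZero [FiniteDimensional ℝ E] [T2Space M] {J : EndField E M}
    (hJ : Integrable J) (hs : SmoothEnd J) (hsq : ∀ x X, J x (J x X) = -X) : NijZero J := by
  intro x v w
  obtain ⟨X, hX, eX⟩ := exists_vField x v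
  obtain ⟨Y, hY, eY⟩ := exists_vField x w
  have cX : coordV x X (𝔠 x x) = v := (coordV_self X x).trans eX
  have cY : coordV x Y (𝔠 x x) = w := (coordV_self Y x).trans eY
  have cJX : coordV x (fun y => J y (X y)) (𝔠 x x) = ptEnd x J v := by
    rw [← cX]; exact coordV_end (mem_extChartAt_target x) J X
  have cJY : coordV x (fun y => J y (Y y)) (𝔠 x x) = ptEnd x J w := by
    rw [← cY]; exact coordV_end (mem_extChartAt_target x) J Y
  have jX := coordV_end_jet hs hX x
  have jY := coordV_end_jet hs hY x
  have h := hJ X Y hX hY x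
  have e := coordEnd_self J x
  have key : ∀ (j : E →L[ℝ] E) (b1 b2 b3 b4 : E), ptEnd x J = j → b1 - j b2 - j b3 - b4 = 0 →
      b1 - ptEnd x J b2 - ptEnd x J b3 - b4 = 0 := by rintro j _ _ _ _ rfl h; exact h
  have h' := key (J x) _ _ _ _ e h
  clear h key
  rw [mlieBracket_jet, mlieBracket_jet, mlieBracket_jet, mlieBracket_jet] at h'
  rw [jX, jX, jY, jY, cX, cY, cJX, cJY] at h'
  simp only [map_sub, map_add, ptEnd_sq hsq] at h'
  rw [← h']
  abel

end Jets

/-! ### Integrability on graphs, for tensor fields -/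

section Inv

variable [IsManifold 𝓘(ℝ, E) ∞ M] {H : ThreeForm E M} {a a₁ B P S W : TwoTensor E M ℝ}
  {I J : EndField E M}

lemma Inv.nijZero (h : Inv H a I) : NijZero I := fun x => (h x).nijenhuis

/-- Integrability on the graph of `a` is not affected by adding `P + SI` to `a`, where `P` and `S`
are closed two-forms. -/
lemma Inv.add (hi : Inv H a I) (ha : SmoothTwoTensor a) (hI : SmoothEnd I)
    (hsq : ∀ x X, I x (I x X) = -X) (hP : IsTwoForm P) (hPc : Closed₂ P) (hS : IsTwoForm S)
    (hSc : Closed₂ S) (h : ∀ x X Y, a₁ x X Y = a x X Y + P x X Y + S x (I x X) Y) :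
    Inv H a₁ I := by
  have e : a₁ = fun x => (fun x => a x + P x) x + (fun x => S x ∘L I x) x := by
    funext x; ext X Y; exact h x X Y
  subst e
  intro x
  refine (hi x).add (ptEnd_sq hsq x) (jetEnd_sq hI hsq x) (hP.closedJet hPc x)
    (hS.closedJet hSc x) (fun X Y => ?_) fun u X Y => ?_
  · have := congrArg (fun f : E →L[ℝ] ℝ => f Y) (ptTwo_comp_left S I x X)
    exact congrArg (ptTwo x a X Y + ptTwo x P X Y + ·) this
  · have := congrArg (fun f : E →L[ℝ] ℝ => f Y) (jetTwo_comp_left hS.smooth hI x u X)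
    have e1 := jetTwo_add (ha.add hP.smooth) (hS.smooth.comp_left hI) x
    rw [jetTwo_add ha hP.smooth] at e1
    rw [jetTwo] at e1
    rw [e1]
    exact congrArg (jetTwo x a u X Y + jetTwo x P u X Y + ·) this

lemma Inv.zero (hn : NijZero I) : Inv 0 (fun _ : M => 0) I := by
  intro x
  have e : coordTwo (E := E) x (fun _ : M => 0) = fun _ => 0 := by
    funext y; ext v w; rfl
  rw [e, fderiv_fun_const]
  exact InvJet.zero (hn x)

lemma Inv.of_closed (hn : NijZero I) (hB : IsTwoForm B)
    (hc : ∀ x (X Y Z : E), jetTwo x B X Y Z + jetTwo x B Y Z X + jetTwo x B Z X Y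
      + tri (E := E) (H x) X Y Z = 0) : Inv H B I := fun x =>
  InvJet.of_closed (hn x) (fun X Y => hB.skew _ _ _) (fun u X Y => by
    have := jetTwo_swap hB.smooth (-1) (fun x X Y => by rw [hB.skew]; ring) x u X Y
    linarith) (hc x)

/-- A complex structure `J` is integrable if `Ω` and `ΩJ` are closed. -/
lemma nijZero_of_closed (hW : IsTwoForm W) (hWc : Closed₂ W)
    (hS : IsTwoForm (fun x => W x ∘L J x)) (hSc : Closed₂ (fun x => W x ∘L J x))
    (hJ : SmoothEnd J) (hsq : ∀ x X, J x (J x X) = -X)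
    (hnd : ∀ x X, (∀ Z, W x X Z = 0) → X = 0) : NijZero J := by
  intro x
  refine nijenhuis_of_closed (hW.closedJet hWc x) (hS.closedJet hSc x) (ptEnd_sq hsq x)
    (jetEnd_sq hJ hsq x) (fun X Y => ?_) (fun u X Y => ?_) fun X h => ?_
  · exact congrArg (fun f : E →L[ℝ] ℝ => f Y) (ptTwo_comp_left W J x X)
  · exact congrArg (fun f : E →L[ℝ] ℝ => f Y) (jetTwo_comp_left hW.smooth hJ x u X)
  · exact hnd x X fun Z =>
      (congrArg (fun f : E →L[ℝ] E →L[ℝ] ℝ => f X Z) (coordTwo_self W x)).symm.trans (h Z)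

end Inv

/-! ### The two-form `dJdu` -/

section DifferentialForms

variable [IsManifold 𝓘(ℝ, E) ∞ M] {u : M → ℝ} {A I J : EndField E M}

lemma extD_dfun_comp (hu : ContMDiff 𝓘(ℝ, E) 𝓘(ℝ, ℝ) ∞ u) (hA : SmoothEnd A) (x : M) (X Y : E) :
    (extD (fun x => dfun u x ∘L A x) x : E →L[ℝ] E →L[ℝ] ℝ) X Y
      = dComp (ptOne x (dfun u)) (jetOne x (dfun u)) (ptEnd x A) (jetEnd x A) X Y := by
  refine (extD_apply _ x X Y).trans ?_
  exact congrArg₂ (· - ·) (jetOne_comp (smoothOneForm_dfun hu) hA x X Y)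
    (jetOne_comp (smoothOneForm_dfun hu) hA x Y X)

lemma jetOne_dfun_symm (hu : ContMDiff 𝓘(ℝ, E) 𝓘(ℝ, ℝ) ∞ u) (x : M) (X Y : E) :
    jetOne x (dfun u) X Y = jetOne x (dfun u) Y X := by
  have e : coordOne x (dfun u) =ᶠ[𝓝 (𝔠 x x)] fderiv ℝ (fun z => u ((𝔠 x).symm z)) :=
    eventually_target fun y hy => coordOne_dfun hu hy
  rw [jetOne, e.fderiv_eq]
  exact (contDiffAt_coord_fun hu x).isSymmSndFDerivAt (by simpa using two_le_infty) X Y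

lemma actOne_eq (J : EndField E M) (α : OneForm E M ℝ) :
    actOne J α = fun x => α x ∘L (fun x => -J x) x := by
  funext x
  exact ((α x).comp_neg (J x)).symm

lemma SmoothOneForm.actOne {α : OneForm E M ℝ} (hα : SmoothOneForm α) (hJ : SmoothEnd J) :
    SmoothOneForm (actOne J α) := by
  rw [actOne_eq]
  exact hα.comp hJ.neg

lemma isTwoForm_dJd (hu : ContMDiff 𝓘(ℝ, E) 𝓘(ℝ, ℝ) ∞ u) (hJ : SmoothEnd J) :
    IsTwoForm (dJd J u) := ((smoothOneForm_dfun hu).actOne hJ).isTwoForm_extD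

lemma closed_dJd (hu : ContMDiff 𝓘(ℝ, E) 𝓘(ℝ, ℝ) ∞ u) (hJ : SmoothEnd J) :
    Closed₂ (dJd J u) := ((smoothOneForm_dfun hu).actOne hJ).closed_extD

lemma dComp_neg (α : E →L[ℝ] ℝ) (α' : E →L[ℝ] E →L[ℝ] ℝ) (A : E →L[ℝ] E) (A' : E →L[ℝ] E →L[ℝ] E)
    (X Y : E) : dComp α α' (-A) (-A') X Y = -dComp α α' A A' X Y := by
  simp only [dComp, neg_apply, map_neg]; ring

lemma dJd_apply (hu : ContMDiff 𝓘(ℝ, E) 𝓘(ℝ, ℝ) ∞ u) (hJ : SmoothEnd J) (x : M) (X Y : E) :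
    (dJd J u x : E →L[ℝ] E →L[ℝ] ℝ) X Y
      = -dComp (ptOne x (dfun u)) (jetOne x (dfun u)) (ptEnd x J) (jetEnd x J) X Y := by
  rw [dJd, actOne_eq, ← dComp_neg, ← ptEnd_neg, ← jetEnd_neg]
  exact extD_dfun_comp hu hJ.neg x X Y

/-- Type (1,1) of `dJdu` is what lets it serve as `K` in the deformation equation; integrability of
`J` is essential here. -/
lemma dJd_invariant (hu : ContMDiff 𝓘(ℝ, E) 𝓘(ℝ, ℝ) ∞ u) (hJ : SmoothEnd J)
    (hsq : ∀ x X, J x (J x X) = -X) (hn : NijZero J) (x : M) (X Y : Tan E x) :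
    dJd J u x (J x X) (J x Y) = dJd J u x X Y := by
  have h := dComp_invariant (α := ptOne x (dfun u)) (jetOne_dfun_symm hu x) (ptEnd_sq hsq x) (jetEnd_sq hJ hsq x) (hn x) X Y
  have e : ∀ Z : E, ptEnd x J Z = J x Z := fun Z => DFunLike.congr_fun (coordEnd_self J x) Z
  refine (dJd_apply hu hJ x _ _).trans (.trans ?_ (dJd_apply hu hJ x X Y).symm)
  rw [← h]
  exact congrArg₂ (fun V W : E => -dComp (ptOne x (dfun u)) (jetOne x (dfun u)) (ptEnd x J)
    (jetEnd x J) V W) (e X).symm (e Y).symm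

end DifferentialForms

end

section

variable {E : Type*} [NormedAddCommGroup E] [NormedSpace ℝ E]
  {F : Type*} [NormedAddCommGroup F] [NormedSpace ℝ F]
  {M : Type*} [TopologicalSpace M] [ChartedSpace E M]

local notation "𝔠" => extChartAt 𝓘(ℝ, E)

/-! ### Linear families of bihermitian data -/

section Line

/-- The symmetric part of the two-tensor `K(I·,·)`. -/
def symmPart (K : TwoTensor E M ℝ) (I : EndField E M) : TwoTensor E M ℝ := fun x =>
  (1 / 2 : ℝ) • (K x ∘L I x - dualMap (I x) ∘L K x)

/-- The skew part of the two-tensor `K(I·,·)`. -/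
def skewPart (K : TwoTensor E M ℝ) (I : EndField E M) : TwoTensor E M ℝ := fun x =>
  (1 / 2 : ℝ) • (K x ∘L I x + dualMap (I x) ∘L K x)

lemma symmPart_apply (K : TwoTensor E M ℝ) (I : EndField E M) (x : M) (X Y : Tan E x) :
    symmPart K I x X Y = 1 / 2 * (K x (I x X) Y - K x X (I x Y)) := rfl

lemma skewPart_apply (K : TwoTensor E M ℝ) (I : EndField E M) (x : M) (X Y : Tan E x) :
    skewPart K I x X Y = 1 / 2 * (K x (I x X) Y + K x X (I x Y)) := rfl

/-- The family `g - t h` of two-tensors. -/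
def line (g h : TwoTensor E M ℝ) (t : ℝ) : TwoTensor E M ℝ := fun x => g x - t • h x

lemma line_apply (g h : TwoTensor E M ℝ) (t : ℝ) (x : M) (X Y : Tan E x) :
    line g h t x X Y = g x X Y - t * h x X Y := rfl

lemma line_zero (g h : TwoTensor E M ℝ) : line g h 0 = g := by
  funext x; ext X Y; rw [line_apply]; ring

variable [IsManifold 𝓘(ℝ, E) ∞ M] {g h b K : TwoTensor E M ℝ} {I J : EndField E M}

lemma SmoothTwoTensor.symmPart (hK : SmoothTwoTensor K) (hI : SmoothEnd I) :
    SmoothTwoTensor (symmPart K I) := ((hK.comp_left hI).sub (hK.comp_right hI)).smul _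

lemma SmoothTwoTensor.skewPart (hK : SmoothTwoTensor K) (hI : SmoothEnd I) :
    SmoothTwoTensor (skewPart K I) := ((hK.comp_left hI).add (hK.comp_right hI)).smul _

lemma SmoothTwoTensor.line (hg : SmoothTwoTensor g) (hh : SmoothTwoTensor h) (t : ℝ) :
    SmoothTwoTensor (line g h t) := hg.sub (hh.smul t)

lemma smoothTwoFamily_line (hg : SmoothTwoTensor g) (hh : SmoothTwoTensor h) (𝒰 : Set ℝ) :
    SmoothTwoFamily 𝒰 (line g h) := fun t _ x => by
  have h1 : ContDiffAt ℝ ∞ (fun q : ℝ × E => coordTwo x g q.2) (t, 𝔠 x x) :=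
    ContDiffAt.comp (t, 𝔠 x x) (g := coordTwo x g) (smoothTwoTensor_iff.1 hg x) contDiffAt_snd
  have h2 : ContDiffAt ℝ ∞ (fun q : ℝ × E => coordTwo x h q.2) (t, 𝔠 x x) :=
    ContDiffAt.comp (t, 𝔠 x x) (g := coordTwo x h) (smoothTwoTensor_iff.1 hh x) contDiffAt_snd
  exact h1.sub (contDiffAt_fst.smul h2)

lemma smoothEndFamily_const (hJ : SmoothEnd J) (𝒰 : Set ℝ) : SmoothEndFamily 𝒰 (fun _ => J) :=
  fun t _ x => ContDiffAt.comp (t, 𝔠 x x) (g := coordEnd x J) (smoothEnd_iff.1 hJ x) contDiffAt_snd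

lemma hasDerivAt_line (g h : TwoTensor E M ℝ) (x : M) (t : ℝ) :
    HasDerivAt (F := E →L[ℝ] E →L[ℝ] ℝ) (fun s => line g h s x) (-h x) t := by
  have key : ∀ a c : E →L[ℝ] E →L[ℝ] ℝ, HasDerivAt (fun s : ℝ => a - s • c) (-c) t := fun a c => by
    simpa using ((hasDerivAt_id t).smul_const c).const_sub a
  exact key (g x) (h x)

lemma isTwoForm_zero : IsTwoForm (0 : TwoTensor E M ℝ) where
  smooth := by
    rw [smoothTwoTensor_iff]
    intro x
    have : coordTwo (E := E) x (0 : TwoTensor E M ℝ) = fun _ => 0 := by funext y; ext; rfl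
    rw [this]; exact contDiffAt_const
  skew x X Y := by
    change (0 : ℝ) = -0
    simp

lemma closed_zero : Closed₂ (0 : TwoTensor E M ℝ) := fun x a b c => by
  have : coordTwo (E := E) x (0 : TwoTensor E M ℝ) = fun _ => 0 := by funext y; ext; rfl
  simp [this]

lemma IsTwoForm.smul (c : ℝ) (hK : IsTwoForm K) : IsTwoForm (fun x => c • K x) where
  smooth := hK.smooth.smul c
  skew x X Y := by
    have := hK.skew x X Y
    change c * K x X Y = -(c * K x Y X)
    rw [this]; ring

lemma Closed₂.smul (c : ℝ) (hK : SmoothTwoTensor K) (hc : Closed₂ K) :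
    Closed₂ (fun x => c • K x) := fun x X Y Z => by
  have := hc x X Y Z
  have e := jetTwo_smul c hK x
  rw [jetTwo] at e
  rw [e]
  simp only [smul_apply, smul_eq_mul] at *
  linear_combination c * this

variable [FiniteDimensional ℝ E] {H : ThreeForm E M} {P S : TwoTensor E M ℝ}

/-- For commuting `I` and `J`, a closed two-form `K` deforms a bihermitian structure linearly. -/
theorem IsBihermitian.isBihermitianFamily_line (hB : IsBihermitian g b I J) (hI : Inv H (b + g) I)
    (hJ : Inv H (b - g) J) (hcomm : ∀ x X, I x (J x X) = J x (I x X)) (hK : IsTwoForm K)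
    (hKc : Closed₂ K) (hKJ : ∀ x X Y, K x (J x X) (J x Y) = K x X Y)
    (hP : IsTwoForm P) (hPc : Closed₂ P) (hS : IsTwoForm S) (hSc : Closed₂ S)
    (hPS : ∀ x X Y, K x X (I x Y) = P x X Y + S x (J x X) Y)
    (hpos : ∀ x X, X ≠ 0 → 0 < g x X X - K x (I x X) X) :
    IsBihermitianFamily H univ (Icc 0 1) (line g (symmPart K I)) (line b (skewPart K I))
      (fun _ => K) I (fun _ => J) := by
  have hIs := hB.hermitian₁.smooth
  have hJs := hB.hermitian₂.smooth
  have hsI := hB.hermitian₁.sq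
  have hsJ := hB.hermitian₂.sq
  have gs := hB.metric.symm
  have ks := hK.skew
  have sI : ∀ x X Y, symmPart K I x (I x X) (I x Y) = symmPart K I x X Y := fun x X Y => by
    rw [symmPart_apply, symmPart_apply, hsI, hsI, map_neg, neg_apply, map_neg]; ring
  have sJ : ∀ x X Y, symmPart K I x (J x X) (J x Y) = symmPart K I x X Y := fun x X Y => by
    rw [symmPart_apply, symmPart_apply, hcomm, hcomm, hKJ, hKJ]
  have ss : ∀ x X Y, symmPart K I x X Y = symmPart K I x Y X := fun x X Y => by
    rw [symmPart_apply, symmPart_apply, ks x (I x X), ks x X]; ring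
  have herm₁ : ∀ t x X Y, line g (symmPart K I) t x (I x X) (I x Y)
      = line g (symmPart K I) t x X Y := fun t x X Y => by
    rw [line_apply, line_apply, sI, hB.hermitian₁.orth]
  have herm₂ : ∀ t x X Y, line g (symmPart K I) t x (J x X) (J x Y)
      = line g (symmPart K I) t x X Y := fun t x X Y => by
    rw [line_apply, line_apply, sJ, hB.hermitian₂.orth]
  have symm : ∀ t x X Y, line g (symmPart K I) t x X Y = line g (symmPart K I) t x Y X :=
    fun t x X Y => by rw [line_apply, line_apply, ss, gs]
  refine
    { isOpen := isOpen_univ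
      subset := subset_univ _
      smooth_g := smoothTwoFamily_line hB.metric.smooth (hK.smooth.symmPart hIs) _
      smooth_b := smoothTwoFamily_line hB.twoForm.smooth (hK.smooth.skewPart hIs) _
      smooth_J := smoothEndFamily_const hJs _
      herm₁ := fun t _ x => ⟨symm t x, hsI x, herm₁ t x⟩
      herm₂ := fun t _ x => ⟨symm t x, hsJ x, herm₂ t x⟩
      bihermitian := fun t ht => ⟨⟨?_, symm t, ?_⟩, ⟨?_, ?_⟩, ⟨hIs, hsI, herm₁ t⟩,
        ⟨hJs, hsJ, herm₂ t⟩⟩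
      inv₁ := fun t _ => ?_
      inv₂ := fun t _ => ?_
      twoForm := fun _ _ => hK
      invariant := fun _ _ => hKJ
      deriv := fun t _ x => ⟨_, _, 0, hasDerivAt_line g _ x t, hasDerivAt_line b _ x t,
        hasDerivAt_const t _, ?_, ?_, ?_⟩ }
  · exact hB.metric.smooth.line (hK.smooth.symmPart hIs) t
  · intro x X hX
    have h0 := hB.metric.pos x X hX
    have h1 := hpos x X hX
    rw [line_apply, symmPart_apply, ks x X]
    -- At time `t` the quadratic form is `(1 - t) g(X,X) + t (g(X,X) - K(IX,X))`, a convex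
    -- combination of two positive numbers.
    rcases ht.2.eq_or_lt with rfl | h
    · linarith
    · nlinarith [ht.1, mul_pos (sub_pos.2 h) h0, mul_nonneg ht.1 h1.le]
  · exact hB.twoForm.smooth.line (hK.smooth.skewPart hIs) t
  · intro x X Y
    rw [line_apply, line_apply, skewPart_apply, skewPart_apply, hB.twoForm.skew, ks x (I x X),
      ks x X]
    ring
  · refine hI.add (hB.twoForm.smooth.add hB.metric.smooth) hIs hsI isTwoForm_zero closed_zero
      (hK.smul (-t)) (hKc.smul (-t) hK.smooth) fun x X Y => ?_
    change line b (skewPart K I) t x X Y + line g (symmPart K I) t x X Y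
      = (b x X Y + g x X Y) + 0 + -t * K x (I x X) Y
    rw [line_apply, line_apply, symmPart_apply, skewPart_apply]; ring
  · refine hJ.add (hB.twoForm.smooth.sub hB.metric.smooth) hJs hsJ (hP.smul (-t))
      (hPc.smul (-t) hP.smooth) (hS.smul (-t)) (hSc.smul (-t) hS.smooth) fun x X Y => ?_
    change line b (skewPart K I) t x X Y - line g (symmPart K I) t x X Y
      = (b x X Y - g x X Y) + -t * P x X Y + -t * S x (J x X) Y
    rw [line_apply, line_apply, symmPart_apply, skewPart_apply, hPS]; ring
  · intro (X : Tan E x) (Y : Tan E x)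
    change -skewPart K I x X Y + -symmPart K I x X Y = -K x (I x X) Y
    rw [symmPart_apply, skewPart_apply]; ring
  · intro (X : Tan E x) (Y : Tan E x)
    change -skewPart K I x X Y - -symmPart K I x X Y = -K x X (I x Y)
    rw [symmPart_apply, skewPart_apply]; ring
  -- Both sides vanish: `J` does not move, and `I` and `J` commute.
  · intro X Y
    have z : ∀ B : E →L[ℝ] E →L[ℝ] ℝ, B ((0 : E →L[ℝ] E) X) Y = 0 := fun B => by simp
    have e := z (line g (symmPart K I) t x)
    have e' := congrArg (K x X) (hcomm x Y)
    exact ((congrArg (2 * ·) e).trans (mul_zero _)).trans (sub_eq_zero.2 e'.symm).symm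

end Line

/-! ### The operators `∂∂̄` -/

section DDbar

variable [IsManifold 𝓘(ℝ, E) ∞ M] {u : M → ℝ} {I P : EndField E M}

lemma extD_dbarFun (hu : ContMDiff 𝓘(ℝ, E) 𝓘(ℝ, ℝ) ∞ u) (hI : SmoothEnd I) (hP : SmoothEnd P)
    (x : M) (X Y : Tan E x) :
    extD (dbarFun I P u) x X Y = (1 / 2 : ℂ) * ((extD (fun x => dfun u x ∘L P x) x X Y : ℂ)
      + Complex.I * (extD (fun x => dfun u x ∘L (I x ∘L P x)) x X Y : ℂ)) := by
  obtain ⟨α, hα⟩ : ∃ α : OneForm E M ℝ, α = fun x => dfun u x ∘L P x := ⟨_, rfl⟩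
  obtain ⟨β, hβ⟩ : ∃ β : OneForm E M ℝ, β = fun x => dfun u x ∘L (I x ∘L P x) := ⟨_, rfl⟩
  have sα : SmoothOneForm α := hα ▸ (smoothOneForm_dfun hu).comp hP
  have sβ : SmoothOneForm β := hβ ▸ (smoothOneForm_dfun hu).comp (hI.comp hP)
  have e : coordOne x (dbarFun I P u) = fun y => (1 / 2 : ℂ) • (Complex.ofRealCLM ∘L coordOne x α y
      + Complex.I • (Complex.ofRealCLM ∘L coordOne x β y)) := by
    subst hα hβ; rfl
  have hd : ∀ v w : E, fderiv ℝ (coordOne x (dbarFun I P u)) (𝔠 x x) v w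
      = (1 / 2 : ℂ) * ((jetOne x α v w : ℂ) + Complex.I * (jetOne x β v w : ℂ)) := fun v w => by
    have hc := hasFDerivAt_const (𝕜 := ℝ) Complex.ofRealCLM (𝔠 x x)
    have h := ((hc.clm_comp (sα.differentiableAt (x := x)).hasFDerivAt).add
      ((hc.clm_comp (sβ.differentiableAt (x := x)).hasFDerivAt).const_smul
        Complex.I)).const_smul (1 / 2 : ℂ)
    rw [e]
    refine (congrArg (fun L : E →L[ℝ] E →L[ℝ] ℂ => L v w) h.fderiv).trans ?_
    simp [jetOne]
    ring
  rw [← hα, ← hβ]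
  refine (extD_apply _ x X Y).trans ?_
  rw [extD_apply α x X Y, extD_apply β x X Y]
  refine (congrArg₂ (· - ·) (hd X Y) (hd Y X)).trans ?_
  push_cast
  ring

lemma extD_dfun (hu : ContMDiff 𝓘(ℝ, E) 𝓘(ℝ, ℝ) ∞ u) (x : M) (X Y : Tan E x) :
    extD (dfun u) x X Y = 0 :=
  (extD_apply _ x X Y).trans (sub_eq_zero.2 (jetOne_dfun_symm hu x X Y))

lemma extD_neg (α : OneForm E M ℝ) (x : M) (X Y : Tan E x) :
    extD (fun x => -α x) x X Y = -extD α x X Y := by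
  have e : fderiv ℝ (coordOne x fun x => -α x) (𝔠 x x) = -fderiv ℝ (coordOne x α) (𝔠 x x) := by
    rw [coordOne_neg]; exact fderiv_fun_neg
  refine (extD_apply _ x X Y).trans (.trans ?_ (congrArg (-·) (extD_apply α x X Y)).symm)
  rw [e]
  exact (neg_sub_neg _ _).trans (neg_sub _ _).symm

lemma extD_dfun_comp_eq (J : EndField E M) (x : M) (X Y : Tan E x) :
    extD (fun x => dfun u x ∘L J x) x X Y = -dJd J u x X Y := by
  have := extD_neg (fun x => dfun u x ∘L J x) x X Y
  exact (neg_eq_iff_eq_neg.2 this).symm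

/-- `2√-1 ∂∂̄u = dJdu` on a complex manifold. -/
lemma ddbarFun_projAll (hu : ContMDiff 𝓘(ℝ, E) 𝓘(ℝ, ℝ) ∞ u) (hI : SmoothEnd I)
    (hK : ∀ x X Y, dJd I u x (I x X) (I x Y) = dJd I u x X Y) (x : M) (X Y : Tan E x) :
    2 * Complex.I * ddbarFun I projAll u x X Y = (dJd I u x X Y : ℂ) := by
  have e : ∀ X Y, extD (dbarFun I projAll u) x X Y = -(Complex.I / 2) * (dJd I u x X Y : ℂ) :=
    fun X Y => by
    rw [extD_dbarFun (P := projAll) hu hI smoothEnd_id]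
    have e1 : extD (fun x => dfun u x ∘L projAll x) x X Y = 0 := extD_dfun hu x X Y
    have e2 : extD (fun x => dfun u x ∘L (I x ∘L projAll x)) x X Y = -dJd I u x X Y :=
      extD_dfun_comp_eq I x X Y
    rw [e1, e2]
    push_cast
    ring
  change 2 * Complex.I * ((extD (dbarFun I projAll u) x X Y
    + extD (dbarFun I projAll u) x (I x X) (I x Y)) / 2) = _
  rw [e, e, hK]
  linear_combination -(dJd I u x X Y : ℂ) * Complex.I_sq

end DDbar

/-! ### The Kähler case -/

section Kahler

variable [IsManifold 𝓘(ℝ, E) ∞ M] [FiniteDimensional ℝ E] [T2Space M]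

lemma smoothThreeForm_zero : SmoothThreeForm (0 : ThreeForm E M) := fun x => by
  have : coordThree (E := E) x (0 : ThreeForm E M) = fun _ => 0 := by funext y; ext; rfl
  rw [this]; exact contDiffOn_const

lemma IsKahler.isBihermitian {g : TwoTensor E M ℝ} {J : EndField E M} (h : IsKahler g J) :
    IsBihermitian g 0 J J := ⟨h.metric, isTwoForm_zero, h.hermitian, h.hermitian⟩

/-- As `g = -ω(J·,·)` with `ω` closed, `g` and `-g` arise from the zero tensor by adding `S(J·,·)`
with `S = -ω` and `S = ω`. -/
lemma IsKahler.inv {g : TwoTensor E M ℝ} {J : EndField E M} (h : IsKahler g J) :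
    Inv 0 (0 + g) J ∧ Inv 0 (0 - g) J := by
  have hs := h.hermitian.smooth
  have hsq := h.hermitian.sq
  have hn := h.integrable.nijZero hs hsq
  have hf : IsTwoForm (fundForm g J) := by
    refine ⟨h.metric.smooth.comp_left hs, fun x X Y => ?_⟩
    change g x (J x X) Y = -g x (J x Y) X
    rw [← h.hermitian.orth x (J x X), hsq, h.metric.symm x (J x Y), ← neg_apply, ← map_neg]
  have key : ∀ c : ℝ, ∀ x X Y, c * g x X Y = 0 + 0 + -c * fundForm g J x (J x X) Y :=
    fun c x X Y => by
    change _ = 0 + 0 + -c * g x (J x (J x X)) Y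
    rw [hsq, map_neg, neg_apply]; ring
  constructor
  · refine (Inv.zero hn).add isTwoForm_zero.smooth hs hsq isTwoForm_zero closed_zero (hf.smul (-1))
      (h.closed.smul (-1) hf.smooth) fun x X Y => ?_
    refine .trans ?_ (key 1 x X Y)
    change 0 + g x X Y = 1 * g x X Y
    ring
  · refine (Inv.zero hn).add isTwoForm_zero.smooth hs hsq isTwoForm_zero closed_zero (hf.smul (- -1))
      (h.closed.smul (- -1) hf.smooth) fun x X Y => ?_
    refine .trans ?_ (key (-1) x X Y)
    change 0 - g x X Y = -1 * g x X Y
    ring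

/-- The linear family with `I = J`. For `K` of type (1,1), `K(·,J·) = -K(J·,·)`: this is the
required splitting with `P = 0` and `S = -K`, and it makes the skew part of `K(J·,·)` zero, so `b`
remains zero. -/
theorem exists_canonicalDeformation_kahler (g : TwoTensor E M ℝ) (J : EndField E M) (u : M → ℝ)
    (h : IsKahler g J) (hu : ContMDiff 𝓘(ℝ, E) 𝓘(ℝ, ℝ) ∞ u)
    (hpos : ∀ x (X : Tan E x), X ≠ 0 → 0 < fundForm g J x X (J x X)
      + (2 * Complex.I * ddbarFun J projAll u x X (J x X)).re) :
    ∃ (𝕁₁ 𝕁₂ : ℝ → GEndField E M) (gt : ℝ → TwoTensor E M ℝ),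
      IsCanonicalDeformation 0 (Icc 0 1) 𝕁₁ 𝕁₂ (fun _ => dJd J u) ∧
      gt 0 = g ∧
      ∀ t ∈ Icc (0 : ℝ) 1,
        IsBihermitianData (𝕁₁ t) (𝕁₂ t) (gt t) 0 J J ∧
        fundForm (gt t) J = fundForm g J + t • dJd J u := by
  have hs := h.hermitian.smooth
  have hsq := h.hermitian.sq
  have hn := h.integrable.nijZero hs hsq
  have hK := isTwoForm_dJd hu hs
  have hKc := closed_dJd hu hs
  have hKJ := dJd_invariant hu hs hsq hn
  have kJ : ∀ x X Y, dJd J u x (J x X) Y = -dJd J u x X (J x Y) := fun x X Y => by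
    rw [← hKJ x X, hsq, map_neg, neg_neg]
  have F := h.isBihermitian.isBihermitianFamily_line h.inv.1 h.inv.2 (fun _ _ => rfl) hK hKc hKJ isTwoForm_zero
    closed_zero (hK.smul (-1)) (hKc.smul (-1) hK.smooth) (fun x X Y => by
      change dJd J u x X (J x Y) = 0 + -1 * dJd J u x (J x X) Y
      rw [kJ]; ring) (fun x X hX => by
      have := hpos x X hX
      rw [ddbarFun_projAll hu hs hKJ, Complex.ofReal_re] at this
      change 0 < g x (J x X) (J x X) + _ at this
      rw [h.hermitian.orth] at this
      rw [kJ]; linarith)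
  have hb : ∀ t, line 0 (skewPart (dJd J u) J) t = 0 := fun t => by
    funext x; ext X Y
    change 0 - t * skewPart (dJd J u) J x X Y = 0
    rw [skewPart_apply, kJ]; ring
  refine ⟨_, _, line g (symmPart (dJd J u) J), F.isCanonicalDeformation smoothThreeForm_zero,
    line_zero _ _, fun t ht => ⟨?_, ?_⟩⟩
  · have := (F.bihermitian t ht).isBihermitianData
    simp only [hb] at this ⊢
    exact this
  · funext x; ext X Y
    change line g (symmPart (dJd J u) J) t x (J x X) Y = g x (J x X) Y + t * dJd J u x X Y
    rw [line_apply, symmPart_apply, hsq, hKJ]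
    have : dJd J u x (-X) Y = -dJd J u x X Y := by rw [map_neg, neg_apply]
    rw [this]; ring

end Kahler

end

section

variable {E : Type*} [NormedAddCommGroup E] [NormedSpace ℝ E]
  {F : Type*} [NormedAddCommGroup F] [NormedSpace ℝ F]
  {M : Type*} [TopologicalSpace M] [ChartedSpace E M]

local notation "𝔠" => extChartAt 𝓘(ℝ, E)

/-! ### The commuting case -/

section Algebra

variable {V : Type*} [AddCommGroup V] [Module ℝ V] [TopologicalSpace V] [IsTopologicalAddGroup V]
  [ContinuousSMul ℝ V] {K P S : V →L[ℝ] V →L[ℝ] ℝ} {I J : V →L[ℝ] V}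

/-- The values of `K`, `P` and `S` on vectors where `I` and `J` agree. -/
lemma forms_eq_of_agree (hK : ∀ X Y, K X Y = -K Y X) (hP : ∀ X Y, P X Y = -P Y X)
    (hS : ∀ X Y, S X Y = -S Y X) (hKJ : ∀ X Y, K (J X) (J Y) = K X Y)
    (hSI : ∀ X Y, S (I X) (I Y) = S X Y) (hI : ∀ X, I (I X) = -X)
    (h : ∀ X Y, K X (I Y) = P X Y + S (J X) Y) {A B : V} (hA : J A = I A) (hB : J B = I B)
    (hIA : J (I A) = I (I A)) :
    P A B = 0 ∧ S A B = -K A B := by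
  have hJJ : ∀ {A : V}, J A = I A → J (I A) = I (I A) → J (J A) = -A := fun h1 h2 => by
    rw [h1, h2, hI]
  -- On such vectors `K(·,I·)` and `S(J·,·)` are both symmetric, whereas their difference `P` is
  -- skew.
  have key : ∀ A B : V, J A = I A → J (I A) = I (I A) → J B = I B → P A B = 0 :=
    fun A B hA hIA hB => by
    have e1 := h A B
    have e2 := h B A
    have e3 := hKJ A (I A)
    have k1 : K (I A) B = -K A (I B) := by
      have := hKJ (I A) B
      rw [hIA, hI, map_neg, neg_apply, hB] at this
      exact this.symm
    have s1 : S (I A) B = -S A (I B) := by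
      have := hSI (I A) B
      rw [hI, map_neg, neg_apply] at this
      exact this.symm
    rw [hA] at e1
    rw [hB] at e2
    have := hK B (I A)
    have := hS (I B) A
    have := hP B A
    linarith
  refine ⟨key A B hA hIA hB, ?_⟩
  have hIIA : J (I (I A)) = I (I (I A)) := by
    rw [hI, map_neg, map_neg, hA]
  have e1 := h (I A) B
  rw [key (I A) B hIA hIIA hB, hIA, hI, map_neg, neg_apply] at e1
  have k1 := hKJ A (I B)
  have k2 : K (I A) (I B) = K A B := by rw [← hA, ← hB, hKJ]
  linarith

/-- The computation of `2√-1 (∂₊∂̄₊ - ∂₋∂̄₋)u`. -/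
lemma ddbar_algebra (hK : ∀ X Y, K X Y = -K Y X) (hP : ∀ X Y, P X Y = -P Y X)
    (hS : ∀ X Y, S X Y = -S Y X) (hKJ : ∀ X Y, K (J X) (J Y) = K X Y)
    (hSI : ∀ X Y, S (I X) (I Y) = S X Y) (hI : ∀ X, I (I X) = -X) (hJ : ∀ X, J (J X) = -X)
    (hcomm : ∀ X, I (J X) = J (I X)) (h : ∀ X Y, K X (I Y) = P X Y + S (J X) Y)
    {p m : V →L[ℝ] V} (hp : ∀ X, p X = (1 / 2 : ℝ) • (X - I (J X)))
    (hm : ∀ X, m X = (1 / 2 : ℝ) • (X + I (J X))) (X Y : V) :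
    P (p X) (p Y) = 0 ∧ S (p X) (p Y) = -K (p X) (p Y) ∧ P (m X) (m Y) = 0 ∧
      S (m X) (m Y) = K (m X) (m Y) ∧
      K (p X) (p Y) + K (p (I X)) (p (I Y)) + K (m X) (m Y) + K (m (I X)) (m (I Y))
        = K X Y + K (I X) (I Y) := by
  have pJ : ∀ X, J (p X) = I (p X) := fun X => by
    rw [hp, map_smul, map_smul, map_sub, map_sub, ← hcomm, hJ, hI, map_neg]; congr 1; abel
  have mJ : ∀ X, J (m X) = -I (m X) := fun X => by
    rw [hm, map_smul, map_smul, map_add, map_add, ← hcomm, hJ, hI, map_neg, ← smul_neg]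
    congr 1; abel
  have pI : ∀ X, p (I X) = I (p X) := fun X => by
    rw [hp, hp, map_smul, map_sub, ← hcomm X]
  have mI : ∀ X, m (I X) = I (m X) := fun X => by
    rw [hm, hm, map_smul, map_add, ← hcomm X]
  have h1 := forms_eq_of_agree hK hP hS hKJ hSI hI h (pJ X) (pJ Y) (by rw [← pI, pJ])
  -- On the image of `m` one has `J = -I`; changing the signs of `K`, `P` and `J` preserves the
  -- relation `h` and reduces to the previous case.
  have h2 := forms_eq_of_agree (K := -K) (P := -P) (J := -J) (I := I) (S := S)
    (A := m X) (B := m Y) (fun X Y => by simpa [neg_eq_iff_eq_neg] using hK X Y)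
    (fun X Y => by simpa [neg_eq_iff_eq_neg] using hP X Y) hS
    (fun X Y => by simpa using hKJ X Y) hSI hI
    (fun X Y => by simp only [neg_apply, map_neg]; linarith [h X Y])
    (by rw [neg_apply, mJ, neg_neg]) (by rw [neg_apply, mJ, neg_neg])
    (by rw [neg_apply, ← mI, mJ, neg_neg])
  simp only [neg_apply, neg_neg, neg_eq_zero] at h2
  refine ⟨h1.1, h1.2, h2.1, h2.2, ?_⟩
  -- The off-diagonal blocks of `K` change sign under `I`, hence drop out of its (1,1)-part.
  have c1 : K (I (p X)) (I (m Y)) = -K (p X) (m Y) := by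
    have := hKJ (p X) (m Y)
    rw [pJ, mJ, map_neg] at this
    linarith
  have c2 : K (I (m X)) (I (p Y)) = -K (m X) (p Y) := by
    have := hKJ (m X) (p Y)
    rw [pJ, mJ, map_neg, neg_apply] at this
    linarith
  have s : ∀ X, X = p X + m X := fun X => by rw [hp, hm]; module
  have s' : ∀ X, I X = I (p X) + I (m X) := fun X => by rw [← map_add, ← s]
  rw [pI, pI, mI, mI]
  have e : K X Y = K (p X + m X) (p Y + m Y) := by rw [← s, ← s]
  have e' : K (I X) (I Y) = K (I (p X) + I (m X)) (I (p Y) + I (m Y)) := by rw [← s', ← s']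
  rw [e, e']
  simp only [map_add, add_apply]
  linarith

end Algebra

section Commuting

variable [IsManifold 𝓘(ℝ, E) ∞ M] [FiniteDimensional ℝ E] {g b : TwoTensor E M ℝ}
  {I J : EndField E M} {H : ThreeForm E M} {u : M → ℝ}

lemma SmoothEnd.smul (c : ℝ) {A : EndField E M} (hA : SmoothEnd A) :
    SmoothEnd (fun x => c • A x) := by
  rw [smoothEnd_iff] at *
  intro x
  have key : ∀ L B : E →L[ℝ] E, L.inverse ∘L (c • B) ∘L L = c • (L.inverse ∘L B ∘L L) :=
    fun L B => by ext; simp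
  have e : coordEnd x (fun x => c • A x) = fun y => c • coordEnd x A y :=
    funext fun y => key (chartInvDiff x y) (A ((𝔠 x).symm y))
  rw [e]
  exact (hA x).const_smul c

/-- For commuting `I` and `J`, the form `K = dJdu` satisfies `K(X, IY) = d(du ∘ Q)(X, Y)
+ d(du ∘ I)(JX, Y)`. -/
lemma IsBihermitian.dJd_comm (h : IsBihermitian g b I J) (hI : Inv H (b + g) I)
    (hJ : Inv H (b - g) J) (hcomm : ∀ x, I x ∘L J x = J x ∘L I x)
    (hu : ContMDiff 𝓘(ℝ, E) 𝓘(ℝ, ℝ) ∞ u) (x : M) (X Y : Tan E x) :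
    dJd J u x X (I x Y) = extD (fun x => dfun u x ∘L (fun x => -(I x ∘L J x)) x) x X Y
      + extD (fun x => dfun u x ∘L I x) x (J x X) Y := by
  have hIs := h.hermitian₁.smooth
  have hJs := h.hermitian₂.smooth
  have ec : (fun x => I x ∘L J x) = fun x => J x ∘L I x := funext hcomm
  have c : ∀ X, ptEnd x I (ptEnd x J X) = ptEnd x J (ptEnd x I X) := fun X => by
    rw [← ptEnd_comp, ← ptEnd_comp, ec]
  have c' : ∀ v X, jetEnd x I v (ptEnd x J X) + ptEnd x I (jetEnd x J v X)
      = jetEnd x J v (ptEnd x I X) + ptEnd x J (jetEnd x I v X) := fun v X => by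
    rw [← jetEnd_comp hIs hJs, ← jetEnd_comp hJs hIs, ec]
  have hac' : ∀ v X Y, jetTwo x (b + g) v X Y + jetTwo x (b - g) v Y X = 0 := fun v X Y => by
    have e1 : jetTwo x (b + g) = _ := jetTwo_add h.twoForm.smooth h.metric.smooth x
    have e2 : jetTwo x (b - g) = _ := jetTwo_sub h.twoForm.smooth h.metric.smooth x
    have e3 := jetTwo_swap h.twoForm.smooth (-1) (fun x X Y => by rw [h.twoForm.skew]; ring) x v X Y
    have e4 := jetTwo_swap h.metric.smooth 1 (fun x X Y => by rw [h.metric.symm]; ring) x v X Y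
    rw [e1, e2]
    simp only [add_apply, sub_apply]
    linarith
  have pos : ∀ X : E, coordTwo x (b + g) (𝔠 x x) X X = 0 → X = 0 := fun X e => by
    by_contra hX
    rw [coordTwo_self] at e
    have h1 := h.metric.pos x X hX
    have h2 := h.twoForm.skew x X X
    change b x X X + g x X X = 0 at e
    linarith
  have hm := (hI x).mixed (hJ x) (h.cross x _) hac' (h.complexJet_plus x) (h.complexJet_minus x)
    c pos
  have key := dComp_mixed (α := ptOne x (dfun u)) (jetOne_dfun_symm hu x) c c'
    (Q := ptEnd x (fun x => -(I x ∘L J x))) (Q' := jetEnd x (fun x => -(I x ∘L J x)))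
    (fun X => by rw [ptEnd_neg (fun x => I x ∘L J x), neg_apply, ptEnd_comp])
    (fun v X => by rw [jetEnd_neg (fun x => I x ∘L J x), neg_apply, neg_apply,
      jetEnd_comp hIs hJs]) hm X Y
  have eI : ptEnd x I Y = I x Y := DFunLike.congr_fun (coordEnd_self I x) Y
  have eJ : ptEnd x J X = J x X := DFunLike.congr_fun (coordEnd_self J x) X
  have k1 := dJd_apply hu hJs x X (I x Y)
  have k2 := extD_dfun_comp hu (hIs.comp hJs).neg x X Y
  have k3 := extD_dfun_comp hu hIs x (J x X) Y
  refine k1.trans (.trans ?_ (congrArg₂ (· + ·) k2 k3).symm)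
  rw [← eI, ← eJ] 
  exact key

variable (u) in
lemma extD_projPlus_aux (hI : SmoothEnd I) (hJ : SmoothEnd J) (hu : ContMDiff 𝓘(ℝ, E) 𝓘(ℝ, ℝ) ∞ u)
    (c : ℝ) (x : M) (X Y : Tan E x) :
    extD (fun x => dfun u x ∘L ((1 / 2 : ℝ) • (I x + c • J x))) x X Y
      = 1 / 2 * (extD (fun x => dfun u x ∘L I x) x X Y
        + c * extD (fun x => dfun u x ∘L J x) x X Y) := by
  have s1 := (smoothOneForm_dfun (E := E) hu).comp hI
  have s2 := (smoothOneForm_dfun (E := E) hu).comp hJ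
  have e : coordOne x (fun x => dfun u x ∘L ((1 / 2 : ℝ) • (I x + c • J x)))
      = fun y => (1 / 2 : ℝ) • (coordOne x (fun x => dfun u x ∘L I x) y
        + c • coordOne x (fun x => dfun u x ∘L J x) y) := by
    funext y
    ext v
    have key : ∀ (α : E →L[ℝ] ℝ) (A B : E →L[ℝ] E) (w : E),
        α (((1 / 2 : ℝ) • (A + c • B)) w) = (1 / 2 : ℝ) * (α (A w) + c * α (B w)) :=
      fun α A B w => by simp [mul_add]
    exact key _ _ _ _
  have hd := ((s1.differentiableAt (x := x)).hasFDerivAt.add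
    ((s2.differentiableAt (x := x)).hasFDerivAt.const_smul c)).const_smul (1 / 2 : ℝ)
  have hd' : ∀ v w : E, fderiv ℝ (coordOne x
      (fun x => dfun u x ∘L ((1 / 2 : ℝ) • (I x + c • J x)))) (𝔠 x x) v w
      = 1 / 2 * (jetOne x (fun x => dfun u x ∘L I x) v w
        + c * jetOne x (fun x => dfun u x ∘L J x) v w) := fun v w => by
    rw [e]
    exact congrArg (fun L : E →L[ℝ] E →L[ℝ] ℝ => L v w) hd.fderiv
  refine (extD_apply _ x X Y).trans ?_
  rw [extD_apply (fun x => dfun u x ∘L I x) x X Y, extD_apply (fun x => dfun u x ∘L J x) x X Y]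
  refine (congrArg₂ (· - ·) (hd' X Y) (hd' Y X)).trans ?_
  ring

/-- The operator applied to `u` is the (1,1)-part of `dJdu` with respect to `I`. Composing `I` with
the two projections gives `½(I ± J)`, so `d(∂̄±u)` is a combination of `P`, `S` and `K`. By
`ddbar_algebra`, `P` vanishes on both `T₊` and `T₋`, while `S` is `-K` on `T₊` and `K` on `T₋`. The
mixed blocks of `K` do not contribute. -/
lemma ddbarFun_sub (hI : SmoothEnd I) (hJ : SmoothEnd J) (hsI : ∀ x X, I x (I x X) = -X)
    (hsJ : ∀ x X, J x (J x X) = -X) (hu : ContMDiff 𝓘(ℝ, E) 𝓘(ℝ, ℝ) ∞ u)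
    (hcomm : ∀ x, I x ∘L J x = J x ∘L I x) (hnI : NijZero I) (hnJ : NijZero J)
    (hmix : ∀ (x : M) (X Y : Tan E x), dJd J u x X (I x Y)
      = extD (fun x => dfun u x ∘L (fun x => -(I x ∘L J x)) x) x X Y
      + extD (fun x => dfun u x ∘L I x) x (J x X) Y) (x : M) (X Y : Tan E x) :
    2 * Complex.I * (ddbarFun I (projPlus I J) u x X Y - ddbarFun I (projMinus I J) u x X Y)
      = ((1 / 2 * (dJd J u x X Y + dJd J u x (I x X) (I x Y)) : ℝ) : ℂ) := by
  obtain ⟨P, hP⟩ : ∃ P, P = extD (fun x => dfun u x ∘L (fun x => -(I x ∘L J x)) x) x := ⟨_, rfl⟩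
  obtain ⟨S, hS⟩ : ∃ S, S = extD (fun x => dfun u x ∘L I x) x := ⟨_, rfl⟩
  obtain ⟨K, hK⟩ : ∃ K, K = dJd J u x := ⟨_, rfl⟩
  have hIJ : ∀ X, I x (J x X) = J x (I x X) := fun X => DFunLike.congr_fun (hcomm x) X
  have hQ : SmoothEnd (fun x => I x ∘L J x) := hI.comp hJ
  have hPe : ∀ X Y, extD (fun x => dfun u x ∘L (fun x => I x ∘L J x) x) x X Y = -P X Y :=
    fun X Y => by
    have := extD_neg (fun x => dfun u x ∘L (fun x => I x ∘L J x) x) x X Y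
    have e : (fun x => -(dfun u x ∘L (fun x => I x ∘L J x) x))
        = (fun x => dfun u x ∘L (fun x => -(I x ∘L J x)) x) := by
      funext x; exact ((dfun u x).comp_neg (I x ∘L J x)).symm
    rw [e, ← hP] at this
    linarith
  have plus : projPlus I J = fun x => (1 / 2 : ℝ) • (projAll x + (-1 : ℝ) • (I x ∘L J x)) := by
    funext x; rw [projPlus, neg_one_smul, sub_eq_add_neg]; rfl
  have minus : projMinus I J = fun x => (1 / 2 : ℝ) • (projAll x + (1 : ℝ) • (I x ∘L J x)) := by
    funext x; rw [projMinus, one_smul]; rfl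
  have Iplus : (fun x => dfun u x ∘L (I x ∘L projPlus I J x))
      = fun x => dfun u x ∘L ((1 / 2 : ℝ) • (I x + (1 : ℝ) • J x)) := by
    funext x; ext V
    change dfun u x (I x ((1 / 2 : ℝ) • (V - I x (J x V)))) = dfun u x ((1 / 2 : ℝ) • (I x V + (1 : ℝ) • J x V))
    rw [map_smul (I x), map_sub (I x), hsI, sub_neg_eq_add, one_smul]
  have Iminus : (fun x => dfun u x ∘L (I x ∘L projMinus I J x))
      = fun x => dfun u x ∘L ((1 / 2 : ℝ) • (I x + (-1 : ℝ) • J x)) := by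
    funext x; ext V
    change dfun u x (I x ((1 / 2 : ℝ) • (V + I x (J x V)))) = dfun u x ((1 / 2 : ℝ) • (I x V + (-1 : ℝ) • J x V))
    rw [map_smul (I x), map_add (I x), hsI, neg_one_smul]
  have splus : SmoothEnd (projPlus I J) := (smoothEnd_id.sub hQ).smul _
  have sminus : SmoothEnd (projMinus I J) := (smoothEnd_id.add hQ).smul _
  have e0 : ∀ X Y, extD (fun x => dfun u x ∘L projAll x) x X Y = 0 := fun X Y => extD_dfun hu x X Y
  have d1 : ∀ X Y, extD (dbarFun I (projPlus I J) u) x X Y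
      = (1 / 2 : ℂ) * (((1 / 2 * P X Y : ℝ) : ℂ)
        + Complex.I * ((1 / 2 * (S X Y - K X Y) : ℝ) : ℂ)) := fun X Y => by
    rw [extD_dbarFun hu hI splus, Iplus, extD_projPlus_aux u hI hJ hu, plus,
      extD_projPlus_aux u (I := projAll) smoothEnd_id hQ hu, e0, hPe, extD_dfun_comp_eq J, hS, hK]
    push_cast; ring
  have d2 : ∀ X Y, extD (dbarFun I (projMinus I J) u) x X Y
      = (1 / 2 : ℂ) * (((-(1 / 2) * P X Y : ℝ) : ℂ)
        + Complex.I * ((1 / 2 * (S X Y + K X Y) : ℝ) : ℂ)) := fun X Y => by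
    rw [extD_dbarFun hu hI sminus, Iminus, extD_projPlus_aux u hI hJ hu, minus,
      extD_projPlus_aux u (I := projAll) smoothEnd_id hQ hu, e0, hPe, extD_dfun_comp_eq J, hS, hK]
    push_cast; ring
  have alg := fun X Y => ddbar_algebra (K := K) (P := P) (S := S) (I := I x) (J := J x)
    (fun X Y => by rw [hK]; exact extD_skew _ x X Y) (fun X Y => by rw [hP]; exact extD_skew _ x X Y)
    (fun X Y => by rw [hS]; exact extD_skew _ x X Y)
    (fun X Y => by rw [hK]; exact dJd_invariant hu hJ hsJ hnJ x X Y)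
    (fun X Y => by
      have := dJd_invariant hu hI hsI hnI x X Y
      rw [hS, extD_dfun_comp_eq, extD_dfun_comp_eq, this]) (hsI x) (hsJ x) hIJ
    (fun X Y => by rw [hK, hP, hS]; exact hmix x X Y) (p := projPlus I J x) (m := projMinus I J x)
    (fun _ => rfl) (fun _ => rfl) X Y
  obtain ⟨a1, a2, a3, a4, a5⟩ := alg X Y
  obtain ⟨b1, b2, b3, b4, -⟩ := alg (I x X) (I x Y)
  change 2 * Complex.I * ((extD (dbarFun I (projPlus I J) u) x (projPlus I J x X) (projPlus I J x Y)
    + extD (dbarFun I (projPlus I J) u) x (projPlus I J x (I x X)) (projPlus I J x (I x Y))) / 2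
    - (extD (dbarFun I (projMinus I J) u) x (projMinus I J x X) (projMinus I J x Y)
    + extD (dbarFun I (projMinus I J) u) x (projMinus I J x (I x X)) (projMinus I J x (I x Y))) / 2)
    = _
  rw [d1, d1, d2, d2, a1, a2, a3, a4, b1, b2, b3, b4, ← hK, ← a5]
  push_cast
  linear_combination (-(1 / 2 : ℂ)) * (K (projPlus I J x X) (projPlus I J x Y)
    + K (projPlus I J x (I x X)) (projPlus I J x (I x Y))
    + K (projMinus I J x X) (projMinus I J x Y)
    + K (projMinus I J x (I x X)) (projMinus I J x (I x Y))) * Complex.I_sq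

variable [T2Space M]

/-- The linear family, where `IsBihermitian.dJd_comm` supplies the closed forms `P = d(du ∘ Q)` and
`S = d(du ∘ I)`, and `ddbarFun_sub` translates both the positivity hypothesis and the formula for
the fundamental form. -/
theorem exists_canonicalDeformation_commuting (H : ThreeForm E M) (𝕁₁₀ 𝕁₂₀ : GEndField E M)
    (g b : TwoTensor E M ℝ) (I J : EndField E M) (u : M → ℝ) (hH : SmoothThreeForm H)
    (hK : IsGenKahler H 𝕁₁₀ 𝕁₂₀) (hB : IsBihermitianData 𝕁₁₀ 𝕁₂₀ g b I J)
    (hcomm : ∀ x, I x ∘L J x = J x ∘L I x) (hu : ContMDiff 𝓘(ℝ, E) 𝓘(ℝ, ℝ) ∞ u)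
    (hpos : ∀ x (X : Tan E x), X ≠ 0 → 0 < fundForm g I x X (I x X)
      + (2 * Complex.I * (ddbarFun I (projPlus I J) u x X (I x X)
        - ddbarFun I (projMinus I J) u x X (I x X))).re) :
    ∃ (𝕁₁ 𝕁₂ : ℝ → GEndField E M) (gt bt : ℝ → TwoTensor E M ℝ),
      IsCanonicalDeformation H (Icc 0 1) 𝕁₁ 𝕁₂ (fun _ => dJd J u) ∧
      𝕁₁ 0 = 𝕁₁₀ ∧ 𝕁₂ 0 = 𝕁₂₀ ∧ gt 0 = g ∧ bt 0 = b ∧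
      ∀ t ∈ Icc (0 : ℝ) 1,
        IsBihermitianData (𝕁₁ t) (𝕁₂ t) (gt t) (bt t) I J ∧
        ∀ x (X Y : Tan E x),
          (fundForm (gt t) I x X Y : ℂ) = (fundForm g I x X Y : ℂ)
            + t * (2 * Complex.I * (ddbarFun I (projPlus I J) u x X Y
                - ddbarFun I (projMinus I J) u x X Y)) := by
  obtain ⟨h1, h2, h3, h4, rfl, rfl⟩ := hB
  have h : IsBihermitian g b I J := ⟨h1, h2, h3, h4⟩
  obtain ⟨hI, hJ⟩ := h.inv_of_isGenKahler hK
  have mix := h.dJd_comm hI hJ hcomm hu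
  have hdd := ddbarFun_sub h3.smooth h4.smooth h3.sq h4.sq hu hcomm hI.nijZero hJ.nijZero mix
  have hKJ := dJd_invariant hu h4.smooth h4.sq hJ.nijZero
  have sQ := (smoothOneForm_dfun (E := E) hu).comp (h3.smooth.comp h4.smooth).neg
  have sI := (smoothOneForm_dfun (E := E) hu).comp h3.smooth
  have Fam := h.isBihermitianFamily_line hI hJ (fun x X => DFunLike.congr_fun (hcomm x) X)
    (isTwoForm_dJd hu h4.smooth) (closed_dJd hu h4.smooth) hKJ sQ.isTwoForm_extD sQ.closed_extD
    sI.isTwoForm_extD sI.closed_extD mix (fun x X hX => by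
      have := hpos x X hX
      rw [hdd, Complex.ofReal_re] at this
      change 0 < g x (I x X) (I x X) + _ at this
      have e := extD_skew (actOne J (dfun u)) x (I x X) X
      change dJd J u x (I x X) X = -dJd J u x X (I x X) at e
      rw [h3.orth, h3.sq, map_neg] at this
      linarith)
  refine ⟨_, _, line g (symmPart (dJd J u) I), line b (skewPart (dJd J u) I),
    Fam.isCanonicalDeformation hH, ?_, ?_, line_zero _ _, line_zero _ _, fun t ht =>
      ⟨(Fam.bihermitian t ht).isBihermitianData, fun x X Y => ?_⟩⟩
  · simp only [line_zero]
  · simp only [line_zero]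
  · rw [hdd]
    have e : fundForm (line g (symmPart (dJd J u) I) t) I x X Y
        = fundForm g I x X Y + t * (1 / 2 * (dJd J u x X Y + dJd J u x (I x X) (I x Y))) := by
      change line g (symmPart (dJd J u) I) t x (I x X) Y = g x (I x X) Y + _
      rw [line_apply, symmPart_apply, h3.sq, map_neg, neg_apply]
      ring
    rw [e]
    push_cast
    ring

end Commuting

end

section

variable {E : Type*} [NormedAddCommGroup E] [NormedSpace ℝ E]
  {F : Type*} [NormedAddCommGroup F] [NormedSpace ℝ F]
  {M : Type*} [TopologicalSpace M] [ChartedSpace E M]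

local notation "𝔠" => extChartAt 𝓘(ℝ, E)

/-! ### Pullback along families of maps of a vector space -/

section PullTwo

variable {L : F → E →L[ℝ] E} {B : F → E →L[ℝ] E →L[ℝ] ℝ} {L' : F →L[ℝ] E →L[ℝ] E}
  {B' : F →L[ℝ] E →L[ℝ] E →L[ℝ] ℝ} {p : F}

lemma hasFDerivAt_pullTwo (hL : HasFDerivAt L L' p) (hB : HasFDerivAt B B' p) :
    ∃ D : F →L[ℝ] E →L[ℝ] E →L[ℝ] ℝ, HasFDerivAt (fun q => pullTwo (L q) (B q)) D p ∧ ∀ u v w,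
      D u v w = B' u (L p v) (L p w) + B p (L' u v) (L p w) + B p (L p v) (L' u w) := by
  have h1 : HasFDerivAt (fun q => (compL ℝ E E ℝ).flip (L q)) ((compL ℝ E E ℝ).flip ∘L L') p :=
    (compL ℝ E E ℝ).flip.hasFDerivAt.comp p hL
  refine ⟨_, h1.clm_comp (hB.clm_comp hL), fun u v w => ?_⟩
  simp
  ring

lemma contDiffAt_pullTwo (hL : ContDiffAt ℝ ∞ L p) (hB : ContDiffAt ℝ ∞ B p) :
    ContDiffAt ℝ ∞ (fun q => pullTwo (L q) (B q)) p :=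
  ((compL ℝ E E ℝ).flip.contDiff.contDiffAt.comp p hL).clm_comp (hB.clm_comp hL)

end PullTwo

section Model

variable {f : E → E} {α : E → E →L[ℝ] E →L[ℝ] ℝ} {z : E}

lemma fderiv_pullTwo (hf : ContDiffAt ℝ ∞ f z) (hα : DifferentiableAt ℝ α (f z)) (u v w : E) :
    fderiv ℝ (fun y => pullTwo (fderiv ℝ f y) (α (f y))) z u v w
      = fderiv ℝ α (f z) (fderiv ℝ f z u) (fderiv ℝ f z v) (fderiv ℝ f z w)
        + α (f z) (fderiv ℝ (fderiv ℝ f) z u v) (fderiv ℝ f z w)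
        + α (f z) (fderiv ℝ f z v) (fderiv ℝ (fderiv ℝ f) z u w) := by
  have h1 : HasFDerivAt (fderiv ℝ f) (fderiv ℝ (fderiv ℝ f) z) z :=
    ((hf.fderiv_right (m := ∞) (by simp)).differentiableAt (by simp)).hasFDerivAt
  have h2 : HasFDerivAt (fun y => α (f y)) (fderiv ℝ α (f z) ∘L fderiv ℝ f z) z :=
    hα.hasFDerivAt.comp z (hf.differentiableAt (by simp)).hasFDerivAt
  obtain ⟨D, hD, e⟩ := hasFDerivAt_pullTwo h1 h2
  rw [hD.fderiv, e]
  rfl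

/-- Second derivatives of `f` cancel by their symmetry and the skewness of `α`; what remains is the
cyclic sum for `α` at the images of the vectors. -/
lemma cyclic_fderiv_pullTwo (hf : ContDiffAt ℝ ∞ f z) (hα : DifferentiableAt ℝ α (f z))
    (hs : ∀ v w, α (f z) v w = -α (f z) w v)
    (hc : ∀ a b c, fderiv ℝ α (f z) a b c + fderiv ℝ α (f z) b c a + fderiv ℝ α (f z) c a b = 0)
    (a b c : E) :
    fderiv ℝ (fun y => pullTwo (fderiv ℝ f y) (α (f y))) z a b c
      + fderiv ℝ (fun y => pullTwo (fderiv ℝ f y) (α (f y))) z b c a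
      + fderiv ℝ (fun y => pullTwo (fderiv ℝ f y) (α (f y))) z c a b = 0 := by
  have hsy : ∀ v w, fderiv ℝ (fderiv ℝ f) z v w = fderiv ℝ (fderiv ℝ f) z w v :=
    fun v w => hf.isSymmSndFDerivAt (by simpa using two_le_infty) v w
  simp only [fderiv_pullTwo hf hα]
  have := hc (fderiv ℝ f z a) (fderiv ℝ f z b) (fderiv ℝ f z c)
  rw [hsy b a, hsy c b, hsy c a, hs (fderiv ℝ f z b) (fderiv ℝ (fderiv ℝ f) z a c),
    hs (fderiv ℝ f z a) (fderiv ℝ (fderiv ℝ f) z b c), hs (fderiv ℝ f z c)]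
  linarith

variable {Φ : ℝ × E → E} {t : ℝ}

/-- The derivative of a family of maps in the space variable. -/
def spaceDeriv (Φ : ℝ × E → E) (q : ℝ × E) : E →L[ℝ] E := fderiv ℝ Φ q ∘L inr ℝ ℝ E

lemma fderiv_slice (hΦ : DifferentiableAt ℝ Φ (t, z)) :
    fderiv ℝ (fun y => Φ (t, y)) z = spaceDeriv Φ (t, z) := by
  have h : HasFDerivAt (fun y : E => (t, y)) (inr ℝ ℝ E) z := hasFDerivAt_prodMk_right t z
  exact (hΦ.hasFDerivAt.comp z h).fderiv

lemma contDiffAt_spaceDeriv {q : ℝ × E} (hΦ : ContDiffAt ℝ ∞ Φ q) :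
    ContDiffAt ℝ ∞ (spaceDeriv Φ) q :=
  (hΦ.fderiv_right (m := ∞) (by simp)).clm_comp contDiffAt_const

lemma eventually_differentiableAt {q : ℝ × E} (hΦ : ContDiffAt ℝ ∞ Φ q) :
    ∀ᶠ p in 𝓝 q, DifferentiableAt ℝ Φ p := by
  have := (hΦ.of_le (m := 1) (by simp)).eventually (by simp)
  filter_upwards [this] with p hp using hp.differentiableAt (by simp)

/-- The time derivative of the pullbacks of a two-tensor along a family of maps. -/
lemma hasDerivAt_pullTwo_family (hΦ : ContDiffAt ℝ ∞ Φ (t, z))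
    (hα : DifferentiableAt ℝ α (Φ (t, z))) :
    ∃ D, HasDerivAt (fun s => pullTwo (spaceDeriv Φ (s, z)) (α (Φ (s, z)))) D t ∧ ∀ v w,
      D v w = fderiv ℝ α (Φ (t, z)) (fderiv ℝ Φ (t, z) (1, 0)) (spaceDeriv Φ (t, z) v)
          (spaceDeriv Φ (t, z) w)
        + α (Φ (t, z)) (fderiv ℝ (fun y => fderiv ℝ Φ (t, y) (1, 0)) z v) (spaceDeriv Φ (t, z) w)
        + α (Φ (t, z)) (spaceDeriv Φ (t, z) v)
          (fderiv ℝ (fun y => fderiv ℝ Φ (t, y) (1, 0)) z w) := by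
  have h0 : HasFDerivAt (fderiv ℝ Φ) (fderiv ℝ (fderiv ℝ Φ) (t, z)) (t, z) :=
    ((hΦ.fderiv_right (m := ∞) (by simp)).differentiableAt (by simp)).hasFDerivAt
  have h1 : HasFDerivAt (spaceDeriv Φ) _ (t, z) :=
    h0.clm_comp (hasFDerivAt_const (inr ℝ ℝ E) (t, z))
  have h2 : HasFDerivAt (fun q => α (Φ q)) (fderiv ℝ α (Φ (t, z)) ∘L fderiv ℝ Φ (t, z)) (t, z) :=
    hα.hasFDerivAt.comp (t, z) (hΦ.differentiableAt (by simp)).hasFDerivAt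
  obtain ⟨D, hD, e⟩ := hasFDerivAt_pullTwo h1 h2
  have hc : HasDerivAt (fun s : ℝ => (s, z)) ((1 : ℝ), (0 : E)) t :=
    (hasDerivAt_id t).prodMk (hasDerivAt_const t z)
  -- Mixed partial derivatives commute, so the time derivative of `spaceDeriv` is the space
  -- derivative of the velocity.
  have hZ : ∀ v, fderiv ℝ (fun y => fderiv ℝ Φ (t, y) (1, 0)) z v
      = fderiv ℝ (fderiv ℝ Φ) (t, z) (1, 0) (0, v) := fun v => by
    have h3 : HasFDerivAt (fun y => fderiv ℝ Φ (t, y)) _ z :=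
      h0.comp z (hasFDerivAt_prodMk_right t z)
    rw [(h3.clm_apply (hasFDerivAt_const (𝕜 := ℝ) ((1 : ℝ), (0 : E)) z)).fderiv]
    have := hΦ.isSymmSndFDerivAt (by simpa using two_le_infty) (1, 0) (0, v)
    simp [this]
  have hDc := HasFDerivAt.comp_hasDerivAt (f := fun s : ℝ => (s, z)) t hD hc
  refine ⟨D (1, 0), hDc, fun v w => ?_⟩
  rw [e, hZ, hZ]
  simp

/-- The derivative in `t` of the pullbacks of a two-tensor along a family of maps that satisfies
`∂Φ/∂t = DΦ(V)` is the Lie derivative along `V` of the pullback. -/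
lemma hasDerivAt_pullTwo_source {V : E → E} (hΦ : ContDiffAt ℝ ∞ Φ (t, z))
    (hα : DifferentiableAt ℝ α (Φ (t, z))) (hV : DifferentiableAt ℝ V z)
    (hfl : ∀ᶠ y in 𝓝 z, fderiv ℝ Φ (t, y) (1, 0) = spaceDeriv Φ (t, y) (V y)) :
    ∃ D, HasDerivAt (fun s => pullTwo (spaceDeriv Φ (s, z)) (α (Φ (s, z)))) D t ∧ ∀ v w,
      D v w = fderiv ℝ (fun y => pullTwo (spaceDeriv Φ (t, y)) (α (Φ (t, y)))) z (V z) v w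
        + pullTwo (spaceDeriv Φ (t, z)) (α (Φ (t, z))) (fderiv ℝ V z v) w
        + pullTwo (spaceDeriv Φ (t, z)) (α (Φ (t, z))) v (fderiv ℝ V z w) := by
  obtain ⟨D, hD, e⟩ := hasDerivAt_pullTwo_family hΦ hα
  refine ⟨D, hD, fun v w => ?_⟩
  have hf : ContDiffAt ℝ ∞ (fun y => Φ (t, y)) z :=
    hΦ.comp z (contDiffAt_const.prodMk contDiffAt_id)
  have hsl : ∀ᶠ y in 𝓝 z, fderiv ℝ (fun y => Φ (t, y)) y = spaceDeriv Φ (t, y) := by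
    have hc : Continuous fun y : E => (t, y) := by fun_prop
    filter_upwards [hc.continuousAt.eventually (eventually_differentiableAt hΦ)] with y hy
    exact fderiv_slice hy
  have h1 : HasFDerivAt (fderiv ℝ fun y => Φ (t, y))
      (fderiv ℝ (fderiv ℝ fun y => Φ (t, y)) z) z :=
    ((hf.fderiv_right (m := ∞) (by simp)).differentiableAt (by simp)).hasFDerivAt
  -- The flow equation is differentiated in space; the term with two space derivatives becomes part
  -- of the derivative of the pullback along `V`.
  have hZ : ∀ v, fderiv ℝ (fun y => fderiv ℝ Φ (t, y) (1, 0)) z v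
      = fderiv ℝ (fderiv ℝ fun y => Φ (t, y)) z (V z) v + spaceDeriv Φ (t, z) (fderiv ℝ V z v) := by
    intro v
    have e1 : (fun y => fderiv ℝ Φ (t, y) (1, 0)) =ᶠ[𝓝 z]
        fun y => fderiv ℝ (fun y => Φ (t, y)) y (V y) := by
      filter_upwards [hfl, hsl] with y h h'
      rw [h, h']
    have hsy := hf.isSymmSndFDerivAt (by simpa using two_le_infty) v (V z)
    rw [e1.fderiv_eq, (h1.clm_apply hV.hasFDerivAt).fderiv, ← hsl.self_of_nhds]
    simp [add_comm, hsy]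
  have e2 : (fun y => pullTwo (spaceDeriv Φ (t, y)) (α (Φ (t, y)))) =ᶠ[𝓝 z]
      fun y => pullTwo (fderiv ℝ (fun y => Φ (t, y)) y) (α (Φ (t, y))) := by
    filter_upwards [hsl] with y h
    rw [h]
  rw [e, e2.fderiv_eq, fderiv_pullTwo (f := fun y => Φ (t, y)) hf hα, hZ, hZ,
    hfl.self_of_nhds, hsl.self_of_nhds]
  simp only [pullTwo_apply, map_add, add_apply]
  ring

/-- The derivative in `t` of the pullbacks of a two-tensor along a family of maps that satisfies
`∂Φ/∂t = -V ∘ Φ` is minus the pullback of the Lie derivative along `V`. -/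
lemma hasDerivAt_pullTwo_target {V : E → E} (hΦ : ContDiffAt ℝ ∞ Φ (t, z))
    (hα : DifferentiableAt ℝ α (Φ (t, z))) (hV : DifferentiableAt ℝ V (Φ (t, z)))
    (hfl : ∀ᶠ y in 𝓝 z, fderiv ℝ Φ (t, y) (1, 0) = -V (Φ (t, y)))
    (hL : ∀ v w, fderiv ℝ α (Φ (t, z)) (V (Φ (t, z))) v w
      + α (Φ (t, z)) (fderiv ℝ V (Φ (t, z)) v) w
      + α (Φ (t, z)) v (fderiv ℝ V (Φ (t, z)) w) = 0) :
    HasDerivAt (fun s => pullTwo (spaceDeriv Φ (s, z)) (α (Φ (s, z)))) 0 t := by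
  obtain ⟨D, hD, e⟩ := hasDerivAt_pullTwo_family hΦ hα
  refine hD.congr_deriv ?_
  ext v w
  have hf : DifferentiableAt ℝ (fun y => Φ (t, y)) z :=
    (hΦ.comp z (contDiffAt_const.prodMk contDiffAt_id)).differentiableAt (by simp)
  have hZ : ∀ v, fderiv ℝ (fun y => fderiv ℝ Φ (t, y) (1, 0)) z v
      = -fderiv ℝ V (Φ (t, z)) (spaceDeriv Φ (t, z) v) := fun v => by
    have e1 : HasFDerivAt (fun y => -V (Φ (t, y))) _ z :=
      (hV.hasFDerivAt.comp z hf.hasFDerivAt).neg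
    rw [Filter.EventuallyEq.fderiv_eq hfl, e1.fderiv, fderiv_slice (hΦ.differentiableAt (by simp))]
    rfl
  rw [e, hZ, hZ, hfl.self_of_nhds]
  have := hL (spaceDeriv Φ (t, z) v) (spaceDeriv Φ (t, z) w)
  simp only [map_neg, neg_apply, zero_apply]
  linarith

end Model

end

section

variable {E : Type*} [NormedAddCommGroup E] [NormedSpace ℝ E]
  {F : Type*} [NormedAddCommGroup F] [NormedSpace ℝ F]
  {M : Type*} [TopologicalSpace M] [ChartedSpace E M]

local notation "𝔠" => extChartAt 𝓘(ℝ, E)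

/-! ### Pullback of two-tensors along families of maps -/

/-- The pullback of a two-tensor by a map. -/
def pullForm (f : M → M) (W : TwoTensor E M ℝ) : TwoTensor E M ℝ := fun x =>
  precomp ℝ (mfderiv 𝓘(ℝ, E) 𝓘(ℝ, E) f x) ∘L W (f x) ∘L mfderiv 𝓘(ℝ, E) 𝓘(ℝ, E) f x

lemma pullForm_apply (f : M → M) (W : TwoTensor E M ℝ) (x : M) (X Y : Tan E x) :
    pullForm f W x X Y
      = W (f x) (mfderiv 𝓘(ℝ, E) 𝓘(ℝ, E) f x X) (mfderiv 𝓘(ℝ, E) 𝓘(ℝ, E) f x Y) := rfl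

/-- A family of maps in the charts at `x` and at `f t x`. -/
def famMap (f : ℝ → M → M) (t : ℝ) (x : M) (q : ℝ × E) : E := coordMap x (f t x) (f q.1) q.2

/-- Smoothness of a family of maps near `(t, x)`. -/
structure IsSmoothFamilyAt (E : Type*) [NormedAddCommGroup E] [NormedSpace ℝ E]
    {M : Type*} [TopologicalSpace M] [ChartedSpace E M] (f : ℝ → M → M) (t : ℝ) (x : M) :
    Prop where
  source : ∀ᶠ q in 𝓝 (t, extChartAt 𝓘(ℝ, E) x x), q.2 ∈ (extChartAt 𝓘(ℝ, E) x).target ∧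
    f q.1 ((extChartAt 𝓘(ℝ, E) x).symm q.2) ∈ (extChartAt 𝓘(ℝ, E) (f t x)).source
  smooth : ContDiffAt ℝ ∞ (famMap (E := E) f t x) (t, extChartAt 𝓘(ℝ, E) x x)

variable [IsManifold 𝓘(ℝ, E) ∞ M]

lemma coordTwo_pullForm {x y₀ : M} {f : M → M} {z : E} (hz : z ∈ (𝔠 x).target)
    (hf : ContMDiffAt 𝓘(ℝ, E) 𝓘(ℝ, E) ∞ f ((𝔠 x).symm z))
    (hy : f ((𝔠 x).symm z) ∈ (𝔠 y₀).source) (W : TwoTensor E M ℝ) :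
    coordTwo x (pullForm f W) z
      = pullTwo (fderiv ℝ (coordMap x y₀ f) z) (coordTwo y₀ W (coordMap x y₀ f z)) := by
  ext v w
  have e : (𝔠 y₀).symm (coordMap x y₀ f z) = f ((𝔠 x).symm z) := (𝔠 y₀).left_inv hy
  have key : ∀ p q : M, p = q → ∀ a b c d : E, a = c → b = d →
      (W p : E →L[ℝ] E →L[ℝ] ℝ) a b = (W q : E →L[ℝ] E →L[ℝ] ℝ) c d := by
    rintro p _ rfl a b _ _ rfl rfl; rfl
  exact key _ _ e.symm _ _ _ _ (mfderiv_comp_chartInvDiff hz hf hy v)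
    (mfderiv_comp_chartInvDiff hz hf hy w)

lemma isSmoothFamilyAt_of_contMDiffOn {f : ℝ → M → M} {𝒯 : Set ℝ} {t : ℝ} (h𝒯 : 𝒯 ∈ 𝓝 t)
    (h : ContMDiffOn (𝓘(ℝ, ℝ).prod 𝓘(ℝ, E)) 𝓘(ℝ, E) ∞ (fun p : ℝ × M => f p.1 p.2) (𝒯 ×ˢ univ))
    (x : M) : IsSmoothFamilyAt E f t x := by
  have hat : ContMDiffAt (𝓘(ℝ, ℝ).prod 𝓘(ℝ, E)) 𝓘(ℝ, E) ∞ (fun p : ℝ × M => f p.1 p.2) (t, x) :=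
    h.contMDiffAt (prod_mem_nhds h𝒯 Filter.univ_mem)
  have hs : ContMDiffAt 𝓘(ℝ, ℝ × E) 𝓘(ℝ, E) ∞ (fun q : ℝ × E => (𝔠 x).symm q.2) (t, 𝔠 x x) := by
    have h1 := contMDiffWithinAt_extChartAt_symm_range (n := ∞) (I := 𝓘(ℝ, E)) x
      (mem_extChartAt_target x)
    rw [ModelWithCorners.range_eq_univ, contMDiffWithinAt_univ] at h1
    exact ContMDiffAt.comp (g := (𝔠 x).symm) (t, 𝔠 x x) h1 contDiff_snd.contMDiff.contMDiffAt
  have hs2 : ContMDiffAt 𝓘(ℝ, ℝ × E) (𝓘(ℝ, ℝ).prod 𝓘(ℝ, E)) ∞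
      (fun q : ℝ × E => (q.1, (𝔠 x).symm q.2)) (t, 𝔠 x x) :=
    (contDiff_fst.contMDiff.contMDiffAt).prodMk hs
  have hx : (𝔠 x).symm (𝔠 x x) = x := symm_self x
  have hc : ContMDiffAt 𝓘(ℝ, ℝ × E) 𝓘(ℝ, E) ∞ (fun q : ℝ × E => f q.1 ((𝔠 x).symm q.2))
      (t, 𝔠 x x) := by
    refine ContMDiffAt.comp (g := fun p : ℝ × M => f p.1 p.2) (t, 𝔠 x x) ?_ hs2
    simpa only [hx] using hat
  constructor
  · have h1 : ∀ᶠ q : ℝ × E in 𝓝 (t, 𝔠 x x), q.2 ∈ (𝔠 x).target :=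
      continuousAt_snd.eventually_mem (target_mem_nhds (E := E) x)
    refine h1.and (hc.continuousAt.eventually_mem ?_)
    simpa only [hx] using (isOpen_extChartAt_source (f t x)).mem_nhds
      (mem_extChartAt_source (I := 𝓘(ℝ, E)) (f t x))
  · rw [← contMDiffAt_iff_contDiffAt]
    refine ContMDiffAt.comp (g := 𝔠 (f t x)) (t, 𝔠 x x) ?_ hc
    simpa only [hx] using contMDiffAt_extChartAt

section Family

variable {f : ℝ → M → M} {t : ℝ} {x : M} {W : TwoTensor E M ℝ} {X : VField E M}

lemma famMap_self : famMap f t x (t, 𝔠 x x) = 𝔠 (f t x) (f t x) := by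
  rw [famMap, coordMap, symm_self]

lemma IsSmoothFamilyAt.coordTwo_eventuallyEq (h : IsSmoothFamilyAt E f t x)
    (hf : ∀ s, ContMDiff 𝓘(ℝ, E) 𝓘(ℝ, E) ∞ (f s)) (W : TwoTensor E M ℝ) :
    (fun q : ℝ × E => coordTwo x (pullForm (f q.1) W) q.2) =ᶠ[𝓝 (t, 𝔠 x x)]
      fun q => pullTwo (spaceDeriv (famMap f t x) q) (coordTwo (f t x) W (famMap f t x q)) := by
  filter_upwards [h.source, eventually_differentiableAt h.smooth] with q hq hd
  rw [coordTwo_pullForm hq.1 (hf q.1).contMDiffAt hq.2, ← fderiv_slice (t := q.1) (z := q.2) hd]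
  rfl

lemma SmoothTwoTensor.contDiffAt_famMap (hW : SmoothTwoTensor W) (f : ℝ → M → M) (t : ℝ) (x : M) :
    ContDiffAt ℝ ∞ (coordTwo (f t x) W) (famMap f t x (t, 𝔠 x x)) := by
  rw [famMap_self]
  exact smoothTwoTensor_iff.1 hW (f t x)

lemma IsSmoothFamilyAt.contDiffAt_pullForm (h : IsSmoothFamilyAt E f t x)
    (hf : ∀ s, ContMDiff 𝓘(ℝ, E) 𝓘(ℝ, E) ∞ (f s)) (hW : SmoothTwoTensor W) :
    ContDiffAt ℝ ∞ (fun q : ℝ × E => coordTwo x (pullForm (f q.1) W) q.2) (t, 𝔠 x x) :=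
  (contDiffAt_pullTwo (contDiffAt_spaceDeriv h.smooth)
    ((hW.contDiffAt_famMap f t x).comp _ h.smooth)).congr_of_eventuallyEq
      (h.coordTwo_eventuallyEq hf W)

lemma IsSmoothFamilyAt.pullForm_eventuallyEq (h : IsSmoothFamilyAt E f t x)
    (hf : ∀ s, ContMDiff 𝓘(ℝ, E) 𝓘(ℝ, E) ∞ (f s)) (W : TwoTensor E M ℝ) :
    Filter.EventuallyEq (β := E →L[ℝ] E →L[ℝ] ℝ) (𝓝 t) (fun s => pullForm (f s) W x)
      fun s => pullTwo (spaceDeriv (famMap f t x) (s, 𝔠 x x))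
        (coordTwo (f t x) W (famMap f t x (s, 𝔠 x x))) := by
  have hc : ContinuousAt (fun s : ℝ => (s, 𝔠 x x)) t := by fun_prop
  filter_upwards [hc.eventually (h.coordTwo_eventuallyEq hf W)] with s hs
  exact (coordTwo_self _ x).symm.trans hs

lemma IsSmoothFamilyAt.fderiv_time (h : IsSmoothFamilyAt E f t x)
    {Z : M → E} (hZ : ∀ p, HasMFDerivAt 𝓘(ℝ, ℝ) 𝓘(ℝ, E) (fun s => f s p) t
      ((ContinuousLinearMap.id ℝ ℝ).smulRight (Z p : Tan E (f t p)))) :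
    ∀ᶠ y in 𝓝 (𝔠 x x), chartInvDiff (f t x) (famMap f t x (t, y))
      (fderiv ℝ (famMap f t x) (t, y) (1, 0)) = Z ((𝔠 x).symm y) := by
  have hc : ContinuousAt (fun y : E => (t, y)) (𝔠 x x) := by fun_prop
  filter_upwards [hc.eventually h.source, hc.eventually (eventually_differentiableAt h.smooth)]
    with y hy hd
  set p := (𝔠 x).symm y
  have h1 : HasMFDerivAt 𝓘(ℝ, E) 𝓘(ℝ, E) (𝔠 (f t x)) (f t p)
      (mfderiv 𝓘(ℝ, E) 𝓘(ℝ, E) (𝔠 (f t x)) (f t p)) :=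
    ((contMDiffAt_extChartAt' (n := ∞) (I := 𝓘(ℝ, E)) (by
      rw [← extChartAt_source 𝓘(ℝ, E)]; exact hy.2)).mdifferentiableAt (by simp)).hasMFDerivAt
  have h2 := (h1.comp t (hZ p)).hasFDerivAt
  have h3 : HasFDerivAt (fun s : ℝ => famMap f t x (s, y))
      (fderiv ℝ (famMap f t x) (t, y) ∘L inl ℝ ℝ E) t :=
    HasFDerivAt.comp (f := fun s : ℝ => (s, y)) t hd.hasFDerivAt (hasFDerivAt_prodMk_left t y)
  have h4 := DFunLike.congr_fun (h3.unique h2) 1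
  have h5 : fderiv ℝ (famMap f t x) (t, y) (1, 0)
      = mfderiv 𝓘(ℝ, E) 𝓘(ℝ, E) (𝔠 (f t x)) (f t p) (Z p) := by
    refine Eq.trans ?_ (h4.trans ?_)
    · simp
    · change mfderiv 𝓘(ℝ, E) 𝓘(ℝ, E) (𝔠 (f t x)) (f t p) ((1 : ℝ) • Z p) = _
      rw [one_smul]
  have h6 := mfderivWithin_extChartAt_symm_comp_mfderiv_extChartAt' (I := 𝓘(ℝ, E)) hy.2
  rw [ModelWithCorners.range_eq_univ, mfderivWithin_univ] at h6
  exact (congrArg (chartInvDiff (f t x) (famMap f t x (t, y))) h5).trans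
    (DFunLike.congr_fun h6 (Z p))

/-- The flow equation is needed on a neighbourhood and not just at the centre, because the Lie
derivative requires differentiating it in space. -/
lemma IsSmoothFamilyAt.flow_source (h : IsSmoothFamilyAt E f t x)
    (hf : ContMDiff 𝓘(ℝ, E) 𝓘(ℝ, E) ∞ (f t))
    (hX : ∀ p, HasMFDerivAt 𝓘(ℝ, ℝ) 𝓘(ℝ, E) (fun s => f s p) t
      ((ContinuousLinearMap.id ℝ ℝ).smulRight (mfderiv 𝓘(ℝ, E) 𝓘(ℝ, E) (f t) p (X p)))) :
    ∀ᶠ y in 𝓝 (𝔠 x x), fderiv ℝ (famMap f t x) (t, y) (1, 0)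
      = spaceDeriv (famMap f t x) (t, y) (coordV x X y) := by
  have hc : ContinuousAt (fun y : E => (t, y)) (𝔠 x x) := by fun_prop
  filter_upwards [hc.eventually h.source, hc.eventually (eventually_differentiableAt h.smooth),
    h.fderiv_time (Z := fun p => mfderiv 𝓘(ℝ, E) 𝓘(ℝ, E) (f t) p (X p)) hX] with y hy hd ht
  have hw : famMap f t x (t, y) ∈ (𝔠 (f t x)).target := (𝔠 (f t x)).map_source hy.2
  have hL : (chartInvDiff (f t x) (famMap f t x (t, y))).IsInvertible := chartInvDiff_isInvertible hw
  have h1 := mfderiv_comp_chartInvDiff hy.1 hf.contMDiffAt hy.2 (coordV x X y)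
  have h2 : chartInvDiff x y (coordV x X y) = X ((𝔠 x).symm y) :=
    (chartInvDiff_isInvertible hy.1).self_apply_inverse _
  rw [h2] at h1
  refine hL.injective (ht.trans (h1.trans ?_))
  refine congrArg (chartInvDiff (f t x) (famMap f t x (t, y))) ?_
  exact DFunLike.congr_fun (fderiv_slice hd) _

/-- Cartan's formula for the Lie derivative of a closed two-form. -/
lemma lie_eq_extD {β : TwoTensor E M ℝ} (hβ : IsTwoForm β) (hc : Closed₂ β) (hX : SmoothVField X)
    (x : M) (v w : E) :
    jetTwo x β (coordV x X (𝔠 x x)) v w + ptTwo x β (fderiv ℝ (coordV x X) (𝔠 x x) v) w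
      + ptTwo x β v (fderiv ℝ (coordV x X) (𝔠 x x) w)
      = (extD (fun x => β x (X x)) x : E →L[ℝ] E →L[ℝ] ℝ) v w := by
  have hd : ∀ a b, fderiv ℝ (coordOne x fun x => β x (X x)) (𝔠 x x) a b
      = jetTwo x β a (coordV x X (𝔠 x x)) b
        + ptTwo x β (fderiv ℝ (coordV x X) (𝔠 x x) a) b := fun a b => by
    have e : coordOne x (fun x => β x (X x)) =ᶠ[𝓝 (𝔠 x x)]
        fun y => coordTwo x β y (coordV x X y) :=
      eventually_target fun y hy => coordOne_two hy β X
    rw [e.fderiv_eq, (hβ.smooth.differentiableAt.hasFDerivAt.clm_apply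
      hX.differentiableAt.hasFDerivAt).fderiv]
    simp only [add_apply, ContinuousLinearMap.comp_apply, flip_apply]
    ring
  refine Eq.trans ?_ (extD_apply _ x v w).symm
  rw [hd, hd]
  have hj := hβ.closedJet hc x
  have h1 := hj.skew v (fderiv ℝ (coordV x X) (𝔠 x x) w)
  have h2 := hj.skew' v w (coordV x X (𝔠 x x))
  have h3 := hc x (coordV x X (𝔠 x x)) v w
  simp only [ptTwo, jetTwo] at *
  linarith

/-- `∂(f_t^* W)/∂t = d(i_X f_t^* W)` if `∂f_t/∂t = df_t(X)` and `f_t^* W` is closed. -/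
theorem IsSmoothFamilyAt.hasDerivAt_pullForm_source (h : IsSmoothFamilyAt E f t x)
    (hf : ∀ s, ContMDiff 𝓘(ℝ, E) 𝓘(ℝ, E) ∞ (f s)) (hW : SmoothTwoTensor W) (hX : SmoothVField X)
    (hβ : IsTwoForm (pullForm (f t) W)) (hc : Closed₂ (pullForm (f t) W))
    (hfl : ∀ p, HasMFDerivAt 𝓘(ℝ, ℝ) 𝓘(ℝ, E) (fun s => f s p) t
      ((ContinuousLinearMap.id ℝ ℝ).smulRight (mfderiv 𝓘(ℝ, E) 𝓘(ℝ, E) (f t) p (X p)))) :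
    HasDerivAt (F := E →L[ℝ] E →L[ℝ] ℝ) (fun s => pullForm (f s) W x)
      (extD (fun x => pullForm (f t) W x (X x)) x) t := by
  obtain ⟨D, hD, e⟩ := hasDerivAt_pullTwo_source h.smooth
    ((hW.contDiffAt_famMap f t x).differentiableAt (by simp)) hX.differentiableAt
    (h.flow_source (hf t) hfl)
  have hc' : ContinuousAt (fun y : E => (t, y)) (𝔠 x x) := by fun_prop
  have e1 : coordTwo x (pullForm (f t) W) =ᶠ[𝓝 (𝔠 x x)] fun y =>
      pullTwo (spaceDeriv (famMap f t x) (t, y)) (coordTwo (f t x) W (famMap f t x (t, y))) :=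
    hc'.eventually (h.coordTwo_eventuallyEq hf W)
  have e2 : pullTwo (spaceDeriv (famMap f t x) (t, 𝔠 x x))
      (coordTwo (f t x) W (famMap f t x (t, 𝔠 x x))) = coordTwo x (pullForm (f t) W) (𝔠 x x) :=
    e1.self_of_nhds.symm
  have hD' : D = (extD (fun x => pullForm (f t) W x (X x)) x : E →L[ℝ] E →L[ℝ] ℝ) := by
    ext v w
    refine Eq.trans ?_ (lie_eq_extD hβ hc hX x v w)
    rw [e, ← e1.fderiv_eq, e2]
  rw [← hD']
  exact hD.congr_of_eventuallyEq (h.pullForm_eventuallyEq hf W)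

/-- `∂(f_t^* W)/∂t = 0` if `∂f_t/∂t = -X ∘ f_t`, `W` is closed and `d(i_X W) = 0`. -/
theorem IsSmoothFamilyAt.hasDerivAt_pullForm_target (h : IsSmoothFamilyAt E f t x)
    (hf : ∀ s, ContMDiff 𝓘(ℝ, E) 𝓘(ℝ, E) ∞ (f s)) (hW : IsTwoForm W) (hc : Closed₂ W)
    (hX : SmoothVField X) (hXW : extD (fun x => W x (X x)) = 0)
    (hfl : ∀ᶠ y in 𝓝 (𝔠 x x), fderiv ℝ (famMap f t x) (t, y) (1, 0)
      = -coordV (f t x) X (famMap f t x (t, y))) :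
    HasDerivAt (F := E →L[ℝ] E →L[ℝ] ℝ) (fun s => pullForm (f s) W x) 0 t := by
  have hs := famMap_self (E := E) (f := f) (t := t) (x := x)
  refine (hasDerivAt_pullTwo_target (V := coordV (f t x) X) h.smooth
    ((hW.smooth.contDiffAt_famMap f t x).differentiableAt (by simp)) ?_ hfl
    fun v w => ?_).congr_of_eventuallyEq (h.pullForm_eventuallyEq hf W)
  · rw [hs]; exact hX.differentiableAt
  · rw [hs]
    refine (lie_eq_extD hW hc hX (f t x) v w).trans ?_
    rw [hXW]; rfl

end Family

end

section

variable {E : Type*} [NormedAddCommGroup E] [NormedSpace ℝ E]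
  {F : Type*} [NormedAddCommGroup F] [NormedSpace ℝ F]
  {M : Type*} [TopologicalSpace M] [ChartedSpace E M]

local notation "𝔠" => extChartAt 𝓘(ℝ, E)

/-! ### The inverse family -/

section InverseModel

variable [CompleteSpace E] {Φ Ψ : ℝ × E → E} {t : ℝ} {z : E} {V : E → E}

/-- The inverse function theorem with a parameter. -/
lemma exists_inverse_family (hΦ : ContDiffAt ℝ ∞ Φ (t, z))
    (hi : (spaceDeriv Φ (t, z)).IsInvertible) :
    ∃ Ψ : ℝ × E → E, ContDiffAt ℝ ∞ Ψ (t, Φ (t, z)) ∧ Ψ (t, Φ (t, z)) = z ∧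
      ∀ᶠ q in 𝓝 (t, Φ (t, z)), Φ (q.1, Ψ q) = q.2 := by
  obtain ⟨e, he⟩ := hi
  -- Adjoining the parameter as a coordinate gives a map with block triangular, hence invertible,
  -- derivative, to which the usual inverse function theorem applies.
  set G : ℝ × E → ℝ × E := fun q => (q.1, Φ q)
  have hG : ContDiffAt ℝ ∞ G (t, z) := contDiffAt_fst.prodMk hΦ
  have hG' : HasFDerivAt G
      (((ContinuousLinearEquiv.refl ℝ ℝ).skewProd e (fderiv ℝ Φ (t, z) ∘L inl ℝ ℝ E) :
        (ℝ × E) ≃L[ℝ] ℝ × E) : ℝ × E →L[ℝ] ℝ × E) (t, z) := by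
    refine (hasFDerivAt_fst.prodMk (hΦ.differentiableAt (by simp)).hasFDerivAt).congr_fderiv ?_
    have hd : ∀ v : E, e v = fderiv ℝ Φ (t, z) (0, v) := fun v => DFunLike.congr_fun he v
    ext v
    · simp
    · simp
    · simp [show ((0 : ℝ), (0 : E)) = 0 from rfl]
    · simp [hd, show ((0 : ℝ), (0 : E)) = 0 from rfl]
  have hn : (∞ : WithTop ℕ∞) ≠ 0 := by simp
  have h1 := hG.to_localInverse hG' hn
  have h2 : hG.localInverse hG' hn (t, Φ (t, z)) = (t, z) := hG.localInverse_apply_image hG' hn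
  have h3 : ∀ᶠ q in 𝓝 (t, Φ (t, z)), G (hG.localInverse hG' hn q) = q :=
    (hG.hasStrictFDerivAt' hG' hn).eventually_right_inverse
  refine ⟨fun q => (hG.localInverse hG' hn q).2, contDiffAt_snd.comp _ h1, by simp only [h2], ?_⟩
  filter_upwards [h3] with q hq
  have e1 : (G (hG.localInverse hG' hn q)).1 = q.1 := by rw [hq]
  have e2 : (G (hG.localInverse hG' hn q)).2 = q.2 := by rw [hq]
  rw [← e1]
  exact e2

/-- Differentiating `Φ(t, Ψ(t,w)) = w` in `t` gives `DΦ(V) + DΦ(∂Ψ/∂t) = 0` at `Ψ(t,w)`, and `DΦ` is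
injective there. -/
lemma inverse_family_flow (hΦ : ContDiffAt ℝ ∞ Φ (t, z))
    (hi : (spaceDeriv Φ (t, z)).IsInvertible) (hΨ : ContDiffAt ℝ ∞ Ψ (t, Φ (t, z)))
    (hz : Ψ (t, Φ (t, z)) = z) (hinv : ∀ᶠ q in 𝓝 (t, Φ (t, z)), Φ (q.1, Ψ q) = q.2)
    (hfl : ∀ᶠ y in 𝓝 z, fderiv ℝ Φ (t, y) (1, 0) = spaceDeriv Φ (t, y) (V y)) :
    ∀ᶠ w in 𝓝 (Φ (t, z)), fderiv ℝ Ψ (t, w) (1, 0) = -V (Ψ (t, w)) := by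
  have hc : ContinuousAt (fun w : E => (t, w)) (Φ (t, z)) := by fun_prop
  have hc2 : ContinuousAt (fun y : E => (t, y)) z := by fun_prop
  have hΨc : ContinuousAt (fun w : E => Ψ (t, w)) (Φ (t, z)) :=
    ContinuousAt.comp (g := Ψ) hΨ.continuousAt hc
  have hinj : ∀ᶠ y in 𝓝 z, (spaceDeriv Φ (t, y)).IsInvertible := by
    have hcs : ContinuousAt (fun y => spaceDeriv Φ (t, y)) z :=
      ContinuousAt.comp (g := spaceDeriv Φ) (contDiffAt_spaceDeriv hΦ).continuousAt hc2
    obtain ⟨e, he⟩ := hi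
    have := ContinuousLinearEquiv.nhds e
    rw [he] at this
    exact hcs this
  have hall := hfl.and (hinj.and (hc2.eventually (eventually_differentiableAt hΦ)))
  rw [← hz] at hall
  filter_upwards [hc.eventually hinv.eventually_nhds,
    hc.eventually (eventually_differentiableAt hΨ), hΨc.eventually hall] with w h1 h2 h3
  obtain ⟨h3, h4, h5⟩ := h3
  have e1 : HasFDerivAt (fun q : ℝ × E => Φ (q.1, Ψ q))
      (fderiv ℝ Φ (t, Ψ (t, w)) ∘L (fst ℝ ℝ E).prod (fderiv ℝ Ψ (t, w))) (t, w) :=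
    HasFDerivAt.comp (f := fun q : ℝ × E => (q.1, Ψ q)) (t, w) h5.hasFDerivAt
      (hasFDerivAt_fst.prodMk h2.hasFDerivAt)
  have e2 : HasFDerivAt (fun q : ℝ × E => Φ (q.1, Ψ q)) (snd ℝ ℝ E) (t, w) :=
    hasFDerivAt_snd.congr_of_eventuallyEq h1
  have e3 : fderiv ℝ Φ (t, Ψ (t, w)) (1, fderiv ℝ Ψ (t, w) (1, 0)) = 0 :=
    DFunLike.congr_fun (e1.unique e2) (1, 0)
  have e4 : ((1 : ℝ), fderiv ℝ Ψ (t, w) (1, 0)) = (1, 0) + (0, fderiv ℝ Ψ (t, w) (1, 0)) := by simp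
  rw [e4, map_add, h3] at e3
  refine eq_neg_of_add_eq_zero_right (h4.injective ?_)
  rw [map_add, map_zero]
  exact e3

end InverseModel

variable [IsManifold 𝓘(ℝ, E) ∞ M] {f g : ℝ → M → M} {t : ℝ} {x : M} {X : VField E M}

lemma IsSmoothFamilyAt.isInvertible (h : IsSmoothFamilyAt E f t x)
    (hf : ContMDiff 𝓘(ℝ, E) 𝓘(ℝ, E) ∞ (f t))
    (hi : (mfderiv 𝓘(ℝ, E) 𝓘(ℝ, E) (f t) x).IsInvertible) :
    (spaceDeriv (famMap f t x) (t, 𝔠 x x)).IsInvertible := by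
  have hs := symm_self (E := E) x
  have e : ∀ v : E, (mfderiv 𝓘(ℝ, E) 𝓘(ℝ, E) (f t) x : E →L[ℝ] E) v
      = spaceDeriv (famMap f t x) (t, 𝔠 x x) v := fun v => by
    have h1 := mfderiv_comp_chartInvDiff (y₀ := f t x) (mem_extChartAt_target x)
      hf.contMDiffAt h.source.self_of_nhds.2 v
    have h2 : coordMap x (f t x) (f t) (𝔠 x x) = 𝔠 (f t x) (f t x) := by rw [coordMap, hs]
    have key : ∀ p : M, p = x → ∀ L : E →L[ℝ] E, L = ContinuousLinearMap.id ℝ E →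
        (mfderiv 𝓘(ℝ, E) 𝓘(ℝ, E) (f t) p (L v) : E)
          = (mfderiv 𝓘(ℝ, E) 𝓘(ℝ, E) (f t) x v : E) := by rintro p rfl L rfl; rfl
    have key2 : ∀ w : E, w = 𝔠 (f t x) (f t x) → ∀ v : E,
        (chartInvDiff (f t x) w v : E) = v := by
      rintro w rfl v
      exact DFunLike.congr_fun (chartInvDiff_self (E := E) (f t x)) v
    refine (key _ hs _ (chartInvDiff_self (E := E) x)).symm.trans (h1.trans ((key2 _ h2 _).trans ?_))
    exact DFunLike.congr_fun (fderiv_slice (Φ := famMap f t x) (h.smooth.differentiableAt (by simp))) v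
  have e' : (mfderiv 𝓘(ℝ, E) 𝓘(ℝ, E) (f t) x : E →L[ℝ] E)
      = spaceDeriv (famMap f t x) (t, 𝔠 x x) := ContinuousLinearMap.ext e
  rw [← e']
  exact hi

/-- The inverses of a smooth family of diffeomorphisms. -/
theorem IsSmoothFamilyAt.inverse [CompleteSpace E] (h : IsSmoothFamilyAt E f t x)
    (hf : ContMDiff 𝓘(ℝ, E) 𝓘(ℝ, E) ∞ (f t))
    (hi : (mfderiv 𝓘(ℝ, E) 𝓘(ℝ, E) (f t) x).IsInvertible)
    (hg : ∀ s p, g s (f s p) = p)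
    (hfl : ∀ᶠ y in 𝓝 (𝔠 x x), fderiv ℝ (famMap f t x) (t, y) (1, 0)
      = spaceDeriv (famMap f t x) (t, y) (coordV x X y)) :
    IsSmoothFamilyAt E g t (f t x) ∧
      ∀ᶠ w in 𝓝 (𝔠 (f t x) (f t x)), fderiv ℝ (famMap g t (f t x)) (t, w) (1, 0)
        = -coordV (g t (f t x)) X (famMap g t (f t x) (t, w)) := by
  have hs := famMap_self (E := E) (f := f) (t := t) (x := x)
  have hii := h.isInvertible hf hi
  obtain ⟨Ψ, h1, h2, h3⟩ := exists_inverse_family h.smooth hii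
  have h4 := inverse_family_flow h.smooth hii h1 h2 h3 hfl
  rw [hs] at h1 h2 h3 h4
  have hΨ : ContinuousAt (fun q : ℝ × E => (q.1, Ψ q)) (t, 𝔠 (f t x) (f t x)) :=
    continuousAt_fst.prodMk h1.continuousAt
  have h5 := h.source
  have hgt := hg t x
  rw [← h2] at h5
  -- In charts the given inverse `g` coincides with the local inverse `Ψ`, so it inherits smoothness
  -- and the flow equation.
  have h6 : ∀ᶠ q : ℝ × E in 𝓝 (t, 𝔠 (f t x) (f t x)), q.2 ∈ (𝔠 (f t x)).target ∧
      g q.1 ((𝔠 (f t x)).symm q.2) = (𝔠 x).symm (Ψ q) ∧ Ψ q ∈ (𝔠 x).target := by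
    have ht : ∀ᶠ q : ℝ × E in 𝓝 (t, 𝔠 (f t x) (f t x)), q.2 ∈ (𝔠 (f t x)).target :=
      continuousAt_snd.eventually_mem (target_mem_nhds (E := E) (f t x))
    filter_upwards [ht, h3, hΨ.eventually h5] with q hq e1 e2
    refine ⟨hq, ?_, e2.1⟩
    have e3 : f q.1 ((𝔠 x).symm (Ψ q)) = (𝔠 (f t x)).symm q.2 := by
      rw [← e1]
      exact ((𝔠 (f t x)).left_inv e2.2).symm
    rw [← e3, hg]
  have h7 : famMap (E := E) g t (f t x) =ᶠ[𝓝 (t, 𝔠 (f t x) (f t x))] Ψ := by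
    filter_upwards [h6] with q hq
    rw [famMap, coordMap, hq.2.1, hgt]
    exact (𝔠 x).right_inv hq.2.2
  refine ⟨⟨?_, h1.congr_of_eventuallyEq h7⟩, ?_⟩
  · filter_upwards [h6] with q hq
    refine ⟨hq.1, ?_⟩
    rw [hq.2.1, hgt]
    exact (𝔠 x).map_target hq.2.2
  · have hc : ContinuousAt (fun w : E => (t, w)) (𝔠 (f t x) (f t x)) := by fun_prop
    filter_upwards [h4, hc.eventually h7.eventually_nhds] with w e1 e2
    have e3 : famMap (E := E) g t (f t x) (t, w) = Ψ (t, w) := e2.self_of_nhds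
    rw [Filter.EventuallyEq.fderiv_eq e2, e1, e3, hgt]

end

section

variable {E : Type*} [NormedAddCommGroup E] [NormedSpace ℝ E]
  {F : Type*} [NormedAddCommGroup F] [NormedSpace ℝ F]
  {M : Type*} [TopologicalSpace M] [ChartedSpace E M]

local notation "𝔠" => extChartAt 𝓘(ℝ, E)

/-! ### Isotopies generated by vector fields -/

lemma pullForm_id (W : TwoTensor E M ℝ) : pullForm id W = W := by
  funext x
  ext X Y
  rw [pullForm_apply, mfderiv_id]
  rfl

variable [IsManifold 𝓘(ℝ, E) ∞ M]

lemma pullForm_pullForm {f g : M → M} (hf : ContMDiff 𝓘(ℝ, E) 𝓘(ℝ, E) ∞ f)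
    (hg : ContMDiff 𝓘(ℝ, E) 𝓘(ℝ, E) ∞ g) (W : TwoTensor E M ℝ) :
    pullForm f (pullForm g W) = pullForm (g ∘ f) W := by
  funext x
  ext X Y
  have h := mfderiv_comp x (hg.contMDiffAt.mdifferentiableAt (x := f x) (by simp))
    (hf.contMDiffAt.mdifferentiableAt (by simp))
  rw [pullForm_apply, pullForm_apply, pullForm_apply, h]
  rfl

section Closed

variable {f : M → M} {W : TwoTensor E M ℝ}

lemma coordTwo_pullForm_eventuallyEq (hf : ContMDiff 𝓘(ℝ, E) 𝓘(ℝ, E) ∞ f) (W : TwoTensor E M ℝ)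
    (x : M) : coordTwo x (pullForm f W) =ᶠ[𝓝 (𝔠 x x)] fun z =>
      pullTwo (fderiv ℝ (coordMap x (f x) f) z) (coordTwo (f x) W (coordMap x (f x) f z)) := by
  have hc : ContinuousAt (fun z => f ((𝔠 x).symm z)) (𝔠 x x) := by
    refine ContinuousAt.comp hf.continuous.continuousAt ?_
    exact (mdifferentiableAt_symm (mem_extChartAt_target x)).continuousAt
  have hm : f ((𝔠 x).symm (𝔠 x x)) ∈ (𝔠 (f x)).source := by
    rw [symm_self]; exact mem_extChartAt_source (f x)
  filter_upwards [target_mem_nhds (E := E) x,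
    hc.eventually_mem ((isOpen_extChartAt_source (f x)).mem_nhds hm)] with z h1 h2
  exact coordTwo_pullForm h1 hf.contMDiffAt h2 W

lemma coordMap_self (f : M → M) (x : M) : coordMap x (f x) f (𝔠 x x) = 𝔠 (f x) (f x) := by
  rw [coordMap, symm_self]

lemma contDiffAt_coordMap_self (hf : ContMDiff 𝓘(ℝ, E) 𝓘(ℝ, E) ∞ f) (x : M) :
    ContDiffAt ℝ ∞ (coordMap x (f x) f) (𝔠 x x) :=
  contDiffAt_coordMap (mem_extChartAt_target x) hf.contMDiffAt (by
    rw [symm_self]; exact mem_extChartAt_source (f x))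

lemma SmoothTwoTensor.pullForm (hW : SmoothTwoTensor W) (hf : ContMDiff 𝓘(ℝ, E) 𝓘(ℝ, E) ∞ f) :
    SmoothTwoTensor (GenKahler.pullForm f W) := by
  rw [smoothTwoTensor_iff] at *
  intro x
  have hF := contDiffAt_coordMap_self hf x
  have hB : ContDiffAt ℝ ∞ (coordTwo (f x) W) (coordMap x (f x) f (𝔠 x x)) := by
    rw [coordMap_self]
    exact hW (f x)
  have h := contDiffAt_pullTwo (L := fderiv ℝ (coordMap x (f x) f))
    (B := fun z => coordTwo (f x) W (coordMap x (f x) f z))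
    (hF.fderiv_right (m := ∞) (by simp)) (hB.comp (𝔠 x x) hF)
  exact h.congr_of_eventuallyEq (coordTwo_pullForm_eventuallyEq hf W x)

lemma IsTwoForm.pullForm (hW : IsTwoForm W) (hf : ContMDiff 𝓘(ℝ, E) 𝓘(ℝ, E) ∞ f) :
    IsTwoForm (GenKahler.pullForm f W) where
  smooth := hW.smooth.pullForm hf
  skew _ _ _ := hW.skew _ _ _

lemma IsTwoForm.closed_pullForm (hW : IsTwoForm W) (hc : Closed₂ W)
    (hf : ContMDiff 𝓘(ℝ, E) 𝓘(ℝ, E) ∞ f) : Closed₂ (GenKahler.pullForm f W) := by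
  intro x a b c
  have hF := contDiffAt_coordMap_self hf x
  rw [(coordTwo_pullForm_eventuallyEq hf W x).fderiv_eq]
  refine cyclic_fderiv_pullTwo (f := coordMap x (f x) f) hF ?_ ?_ ?_ a b c
  · rw [coordMap_self]; exact hW.smooth.differentiableAt
  · rw [coordMap_self]; exact fun v w => hW.skew _ _ _
  · rw [coordMap_self]; exact hc (f x)

end Closed

/-- A smooth family `φ_t`, `t ∈ 𝒯`, of diffeomorphisms with `φ_0 = id` and `∂φ_t/∂t = dφ_t(X_t)`. -/
structure IsIsotopy (𝒯 : Set ℝ) (X : ℝ → VField E M) (φ : ℝ → M ≃ₘ^∞⟮𝓘(ℝ, E), 𝓘(ℝ, E)⟯ M) :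
    Prop where
  isOpen : IsOpen 𝒯
  ordConnected : 𝒯.OrdConnected
  zero_mem : (0 : ℝ) ∈ 𝒯
  smooth : ContMDiffOn (𝓘(ℝ, ℝ).prod 𝓘(ℝ, E)) 𝓘(ℝ, E) ∞ (fun p : ℝ × M => φ p.1 p.2) (𝒯 ×ˢ univ)
  init : ∀ x, φ 0 x = x
  field : ∀ t ∈ 𝒯, SmoothVField (X t)
  deriv : ∀ t ∈ 𝒯, ∀ x : M, HasMFDerivAt 𝓘(ℝ, ℝ) 𝓘(ℝ, E) (fun s => φ s x) t
    ((ContinuousLinearMap.id ℝ ℝ).smulRight (mfderiv 𝓘(ℝ, E) 𝓘(ℝ, E) (φ t) x (X t x)))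

section Isotopy

variable {𝒯 : Set ℝ} {X : ℝ → VField E M} {φ : ℝ → M ≃ₘ^∞⟮𝓘(ℝ, E), 𝓘(ℝ, E)⟯ M}
  {Ω W : TwoTensor E M ℝ} {J : EndField E M} {t : ℝ}

lemma mfderiv_diffeo_isInvertible (f : M ≃ₘ^∞⟮𝓘(ℝ, E), 𝓘(ℝ, E)⟯ M) (x : M) :
    (mfderiv 𝓘(ℝ, E) 𝓘(ℝ, E) f x).IsInvertible :=
  ⟨f.mfderivToContinuousLinearEquiv (by simp) x, rfl⟩

lemma IsIsotopy.isSmoothFamilyAt (h : IsIsotopy 𝒯 X φ) (ht : t ∈ 𝒯) (x : M) :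
    IsSmoothFamilyAt E (fun s => φ s) t x :=
  isSmoothFamilyAt_of_contMDiffOn (h.isOpen.mem_nhds ht) h.smooth x

lemma IsIsotopy.hasDerivAt_inverse [CompleteSpace E] (h : IsIsotopy 𝒯 X φ) (hΩ : IsTwoForm Ω)
    (hc : Closed₂ Ω) (ht : t ∈ 𝒯) (hX : extD (fun x => Ω x (X t x)) = 0) (y : M) :
    HasDerivAt (F := E →L[ℝ] E →L[ℝ] ℝ) (fun s => pullForm (φ s).symm Ω y) 0 t := by
  obtain ⟨x, rfl⟩ := (φ t).surjective y
  have hs := h.isSmoothFamilyAt ht x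
  obtain ⟨h1, h2⟩ := hs.inverse (g := fun s => (φ s).symm) (φ t).contMDiff
    (mfderiv_diffeo_isInvertible (φ t) x) (fun s p => (φ s).symm_apply_apply p)
    (hs.flow_source (φ t).contMDiff (h.deriv t ht))
  exact h1.hasDerivAt_pullForm_target (fun s => (φ s).symm.contMDiff) hΩ hc (h.field t ht) hX h2

/-- A closed two-form `Ω` with `d(i_X Ω) = 0` is invariant. -/
theorem IsIsotopy.pullForm_eq [CompleteSpace E] (h : IsIsotopy 𝒯 X φ) (hΩ : IsTwoForm Ω)
    (hc : Closed₂ Ω) (hX : ∀ t ∈ 𝒯, extD (fun x => Ω x (X t x)) = 0) (ht : t ∈ 𝒯) :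
    pullForm (φ t) Ω = Ω := by
  -- The inverse maps are used since they satisfy `∂ψ/∂t = -X ∘ ψ`, for which the derivative of
  -- `ψ^*Ω` is minus the pullback of the Lie derivative of `Ω` and hence vanishes. For `φ_t` itself
  -- the derivative is the Lie derivative of the unknown form `φ_t^*Ω`.
  have h1 : pullForm (φ t).symm Ω = Ω := by
    funext y
    have hd : ∀ s ∈ 𝒯, HasDerivAt (F := E →L[ℝ] E →L[ℝ] ℝ)
        (fun s => pullForm (φ s).symm Ω y) 0 s :=
      fun s hs => h.hasDerivAt_inverse hΩ hc hs (hX s hs) y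
    have h2 := h.isOpen.is_const_of_deriv_eq_zero (𝕜 := ℝ) (G := E →L[ℝ] E →L[ℝ] ℝ)
      (f := fun s => pullForm (φ s).symm Ω y)
      h.ordConnected.isPreconnected
      (fun s hs => (hd s hs).differentiableAt.differentiableWithinAt)
      (fun s hs => (hd s hs).deriv) ht h.zero_mem
    have h3 : ((φ 0).symm : M → M) = id := by
      funext p
      have := (φ 0).symm_apply_apply p
      rwa [h.init] at this
    refine h2.trans ?_
    change pullForm (φ 0).symm Ω y = _
    rw [h3, pullForm_id]
  have h4 : (φ t).symm ∘ φ t = id := funext fun p => (φ t).symm_apply_apply p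
  calc pullForm (φ t) Ω = pullForm (φ t) (pullForm (φ t).symm Ω) := by rw [h1]
    _ = Ω := by rw [pullForm_pullForm (φ t).contMDiff (φ t).symm.contMDiff, h4, pullForm_id]

lemma mfderiv_pullEnd (f : M ≃ₘ^∞⟮𝓘(ℝ, E), 𝓘(ℝ, E)⟯ M) (J : EndField E M) (x : M) (Y : Tan E x) :
    mfderiv 𝓘(ℝ, E) 𝓘(ℝ, E) f x (pullEnd f J x Y) = J (f x) (mfderiv 𝓘(ℝ, E) 𝓘(ℝ, E) f x Y) :=
  (mfderiv_diffeo_isInvertible f x).self_apply_inverse _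

lemma pullEnd_sq (f : M ≃ₘ^∞⟮𝓘(ℝ, E), 𝓘(ℝ, E)⟯ M) (hJ : ∀ x X, J x (J x X) = -X) (x : M)
    (Y : Tan E x) : pullEnd f J x (pullEnd f J x Y) = -Y := by
  refine (mfderiv_diffeo_isInvertible f x).injective ?_
  rw [mfderiv_pullEnd, mfderiv_pullEnd, hJ, map_neg]

/-- When `f` preserves `Ω`, moving `J` amounts to pulling back the two-form `ΩJ`. Closedness,
smoothness and time derivatives for the moved `J` are thereby reduced to those of forms. -/
lemma comp_pullEnd (f : M ≃ₘ^∞⟮𝓘(ℝ, E), 𝓘(ℝ, E)⟯ M) (hf : pullForm f Ω = Ω) (J : EndField E M) :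
    (fun x => Ω x ∘L pullEnd f J x) = pullForm f (fun x => Ω x ∘L J x) := by
  funext x
  ext Y Z
  have h : Ω x (pullEnd f J x Y) Z = pullForm f Ω x (pullEnd f J x Y) Z := by rw [hf]
  refine h.trans ?_
  rw [pullForm_apply, mfderiv_pullEnd]
  rfl

end Isotopy

end

section

variable {E : Type*} [NormedAddCommGroup E] [NormedSpace ℝ E]
  {F : Type*} [NormedAddCommGroup F] [NormedSpace ℝ F]
  {M : Type*} [TopologicalSpace M] [ChartedSpace E M]

local notation "𝔠" => extChartAt 𝓘(ℝ, E)

/-! ### Linear algebra of nondegenerate bihermitian structures -/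

section Fibre

variable {Ω g b K : E →L[ℝ] E →L[ℝ] ℝ} {I J J' : E →L[ℝ] E}

/-- Complex structures `I` and `J` for which the two-form `Ω` has type `(2,0) + (0,2)`. -/
structure IsSympFib (Ω : E →L[ℝ] E →L[ℝ] ℝ) (I J : E →L[ℝ] E) : Prop where
  skew : ∀ X Y, Ω X Y = -Ω Y X
  symm₁ : ∀ X Y, Ω (I X) Y = Ω X (I Y)
  symm₂ : ∀ X Y, Ω (J X) Y = Ω X (J Y)
  sq₁ : ∀ X, I (I X) = -X
  sq₂ : ∀ X, J (J X) = -X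

/-- The metric `½Ω[I, J]`. -/
def sympMetric (Ω : E →L[ℝ] E →L[ℝ] ℝ) (I J : E →L[ℝ] E) : E →L[ℝ] E →L[ℝ] ℝ :=
  (1 / 2 : ℝ) • (Ω ∘L (I ∘L J) - Ω ∘L (J ∘L I))

/-- The two-form `½Ω(IJ + JI)`. -/
def sympAnti (Ω : E →L[ℝ] E →L[ℝ] ℝ) (I J : E →L[ℝ] E) : E →L[ℝ] E →L[ℝ] ℝ :=
  (1 / 2 : ℝ) • (Ω ∘L (I ∘L J) + Ω ∘L (J ∘L I))

lemma sympMetric_apply (X Y : E) :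
    sympMetric Ω I J X Y = (Ω (I (J X)) Y - Ω (J (I X)) Y) / 2 := by
  simp [sympMetric]; ring

lemma sympAnti_apply (X Y : E) :
    sympAnti Ω I J X Y = (Ω (I (J X)) Y + Ω (J (I X)) Y) / 2 := by
  simp [sympAnti]; ring

lemma IsSympFib.metric_symm (h : IsSympFib Ω I J) (X Y : E) :
    sympMetric Ω I J X Y = sympMetric Ω I J Y X := by
  simp only [sympMetric_apply, h.symm₁, h.symm₂]
  rw [h.skew X, h.skew X, h.symm₁, h.symm₂, h.symm₁, h.symm₂]
  ring

lemma IsSympFib.anti_skew (h : IsSympFib Ω I J) (X Y : E) :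
    sympAnti Ω I J X Y = -sympAnti Ω I J Y X := by
  simp only [sympAnti_apply, h.symm₁, h.symm₂]
  rw [h.skew X, h.skew X, h.symm₁, h.symm₂, h.symm₁, h.symm₂]
  ring

lemma IsSympFib.isHermFib₁ (h : IsSympFib Ω I J) : IsHermFib (sympMetric Ω I J) I where
  symm := h.metric_symm
  sq := h.sq₁
  orth X Y := by
    simp only [sympMetric_apply, ← h.symm₁, h.sq₁, map_neg, neg_apply]
    ring

lemma IsSympFib.isHermFib₂ (h : IsSympFib Ω I J) : IsHermFib (sympMetric Ω I J) J where
  symm := h.metric_symm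
  sq := h.sq₂
  orth X Y := by
    simp only [sympMetric_apply, ← h.symm₂, h.sq₂, map_neg, neg_apply]
    ring

variable {σ : (E →L[ℝ] ℝ) →L[ℝ] E}

/-- The definition of `σ` says `σ ∘ g = ½[I,J]`; applying `Ω = σ⁻¹` gives back `g`. -/
lemma sympMetric_inverse (hg : g.IsInvertible)
    (hσ : σ = (1 / 2 : ℝ) • ((I ∘L J - J ∘L I) ∘L g.inverse)) (hi : σ.IsInvertible) :
    sympMetric σ.inverse I J = g := by
  ext X Y
  have e : σ (g X) = (1 / 2 : ℝ) • (I (J X) - J (I X)) := by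
    rw [hσ]; simp [hg.inverse_apply_self]
  have e2 : σ.inverse ((1 / 2 : ℝ) • (I (J X) - J (I X))) = g X := by
    rw [← e, hi.inverse_apply_self]
  rw [← e2, sympMetric_apply]
  simp; ring

/-- The operator `A = ½[I,J]` is skew for `g` and anticommutes with `I` and with `J`, and `ΩA = g`.
Since `A` is surjective, every identity for `Ω` can be tested on the image of `A`, where it is one
for `g`. -/
lemma isSympFib_inverse (hI : IsHermFib g I) (hJ : IsHermFib g J) (hg : g.IsInvertible)
    (hσ : σ = (1 / 2 : ℝ) • ((I ∘L J - J ∘L I) ∘L g.inverse)) (hi : σ.IsInvertible) :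
    IsSympFib σ.inverse I J := by
  set Ω := σ.inverse
  set A : E →L[ℝ] E := (1 / 2 : ℝ) • (I ∘L J - J ∘L I)
  have hA : ∀ X, A X = (1 / 2 : ℝ) • (I (J X) - J (I X)) := fun X => by simp [A]
  have hΩ : ∀ X, Ω (A X) = g X := fun X => by
    have e : σ (g X) = A X := by rw [hσ, hA]; simp [hg.inverse_apply_self]
    rw [← e, hi.inverse_apply_self]
  have hs : ∀ Y, ∃ X, Y = A X := fun Y => ⟨g.inverse (Ω Y), by
    have e : σ (Ω Y) = A (g.inverse (Ω Y)) := by rw [hσ]; rfl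
    exact (hi.self_apply_inverse Y).symm.trans e⟩
  have gI : ∀ X Y, g (I X) Y = -g X (I Y) := fun X Y => by
    rw [← hI.orth X, hI.sq]; simp
  have gJ : ∀ X Y, g (J X) Y = -g X (J Y) := fun X Y => by
    rw [← hJ.orth X, hJ.sq]; simp
  have gA : ∀ X Y, g (A X) Y = -g X (A Y) := fun X Y => by
    simp only [hA, map_smul, map_sub, smul_apply, sub_apply, gI, gJ, smul_eq_mul]; ring
  have AI : ∀ X, A (I X) = -I (A X) := fun X => by
    simp only [hA, map_smul, map_sub, hI.sq, map_neg]; module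
  have AJ : ∀ X, A (J X) = -J (A X) := fun X => by
    simp only [hA, map_smul, map_sub, hJ.sq, map_neg]; module
  refine ⟨fun X Y => ?_, fun X Y => ?_, fun X Y => ?_, hI.sq, hJ.sq⟩ <;>
    obtain ⟨X, rfl⟩ := hs X <;> obtain ⟨Y, rfl⟩ := hs Y
  · rw [hΩ, hΩ, hI.symm Y, gA]; simp
  · have e : I (A X) = -A (I X) := by rw [AI, neg_neg]
    rw [e, map_neg, neg_apply, hΩ, hΩ, gI, neg_neg]
  · have e : J (A X) = -A (J X) := by rw [AJ, neg_neg]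
    rw [e, map_neg, neg_apply, hΩ, hΩ, gJ, neg_neg]

/-- By `J[I,J] = (1 + JI)(I + J)`, surjectivity of the commutator passes to `1 + JI`. -/
lemma exists_add_comp_eq (hI : ∀ X, I (I X) = -X) (hJ : ∀ X, J (J X) = -X)
    (hs : ∀ X, ∃ U, X = I (J U) - J (I U)) (X : E) : ∃ U, X = U + J (I U) := by
  obtain ⟨U, hU⟩ := hs (-J X)
  refine ⟨I U + J U, ?_⟩
  have e := congrArg J hU
  simp only [map_neg, hJ, map_sub, map_add, neg_neg, hI] at e ⊢
  rw [e]; abel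

/-- A generalized complex structure of symplectic type. -/
lemma IsFrame.map_symp {𝕁 : GFib E →L[ℝ] GFib E} (F : IsFrame 𝕁 g b I J) (hI : ∀ X, I (I X) = -X)
    (hJ : ∀ X, J (J X) = -X) (hs : ∀ X, ∃ U, X = U + J (I U)) (hg : sympMetric Ω I J = g) (X : E) :
    𝕁 (X, (b + sympAnti Ω I J - Ω) X) = (0, (Ω ∘L I + Ω ∘L J) X) := by
  obtain ⟨U, rfl⟩ := hs X
  -- The terms in `Ω` cancel, so this element is the lift of `U` to the graph of `b + g` plus the
  -- lift of `JIU` to that of `b - g`. Under `𝕁` their vector parts become `IU` and `-IU`.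
  have e1 : (U + J (I U), (b + sympAnti Ω I J - Ω) (U + J (I U)))
      = (U, (b + g) U) + (J (I U), (b - g) (J (I U))) := by
    refine Prod.ext rfl ?_
    ext Y
    simp only [← hg, add_apply, sub_apply, sympAnti_apply, sympMetric_apply, map_add, Prod.snd_add,
      hI, hJ, map_neg, neg_apply]
    ring
  have e2 : ((0 : E), (Ω ∘L I + Ω ∘L J) (U + J (I U)))
      = (I U, (b + g) (I U)) + (J (J (I U)), (b - g) (J (J (I U)))) := by
    refine Prod.ext (by simp [hJ]) ?_
    ext Y
    simp only [← hg, add_apply, sub_apply, sympMetric_apply, map_add, Prod.snd_add,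
      hI, hJ, map_neg, neg_apply, ContinuousLinearMap.comp_apply]
    ring
  rw [e1, e2, map_add, F.plus, F.minus]

lemma exists_commutator_eq (hσ : σ = (1 / 2 : ℝ) • ((I ∘L J - J ∘L I) ∘L g.inverse))
    (hi : σ.IsInvertible) (X : E) : ∃ U, X = I (J U) - J (I U) :=
  ⟨(1 / 2 : ℝ) • g.inverse (σ.inverse X), by
    have e : ∀ ξ, σ ξ = I (J ((1 / 2 : ℝ) • g.inverse ξ)) - J (I ((1 / 2 : ℝ) • g.inverse ξ)) :=
      fun ξ => by rw [hσ]; simp [smul_sub]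
    exact (hi.self_apply_inverse X).symm.trans (e _)⟩

/-- The preceding statement for `-Ω` and `-J`, a substitution that leaves `½Ω[I,J]` and `½Ω(IJ +
JI)` unchanged. -/
lemma IsFrame.map_symp_neg {𝕁 : GFib E →L[ℝ] GFib E} (F : IsFrame 𝕁 g b I (-J))
    (hI : ∀ X, I (I X) = -X) (hJ : ∀ X, J (J X) = -X) (hs : ∀ X, ∃ U, X = I (J U) - J (I U))
    (hg : sympMetric Ω I J = g) (X : E) :
    𝕁 (X, (b + sympAnti Ω I J + Ω) X) = (0, (Ω ∘L J - Ω ∘L I) X) := by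
  have e1 : sympMetric (-Ω) I (-J) = sympMetric Ω I J := by ext; simp [sympMetric_apply]
  have e2 : sympAnti (-Ω) I (-J) = sympAnti Ω I J := by ext; simp [sympAnti_apply]
  have hJ' : ∀ X, (-J) ((-J) X) = -X := fun X => by simp [hJ]
  have hs' : ∀ X, ∃ U, X = I ((-J) U) - (-J) (I U) := fun X => by
    obtain ⟨U, hU⟩ := hs X
    refine ⟨-U, ?_⟩
    simpa [sub_eq_add_neg] using hU
  have := F.map_symp hI hJ' (exists_add_comp_eq hI hJ' hs') (e1.trans hg) X
  rw [e2, sub_neg_eq_add] at this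
  rw [this]
  refine Prod.ext rfl ?_
  ext Y
  simp
  ring

end Fibre

end

section

variable {E : Type*} [NormedAddCommGroup E] [NormedSpace ℝ E]
  {F : Type*} [NormedAddCommGroup F] [NormedSpace ℝ F]
  {M : Type*} [TopologicalSpace M] [ChartedSpace E M]

local notation "𝔠" => extChartAt 𝓘(ℝ, E)

/-! ### Closedness of the symplectic forms of a generalized Kähler structure -/

variable [IsManifold 𝓘(ℝ, E) ∞ M] [FiniteDimensional ℝ E] {g b β ω' : TwoTensor E M ℝ}
  {I J : EndField E M} {H : ThreeForm E M}

lemma coordGual_graph (h : IsBihermitian g b I J)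
    (hrel : ∀ p (X : E), gual (E := E) (g p) (b p) (I p) (J p) (X, β p X) = (0, ω' p X))
    {x : M} {y : E} (hy : y ∈ (𝔠 x).target) (X : E) :
    coordGual x g b I J y (X, coordTwo x β y X) = (0, coordTwo x ω' y X) := by
  set L : E →L[ℝ] E := chartInvDiff x y
  have hL : L.IsInvertible := chartInvDiff_isInvertible hy
  have key := gual_conj (E := E) (b := b ((𝔠 x).symm y))
    (h.metric.isHermFib h.hermitian₁ ((𝔠 x).symm y))
    (h.metric.isHermFib h.hermitian₂ ((𝔠 x).symm y)) (h.metric.isInvertible ((𝔠 x).symm y)) hL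
    (L X, β ((𝔠 x).symm y) (L X))
  rw [hrel] at key
  have e1 : ((L.inverse (L X), (β ((𝔠 x).symm y) (L X) : E →L[ℝ] ℝ) ∘L L) : GFib E)
      = (X, coordTwo x β y X) := Prod.ext (hL.inverse_apply_self X) rfl
  refine (congrArg _ e1.symm).trans (key.trans (Prod.ext (map_zero _) rfl))

/-- If the structure carries the graph of `β` into `T^*` by `ω'`, it is of symplectic type, and by
`IsOrthJet.symplectic` its torsion consists of `dβ + H` and `dω'`. -/
lemma IsBihermitian.closed_of_graph (h : IsBihermitian g b I J)
    (ht : ∀ x s t r, torsion (E := E) (H x) (coordGual x g b I J (𝔠 x x))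
      (fderiv ℝ (coordGual x g b I J) (𝔠 x x)) s t r = 0)
    (hβ : SmoothTwoTensor β) (hω : SmoothTwoTensor ω')
    (hrel : ∀ p (X : E), gual (E := E) (g p) (b p) (I p) (J p) (X, β p X) = (0, ω' p X))
    (x : M) (X Y Z : E) :
    jetTwo x β X Y Z + jetTwo x β Y Z X + jetTwo x β Z X Y + tri (E := E) (H x) X Y Z = 0 ∧
      jetTwo x ω' X Y Z + jetTwo x ω' Y Z X + jetTwo x ω' Z X Y = 0 := by
  have h0 := fun X => coordGual_graph h hrel (mem_extChartAt_target x) X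
  have h1 : ∀ u X, fderiv ℝ (coordGual x g b I J) (𝔠 x x) u (X, ptTwo x β X)
      + coordGual x g b I J (𝔠 x x) (0, jetTwo x β u X) = (0, jetTwo x ω' u X) := fun u X => by
    have hX := hasFDerivAt_const (𝕜 := ℝ) X (𝔠 x x)
    have e1 := (((h.represents x).smooth.differentiableAt (by simp)).hasFDerivAt).clm_apply
      (hX.prodMk (hβ.differentiableAt.hasFDerivAt.clm_apply hX))
    have e2 := (hasFDerivAt_const (𝕜 := ℝ) (0 : E) (𝔠 x x)).prodMk
      (hω.differentiableAt.hasFDerivAt.clm_apply hX)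
    have e3 : (fun y => coordGual x g b I J y (X, coordTwo x β y X)) =ᶠ[𝓝 (𝔠 x x)]
        fun y => (0, coordTwo x ω' y X) := eventually_target fun y hy => coordGual_graph h hrel hy X
    have := DFunLike.congr_fun (e1.unique (e2.congr_of_eventuallyEq e3)) u
    simp only [add_apply, ContinuousLinearMap.comp_apply, flip_apply, prod_apply, zero_apply,
      map_zero, zero_add] at this
    rw [add_comm]
    exact this
  have := (h.isOrthJet x).symplectic (H x) h0 h1 X Y Z
  rw [ht, ht] at this
  exact ⟨this.1.symm, this.2.symm⟩

/-- A symplectic form `Ω` of type `(2,0) + (0,2)` with respect to two integrable complex structures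
`I` and `J`, and a two-form `B` with `dB + H = 0`. -/
structure IsSympPair (H : ThreeForm E M) (Ω B : TwoTensor E M ℝ) (I J : EndField E M) : Prop where
  fibre : ∀ x, IsSympFib (E := E) (Ω x) (I x) (J x)
  nondeg : ∀ x, IsNondeg (E := E) (Ω x)
  smooth : SmoothTwoTensor Ω
  smooth₁ : SmoothEnd I
  smooth₂ : SmoothEnd J
  closed : Closed₂ Ω
  closed₁ : Closed₂ (fun x => Ω x ∘L I x)
  closed₂ : Closed₂ (fun x => Ω x ∘L J x)
  twoForm : IsTwoForm B
  closed_twoForm : ∀ x (X Y Z : E), jetTwo x B X Y Z + jetTwo x B Y Z X + jetTwo x B Z X Y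
    + tri (E := E) (H x) X Y Z = 0

section SympPair

variable {Ω B : TwoTensor E M ℝ}

/-- The metric of a pair of holomorphic symplectic structures. -/
def metricField (Ω : TwoTensor E M ℝ) (I J : EndField E M) : TwoTensor E M ℝ := fun x =>
  sympMetric (E := E) (Ω x) (I x) (J x)

/-- The field `½Ω(IJ + JI)`. -/
def antiField (Ω : TwoTensor E M ℝ) (I J : EndField E M) : TwoTensor E M ℝ := fun x =>
  sympAnti (E := E) (Ω x) (I x) (J x)

/-- The two-form of a pair of holomorphic symplectic structures. -/
def twoField (Ω B : TwoTensor E M ℝ) (I J : EndField E M) : TwoTensor E M ℝ := fun x =>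
  B x - antiField Ω I J x

lemma metricField_apply (x : M) (X Y : Tan E x) :
    metricField Ω I J x X Y = (Ω x (I x (J x X)) Y - Ω x (J x (I x X)) Y) / 2 :=
  sympMetric_apply (E := E) X Y

lemma twoField_apply (x : M) (X Y : Tan E x) :
    twoField Ω B I J x X Y = B x X Y - (Ω x (I x (J x X)) Y + Ω x (J x (I x X)) Y) / 2 :=
  congrArg (B x X Y - ·) (sympAnti_apply (E := E) (Ω := Ω x) (I := I x) (J := J x) X Y)

lemma IsSympPair.isTwoForm (h : IsSympPair H Ω B I J) : IsTwoForm Ω :=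
  ⟨h.smooth, fun x => (h.fibre x).skew⟩

lemma IsSympPair.isTwoForm₁ (h : IsSympPair H Ω B I J) : IsTwoForm (fun x => Ω x ∘L I x) :=
  ⟨h.smooth.comp_left h.smooth₁, fun x X Y =>
    ((h.fibre x).symm₁ X Y).trans ((h.fibre x).skew X (I x Y))⟩

lemma IsSympPair.isTwoForm₂ (h : IsSympPair H Ω B I J) : IsTwoForm (fun x => Ω x ∘L J x) :=
  ⟨h.smooth.comp_left h.smooth₂, fun x X Y =>
    ((h.fibre x).symm₂ X Y).trans ((h.fibre x).skew X (J x Y))⟩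

lemma IsSympPair.eq_zero (h : IsSympPair H Ω B I J) (x : M) (X : Tan E x)
    (hX : ∀ Z, Ω x X Z = 0) : X = 0 :=
  (h.nondeg x).injective ((ContinuousLinearMap.ext hX).trans (map_zero (Ω x)).symm)

lemma IsSympPair.nijZero₁ (h : IsSympPair H Ω B I J) : NijZero I :=
  nijZero_of_closed h.isTwoForm h.closed h.isTwoForm₁ h.closed₁ h.smooth₁
    (fun x => (h.fibre x).sq₁) h.eq_zero

lemma IsSympPair.nijZero₂ (h : IsSympPair H Ω B I J) : NijZero J :=
  nijZero_of_closed h.isTwoForm h.closed h.isTwoForm₂ h.closed₂ h.smooth₂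
    (fun x => (h.fibre x).sq₂) h.eq_zero

/-- `dB + H = 0` makes the graph of `B` integrable for any integrable complex structure. Now `b + g
= B - ΩJI` differs from `B` by the closed form `-ΩJ` composed with `I`; likewise `b - g = B - ΩIJ`
for the other half. -/
lemma IsSympPair.inv₁ (h : IsSympPair H Ω B I J) :
    Inv H (twoField Ω B I J + metricField Ω I J) I := by
  refine (Inv.of_closed h.nijZero₁ h.twoForm h.closed_twoForm).add h.twoForm.smooth h.smooth₁
    (fun x => (h.fibre x).sq₁) isTwoForm_zero closed_zero (h.isTwoForm₂.smul (-1))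
    (h.closed₂.smul (-1) h.isTwoForm₂.smooth) fun x X Y => ?_
  change twoField Ω B I J x X Y + metricField Ω I J x X Y
    = B x X Y + 0 + -1 * Ω x (J x (I x X)) Y
  rw [twoField_apply, metricField_apply]
  ring

lemma IsSympPair.inv₂ (h : IsSympPair H Ω B I J) :
    Inv H (twoField Ω B I J - metricField Ω I J) J := by
  refine (Inv.of_closed h.nijZero₂ h.twoForm h.closed_twoForm).add h.twoForm.smooth h.smooth₂
    (fun x => (h.fibre x).sq₂) isTwoForm_zero closed_zero (h.isTwoForm₁.smul (-1))
    (h.closed₁.smul (-1) h.isTwoForm₁.smooth) fun x X Y => ?_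
  change twoField Ω B I J x X Y - metricField Ω I J x X Y
    = B x X Y + 0 + -1 * Ω x (I x (J x X)) Y
  rw [twoField_apply, metricField_apply]
  ring

lemma IsSympPair.isBihermitian (h : IsSympPair H Ω B I J)
    (hpos : ∀ x (X : Tan E x), X ≠ 0 → 0 < metricField Ω I J x X X) :
    IsBihermitian (metricField Ω I J) (twoField Ω B I J) I J := by
  have h1 := h.smooth.comp_left (h.smooth₁.comp h.smooth₂)
  have h2 := h.smooth.comp_left (h.smooth₂.comp h.smooth₁)
  have hm : SmoothTwoTensor (metricField Ω I J) := (h1.sub h2).smul (1 / 2)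
  have ha : SmoothTwoTensor (antiField Ω I J) := (h1.add h2).smul (1 / 2)
  refine ⟨⟨hm, fun x => (h.fibre x).metric_symm, hpos⟩, ⟨h.twoForm.smooth.sub ha, fun x X Y => ?_⟩,
    ⟨h.smooth₁, fun x => (h.fibre x).sq₁, fun x => (h.fibre x).isHermFib₁.orth⟩,
    ⟨h.smooth₂, fun x => (h.fibre x).sq₂, fun x => (h.fibre x).isHermFib₂.orth⟩⟩
  have e1 := h.twoForm.skew x X Y
  have e2 : antiField Ω I J x X Y = -antiField Ω I J x Y X := (h.fibre x).anti_skew X Y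
  change B x X Y - antiField Ω I J x X Y = -(B x Y X - antiField Ω I J x Y X)
  rw [e1, e2]
  ring

lemma contDiffAt_inverse_end {P : Type*} [NormedAddCommGroup P] [NormedSpace ℝ P] {p₀ : P}
    {f : P → E →L[ℝ] E} (hf : ContDiffAt ℝ ∞ f p₀) (hi : (f p₀).IsInvertible) :
    ContDiffAt ℝ ∞ (fun p => (f p).inverse) p₀ := by
  have : CompleteSpace E := FiniteDimensional.complete ℝ E
  obtain ⟨e, he⟩ := hi
  have := contDiffAt_map_inverse (𝕜 := ℝ) (n := ∞) e
  rw [he] at this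
  exact this.comp p₀ hf

lemma coordEnd_isInvertible {A : EndField E M} {x : M} {y : E} (hy : y ∈ (𝔠 x).target)
    (hA : (A ((𝔠 x).symm y)).IsInvertible) : (coordEnd x A y).IsInvertible :=
  have hL : (chartInvDiff (M := M) x y).IsInvertible := chartInvDiff_isInvertible hy
  hL.inverse.comp (hA.comp hL)

/-- Used to deduce smoothness of `Ω`, defined by pointwise inversion, from that of `g = ½Ω[I,J]`. -/
lemma smoothTwoTensor_of_comp {A : EndField E M} (hA : SmoothEnd A)
    (hi : ∀ x, (A x).IsInvertible) (h : SmoothTwoTensor (fun x => Ω x ∘L A x)) :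
    SmoothTwoTensor Ω := by
  rw [smoothTwoTensor_iff] at *
  intro x
  have hA' := contDiffAt_inverse_end (smoothEnd_iff.1 hA x)
    (coordEnd_isInvertible (mem_extChartAt_target x) (hi _))
  refine ((h x).clm_comp hA').congr_of_eventuallyEq (eventually_target fun y hy => ?_)
  have e := coordTwo_comp_left hy Ω A
  have hAy := coordEnd_isInvertible hy (hi ((𝔠 x).symm y))
  beta_reduce
  rw [e, ContinuousLinearMap.comp_assoc, hAy.self_comp_inverse, ContinuousLinearMap.comp_id]

variable [T2Space M]

/-- The holomorphic symplectic structures of a generalized Kähler structure with invertible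
`[I, J]`. -/
theorem IsBihermitian.isSympPair (h : IsBihermitian g b I J)
    (hK : IsGenKahler H (gualtieri₁ g b I J) (gualtieri₂ g b I J))
    (hσ : ∀ x, (poisson g I J x).IsInvertible) :
    metricField (sympForm g I J) I J = g ∧
      ∃ B, IsSympPair H (sympForm g I J) B I J ∧ twoField (sympForm g I J) B I J = b := by
  set Ω := sympForm g I J
  have hI := fun x => h.metric.isHermFib h.hermitian₁ x
  have hJ := fun x => h.metric.isHermFib h.hermitian₂ x
  have hg := fun x => h.metric.isInvertible x
  have sI := h.hermitian₁.smooth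
  have sJ := h.hermitian₂.smooth
  have hf : ∀ x, IsSympFib (E := E) (Ω x) (I x) (J x) := fun x =>
    isSympFib_inverse (E := E) (hI x) (hJ x) (hg x) rfl (hσ x)
  have hm : metricField Ω I J = g := funext fun x =>
    sympMetric_inverse (E := E) (hg x) rfl (hσ x)
  have hs : SmoothTwoTensor Ω := by
    refine smoothTwoTensor_of_comp
      (A := fun x => (1 / 2 : ℝ) • (I x ∘L J x - J x ∘L I x))
      (((sI.comp sJ).sub (sJ.comp sI)).smul (1 / 2)) (fun x => ?_) ?_
    · have e : (1 / 2 : ℝ) • (I x ∘L J x - J x ∘L I x) = poisson g I J x ∘L g x := by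
        ext X
        have hx : (g x).IsInvertible := hg x
        have e0 : (g x).inverse (g x X) = X := hx.inverse_apply_self X
        simp [poisson, e0]
      rw [e]
      exact (hσ x).comp (hg x)
    · have e : (fun x => Ω x ∘L ((1 / 2 : ℝ) • (I x ∘L J x - J x ∘L I x))) = g := by
        rw [← hm]
        funext x
        ext X Y
        rw [metricField_apply]
        simp
        ring
      rw [e]
      exact h.metric.smooth
  have hI2 : SmoothTwoTensor (fun x => Ω x ∘L I x) := hs.comp_left sI
  have hJ2 : SmoothTwoTensor (fun x => Ω x ∘L J x) := hs.comp_left sJ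
  have hC : SmoothTwoTensor (antiField Ω I J) :=
    ((hs.comp_left (sI.comp sJ)).add (hs.comp_left (sJ.comp sI))).smul (1 / 2)
  set C := antiField Ω I J
  have hB : IsTwoForm (fun x => b x + C x) := by
    refine ⟨h.twoForm.smooth.add hC, fun x X Y => ?_⟩
    have e1 := h.twoForm.skew x X Y
    have e2 : C x X Y = -C x Y X := (hf x).anti_skew X Y
    rw [add_apply, add_apply, add_apply, add_apply, e1, e2]
    ring
  rw [gualtieri₂_eq] at hK
  have t1 := hK.fst.torsion_eq_zero h.represents h.isOrthJet h.metric.exists_gSection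
  have t2 := hK.snd.torsion_eq_zero h.neg.represents h.neg.isOrthJet h.metric.exists_gSection
  -- With `B = b + C`, the structure `𝕁₁` gives `d(B - Ω) + H = 0` and closedness of `Ω(I + J)`, and
  -- `𝕁₂` gives `d(B + Ω) + H = 0` and closedness of `Ω(J - I)`. Half sums and half differences
  -- yield all four equations.
  have hc1 := h.closed_of_graph t1 (β := fun x => (b x + C x) - Ω x)
    (ω' := fun x => Ω x ∘L I x + Ω x ∘L J x) (hB.smooth.sub hs) (hI2.add hJ2) fun p X =>
      (isFrame_gual (hI p) (hJ p) (hg p)).map_symp (hI p).sq (hJ p).sq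
        (exists_add_comp_eq (hI p).sq (hJ p).sq (exists_commutator_eq rfl (hσ p)))
        (congrFun hm p) X
  have hc2 := h.neg.closed_of_graph t2 (β := fun x => (b x + C x) + Ω x)
    (ω' := fun x => Ω x ∘L J x - Ω x ∘L I x) (hB.smooth.add hs) (hJ2.sub hI2) fun p X =>
      (isFrame_gual (hI p) (hJ p).neg (hg p)).map_symp_neg (hI p).sq (hJ p).sq
        (exists_commutator_eq rfl (hσ p)) (congrFun hm p) X
  have j1 := jetTwo_sub hB.smooth hs
  have j2 := jetTwo_add hB.smooth hs
  have j3 := jetTwo_add hI2 hJ2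
  have j4 := jetTwo_sub hJ2 hI2
  refine ⟨hm, fun x => b x + C x, ⟨hf, fun x => (hσ x).inverse, hs, sI, sJ, fun x X Y Z => ?_,
    fun x X Y Z => ?_, fun x X Y Z => ?_, hB, fun x X Y Z => ?_⟩, ?_⟩
  · have e1 := (hc1 x X Y Z).1
    have e2 := (hc2 x X Y Z).1
    simp only [j1, j2, add_apply, sub_apply] at e1 e2
    change jetTwo x Ω X Y Z + jetTwo x Ω Y Z X + jetTwo x Ω Z X Y = 0
    linarith
  · have e1 := (hc1 x X Y Z).2
    have e2 := (hc2 x X Y Z).2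
    simp only [j3, j4, add_apply, sub_apply] at e1 e2
    change jetTwo x (fun x => Ω x ∘L I x) X Y Z + jetTwo x (fun x => Ω x ∘L I x) Y Z X
      + jetTwo x (fun x => Ω x ∘L I x) Z X Y = 0
    linarith
  · have e1 := (hc1 x X Y Z).2
    have e2 := (hc2 x X Y Z).2
    simp only [j3, j4, add_apply, sub_apply] at e1 e2
    change jetTwo x (fun x => Ω x ∘L J x) X Y Z + jetTwo x (fun x => Ω x ∘L J x) Y Z X
      + jetTwo x (fun x => Ω x ∘L J x) Z X Y = 0
    linarith
  · have e1 := (hc1 x X Y Z).1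
    have e2 := (hc2 x X Y Z).1
    simp only [j1, j2, add_apply, sub_apply] at e1 e2
    linarith
  · funext x
    exact add_sub_cancel_right _ _

end SympPair

end

section

variable {E : Type*} [NormedAddCommGroup E] [NormedSpace ℝ E]
  {F : Type*} [NormedAddCommGroup F] [NormedSpace ℝ F]
  {M : Type*} [TopologicalSpace M] [ChartedSpace E M]

local notation "𝔠" => extChartAt 𝓘(ℝ, E)

/-! ### The nondegenerate case -/

section FibreDeriv

variable {Ω K : E →L[ℝ] E →L[ℝ] ℝ} {I J' : E →L[ℝ] E} {J : ℝ → E →L[ℝ] E} {t : ℝ}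

lemma hasDerivAt_sympMetric (Ω : E →L[ℝ] E →L[ℝ] ℝ) (I : E →L[ℝ] E) (hJ : HasDerivAt J J' t) :
    HasDerivAt (fun s => sympMetric Ω I (J s)) (sympMetric Ω I J') t := by
  have h1 := (hasDerivAt_const t Ω).clm_comp ((hasDerivAt_const t I).clm_comp hJ)
  have h2 := (hasDerivAt_const t Ω).clm_comp (hJ.clm_comp (hasDerivAt_const t I))
  exact ((h1.sub h2).const_smul (1 / 2 : ℝ)).congr_deriv (by simp [sympMetric])

lemma hasDerivAt_sympAnti (Ω : E →L[ℝ] E →L[ℝ] ℝ) (I : E →L[ℝ] E) (hJ : HasDerivAt J J' t) :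
    HasDerivAt (fun s => sympAnti Ω I (J s)) (sympAnti Ω I J') t := by
  have h1 := (hasDerivAt_const t Ω).clm_comp ((hasDerivAt_const t I).clm_comp hJ)
  have h2 := (hasDerivAt_const t Ω).clm_comp (hJ.clm_comp (hasDerivAt_const t I))
  exact ((h1.add h2).const_smul (1 / 2 : ℝ)).congr_deriv (by simp [sympAnti])

/-- The equations of the canonical deformation follow from `∂(ΩJ)/∂t = K`. -/
lemma IsSympFib.exists_deriv {b : E →L[ℝ] E →L[ℝ] ℝ} {j : ℝ → E →L[ℝ] E}
    (h : IsSympFib Ω I (j t)) (hj : HasDerivAt j J' t) (hK : ∀ X, Ω (J' X) = K X) :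
    ∃ (g' b' : E →L[ℝ] E →L[ℝ] ℝ) (J' : E →L[ℝ] E),
      HasDerivAt (fun s => sympMetric Ω I (j s)) g' t ∧
      HasDerivAt (fun s => b - sympAnti Ω I (j s)) b' t ∧ HasDerivAt j J' t ∧
      (∀ X Y : E, b' X Y + g' X Y = -K (I X) Y) ∧
      (∀ X Y : E, b' X Y - g' X Y = -K X (I Y)) ∧
      ∀ X Y : E, 2 * sympMetric Ω I (j t) (J' X) Y = K X (j t (I Y)) - K X (I (j t Y)) := by
  refine ⟨_, _, J', hasDerivAt_sympMetric Ω I hj, (hasDerivAt_sympAnti Ω I hj).const_sub b, hj,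
    fun X Y => ?_, fun X Y => ?_, fun X Y => ?_⟩ <;>
  simp only [neg_apply, sympAnti_apply, sympMetric_apply, h.symm₁, h.symm₂, hK] <;> ring

/-- The Poisson tensor computed from the metric `½Ω[I,J]` is again `Ω⁻¹`; this is why `Ω` does not
change along the deformation. -/
lemma poisson_sympMetric {σ : (E →L[ℝ] ℝ) →L[ℝ] E} {J : E →L[ℝ] E} (hσ : σ.IsInvertible)
    (hg : (sympMetric σ.inverse I J).IsInvertible) :
    (1 / 2 : ℝ) • ((I ∘L J - J ∘L I) ∘L (sympMetric σ.inverse I J).inverse) = σ := by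
  ext ξ
  obtain ⟨X, rfl⟩ := hg.surjective ξ
  have e : sympMetric σ.inverse I J X = σ.inverse ((1 / 2 : ℝ) • (I (J X) - J (I X))) := by
    simp [sympMetric, smul_sub]
  nth_rewrite 2 [e]
  rw [hσ.self_apply_inverse]
  simp [hg.inverse_apply_self]

end FibreDeriv

variable [IsManifold 𝓘(ℝ, E) ∞ M] [FiniteDimensional ℝ E]

/-! ### Smoothness of fields defined through a nondegenerate two-form -/

section Sharp

variable {Ω : TwoTensor E M ℝ} {X : VField E M} {A I : EndField E M}

lemma smoothVField_of_flat (hΩ : SmoothTwoTensor Ω) (hi : ∀ x, IsNondeg (E := E) (Ω x))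
    (h : SmoothOneForm (fun x => Ω x (X x))) : SmoothVField X := by
  rw [smoothVField_iff]
  intro x
  have h1 := contDiffAt_inverse (smoothTwoTensor_iff.1 hΩ x)
    (coord_isInvertible (mem_extChartAt_target x) (hi _))
  refine (h1.clm_apply (smoothOneForm_iff.1 h x)).congr_of_eventuallyEq
    (eventually_target fun y hy => ?_)
  beta_reduce
  rw [coordOne_two hy, (coord_isInvertible hy (hi _)).inverse_apply_self]

lemma coordEnd_of_flat (hi : ∀ x, IsNondeg (E := E) (Ω x)) {x : M} {y : E}
    (hy : y ∈ (𝔠 x).target) (A : EndField E M) :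
    coordEnd x A y = (coordTwo x Ω y).inverse ∘L coordTwo x (fun x => Ω x ∘L A x) y := by
  ext v
  rw [coordTwo_comp_left hy, ContinuousLinearMap.comp_apply, ContinuousLinearMap.comp_apply,
    (coord_isInvertible hy (hi _)).inverse_apply_self]

lemma smoothEnd_of_flat (hΩ : SmoothTwoTensor Ω) (hi : ∀ x, IsNondeg (E := E) (Ω x))
    (h : SmoothTwoTensor (fun x => Ω x ∘L A x)) : SmoothEnd A := by
  rw [smoothEnd_iff]
  intro x
  have h1 := contDiffAt_inverse (smoothTwoTensor_iff.1 hΩ x)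
    (coord_isInvertible (mem_extChartAt_target x) (hi _))
  exact (h1.clm_comp (smoothTwoTensor_iff.1 h x)).congr_of_eventuallyEq
    (eventually_target fun y hy => coordEnd_of_flat hi hy A)

/-- Joint smoothness of `J_t` is obtained from that of the forms `ΩJ_t`, by composing with the
inverse of the fixed `Ω`; the inverse of `dφ_t` need not be treated. -/
lemma smoothEndFamily_of_flat {𝒯 : Set ℝ} {A : ℝ → EndField E M} (hΩ : SmoothTwoTensor Ω)
    (hi : ∀ x, IsNondeg (E := E) (Ω x)) (h : SmoothTwoFamily 𝒯 (fun t x => Ω x ∘L A t x)) :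
    SmoothEndFamily 𝒯 A := by
  intro t ht x
  have h1 : ContDiffAt ℝ ∞ (fun q : ℝ × E => (coordTwo x Ω q.2).inverse) (t, 𝔠 x x) :=
    ContDiffAt.comp (g := fun y => (coordTwo x Ω y).inverse) (t, 𝔠 x x)
      (contDiffAt_inverse (smoothTwoTensor_iff.1 hΩ x)
        (coord_isInvertible (mem_extChartAt_target x) (hi _))) contDiffAt_snd
  refine (h1.clm_comp (h t ht x)).congr_of_eventuallyEq ?_
  have h2 : ∀ᶠ q : ℝ × E in 𝓝 (t, 𝔠 x x), q.2 ∈ (𝔠 x).target :=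
    continuousAt_snd.eventually_mem (target_mem_nhds (E := E) x)
  filter_upwards [h2] with q hq using coordEnd_of_flat hi hq (A q.1)

lemma coordTwo_metricField {x : M} {y : E} (hy : y ∈ (𝔠 x).target) (Ω : TwoTensor E M ℝ)
    (I A : EndField E M) : coordTwo x (metricField Ω I A) y
      = sympMetric (coordTwo x Ω y) (coordEnd x I y) (coordEnd x A y) := by
  ext v w
  have e : ∀ (I A : EndField E M) (v : E),
      coordTwo x Ω y (coordEnd x I y (coordEnd x A y v)) w
        = Ω ((𝔠 x).symm y) (I _ (A _ (chartInvDiff x y v))) (chartInvDiff x y w) :=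
    fun I A v => congrArg (fun z => Ω ((𝔠 x).symm y) z (chartInvDiff x y w))
      ((chartInvDiff_coordEnd hy I _).trans (congrArg _ (chartInvDiff_coordEnd hy A v)))
  rw [sympMetric_apply, e, e]
  exact sympMetric_apply (E := E) (Ω := Ω ((𝔠 x).symm y)) (I := I ((𝔠 x).symm y))
    (J := A ((𝔠 x).symm y)) _ _

lemma coordTwo_antiField {x : M} {y : E} (hy : y ∈ (𝔠 x).target) (Ω : TwoTensor E M ℝ)
    (I A : EndField E M) : coordTwo x (antiField Ω I A) y
      = sympAnti (coordTwo x Ω y) (coordEnd x I y) (coordEnd x A y) := by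
  ext v w
  have e : ∀ (I A : EndField E M) (v : E),
      coordTwo x Ω y (coordEnd x I y (coordEnd x A y v)) w
        = Ω ((𝔠 x).symm y) (I _ (A _ (chartInvDiff x y v))) (chartInvDiff x y w) :=
    fun I A v => congrArg (fun z => Ω ((𝔠 x).symm y) z (chartInvDiff x y w))
      ((chartInvDiff_coordEnd hy I _).trans (congrArg _ (chartInvDiff_coordEnd hy A v)))
  rw [sympAnti_apply, e, e]
  exact sympAnti_apply (E := E) (Ω := Ω ((𝔠 x).symm y)) (I := I ((𝔠 x).symm y))
    (J := A ((𝔠 x).symm y)) _ _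

variable {𝒯 : Set ℝ} {A : ℝ → EndField E M}

lemma contDiffAt_symp {Ω : E → E →L[ℝ] E →L[ℝ] ℝ} {I : E → E →L[ℝ] E} {A : ℝ × E → E →L[ℝ] E}
    {t : ℝ} {z : E} (hΩ : ContDiffAt ℝ ∞ Ω z) (hI : ContDiffAt ℝ ∞ I z)
    (hA : ContDiffAt ℝ ∞ A (t, z)) :
    ContDiffAt ℝ ∞ (fun q : ℝ × E => sympMetric (Ω q.2) (I q.2) (A q)) (t, z) ∧
      ContDiffAt ℝ ∞ (fun q : ℝ × E => sympAnti (Ω q.2) (I q.2) (A q)) (t, z) := by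
  have h1 : ContDiffAt ℝ ∞ (fun q : ℝ × E => Ω q.2) (t, z) :=
    ContDiffAt.comp (g := Ω) (t, z) hΩ contDiffAt_snd
  have h2 : ContDiffAt ℝ ∞ (fun q : ℝ × E => I q.2) (t, z) :=
    ContDiffAt.comp (g := I) (t, z) hI contDiffAt_snd
  exact ⟨((h1.clm_comp (h2.clm_comp hA)).sub (h1.clm_comp (hA.clm_comp h2))).const_smul (1 / 2 : ℝ),
    ((h1.clm_comp (h2.clm_comp hA)).add (h1.clm_comp (hA.clm_comp h2))).const_smul (1 / 2 : ℝ)⟩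

lemma smoothTwoFamily_metricField (hΩ : SmoothTwoTensor Ω) (hI : SmoothEnd I)
    (hA : SmoothEndFamily 𝒯 A) : SmoothTwoFamily 𝒯 (fun t => metricField Ω I (A t)) := by
  intro t ht x
  refine (contDiffAt_symp (smoothTwoTensor_iff.1 hΩ x) (smoothEnd_iff.1 hI x)
    (hA t ht x)).1.congr_of_eventuallyEq ?_
  have h2 : ∀ᶠ q : ℝ × E in 𝓝 (t, 𝔠 x x), q.2 ∈ (𝔠 x).target :=
    continuousAt_snd.eventually_mem (target_mem_nhds (E := E) x)
  filter_upwards [h2] with q hq using coordTwo_metricField hq Ω I (A q.1)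

lemma smoothTwoFamily_twoField {B : TwoTensor E M ℝ} (hB : SmoothTwoTensor B)
    (hΩ : SmoothTwoTensor Ω) (hI : SmoothEnd I) (hA : SmoothEndFamily 𝒯 A) :
    SmoothTwoFamily 𝒯 (fun t => twoField Ω B I (A t)) := by
  intro t ht x
  have h1 : ContDiffAt ℝ ∞ (fun q : ℝ × E => coordTwo x B q.2) (t, 𝔠 x x) :=
    ContDiffAt.comp (g := coordTwo x B) (t, 𝔠 x x) (smoothTwoTensor_iff.1 hB x) contDiffAt_snd
  refine (h1.sub (contDiffAt_symp (smoothTwoTensor_iff.1 hΩ x) (smoothEnd_iff.1 hI x)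
    (hA t ht x)).2).congr_of_eventuallyEq ?_
  have h2 : ∀ᶠ q : ℝ × E in 𝓝 (t, 𝔠 x x), q.2 ∈ (𝔠 x).target :=
    continuousAt_snd.eventually_mem (target_mem_nhds (E := E) x)
  filter_upwards [h2] with q hq
  rw [← coordTwo_antiField hq]
  rfl

end Sharp

/-! ### Moving `J` by a Hamiltonian isotopy -/

section Flow

variable {𝒯 : Set ℝ} {X : ℝ → VField E M} {φ : ℝ → M ≃ₘ^∞⟮𝓘(ℝ, E), 𝓘(ℝ, E)⟯ M}
  {H : ThreeForm E M} {Ω B : TwoTensor E M ℝ} {I J : EndField E M} {u : ℝ → M → ℝ} {t : ℝ}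

lemma IsSympPair.extD_flat (hu : ∀ t ∈ 𝒯, ContMDiff 𝓘(ℝ, E) 𝓘(ℝ, ℝ) ∞ (u t))
    (hX : ∀ t ∈ 𝒯, ∀ x, Ω x (X t x) = -dfun (u t) x) (ht : t ∈ 𝒯) :
    extD (fun x => Ω x (X t x)) = 0 := by
  have e : (fun x => Ω x (X t x)) = fun x => -dfun (u t) x := funext (hX t ht)
  rw [e]
  funext x
  ext Y Z
  refine (extD_neg _ x Y Z).trans ?_
  rw [extD_dfun (hu t ht), neg_zero]
  rfl

lemma IsSympPair.pullForm_eq (h : IsSympPair H Ω B I J) (hφ : IsIsotopy 𝒯 X φ)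
    (hu : ∀ t ∈ 𝒯, ContMDiff 𝓘(ℝ, E) 𝓘(ℝ, ℝ) ∞ (u t))
    (hX : ∀ t ∈ 𝒯, ∀ x, Ω x (X t x) = -dfun (u t) x) (ht : t ∈ 𝒯) : pullForm (φ t) Ω = Ω :=
  have : CompleteSpace E := FiniteDimensional.complete ℝ E
  hφ.pullForm_eq h.isTwoForm h.closed (fun _ hs => IsSympPair.extD_flat hu hX hs) ht

/-- The pullback of a pair of holomorphic symplectic structures in its second member. -/
lemma IsSympPair.pullEnd (h : IsSympPair H Ω B I J) (f : M ≃ₘ^∞⟮𝓘(ℝ, E), 𝓘(ℝ, E)⟯ M)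
    (hf : pullForm f Ω = Ω) : IsSympPair H Ω B I (GenKahler.pullEnd f J) := by
  have e := comp_pullEnd f hf J
  refine ⟨fun x => ⟨(h.fibre x).skew, (h.fibre x).symm₁, fun X Y => ?_, (h.fibre x).sq₁,
    pullEnd_sq f (fun x => (h.fibre x).sq₂) x⟩, h.nondeg, h.smooth, h.smooth₁,
    smoothEnd_of_flat h.smooth h.nondeg ?_, h.closed, h.closed₁, ?_, h.twoForm, h.closed_twoForm⟩
  · have h1 : IsTwoForm (fun x => Ω x ∘L GenKahler.pullEnd f J x) := by
      rw [e]; exact h.isTwoForm₂.pullForm f.contMDiff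
    exact (h1.skew x X Y).trans ((h.fibre x).skew X _).symm
  · rw [e]; exact h.isTwoForm₂.smooth.pullForm f.contMDiff
  · rw [e]; exact h.isTwoForm₂.closed_pullForm h.closed₂ f.contMDiff

/-- The form `ΩJ_t` equals `φ_t^*(ΩJ)`, so Cartan's formula gives its time derivative as `d(i_X
ΩJ_t)`. Moreover `Ω(J_tX, ·) = Ω(X, J_t·) = -du_t ∘ J_t = J_tdu_t`, so the derivative is `dJ_tdu_t`.
-/
lemma IsSympPair.hasDerivAt_pullEnd (h : IsSympPair H Ω B I J) (hφ : IsIsotopy 𝒯 X φ)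
    (hu : ∀ t ∈ 𝒯, ContMDiff 𝓘(ℝ, E) 𝓘(ℝ, ℝ) ∞ (u t))
    (hX : ∀ t ∈ 𝒯, ∀ x, Ω x (X t x) = -dfun (u t) x) (ht : t ∈ 𝒯) (x : M) :
    ∃ J' : E →L[ℝ] E, HasDerivAt (F := E →L[ℝ] E) (fun s => GenKahler.pullEnd (φ s) J x) J' t ∧
      ∀ Y : E, Ω x (J' Y) = dJd (GenKahler.pullEnd (φ t) J) (u t) x Y := by
  have hf : ∀ s ∈ 𝒯, pullForm (φ s) Ω = Ω := fun s hs => h.pullForm_eq hφ hu hX hs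
  have hp := h.pullEnd (φ t) (hf t ht)
  have e : ∀ s ∈ 𝒯, (fun x => Ω x ∘L GenKahler.pullEnd (φ s) J x)
      = pullForm (φ s) (fun x => Ω x ∘L J x) := fun s hs => comp_pullEnd (φ s) (hf s hs) J
  have h1 := (hφ.isSmoothFamilyAt ht x).hasDerivAt_pullForm_source (fun s => (φ s).contMDiff)
    h.isTwoForm₂.smooth (hφ.field t ht) (by rw [← e t ht]; exact hp.isTwoForm₂)
    (by rw [← e t ht]; exact hp.closed₂) (hφ.deriv t ht)
  have e1 : (fun x => pullForm (φ t) (fun x => Ω x ∘L J x) x (X t x))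
      = actOne (GenKahler.pullEnd (φ t) J) (dfun (u t)) := by
    rw [← e t ht]
    funext p
    ext Z
    refine ((hp.fibre p).symm₂ (X t p) Z).trans ?_
    exact DFunLike.congr_fun (hX t ht p) _
  rw [e1] at h1
  have hi : IsNondeg (E := E) (Ω x) := h.nondeg x
  -- As `Ω` at `x` is fixed and invertible, the derivative of `J_t` is recovered from that of
  -- `ΩJ_t`.
  have key : ∀ (o o' : E →L[ℝ] E →L[ℝ] ℝ) (j : ℝ → E →L[ℝ] E) (w : ℝ → E →L[ℝ] E →L[ℝ] ℝ),
      o.IsInvertible → HasDerivAt w o' t → (∀ᶠ s in 𝓝 t, o ∘L j s = w s) →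
      ∃ J' : E →L[ℝ] E, HasDerivAt j J' t ∧ ∀ Y, o (J' Y) = o' Y := by
    intro o o' j w ho hw hj
    refine ⟨o.inverse ∘L o', ?_, fun Y => ho.self_apply_inverse _⟩
    have h2 := (hasDerivAt_const t o.inverse).clm_comp hw
    simp only [zero_comp, zero_add] at h2
    refine h2.congr_of_eventuallyEq (hj.mono fun s hs => ?_)
    beta_reduce
    rw [← hs]
    ext Y
    exact (ho.inverse_apply_self _).symm
  refine key (Ω x) _ (fun s => GenKahler.pullEnd (φ s) J x) _ hi h1 ?_
  filter_upwards [hφ.isOpen.mem_nhds ht] with s hs using congrFun (e s hs) x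

lemma IsSympPair.smoothEndFamily_pullEnd (h : IsSympPair H Ω B I J) (hφ : IsIsotopy 𝒯 X φ)
    (hf : ∀ t ∈ 𝒯, pullForm (φ t) Ω = Ω) :
    SmoothEndFamily 𝒯 (fun t => GenKahler.pullEnd (φ t) J) := by
  refine smoothEndFamily_of_flat h.smooth h.nondeg fun t ht x => ?_
  refine ((hφ.isSmoothFamilyAt ht x).contDiffAt_pullForm (fun s => (φ s).contMDiff)
    h.isTwoForm₂.smooth).congr_of_eventuallyEq ?_
  filter_upwards [continuousAt_fst.eventually_mem (hφ.isOpen.mem_nhds ht)] with q hq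
  rw [comp_pullEnd (φ q.1) (hf q.1 hq) J]

/-- The family of bihermitian structures obtained by moving `J` by an isotopy. -/
theorem IsSympPair.isBihermitianFamily (h : IsSympPair H Ω B I J) (hφ : IsIsotopy 𝒯 X φ)
    (hu : ∀ t ∈ 𝒯, ContMDiff 𝓘(ℝ, E) 𝓘(ℝ, ℝ) ∞ (u t))
    (hX : ∀ t ∈ 𝒯, ∀ x, Ω x (X t x) = -dfun (u t) x) {𝒮 : Set ℝ} (hS : 𝒮 ⊆ 𝒯)
    (hpos : ∀ t ∈ 𝒮, ∀ x (Y : Tan E x), Y ≠ 0 →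
      0 < metricField Ω I (GenKahler.pullEnd (φ t) J) x Y Y) :
    IsBihermitianFamily H 𝒯 𝒮 (fun t => metricField Ω I (GenKahler.pullEnd (φ t) J))
      (fun t => twoField Ω B I (GenKahler.pullEnd (φ t) J))
      (fun t => dJd (GenKahler.pullEnd (φ t) J) (u t)) I (fun t => GenKahler.pullEnd (φ t) J) := by
  have hf : ∀ s ∈ 𝒯, pullForm (φ s) Ω = Ω := fun s hs => h.pullForm_eq hφ hu hX hs
  have hp : ∀ t ∈ 𝒯, IsSympPair H Ω B I (GenKahler.pullEnd (φ t) J) := fun t ht =>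
    h.pullEnd (φ t) (hf t ht)
  have sJ := h.smoothEndFamily_pullEnd hφ hf
  refine ⟨hφ.isOpen, hS, smoothTwoFamily_metricField h.smooth h.smooth₁ sJ,
    smoothTwoFamily_twoField h.twoForm.smooth h.smooth h.smooth₁ sJ, sJ,
    fun t ht x => ((hp t ht).fibre x).isHermFib₁, fun t ht x => ((hp t ht).fibre x).isHermFib₂,
    fun t ht => ?_, fun t ht => (hp t (hS ht)).inv₁, fun t ht => (hp t (hS ht)).inv₂,
    fun t ht => isTwoForm_dJd (hu t (hS ht)) (hp t (hS ht)).smooth₂, fun t ht =>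
      dJd_invariant (hu t (hS ht)) (hp t (hS ht)).smooth₂ (fun x => ((hp t (hS ht)).fibre x).sq₂)
        (hp t (hS ht)).nijZero₂, fun t ht x => ?_⟩
  · exact (hp t (hS ht)).isBihermitian (hpos t ht)
  · obtain ⟨J', hJ', hK⟩ := h.hasDerivAt_pullEnd hφ hu hX (hS ht) x
    exact IsSympFib.exists_deriv (E := E) (b := B x) (j := fun s => GenKahler.pullEnd (φ s) J x)
      ((hp t (hS ht)).fibre x) hJ' hK

end Flow

end

section

variable {E : Type*} [NormedAddCommGroup E] [NormedSpace ℝ E]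
  {F : Type*} [NormedAddCommGroup F] [NormedSpace ℝ F]
  {M : Type*} [TopologicalSpace M] [ChartedSpace E M]

local notation "𝔠" => extChartAt 𝓘(ℝ, E)

section Nondegenerate

variable [IsManifold 𝓘(ℝ, E) ∞ M]

lemma contMDiff_slice {𝒯 : Set ℝ} (h𝒯 : IsOpen 𝒯) {u : ℝ → M → ℝ}
    (hu : ContMDiffOn (𝓘(ℝ, ℝ).prod 𝓘(ℝ, E)) 𝓘(ℝ, ℝ) ∞ (fun p : ℝ × M => u p.1 p.2) (𝒯 ×ˢ univ))
    {t : ℝ} (ht : t ∈ 𝒯) : ContMDiff 𝓘(ℝ, E) 𝓘(ℝ, ℝ) ∞ (u t) := by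
  intro x
  have h1 : ContMDiffAt (𝓘(ℝ, ℝ).prod 𝓘(ℝ, E)) 𝓘(ℝ, ℝ) ∞ (fun p : ℝ × M => u p.1 p.2) (t, x) :=
    hu.contMDiffAt (prod_mem_nhds (h𝒯.mem_nhds ht) Filter.univ_mem)
  exact ContMDiffAt.comp (g := fun p : ℝ × M => u p.1 p.2) x h1
    (contMDiffAt_const.prodMk contMDiffAt_id)

lemma pullEnd_id (J : EndField E M) : pullEnd id J = J := by
  funext x
  ext X
  change (mfderiv 𝓘(ℝ, E) 𝓘(ℝ, E) id x).inverse (J x (mfderiv 𝓘(ℝ, E) 𝓘(ℝ, E) id x X)) = J x X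
  rw [mfderiv_id]
  exact DFunLike.congr_fun (inverse_id (R := ℝ) (M := E)) _

/-- On the pair `(X, IX)` the left side is half of `Ω(JX, IX) - Ω(JIX, X)`, and `Ω(JX, IX) = Ω(IJX,
X)`. Positivity of the (1,1)-part is therefore exactly positivity of the metric `½Ω[I,J]`. -/
lemma im_pr11_holSymp [FiniteDimensional ℝ E] (Ω : TwoTensor E M ℝ) {I J : EndField E M} {x : M}
    (h : IsSympFib (E := E) (Ω x) (I x) (J x)) (X : Tan E x) :
    -(pr11 (I x) (holSymp Ω J x) X (I x X)).im = metricField Ω I J x X X := by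
  have e1 : Ω x (I x (J x X)) X = Ω x (J x X) (I x X) := h.symm₁ _ _
  rw [metricField_apply, e1]
  have e2 : I x (I x X) = -X := h.sq₁ X
  simp [pr11, holSymp, e2]
  ring

variable [FiniteDimensional ℝ E] [T2Space M]

/-- The canonical deformation of a generalized Kähler structure with invertible `[I, J]` along
Hamiltonian diffeomorphisms. -/
theorem exists_canonicalDeformation_nondegenerate (H : ThreeForm E M) (𝕁₁₀ 𝕁₂₀ : GEndField E M)
    (g b : TwoTensor E M ℝ) (I J : EndField E M) (𝒯 : Set ℝ) (u : ℝ → M → ℝ)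
    (φ : ℝ → M ≃ₘ^∞⟮𝓘(ℝ, E), 𝓘(ℝ, E)⟯ M) (hH : SmoothThreeForm H)
    (hK : IsGenKahler H 𝕁₁₀ 𝕁₂₀) (hB : IsBihermitianData 𝕁₁₀ 𝕁₂₀ g b I J)
    (hσ : ∀ x, (poisson g I J x).IsInvertible) (h𝒯 : IsOpen 𝒯) (hc : 𝒯.OrdConnected)
    (h0 : (0 : ℝ) ∈ 𝒯)
    (hu : ContMDiffOn (𝓘(ℝ, ℝ).prod 𝓘(ℝ, E)) 𝓘(ℝ, ℝ) ∞ (fun p : ℝ × M => u p.1 p.2) (𝒯 ×ˢ univ))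
    (hφ : IsHamiltonianFamily (poisson g I J) 𝒯 u φ) :
    ∃ (𝕁₁ 𝕁₂ : ℝ → GEndField E M) (gt bt : ℝ → TwoTensor E M ℝ),
      let 𝒯pos : Set ℝ := {t ∈ 𝒯 | ∀ x (X : Tan E x), X ≠ 0 →
        0 < -(pr11 (I x) (holSymp (sympForm g I J) (pullEnd (φ t) J) x) X (I x X)).im}
      IsCanonicalDeformation H 𝒯pos 𝕁₁ 𝕁₂ (fun t => dJd (pullEnd (φ t) J) (u t)) ∧
      (0 : ℝ) ∈ 𝒯pos ∧ 𝕁₁ 0 = 𝕁₁₀ ∧ 𝕁₂ 0 = 𝕁₂₀ ∧ gt 0 = g ∧ bt 0 = b ∧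
      ∀ t ∈ 𝒯pos,
        IsBihermitianData (𝕁₁ t) (𝕁₂ t) (gt t) (bt t) I (pullEnd (φ t) J) ∧
        (∀ x, (poisson (gt t) I (pullEnd (φ t) J) x).IsInvertible) ∧
        sympForm (gt t) I (pullEnd (φ t) J) = sympForm g I J := by
  obtain ⟨h1, h2, h3, h4, rfl, rfl⟩ := hB
  have h : IsBihermitian g b I J := ⟨h1, h2, h3, h4⟩
  obtain ⟨hm, B, hS, hb⟩ := h.isSympPair hK hσ
  set Ω := sympForm g I J
  have su : ∀ t ∈ 𝒯, ContMDiff 𝓘(ℝ, E) 𝓘(ℝ, ℝ) ∞ (u t) := fun t ht => contMDiff_slice h𝒯 hu ht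
  have hX : ∀ t ∈ 𝒯, ∀ x, Ω x (hamField (poisson g I J) (u t) x) = -dfun (u t) x :=
    fun t _ x => ((Ω x).map_neg _).trans (congrArg Neg.neg ((hσ x).inverse_apply_self _))
  have hφ' : IsIsotopy 𝒯 (fun t => hamField (poisson g I J) (u t)) φ :=
    ⟨h𝒯, hc, h0, hφ.smooth, hφ.init, fun t ht => smoothVField_of_flat hS.smooth hS.nondeg (by
      rw [show (fun x => Ω x (hamField (poisson g I J) (u t) x)) = fun x => -dfun (u t) x from
        funext (hX t ht)]
      exact (smoothOneForm_dfun (su t ht)).neg), hφ.deriv⟩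
  have hp : ∀ t ∈ 𝒯, IsSympPair H Ω B I (pullEnd (φ t) J) := fun t ht =>
    hS.pullEnd (φ t) (hS.pullForm_eq hφ' su hX ht)
  have e0 : pullEnd (φ 0) J = J := by
    rw [show (φ 0 : M → M) = id from funext hφ.init, pullEnd_id]
  set 𝒯pos : Set ℝ := {t ∈ 𝒯 | ∀ x (X : Tan E x), X ≠ 0 →
    0 < -(pr11 (I x) (holSymp Ω (pullEnd (φ t) J) x) X (I x X)).im}
  have hpos : ∀ t ∈ 𝒯pos, ∀ x (X : Tan E x), X ≠ 0 →
      0 < metricField Ω I (pullEnd (φ t) J) x X X := fun t ht x X hX0 => by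
    rw [← im_pr11_holSymp Ω ((hp t ht.1).fibre x)]
    exact ht.2 x X hX0
  have fam := hS.isBihermitianFamily hφ' su hX (𝒮 := 𝒯pos) (fun t ht => ht.1) hpos
  refine ⟨_, _, fun t => metricField Ω I (pullEnd (φ t) J),
    fun t => twoField Ω B I (pullEnd (φ t) J), fam.isCanonicalDeformation hH, ⟨h0, fun x X hX0 => ?_⟩, ?_, ?_, ?_, ?_,
    fun t ht => ?_⟩
  · rw [e0, im_pr11_holSymp Ω (hS.fibre x), hm]
    exact h1.pos x X hX0
  · simp only [e0, hm, hb]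
  · simp only [e0, hm, hb]
  · simp only [e0, hm]
  · simp only [e0, hb]
  · have hbi := fam.bihermitian t ht
    -- The Poisson tensor of the deformed data is the original one, which settles both invertibility
    -- and the constancy of `Ω`.
    have e : ∀ x, poisson (metricField Ω I (pullEnd (φ t) J)) I (pullEnd (φ t) J) x
        = poisson g I J x := fun x =>
      poisson_sympMetric (E := E) (σ := poisson g I J x) (I := I x) (J := pullEnd (φ t) J x)
        (hσ x) (hbi.metric.isInvertible x)
    refine ⟨hbi.isBihermitianData, fun x => ?_, ?_⟩
    · rw [e]; exact hσ x
    · funext x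
      exact congrArg ContinuousLinearMap.inverse (e x)

end Nondegenerate

end

end GenKahler

end

theorem propositionp
    {E : Type*} [NormedAddCommGroup E] [NormedSpace ℝ E] [FiniteDimensional ℝ E]
    {M : Type*} [TopologicalSpace M] [T2Space M] [SecondCountableTopology M]
    [ChartedSpace E M] [IsManifold 𝓘(ℝ, E) ∞ M] :
    -- (1) the Kähler case
    (∀ (g : TwoTensor E M ℝ) (J : EndField E M) (u : M → ℝ),
      IsKahler g J → ContMDiff 𝓘(ℝ, E) 𝓘(ℝ, ℝ) ∞ u →
      (∀ x (X : Tan E x), X ≠ 0 →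
        0 < fundForm g J x X (J x X)
          + (2 * Complex.I * ddbarFun J projAll u x X (J x X)).re) →
      ∃ (𝕁₁ 𝕁₂ : ℝ → GEndField E M) (gt : ℝ → TwoTensor E M ℝ),
        IsCanonicalDeformation 0 (Icc 0 1) 𝕁₁ 𝕁₂ (fun _ => dJd J u) ∧
        gt 0 = g ∧
        ∀ t ∈ Icc (0 : ℝ) 1,
          IsBihermitianData (𝕁₁ t) (𝕁₂ t) (gt t) 0 J J ∧
          fundForm (gt t) J = fundForm g J + t • dJd J u) ∧
    -- (2) the commuting case
    (∀ (H : ThreeForm E M) (𝕁₁₀ 𝕁₂₀ : GEndField E M) (g b : TwoTensor E M ℝ)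
      (I J : EndField E M) (u : M → ℝ),
      SmoothThreeForm H → Closed₃ H →
      IsGenKahler H 𝕁₁₀ 𝕁₂₀ → IsBihermitianData 𝕁₁₀ 𝕁₂₀ g b I J →
      (∀ x, I x ∘L J x = J x ∘L I x) → ContMDiff 𝓘(ℝ, E) 𝓘(ℝ, ℝ) ∞ u →
      (∀ x (X : Tan E x), X ≠ 0 →
        0 < fundForm g I x X (I x X)
          + (2 * Complex.I * (ddbarFun I (projPlus I J) u x X (I x X)
              - ddbarFun I (projMinus I J) u x X (I x X))).re) →
      ∃ (𝕁₁ 𝕁₂ : ℝ → GEndField E M) (gt bt : ℝ → TwoTensor E M ℝ),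
        IsCanonicalDeformation H (Icc 0 1) 𝕁₁ 𝕁₂ (fun _ => dJd J u) ∧
        𝕁₁ 0 = 𝕁₁₀ ∧ 𝕁₂ 0 = 𝕁₂₀ ∧ gt 0 = g ∧ bt 0 = b ∧
        ∀ t ∈ Icc (0 : ℝ) 1,
          IsBihermitianData (𝕁₁ t) (𝕁₂ t) (gt t) (bt t) I J ∧
          ∀ x (X Y : Tan E x),
            (fundForm (gt t) I x X Y : ℂ) = (fundForm g I x X Y : ℂ)
              + t * (2 * Complex.I * (ddbarFun I (projPlus I J) u x X Y
                  - ddbarFun I (projMinus I J) u x X Y))) ∧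
    -- (3) the nondegenerate case
    (∀ (H : ThreeForm E M) (𝕁₁₀ 𝕁₂₀ : GEndField E M) (g b : TwoTensor E M ℝ)
      (I J : EndField E M) (𝒯 : Set ℝ) (u : ℝ → M → ℝ)
      (φ : ℝ → M ≃ₘ^∞⟮𝓘(ℝ, E), 𝓘(ℝ, E)⟯ M),
      SmoothThreeForm H → Closed₃ H →
      IsGenKahler H 𝕁₁₀ 𝕁₂₀ → IsBihermitianData 𝕁₁₀ 𝕁₂₀ g b I J →
      (∀ x, (poisson g I J x).IsInvertible) →
      IsOpen 𝒯 → 𝒯.OrdConnected → (0 : ℝ) ∈ 𝒯 →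
      ContMDiffOn (𝓘(ℝ, ℝ).prod 𝓘(ℝ, E)) 𝓘(ℝ, ℝ) ∞ (fun p : ℝ × M => u p.1 p.2) (𝒯 ×ˢ univ) →
      IsHamiltonianFamily (poisson g I J) 𝒯 u φ →
      ∃ (𝕁₁ 𝕁₂ : ℝ → GEndField E M) (gt bt : ℝ → TwoTensor E M ℝ),
        let 𝒯pos : Set ℝ := {t ∈ 𝒯 | ∀ x (X : Tan E x), X ≠ 0 →
          0 < -(pr11 (I x) (holSymp (sympForm g I J) (pullEnd (φ t) J) x) X (I x X)).im}
        IsCanonicalDeformation H 𝒯pos 𝕁₁ 𝕁₂ (fun t => dJd (pullEnd (φ t) J) (u t)) ∧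
        (0 : ℝ) ∈ 𝒯pos ∧ 𝕁₁ 0 = 𝕁₁₀ ∧ 𝕁₂ 0 = 𝕁₂₀ ∧ gt 0 = g ∧ bt 0 = b ∧
        ∀ t ∈ 𝒯pos,
          IsBihermitianData (𝕁₁ t) (𝕁₂ t) (gt t) (bt t) I (pullEnd (φ t) J) ∧
          (∀ x, (poisson (gt t) I (pullEnd (φ t) J) x).IsInvertible) ∧
          sympForm (gt t) I (pullEnd (φ t) J) = sympForm g I J) := by
  refine ⟨exists_canonicalDeformation_kahler, ?_, ?_⟩
  · intro H 𝕁₁₀ 𝕁₂₀ g b I J u hH _ hK hB hcomm hu hpos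
    exact exists_canonicalDeformation_commuting H 𝕁₁₀ 𝕁₂₀ g b I J u hH hK hB hcomm hu hpos
  · intro H 𝕁₁₀ 𝕁₂₀ g b I J 𝒯 u φ hH _ hK hB hσ h𝒯 hc h0 hu hφ
    exact exists_canonicalDeformation_nondegenerate H 𝕁₁₀ 𝕁₂₀ g b I J 𝒯 u φ hH hK hB hσ h𝒯 hc h0
      hu hφ
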